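/- Let $\Omega\subset\mathbb{R}^3$ be a bounded convex domain with $C^2$ boundary of positive Gaussian curvature. For $x\in\Omega$, $v\in\mathbb{R}^3$ put $\tau_\pm(x,v)=\inf\{t>0: x\pm tv\notin\Omega\}$ and $q_-(x,v)=x-\tau_-(x,v)v$. Let $\gamma\in[0,1]$ and let $B(r,\theta)$ be a measurable cross-section with $0\le B(r,\theta)\le C_0\,r^\gamma\cos\theta\sin\theta$ for all $r>0$, $\theta\in[0,\pi/2]$ and some constant $C_0$. Let $M(v)=\pi^{-3/2}e^{-|v|^2}$ and $$Q(F,G)(v)=\int_{\mathbb{R}^3}\int_0^{2\pi}\int_0^{\pi/2}\bigl(F(v')G(v'_*)-F(v)G(v_*)\bigr)B(|v-v_*|,\theta)\,d\theta\,d\epsilon\,dv_*,$$ where $v'=v+((v_*-v)\cdot\alpha)\alpha$, $v'_*=v_*-((v_*-v)\cdot\alpha)\alpha$, $\alpha=\cos\theta\,e_1+\sin\theta\cos\epsilon\,e_2+\sin\theta\sin\epsilon\,e_3$, $e_1=(v_*-v)/|v_*-v|$, and $(e_1,e_2,e_3)$ is an orthonormal basis. Write the linearized collision operator $L(f)=M^{-1/2}\bigl(Q(M,M^{1/2}f)+Q(M^{1/2}f,M)\bigr)$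 as $L(f)=-\nu f+K(f)$, where $$\nu(v)=\int_{\mathbb{R}^3}\int_0^{2\pi}\int_0^{\pi/2}M(v_*)B(|v-v_*|,\theta)\,d\theta\,d\epsilon\,dv_*$$ and $K$ (acting in $v$ only) collects the remaining terms, those containing $f(v')$, $f(v'_*)$ and $f(v_*)$. Put $$(S_\Omega f)(x,v)=\int_0^{\tau_-(x,v)}e^{-\nu(v)s}f(x-sv,v)\,ds.$$ Let $L^2_v(\mathbb{R}^3;H^{1/2}_x(\Omega))$ be the space of $f\in L^2(\Omega\times\mathbb{R}^3)$ with finite norm $$\|f\|_{L^2_v(\mathbb{R}^3;H^{1/2}_x(\Omega))}=\Bigl(\|f\|_{L^2(\Omega\times\mathbb{R}^3)}^2+\int_{\mathbb{R}^3}\int_\Omega\int_\Omega\frac{|f(x,v)-f(y,v)|^2}{|x-y|^4}\,dx\,dy\,dv\Bigr)^{1/2}.$$ (i) The operator $S_\Omega KS_\Omega K$ is a well-defined bounded linear operator from $L^2(\Omega\times\mathbb{R}^3)$ into $L^2_v(\mathbb{R}^3;H^{1/2}_x(\Omega))$: there is a constant $C$ such that $\|S_\Omega KS_\Omega Kf\|_{L^2_v(\mathbb{R}^3;H^{1/2}_x(\Omega))}\le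 C\|f\|_{L^2(\Omega\times\mathbb{R}^3)}$ for all $f\in L^2(\Omega\times\mathbb{R}^3)$. (ii) Consequently, let $n(q)$ be the outward unit normal of $\partial\Omega$ at $q$, let $\Gamma_-=\{(q,v)\in\partial\Omega\times\mathbb{R}^3: n(q)\cdot v<0\}$, and let $g$ be incoming data for which there are constants $a,C>0$ with $|g(q_1,v)|\le Ce^{-a|v|^2}$ and $|g(q_1,v)-g(q_2,v)|\le C|q_1-q_2|$ for all $(q_1,v),(q_2,v)\in\Gamma_-$. Then every solution $f\in L^2(\Omega\times\mathbb{R}^3)$ of $$\nu f+v\cdot\nabla_xf=K(f)\ \text{ in }\Omega\times\mathbb{R}^3,\qquad f=g\ \text{ on }\Gamma_-$$ belongs to $L^2_v(\mathbb{R}^3;H^{1/2}_x(\Omega))$. Here $f$ is a solution if, after modification on a null set, for almost every $(x,v)\in\Omega\times\mathbb{R}^3$ the function $s\mapsto f(q_-(x,v)+sv,v)$ on $(0,\tau_-(x,v)+\tau_+(x,v))$ is locally absolutely continuous with derivative $(K(f)-\nu f)(q_-(x,v)+sv,v)$ almost everywhere and has the limit $g(q_-(x,v),v)$ as $s\to0^+$.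 -/

import Mathlib

open MeasureTheory Filter Set
open scoped ENNReal NNReal Topology RealInnerProductSpace

namespace LinBoltzmann

/-- Euclidean three-space, used both for positions and for velocities. -/
abbrev V3 : Type := EuclideanSpace ℝ (Fin 3)

noncomputable section

/-! ### Domains -/

/-- `φ` is a `C²` defining function of `Ω` near the boundary point `q`: close to `q` the set `Ω` is
`{φ < 0}`, and `φ` has nonvanishing gradient at `q`. -/
structure IsDefiningFunctionAt (Ω : Set V3) (q : V3) (φ : V3 → ℝ) : Prop where
  contDiffAt : ContDiffAt ℝ 2 φ q
  fderiv_ne_zero : fderiv ℝ φ q ≠ 0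
  eventually_mem_iff : ∀ᶠ x in 𝓝 q, (x ∈ Ω ↔ φ x < 0)

/-- Second fundamental form at `q` of the level surface of `φ` through `q`, on tangent vectors
`u`, `w`: it is `D²φ(q)(u, w) / |∇φ(q)|`. -/
def secondFundamentalForm (φ : V3 → ℝ) (q u w : V3) : ℝ :=
  fderiv ℝ (fderiv ℝ φ) q u w / ‖fderiv ℝ φ q‖

/-- `(u, w)` is an orthonormal basis of the tangent plane at `q` of the level surface of `φ`. -/
def IsTangentFrame (φ : V3 → ℝ) (q u w : V3) : Prop :=
  ‖u‖ = 1 ∧ ‖w‖ = 1 ∧ ⟪u, w⟫ = 0 ∧ fderiv ℝ φ q u = 0 ∧ fderiv ℝ φ q w = 0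

/-- Gaussian curvature: the determinant of the second fundamental form in an orthonormal basis
`(u, w)` of the tangent plane (its value does not depend on that basis). -/
def gaussianCurvature (φ : V3 → ℝ) (q u w : V3) : ℝ :=
  secondFundamentalForm φ q u u * secondFundamentalForm φ q w w -
    secondFundamentalForm φ q u w * secondFundamentalForm φ q w u

/-- A bounded convex domain in `ℝ³` with `C²` boundary of positive Gaussian curvature. -/
structure IsPosCurvedConvexDomain (Ω : Set V3) : Prop where
  nonempty : Ω.Nonempty
  isOpen : IsOpen Ω
  isBounded : Bornology.IsBounded Ω
  convex : Convex ℝ Ω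
  posCurvature : ∀ q ∈ frontier Ω, ∃ φ : V3 → ℝ, IsDefiningFunctionAt Ω q φ ∧
    ∀ u w : V3, IsTangentFrame φ q u w → 0 < gaussianCurvature φ q u w

/-- Backward exit time `τ₋(x, v) = inf {t > 0 : x - t v ∉ Ω}`. -/
def tauMinus (Ω : Set V3) (x v : V3) : ℝ := sInf {t : ℝ | 0 < t ∧ x - t • v ∉ Ω}

/-- Forward exit time `τ₊(x, v) = inf {t > 0 : x + t v ∉ Ω}`. -/
def tauPlus (Ω : Set V3) (x v : V3) : ℝ := sInf {t : ℝ | 0 < t ∧ x + t • v ∉ Ω}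

/-- Backward exit point `q₋(x, v) = x - τ₋(x, v) v`. -/
def qMinus (Ω : Set V3) (x v : V3) : V3 := x - tauMinus Ω x v • v

/-- `n` is an outward unit normal of the convex set `Ω` at `q` (for a convex set with `C¹` boundary
there is exactly one at each boundary point). -/
def IsOutwardUnitNormal (Ω : Set V3) (q n : V3) : Prop :=
  ‖n‖ = 1 ∧ ∀ x ∈ Ω, ⟪n, x - q⟫ ≤ 0

/-- The incoming part `Γ₋` of `∂Ω × ℝ³`. -/
def gammaMinus (Ω : Set V3) : Set (V3 × V3) :=
  {p | p.1 ∈ frontier Ω ∧ ∃ n, IsOutwardUnitNormal Ω p.1 n ∧ ⟪n, p.2⟫ < 0}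

/-! ### Collision operator -/

/-- Grad's angular cutoff with exponent `γ` for a cross-section `B(r, θ)`, `r = |v - v_*|`. -/
structure IsCutoff (B : ℝ → ℝ → ℝ) (γ : ℝ) : Prop where
  measurable : Measurable (Function.uncurry B)
  bound : ∃ C : ℝ, ∀ r : ℝ, 0 < r → ∀ θ ∈ Icc (0 : ℝ) (Real.pi / 2),
    0 ≤ B r θ ∧ B r θ ≤ C * r ^ γ * Real.cos θ * Real.sin θ

/-- The standard Maxwellian `M(v) = π^{-3/2} exp(-|v|²)`. -/
def maxwellian (v : V3) : ℝ := Real.pi ^ (-(3 / 2) : ℝ) * Real.exp (-‖v‖ ^ 2)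

/-- A unit vector orthogonal to the unit vector `e`. -/
def frame₂ (e : V3) : V3 :=
  if e 0 = 0 ∧ e 1 = 0 then !₂[(1 : ℝ), 0, 0]
  else (Real.sqrt (e 0 ^ 2 + e 1 ^ 2))⁻¹ • !₂[-e 1, e 0, (0 : ℝ)]

/-- The cross product `e × frame₂ e`, which completes `e`, `frame₂ e` to an orthonormal basis. -/
def frame₃ (e : V3) : V3 :=
  !₂[e 1 * frame₂ e 2 - e 2 * frame₂ e 1,
     e 2 * frame₂ e 0 - e 0 * frame₂ e 2,
     e 0 * frame₂ e 1 - e 1 * frame₂ e 0]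

/-- `e₁ = (v_* - v) / |v_* - v|`. -/
def axis (v vs : V3) : V3 := ‖vs - v‖⁻¹ • (vs - v)

/-- `α = cos θ e₁ + sin θ cos ε e₂ + sin θ sin ε e₃`. -/
def scatter (v vs : V3) (θ ε : ℝ) : V3 :=
  Real.cos θ • axis v vs + (Real.sin θ * Real.cos ε) • frame₂ (axis v vs) +
    (Real.sin θ * Real.sin ε) • frame₃ (axis v vs)

/-- Post-collisional velocity `v' = v + ((v_* - v) · α) α`. -/
def postV (v vs : V3) (θ ε : ℝ) : V3 :=
  v + ⟪vs - v, scatter v vs θ ε⟫ • scatter v vs θ ε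

/-- Post-collisional velocity `v'_* = v_* - ((v_* - v) · α) α`. -/
def postVs (v vs : V3) (θ ε : ℝ) : V3 :=
  vs - ⟪vs - v, scatter v vs θ ε⟫ • scatter v vs θ ε

/-- With `Q(F, G) = ∫∫∫ (F(v') G(v'_*) - F(v) G(v_*)) B(|v - v_*|, θ) dθ dε dv_*`, the linearized
operator `L f = M^{-1/2} (Q(M, M^{1/2} f) + Q(M^{1/2} f, M))` is `- ν f + K f`, where `- ν f`
collects the terms that contain `f(v)`. This is the collision frequency `ν`. -/
def collisionFrequency (B : ℝ → ℝ → ℝ) (v : V3) : ℝ :=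
  ∫ vs : V3, ∫ _ε in (0 : ℝ)..(2 * Real.pi), ∫ θ in (0 : ℝ)..(Real.pi / 2),
    maxwellian vs * B ‖v - vs‖ θ

/-- The operator `K` of the decomposition `L = - ν + K`, on functions of the velocity: it collects
the terms of `L f` that contain `f(v'_*)`, `f(v')` and `f(v_*)`. -/
def collisionK (B : ℝ → ℝ → ℝ) (h : V3 → ℝ) (v : V3) : ℝ :=
  ∫ vs : V3, ∫ ε in (0 : ℝ)..(2 * Real.pi), ∫ θ in (0 : ℝ)..(Real.pi / 2),
    (Real.sqrt (maxwellian v))⁻¹ *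
      (maxwellian (postV v vs θ ε) *
          (Real.sqrt (maxwellian (postVs v vs θ ε)) * h (postVs v vs θ ε)) +
        Real.sqrt (maxwellian (postV v vs θ ε)) * h (postV v vs θ ε) *
          maxwellian (postVs v vs θ ε) -
        maxwellian v * (Real.sqrt (maxwellian vs) * h vs)) *
      B ‖v - vs‖ θ

/-- `K` acting on functions of `(x, v)`. -/
def opK (B : ℝ → ℝ → ℝ) (f : V3 × V3 → ℝ) (p : V3 × V3) : ℝ :=
  collisionK B (fun w => f (p.1, w)) p.2

/-- `(S_Ω f)(x, v) = ∫_0^{τ₋(x,v)} exp(-ν(v) s) f(x - s v, v) ds`. -/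
def opS (Ω : Set V3) (B : ℝ → ℝ → ℝ) (f : V3 × V3 → ℝ) (p : V3 × V3) : ℝ :=
  ∫ s in (0 : ℝ)..(tauMinus Ω p.1 p.2),
    Real.exp (-collisionFrequency B p.2 * s) * f (p.1 - s • p.2, p.2)

/-! ### Function spaces -/

/-- Lebesgue measure on `Ω × ℝ³`. -/
def phaseMeasure (Ω : Set V3) : Measure (V3 × V3) :=
  (volume.restrict Ω).prod volume

/-- The Slobodeckij integral `∫_{ℝ³} ∫_Ω ∫_Ω |f(x,v) - f(y,v)|² / |x-y|^{3+2s} dx dy dv`. -/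
def slobodeckij (Ω : Set V3) (s : ℝ) (f : V3 × V3 → ℝ) : ℝ≥0∞ :=
  ∫⁻ v : V3, ∫⁻ y in Ω, ∫⁻ x in Ω,
    ENNReal.ofReal (|f (x, v) - f (y, v)| ^ 2 / ‖x - y‖ ^ (3 + 2 * s))

/-- Membership in `L²_v(ℝ³; H^s_x(Ω))`. -/
def MemL2Hs (Ω : Set V3) (s : ℝ) (f : V3 × V3 → ℝ) : Prop :=
  MemLp f 2 (phaseMeasure Ω) ∧ slobodeckij Ω s f < ∞

/-- The norm of `L²_v(ℝ³; H^s_x(Ω))`, with value `∞` outside of the space. -/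
def l2HsNorm (Ω : Set V3) (s : ℝ) (f : V3 × V3 → ℝ) : ℝ≥0∞ :=
  (eLpNorm f 2 (phaseMeasure Ω) ^ 2 + slobodeckij Ω s f) ^ (1 / 2 : ℝ)

/-! ### The incoming boundary value problem -/

/-- Incoming data with Gaussian decay in `v`, Lipschitz in the boundary point. -/
def IsIncomingData (Ω : Set V3) (g : V3 × V3 → ℝ) : Prop :=
  ∃ a C : ℝ, 0 < a ∧ 0 < C ∧
    (∀ p ∈ gammaMinus Ω, |g p| ≤ C * Real.exp (-a * ‖p.2‖ ^ 2)) ∧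
    ∀ q₁ q₂ v : V3, (q₁, v) ∈ gammaMinus Ω → (q₂, v) ∈ gammaMinus Ω →
      |g (q₁, v) - g (q₂, v)| ≤ C * ‖q₁ - q₂‖

/-- `f ∈ L²(Ω × ℝ³)` solves `ν f + v · ∇ₓ f = K f` in `Ω × ℝ³`, `f = g` on `Γ₋`: after modification
on a null set, along almost every characteristic `s ↦ (q₋ + s v, v)` the function `f` is absolutely
continuous with derivative `K f - ν f`, and its limit at the entrance point `q₋` is `g(q₋, v)`. -/
def IsIncomingSolution (Ω : Set V3) (B : ℝ → ℝ → ℝ) (g f : V3 × V3 → ℝ) : Prop :=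
  MemLp f 2 (phaseMeasure Ω) ∧
  ∃ F : V3 × V3 → ℝ, F =ᵐ[phaseMeasure Ω] f ∧
    ∀ᵐ p ∂(phaseMeasure Ω),
      (∀ a b : ℝ, 0 < a → a ≤ b → b < tauMinus Ω p.1 p.2 + tauPlus Ω p.1 p.2 →
        F (qMinus Ω p.1 p.2 + b • p.2, p.2) - F (qMinus Ω p.1 p.2 + a • p.2, p.2) =
          ∫ s in a..b, (opK B F (qMinus Ω p.1 p.2 + s • p.2, p.2) -
            collisionFrequency B p.2 * F (qMinus Ω p.1 p.2 + s • p.2, p.2))) ∧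
      Tendsto (fun s : ℝ => F (qMinus Ω p.1 p.2 + s • p.2, p.2)) (𝓝[>] 0)
        (𝓝 (g (qMinus Ω p.1 p.2, p.2)))

end

end LinBoltzmann

open LinBoltzmann

namespace LinBoltzmann

/-! ### Integration tools -/

/-! Half a derivative in `x` is gained by velocity averaging; the work lies in not losing it again
at the boundary.

The operator `K` is an integral operator in `v` with kernel dominated by `|v - w|⁻¹ exp(-|v -
w|²/8)` (`exists_collision_kernel`); for the two gain terms this is Carleman's change of variables
(`exists_gain_le`). After extension by zero outside `Ω`, the operator `S` becomes a damped line
average over a time `d/|w|` in the whole space (`opS_eq_truncS`), that is, a Fourier multiplier in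
`x` bounded by `min(d/|w|, 1/|w·ξ|)`. Its square, integrated in `w` over the slices `w·ξ = const`,
is of size `1/|ξ|`. Hence `K S` maps into `H^{1/2}` in `x` (`exists_averaging_le`), and so does `K S
K`.

The outer `S` has to preserve this regularity. While the backward lines through `x` and `y` are both
inside `Ω`, increments are carried along rigidly. While one line has left and the other has not,
convexity bounds the length of the time interval by `|v|⁻¹ |x - y|^{1/2} dist(x, ∂Ω)^{-1/2}`
(`tauMinus_sub_le`). This weakens the singularity `|x - y|⁻⁴` to `|x - y|^{-7/2}`, whose integral
over the complement of `Ω` is again of size `dist^{-1/2}` (`exists_lintegral_compl_ipow_le`).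
Integration in `v` turns the line integrals into the Riesz potential with kernel `|X|⁻²`, and
`dist^{-1/2}` has a bounded one (`exists_lintegral_ipow_two_bw_le`). So the boundary terms are
controlled by an `L²` norm with weight `dist^{-1/2}` (`exists_gagliardo_transport_le`), and this
norm is finite for `S K f` by the same averaging (`exists_lintegral_bw_truncS_le`).

For the boundary value problem, Duhamel's formula applied twice gives `f = u + S K u + S K S K f`
almost everywhere, with `u` the free transport of the data (`ae_eq_inflow_add`). The last term is
covered by the operator bound. The regularity of `u` reduces to a fractional estimate for the exit
time (`lintegral_tauMinus_sub_le`), and `S K u` inherits it because `K` acts in `v` only.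

Estimates are proved for measurable functions, in part for those vanishing outside `Ω`; `ae_ae_line`
carries them over to classes modulo null sets. -/

theorem sq_lintegral_mul_le {α : Type*} [MeasurableSpace α] {μ : Measure α} {f g : α → ℝ≥0∞}
    (hf : AEMeasurable f μ) (hg : AEMeasurable g μ) :
    (∫⁻ a, f a * g a ∂μ) ^ 2 ≤ (∫⁻ a, f a ^ 2 ∂μ) * ∫⁻ a, g a ^ 2 ∂μ := by
  have h := ENNReal.lintegral_mul_le_Lp_mul_Lq μ Real.HolderConjugate.two_two hf hg
  simp only [Pi.mul_apply, ENNReal.rpow_two] at h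
  calc _ ≤ ((∫⁻ a, f a ^ 2 ∂μ) ^ (1 / 2 : ℝ) * (∫⁻ a, g a ^ 2 ∂μ) ^ (1 / 2 : ℝ)) ^ 2 := by gcongr
    _ = _ := by
      rw [mul_pow, ← ENNReal.rpow_natCast, ← ENNReal.rpow_natCast, ← ENNReal.rpow_mul,
        ← ENNReal.rpow_mul]
      norm_num

theorem sq_setLIntegral_le {α : Type*} [MeasurableSpace α] {μ : Measure α} {f : α → ℝ≥0∞}
    (s : Set α) (hf : AEMeasurable f (μ.restrict s)) :
    (∫⁻ a in s, f a ∂μ) ^ 2 ≤ μ s * ∫⁻ a in s, f a ^ 2 ∂μ := by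
  have h := sq_lintegral_mul_le (μ := μ.restrict s) (f := fun _ => 1) aemeasurable_const hf
  simpa using h

theorem ennreal_add_sq_le (a b : ℝ≥0∞) : (a + b) ^ 2 ≤ 2 * (a ^ 2 + b ^ 2) := by
  have := ENNReal.rpow_add_le_mul_rpow_add_rpow a b (p := 2) (by norm_num)
  norm_num at this
  simpa using this

/-- The inverse power `|z|^{-a}`, equal to `∞` at `0` for `a > 0`. -/
noncomputable def ipow {E : Type*} [NormedAddCommGroup E] (a : ℝ) (z : E) : ℝ≥0∞ :=
  (‖z‖ₑ⁻¹) ^ a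

/-- The Gaussian-damped inverse power `|z|^{-a} exp(-c |z|²)`. -/
noncomputable def gk {E : Type*} [NormedAddCommGroup E] (a c : ℝ) (z : E) : ℝ≥0∞ :=
  ipow a z * ENNReal.ofReal (Real.exp (-c * ‖z‖ ^ 2))

/-! ### Inverse powers with Gaussian damping. -/

section kernels

variable {E F : Type*} [NormedAddCommGroup E] [NormedAddCommGroup F]

theorem measurable_ipow [MeasurableSpace E] [OpensMeasurableSpace E] (a : ℝ) :
    Measurable (ipow a : E → ℝ≥0∞) := by
  unfold ipow; fun_prop

theorem measurable_gk [MeasurableSpace E] [OpensMeasurableSpace E] (a c : ℝ) :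
    Measurable (gk a c : E → ℝ≥0∞) := by
  unfold gk; exact (measurable_ipow a).mul (by fun_prop)

theorem ipow_neg (a : ℝ) (z : E) : ipow a (-z) = ipow a z := by simp [ipow]

theorem gk_neg (a c : ℝ) (z : E) : gk a c (-z) = gk a c z := by simp [gk, ipow_neg]

theorem gk_sub_comm (a c : ℝ) (z w : E) : gk a c (z - w) = gk a c (w - z) := by
  rw [← gk_neg, neg_sub]

theorem ipow_sub_comm (a : ℝ) (z w : E) : ipow a (z - w) = ipow a (w - z) := by
  rw [← ipow_neg, neg_sub]

theorem ipow_eq_ofReal (a : ℝ) {z : E} (hz : z ≠ 0) :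
    ipow a z = ENNReal.ofReal (‖z‖ ^ (-a)) := by
  have h : 0 < ‖z‖ := norm_pos_iff.2 hz
  rw [ipow, ← ofReal_norm, ← ENNReal.ofReal_inv_of_pos h, ENNReal.ofReal_rpow_of_pos (inv_pos.2 h),
    Real.inv_rpow h.le, Real.rpow_neg h.le]

theorem ipow_add {a b : ℝ} (ha : 0 ≤ a) (hb : 0 ≤ b) (z : E) :
    ipow (a + b) z = ipow a z * ipow b z :=
  ENNReal.rpow_add_of_nonneg _ _ ha hb

theorem ipow_anti {a : ℝ} (ha : 0 ≤ a) {z : E} {w : F} (h : ‖z‖ ≤ ‖w‖) :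
    ipow a w ≤ ipow a z := by
  refine ENNReal.rpow_le_rpow (ENNReal.inv_le_inv.2 ?_) ha
  rw [← ofReal_norm, ← ofReal_norm]; exact ENNReal.ofReal_le_ofReal h

theorem gk_anti {a c : ℝ} (ha : 0 ≤ a) (hc : 0 ≤ c) {z : E} {w : F} (h : ‖z‖ ≤ ‖w‖) :
    gk a c w ≤ gk a c z := by
  unfold gk
  gcongr 1
  · exact ipow_anti ha h
  · apply ENNReal.ofReal_le_ofReal
    apply Real.exp_le_exp.2
    have : ‖z‖ ^ 2 ≤ ‖w‖ ^ 2 := by gcongr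
    nlinarith

theorem ipow_ne_top {a : ℝ} (ha : 0 ≤ a) {z : E} (hz : z ≠ 0) : ipow a z ≠ ∞ := by
  refine ENNReal.rpow_ne_top_of_nonneg ha ?_
  simpa using hz

theorem gk_mul_gk {a b c c' : ℝ} (ha : 0 ≤ a) (hb : 0 ≤ b) (z : E) :
    gk a c z * gk b c' z = gk (a + b) (c + c') z := by
  unfold gk
  rw [ipow_add ha hb, show -(c + c') * ‖z‖ ^ 2 = -c * ‖z‖ ^ 2 + -c' * ‖z‖ ^ 2 by ring,
    Real.exp_add, ENNReal.ofReal_mul (Real.exp_nonneg _)]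
  ring

theorem gk_sq {a c : ℝ} (ha : 0 ≤ a) (z : E) : gk a c z ^ 2 = gk (2 * a) (2 * c) z := by
  rw [sq, gk_mul_gk ha ha, two_mul, two_mul]

/-- The radial density in polar coordinates is `r^{n-1-a} exp(-c r²)`, integrable at the origin as
soon as `a < n`. -/
theorem lintegral_gk_lt_top [NormedSpace ℝ E] [FiniteDimensional ℝ E] [Nontrivial E]
    [MeasurableSpace E] [BorelSpace E] (μ : Measure E) [μ.IsAddHaarMeasure] {a c : ℝ}
    (ha : a < Module.finrank ℝ E) (hc : 0 < c) : ∫⁻ z, gk a c z ∂μ < ∞ := by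
  have hInt : Integrable (fun z : E => ‖z‖ ^ (-a) * Real.exp (-c * ‖z‖ ^ 2)) μ := by
    rw [integrable_fun_norm_addHaar μ (f := fun r => r ^ (-a) * Real.exp (-c * r ^ 2))]
    have h1 := integrableOn_rpow_mul_exp_neg_mul_sq hc
      (s := (Module.finrank ℝ E : ℝ) - 1 - a) (by linarith)
    refine h1.congr_fun (fun r hr => ?_) measurableSet_Ioi
    have hr' : 0 < r := hr
    have hd : 1 ≤ Module.finrank ℝ E := Module.finrank_pos
    simp only [smul_eq_mul]
    rw [sub_eq_add_neg, Real.rpow_add hr', ← Nat.cast_pred hd, Real.rpow_natCast, mul_assoc]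
  refine lt_of_eq_of_lt (lintegral_congr_ae ?_) hInt.lintegral_lt_top
  filter_upwards [compl_mem_ae_iff.2 (measure_singleton (0 : E))] with z hz
  rw [gk, ipow_eq_ofReal a hz, ← ENNReal.ofReal_mul (by positivity)]

end kernels

theorem finrank_V3 : Module.finrank ℝ V3 = 3 := by simp

theorem exists_lintegral_gk_le (a c : ℝ) (ha : a < 3) (hc : 0 < c) :
    ∃ C : ℝ≥0, ∀ w : V3, ∫⁻ v, gk a c (v - w) ≤ C := by
  have h := lintegral_gk_lt_top (E := V3) volume (a := a) (c := c)
    (by rw [finrank_V3]; exact_mod_cast ha) hc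
  refine ⟨(∫⁻ z : V3, gk a c z).toNNReal, fun w => ?_⟩
  rw [ENNReal.coe_toNNReal h.ne, lintegral_sub_right_eq_self (fun v => gk a c v) w]

theorem exists_lintegral_real_gk_le (a c : ℝ) (ha : a < 1) (hc : 0 < c) :
    ∃ C : ℝ≥0, ∀ w : ℝ, ∫⁻ v : ℝ, gk a c (v - w) ≤ C := by
  have h := lintegral_gk_lt_top (E := ℝ) volume (a := a) (c := c) (by simpa using ha) hc
  refine ⟨(∫⁻ z : ℝ, gk a c z).toNNReal, fun w => ?_⟩
  rw [ENNReal.coe_toNNReal h.ne, lintegral_sub_right_eq_self (fun v => gk a c v) w]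

/-- The weight `|v|⁻²` is what the square of the exit-time bound `d/|v|` costs. Of the two poles `0`
and `w`, the nearer one can be made to carry both powers, and `2 + 1/2 < 3` keeps the result
integrable uniformly in `w`. -/
theorem exists_lintegral_ipow_two_mul_gk_le (c : ℝ) (hc : 0 < c) :
    ∃ C : ℝ≥0, ∀ w : V3, ∫⁻ v, (1 + ipow 2 v) * gk (1 / 2) c (v - w) ≤ C := by
  obtain ⟨C₁, h₁⟩ := exists_lintegral_gk_le (1 / 2) c (by norm_num) hc
  obtain ⟨C₂, h₂⟩ := exists_lintegral_gk_le (5 / 2) c (by norm_num) hc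
  refine ⟨C₁ + (C₂ + C₂), fun w => ?_⟩
  have key : ∀ v : V3, (1 + ipow 2 v) * gk (1 / 2) c (v - w) ≤
      gk (1 / 2) c (v - w) + (gk (5 / 2) c (v - w) + gk (5 / 2) c (v - 0)) := by
    intro v
    rw [add_mul, one_mul, sub_zero]
    gcongr
    have e : ∀ z : V3, gk (5 / 2) c z = ipow 2 z * gk (1 / 2) c z := by
      intro z
      rw [gk, gk, ← mul_assoc, ← ipow_add (by norm_num) (by norm_num)]
      norm_num
    rcases le_total ‖v‖ ‖v - w‖ with h | h
    · refine le_trans ?_ le_add_self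
      rw [e v]; gcongr; exact gk_anti (by norm_num) hc.le h
    · refine le_trans ?_ le_self_add
      rw [e (v - w)]; gcongr; exact ipow_anti (by norm_num) h
  have m : ∀ (a : ℝ) (w : V3), Measurable fun v => gk a c (v - w) := fun a w =>
    (measurable_gk a c).comp (measurable_id.sub_const w)
  calc _ ≤ ∫⁻ v, (gk (1 / 2) c (v - w) + (gk (5 / 2) c (v - w) + gk (5 / 2) c (v - 0))) :=
        lintegral_mono key
    _ = (∫⁻ v, gk (1 / 2) c (v - w)) + ((∫⁻ v, gk (5 / 2) c (v - w)) +
          ∫⁻ v : V3, gk (5 / 2) c (v - 0)) := by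
        rw [lintegral_add_left (m _ _), lintegral_add_left (m _ _)]
    _ ≤ _ := by push_cast; exact add_le_add (h₁ w) (add_le_add (h₂ w) (h₂ 0))

/-- Projection onto the ray only shrinks distances, `|t e - w| ≥ |t - ⟪e, w⟫|`, so a one-dimensional
kernel with exponent `1/2 < 1` dominates, uniformly in `w`. -/
theorem exists_lintegral_ray_gk_le (c : ℝ) (hc : 0 < c) :
    ∃ C : ℝ≥0, ∀ (e w : V3), ‖e‖ = 1 →
      ∫⁻ t in Ioi (0 : ℝ), gk (1 / 2) c (t • e - w) ≤ C := by
  obtain ⟨C, h⟩ := exists_lintegral_real_gk_le (1 / 2) c (by norm_num) hc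
  refine ⟨C, fun e w he => (setLIntegral_le_lintegral _ _).trans
    (le_trans (lintegral_mono fun t => ?_) (h ⟪e, w⟫))⟩
  refine gk_anti (by norm_num) hc.le ?_
  have h1 := abs_real_inner_le_norm e (t • e - w)
  rw [he, one_mul, inner_sub_right, inner_smul_right, real_inner_self_eq_norm_sq, he] at h1
  simpa using h1

/-- Integration in polar coordinates. -/
theorem lintegral_polar {Φ : V3 → ℝ≥0∞} (hΦ : Measurable Φ) :
    ∫⁻ x, Φ x = ∫⁻ σ : Metric.sphere (0 : V3) 1, (∫⁻ r in Ioi (0 : ℝ),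
      ENNReal.ofReal (r ^ 2) * Φ (r • (σ : V3))) ∂(volume : Measure V3).toSphere := by
  have hmp := (volume : Measure V3).measurePreserving_homeomorphUnitSphereProd
  rw [finrank_V3] at hmp
  have hr : volume.restrict ({0}ᶜ : Set V3) = volume := by
    rw [Measure.restrict_eq_self_of_ae_mem]
    exact compl_mem_ae_iff.2 (measure_singleton (0 : V3))
  have e1 : ∫⁻ x, Φ x = ∫⁻ x : ({0}ᶜ : Set V3), Φ x ∂(volume.comap Subtype.val) := by
    rw [lintegral_subtype_comap (measurableSet_singleton (0 : V3)).compl, hr]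
  have hm : Measurable fun p : Metric.sphere (0 : V3) 1 × Ioi (0 : ℝ) =>
      Φ ((p.2 : ℝ) • (p.1 : V3)) := by
    apply hΦ.comp; fun_prop
  rw [e1]
  have e2 : ∀ x : ({0}ᶜ : Set V3), Φ x = (fun p : Metric.sphere (0 : V3) 1 × Ioi (0 : ℝ) =>
      Φ ((p.2 : ℝ) • (p.1 : V3))) (homeomorphUnitSphereProd V3 x) := by
    intro x
    have h := (homeomorphUnitSphereProd V3).symm_apply_apply x
    conv_lhs => rw [← h]
    rfl
  rw [lintegral_congr e2, hmp.lintegral_comp hm, lintegral_prod _ hm.aemeasurable]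
  refine lintegral_congr fun σ => ?_
  have hσ : Measurable fun r : Ioi (0 : ℝ) => Φ ((r : ℝ) • (σ : V3)) :=
    hm.comp measurable_prodMk_left
  rw [Measure.volumeIoiPow, lintegral_withDensity_eq_lintegral_mul _ (by fun_prop) hσ]
  exact lintegral_subtype_comap measurableSet_Ioi
    (fun r => ENNReal.ofReal (r ^ 2) * Φ (r • (σ : V3)))

/-- Integration in the coordinates of an orthonormal frame. -/
theorem lintegral_frame {e₁ e₂ e₃ : V3} (he : Orthonormal ℝ ![e₁, e₂, e₃]) {Φ : V3 → ℝ≥0∞}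
    (hΦ : Measurable Φ) :
    ∫⁻ x, Φ x = ∫⁻ a : ℝ, ∫⁻ b : ℝ, ∫⁻ c : ℝ, Φ (a • e₁ + b • e₂ + c • e₃) := by
  have hsp : ⊤ ≤ Submodule.span ℝ (Set.range ![e₁, e₂, e₃]) := by
    rw [he.linearIndependent.span_eq_top_of_card_eq_finrank' (by simp)]
  let b := OrthonormalBasis.mk he hsp
  have h1 := b.measurePreserving_repr_symm
  have h2 := (EuclideanSpace.volume_preserving_symm_measurableEquiv_toLp (Fin 3)).symm
  have h3 := volume_preserving_piFinSuccAbove (fun _ : Fin 3 => ℝ) 0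
  have h4 := volume_preserving_finTwoArrow ℝ
  rw [← h1.lintegral_comp hΦ, ← h2.lintegral_comp (by
    exact hΦ.comp b.repr.symm.continuous.measurable)]
  rw [← h3.symm.lintegral_comp (by
    exact hΦ.comp (b.repr.symm.continuous.measurable.comp (MeasurableEquiv.measurable _)))]
  have hm : Measurable fun p : ℝ × (Fin 2 → ℝ) => Φ (p.1 • e₁ + p.2 0 • e₂ + p.2 1 • e₃) := by
    apply hΦ.comp; fun_prop
  have hm' : Measurable fun p : ℝ × ℝ × ℝ => Φ (p.1 • e₁ + p.2.1 • e₂ + p.2.2 • e₃) := by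
    apply hΦ.comp; fun_prop
  have : ∀ p : ℝ × (Fin 2 → ℝ), Φ (b.repr.symm ((MeasurableEquiv.toLp 2 (Fin 3 → ℝ)).symm.symm
      ((MeasurableEquiv.piFinSuccAbove (fun _ : Fin 3 => ℝ) 0).symm p))) =
      Φ (p.1 • e₁ + p.2 0 • e₂ + p.2 1 • e₃) := by
    intro p
    congr 1
    rw [← b.sum_repr_symm]
    simp [Fin.sum_univ_three, b]
    rfl
  rw [lintegral_congr this]
  rw [Measure.volume_eq_prod, lintegral_prod _ hm.aemeasurable]
  refine lintegral_congr fun a => ?_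
  rw [← h4.symm.lintegral_comp (by
    exact hm.comp measurable_prodMk_left)]
  rw [Measure.volume_eq_prod, lintegral_prod]
  · rfl
  · apply Measurable.aemeasurable
    apply hΦ.comp
    have : Measurable fun a : ℝ × ℝ => (MeasurableEquiv.finTwoArrow (α := ℝ)).symm a :=
      MeasurableEquiv.measurable _
    fun_prop

theorem orthonormal_triple {e₁ e₂ e₃ : V3} (h₁ : ‖e₁‖ = 1) (h₂ : ‖e₂‖ = 1) (h₃ : ‖e₃‖ = 1)
    (h₁₂ : ⟪e₁, e₂⟫ = 0) (h₁₃ : ⟪e₁, e₃⟫ = 0) (h₂₃ : ⟪e₂, e₃⟫ = 0) :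
    Orthonormal ℝ ![e₁, e₂, e₃] := by
  constructor
  · intro i; fin_cases i <;> simpa
  · intro i j hij
    fin_cases i <;> fin_cases j <;> simp_all [real_inner_comm]

theorem norm_sq_V3 (x : V3) : ‖x‖ ^ 2 = x 0 ^ 2 + x 1 ^ 2 + x 2 ^ 2 := by
  simp [EuclideanSpace.norm_sq_eq, Fin.sum_univ_three]

theorem inner_V3 (x y : V3) : ⟪x, y⟫ = x 0 * y 0 + x 1 * y 1 + x 2 * y 2 := by
  simp [PiLp.inner_apply, Fin.sum_univ_three, mul_comm]

theorem norm_frame₂ (e : V3) : ‖frame₂ e‖ = 1 := by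
  rw [← sq_eq_sq₀ (norm_nonneg _) zero_le_one, norm_sq_V3, frame₂]
  split_ifs with h
  · simp
  · have hp : 0 < e 0 ^ 2 + e 1 ^ 2 := by
      rcases not_and_or.1 h with h | h <;> positivity
    have hs : Real.sqrt (e 0 ^ 2 + e 1 ^ 2) ^ 2 = e 0 ^ 2 + e 1 ^ 2 := Real.sq_sqrt hp.le
    simp only [PiLp.smul_apply, smul_eq_mul, mul_pow, inv_pow, hs]
    simp
    field_simp
    ring

theorem inner_frame₂ (e : V3) : ⟪e, frame₂ e⟫ = 0 := by
  rw [inner_V3, frame₂]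
  split_ifs with h
  · simp [h.1]
  · simp; ring

theorem norm_frame₃ {e : V3} (he : ‖e‖ = 1) : ‖frame₃ e‖ = 1 := by
  have h1 := norm_frame₂ e
  have h2 := inner_frame₂ e
  rw [inner_V3] at h2
  rw [← sq_eq_sq₀ (norm_nonneg _) zero_le_one, norm_sq_V3] at h1 he ⊢
  simp only [frame₃]
  simp
  linear_combination (frame₂ e 0 ^ 2 + frame₂ e 1 ^ 2 + frame₂ e 2 ^ 2) * he + h1 -
    (e 0 * frame₂ e 0 + e 1 * frame₂ e 1 + e 2 * frame₂ e 2) * h2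

theorem orthonormal_frame {e : V3} (he : ‖e‖ = 1) : Orthonormal ℝ ![e, frame₂ e, frame₃ e] := by
  refine orthonormal_triple he (norm_frame₂ e) (norm_frame₃ he) (inner_frame₂ e) ?_ ?_ <;>
  · rw [inner_V3]; simp [frame₃]; ring

theorem orthonormal_frame_neg {e : V3} (he : ‖e‖ = 1) :
    Orthonormal ℝ ![e, -frame₂ e, -frame₃ e] := by
  have h := orthonormal_frame he
  refine orthonormal_triple he (by simpa using norm_frame₂ e) (by simpa using norm_frame₃ he)
    (by simpa using inner_frame₂ e) ?_ ?_
  · simpa using h.2 (show (0 : Fin 3) ≠ 2 by decide)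
  · simpa using h.2 (show (1 : Fin 3) ≠ 2 by decide)

/-- The exponent `3/2` splits as `3/4 + 3/4` over the two coordinates orthogonal to `e`, each
integrable on a line. Only the integral along `e` survives; `Θ` will be the bound for a Fourier
multiplier depending on `⟪e, w⟫`. -/
theorem exists_lintegral_slice_le (c : ℝ) (hc : 0 < c) :
    ∃ C : ℝ≥0, ∀ (e v : V3) (Θ : ℝ → ℝ≥0∞), ‖e‖ = 1 → Measurable Θ →
      ∫⁻ w, gk (3 / 2) c (v - w) * Θ ⟪e, w⟫ ≤ C * ∫⁻ t, Θ t := by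
  obtain ⟨C, h⟩ := exists_lintegral_real_gk_le (3 / 4) (c / 2) (by norm_num) (by positivity)
  refine ⟨C * C, fun e v Θ he hΘ => ?_⟩
  have hf := orthonormal_frame he
  set f := frame₂ e
  set g := frame₃ e
  have i₁ : ⟪e, f⟫ = 0 := by simpa using hf.2 (show (0 : Fin 3) ≠ 1 by decide)
  have i₂ : ⟪e, g⟫ = 0 := by simpa using hf.2 (show (0 : Fin 3) ≠ 2 by decide)
  have i₃ : ⟪f, g⟫ = 0 := by simpa using hf.2 (show (1 : Fin 3) ≠ 2 by decide)
  have i₁' : ⟪f, e⟫ = 0 := by rwa [real_inner_comm]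
  have i₂' : ⟪g, e⟫ = 0 := by rwa [real_inner_comm]
  have i₃' : ⟪g, f⟫ = 0 := by rwa [real_inner_comm]
  have nf : ‖f‖ = 1 := hf.1 1
  have ng : ‖g‖ = 1 := hf.1 2
  have mg : Measurable fun z : ℝ => gk (3 / 4) (c / 2) z := measurable_gk _ _
  have key : ∀ z : V3, gk (3 / 2) c z ≤
      gk (3 / 4) (c / 2) ⟪f, z⟫ * gk (3 / 4) (c / 2) ⟪g, z⟫ := by
    intro z
    have : gk (3 / 2) c z = gk (3 / 4) (c / 2) z * gk (3 / 4) (c / 2) z := by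
      rw [gk_mul_gk (by norm_num) (by norm_num)]; norm_num
    rw [this]
    gcongr 1 <;> refine gk_anti (by norm_num) (by positivity) ?_
    · simpa [nf] using norm_inner_le_norm (𝕜 := ℝ) f z
    · simpa [ng] using norm_inner_le_norm (𝕜 := ℝ) g z
  calc ∫⁻ w, gk (3 / 2) c (v - w) * Θ ⟪e, w⟫
      ≤ ∫⁻ w, gk (3 / 4) (c / 2) (⟪f, w⟫ - ⟪f, v⟫) * gk (3 / 4) (c / 2) (⟪g, w⟫ - ⟪g, v⟫) *
          Θ ⟪e, w⟫ := by
        refine lintegral_mono fun w => ?_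
        gcongr
        rw [gk_sub_comm, ← inner_sub_right, ← inner_sub_right]; exact key _
    _ = ∫⁻ a : ℝ, ∫⁻ x : ℝ, ∫⁻ y : ℝ, gk (3 / 4) (c / 2) (x - ⟪f, v⟫) *
          gk (3 / 4) (c / 2) (y - ⟪g, v⟫) * Θ a := by
        rw [lintegral_frame hf]
        · simp only [inner_add_right, inner_smul_right, i₁, i₂, i₃, i₁', i₂', i₃',
            real_inner_self_eq_norm_sq, he, nf, ng]
          simp
        · refine Measurable.mul (Measurable.mul (mg.comp ?_) (mg.comp ?_)) (hΘ.comp ?_) <;> fun_prop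
    _ = ∫⁻ a : ℝ, ((∫⁻ x : ℝ, gk (3 / 4) (c / 2) (x - ⟪f, v⟫)) *
          (∫⁻ y : ℝ, gk (3 / 4) (c / 2) (y - ⟪g, v⟫))) * Θ a := by
        refine lintegral_congr fun a => ?_
        have m1 : ∀ u : ℝ, Measurable fun x : ℝ => gk (3 / 4) (c / 2) (x - u) := fun u =>
          mg.comp (measurable_id.sub_const u)
        simp_rw [mul_assoc, lintegral_const_mul _ ((m1 _).mul_const _),
          lintegral_mul_const _ (m1 _)]
    _ ≤ ∫⁻ a : ℝ, ((C : ℝ≥0∞) * C) * Θ a := by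
        gcongr <;> exact h _
    _ = _ := by rw [lintegral_const_mul _ hΘ, ENNReal.coe_mul]

/-- Averaging of line integrals over a concentrated set of directions. -/
theorem exists_lintegral_gk_line_le (c : ℝ) (hc : 0 < c) :
    ∃ C : ℝ≥0, ∀ (w x : V3) (Θ : V3 → ℝ≥0∞), Measurable Θ →
      ∫⁻ v, gk (1 / 2) c (v - w) * ipow 1 v * ∫⁻ s in Ioi (0 : ℝ), Θ (x + s • v) ≤
        C * ∫⁻ X, ipow 2 X * Θ (x + X) := by
  obtain ⟨C, h⟩ := exists_lintegral_ray_gk_le c hc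
  refine ⟨C, fun w x Θ hΘ => ?_⟩
  have hm : Measurable fun v : V3 => gk (1 / 2) c (v - w) * ipow 1 v *
      ∫⁻ s in Ioi (0 : ℝ), Θ (x + s • v) := by
    refine (((measurable_gk _ _).comp (measurable_id.sub_const w)).mul (measurable_ipow 1)).mul ?_
    refine Measurable.lintegral_prod_right' (f := fun p : V3 × ℝ => Θ (x + p.2 • p.1)) ?_
    apply hΘ.comp; fun_prop
  have hm2 : Measurable fun X : V3 => ipow 2 X * Θ (x + X) :=
    (measurable_ipow 2).mul (hΘ.comp (measurable_const_add x))
  rw [lintegral_polar hm, lintegral_polar hm2, ← lintegral_const_mul']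
  swap; · simp
  refine lintegral_mono fun σ => ?_
  have hσ : ‖(σ : V3)‖ = 1 := by simp
  have hσ0 : (σ : V3) ≠ 0 := by intro h; simp [h] at hσ
  -- The Jacobian `r²` cancels `|X|⁻²`.
  have e1 : ∀ r ∈ Ioi (0 : ℝ), ENNReal.ofReal (r ^ 2) * (ipow 2 (r • (σ : V3)) *
      Θ (x + r • (σ : V3))) = Θ (x + r • (σ : V3)) := by
    intro r hr
    have hr' : 0 < r := hr
    rw [← mul_assoc, ipow_eq_ofReal _ (smul_ne_zero hr'.ne' hσ0), ← ENNReal.ofReal_mul (by positivity),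
      norm_smul, hσ, mul_one, Real.norm_of_nonneg hr'.le, Real.rpow_neg hr'.le, Real.rpow_two,
      mul_inv_cancel₀ (by positivity), ENNReal.ofReal_one, one_mul]
  rw [setLIntegral_congr_fun measurableSet_Ioi e1]
  -- The Jacobian `r²` is used up by the factor `|v|⁻¹` and by the substitution `s ↦ s r`, which
  -- passes to unit speed. What is left in `r` is the kernel along a ray.
  have e2 : ∀ r ∈ Ioi (0 : ℝ), ENNReal.ofReal (r ^ 2) * (gk (1 / 2) c (r • (σ : V3) - w) *
      ipow 1 (r • (σ : V3)) * ∫⁻ s in Ioi (0 : ℝ), Θ (x + s • r • (σ : V3))) =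
      gk (1 / 2) c (r • (σ : V3) - w) * ∫⁻ s in Ioi (0 : ℝ), Θ (x + s • (σ : V3)) := by
    intro r hr
    have hr' : 0 < r := hr
    have hsub : ∫⁻ s in Ioi (0 : ℝ), Θ (x + s • (σ : V3)) =
        ENNReal.ofReal r * ∫⁻ s in Ioi (0 : ℝ), Θ (x + s • r • (σ : V3)) := by
      have himg : (fun s : ℝ => s * r) '' Ioi 0 = Ioi 0 := by
        ext t
        exact ⟨fun ⟨s, hs, hst⟩ => hst ▸ mul_pos hs hr',
          fun ht => ⟨t / r, div_pos ht hr', div_mul_cancel₀ t hr'.ne'⟩⟩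
      rw [← himg, lintegral_image_eq_lintegral_abs_deriv_mul measurableSet_Ioi (f' := fun _ => r)
        (fun s _ => by simpa using ((hasDerivAt_id s).mul_const r).hasDerivWithinAt)
        (fun a _ b _ hab => mul_right_cancel₀ hr'.ne' hab), himg, ← lintegral_const_mul]
      · simp only [abs_of_pos hr', smul_smul]
      · apply hΘ.comp; fun_prop
    rw [hsub, ipow_eq_ofReal _ (smul_ne_zero hr'.ne' hσ0), norm_smul, hσ, mul_one,
      Real.norm_of_nonneg hr'.le, Real.rpow_neg_one]
    have : ENNReal.ofReal (r ^ 2) * ENNReal.ofReal r⁻¹ = ENNReal.ofReal r := by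
      rw [← ENNReal.ofReal_mul (by positivity)]; congr 1; field_simp
    rw [← this]; ring
  rw [setLIntegral_congr_fun measurableSet_Ioi e2, lintegral_mul_const]
  · gcongr; exact h _ _ hσ
  · apply (measurable_gk _ _).comp; fun_prop

end LinBoltzmann

namespace LinBoltzmann

/-! ### Spherical coordinates -/

theorem lintegral_polar_plane {F : ℝ → ℝ → ℝ≥0∞} (hF : Measurable (Function.uncurry F)) :
    ∫⁻ b : ℝ, ∫⁻ c : ℝ, F b c = ∫⁻ s in Ioi (0 : ℝ), ∫⁻ φ in Ioo (-Real.pi) Real.pi,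
      ENNReal.ofReal s * F (s * Real.cos φ) (s * Real.sin φ) := by
  rw [← lintegral_prod (fun p : ℝ × ℝ => F p.1 p.2) hF.aemeasurable, ← Measure.volume_eq_prod,
    ← lintegral_comp_polarCoord_symm]
  have hm : Measurable fun p : ℝ × ℝ => ENNReal.ofReal p.1 *
      F (p.1 * Real.cos p.2) (p.1 * Real.sin p.2) := by
    refine Measurable.mul (by fun_prop) ?_
    exact hF.comp (f := fun p : ℝ × ℝ => (p.1 * Real.cos p.2, p.1 * Real.sin p.2)) (by fun_prop)
  simp only [polarCoord_target, polarCoord_symm_apply, smul_eq_mul]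
  rw [Measure.volume_eq_prod, ← Measure.prod_restrict, lintegral_prod _ hm.aemeasurable]

theorem lintegral_Ioo_shift_pi {F : ℝ → ℝ≥0∞} :
    ∫⁻ φ in Ioo (-Real.pi) Real.pi, F φ = ∫⁻ ε in Ioo 0 (2 * Real.pi), F (ε - Real.pi) := by
  rw [← lintegral_indicator measurableSet_Ioo, ← lintegral_indicator measurableSet_Ioo,
    ← lintegral_sub_right_eq_self _ Real.pi]
  refine lintegral_congr fun ε => ?_
  by_cases h : ε ∈ Ioo 0 (2 * Real.pi)
  · have h' : ε - Real.pi ∈ Ioo (-Real.pi) Real.pi := ⟨by linarith [h.1], by linarith [h.2]⟩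
    rw [indicator_of_mem h, indicator_of_mem h']
  · have h' : ε - Real.pi ∉ Ioo (-Real.pi) Real.pi :=
      fun h' => h ⟨by linarith [h'.1], by linarith [h'.2]⟩
    rw [indicator_of_notMem h, indicator_of_notMem h']

/-- Unit vector with polar angle `θ` and azimuth `ε` in a frame `(e, f, g)`. -/
noncomputable def sphVec (e f g : V3) (θ ε : ℝ) : V3 :=
  Real.cos θ • e + (Real.sin θ * Real.cos ε) • f + (Real.sin θ * Real.sin ε) • g

/-- Integration in spherical coordinates. -/
theorem lintegral_spherical {e f g : V3} (he : Orthonormal ℝ ![e, -f, -g]) {Φ : V3 → ℝ≥0∞}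
    (hΦ : Measurable Φ) :
    ∫⁻ x, Φ x = ∫⁻ ε in Ioo 0 (2 * Real.pi), ∫⁻ ρ in Ioi (0 : ℝ), ∫⁻ θ in Ioo 0 Real.pi,
      ENNReal.ofReal (ρ ^ 2 * Real.sin θ) * Φ (ρ • sphVec e f g θ ε) := by
  rw [lintegral_frame he hΦ]
  have s1 : ∀ a : ℝ, ∫⁻ b : ℝ, ∫⁻ c : ℝ, Φ (a • e + b • -f + c • -g) =
      ∫⁻ s in Ioi (0 : ℝ), ∫⁻ ε in Ioo 0 (2 * Real.pi), ENNReal.ofReal s *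
        Φ (a • e + (s * Real.cos ε) • f + (s * Real.sin ε) • g) := by
    intro a
    rw [lintegral_polar_plane (F := fun b c => Φ (a • e + b • -f + c • -g))
      (by apply hΦ.comp; fun_prop)]
    refine lintegral_congr fun s => ?_
    -- Moving the azimuth from `(-π, π)` to `(0, 2π)` reverses the sign of its sine and cosine. This
    -- is why the orthonormal frame is taken with `-f` and `-g`.
    rw [lintegral_Ioo_shift_pi]
    simp only [Real.cos_sub_pi, Real.sin_sub_pi, mul_neg, neg_smul, smul_neg, neg_neg]
  simp_rw [s1]
  have hm : Measurable fun p : ℝ × ℝ × ℝ => ENNReal.ofReal p.2.1 *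
      Φ (p.1 • e + (p.2.1 * Real.cos p.2.2) • f + (p.2.1 * Real.sin p.2.2) • g) :=
    Measurable.mul (by fun_prop) (hΦ.comp (by fun_prop))
  have s2 : ∀ a : ℝ, ∫⁻ s in Ioi (0 : ℝ), ∫⁻ ε in Ioo 0 (2 * Real.pi), ENNReal.ofReal s *
        Φ (a • e + (s * Real.cos ε) • f + (s * Real.sin ε) • g) =
      ∫⁻ ε in Ioo 0 (2 * Real.pi), ∫⁻ s in Ioi (0 : ℝ), ENNReal.ofReal s *
        Φ (a • e + (s * Real.cos ε) • f + (s * Real.sin ε) • g) := by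
    intro a
    rw [lintegral_lintegral_swap]
    exact (hm.comp measurable_prodMk_left).aemeasurable
  simp_rw [s2]
  rw [lintegral_lintegral_swap]
  swap
  · apply Measurable.aemeasurable
    refine Measurable.lintegral_prod_right' (f := fun q : (ℝ × ℝ) × ℝ => ENNReal.ofReal q.2 *
      Φ (q.1.1 • e + (q.2 * Real.cos q.1.2) • f + (q.2 * Real.sin q.1.2) • g)) ?_
    exact Measurable.mul (by fun_prop) (hΦ.comp (by fun_prop))
  refine lintegral_congr fun ε => ?_
  simp_rw [← lintegral_indicator (measurableSet_Ioi (a := (0 : ℝ)))]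
  -- A second polar change, now in the plane of height `a` and cylindrical radius `s`. Only `s > 0`
  -- contributes, which restricts the polar angle to `(0, π)`.
  rw [lintegral_polar_plane (F := fun a s => (Ioi (0 : ℝ)).indicator (fun s => ENNReal.ofReal s *
        Φ (a • e + (s * Real.cos ε) • f + (s * Real.sin ε) • g)) s)]
  swap
  · have : Measurable fun p : ℝ × ℝ => (Prod.snd ⁻¹' Ioi (0 : ℝ)).indicator (fun p : ℝ × ℝ =>
        ENNReal.ofReal p.2 * Φ (p.1 • e + (p.2 * Real.cos ε) • f + (p.2 * Real.sin ε) • g)) p := by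
      refine Measurable.indicator ?_ (measurable_snd measurableSet_Ioi)
      exact Measurable.mul (by fun_prop) (hΦ.comp (by fun_prop))
    exact this
  rw [lintegral_indicator measurableSet_Ioi]
  refine setLIntegral_congr_fun measurableSet_Ioi fun ρ hρ => ?_
  have hρ' : 0 < ρ := hρ
  rw [← lintegral_indicator measurableSet_Ioo, ← lintegral_indicator measurableSet_Ioo]
  refine lintegral_congr fun θ => ?_
  by_cases h : θ ∈ Ioo 0 Real.pi
  · have h' : θ ∈ Ioo (-Real.pi) Real.pi := ⟨by linarith [h.1, Real.pi_pos], h.2⟩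
    have hs : 0 < ρ * Real.sin θ := mul_pos hρ' (Real.sin_pos_of_pos_of_lt_pi h.1 h.2)
    rw [indicator_of_mem h, indicator_of_mem h', indicator_of_mem (by exact hs), ← mul_assoc,
      ← ENNReal.ofReal_mul hρ'.le]
    congr 2
    · ring
    · simp only [sphVec, smul_add, smul_smul, mul_assoc]
  · rw [indicator_of_notMem h]
    by_cases h' : θ ∈ Ioo (-Real.pi) Real.pi
    · have hθ : θ ≤ 0 := by by_contra hc; exact h ⟨not_le.1 hc, h'.2⟩
      have hs : ¬ 0 < ρ * Real.sin θ := by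
        have := Real.sin_nonpos_of_nonpos_of_neg_pi_le hθ h'.1.le
        exact not_lt.2 (mul_nonpos_of_nonneg_of_nonpos hρ'.le this)
      rw [indicator_of_mem h', indicator_of_notMem (by exact hs), mul_zero]
    · rw [indicator_of_notMem h']

theorem norm_sphVec {e f g : V3} (he : Orthonormal ℝ ![e, f, g]) (θ ε : ℝ) :
    ‖sphVec e f g θ ε‖ = 1 ∧ ⟪e, sphVec e f g θ ε⟫ = Real.cos θ := by
  have i₁ : ⟪e, f⟫ = 0 := by simpa using he.2 (show (0 : Fin 3) ≠ 1 by decide)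
  have i₂ : ⟪e, g⟫ = 0 := by simpa using he.2 (show (0 : Fin 3) ≠ 2 by decide)
  have i₃ : ⟪f, g⟫ = 0 := by simpa using he.2 (show (1 : Fin 3) ≠ 2 by decide)
  have n₁ : ⟪e, e⟫ = 1 := by rw [real_inner_self_eq_norm_sq, show ‖e‖ = 1 from he.1 0, one_pow]
  have n₂ : ⟪f, f⟫ = 1 := by rw [real_inner_self_eq_norm_sq, show ‖f‖ = 1 from he.1 1, one_pow]
  have n₃ : ⟪g, g⟫ = 1 := by rw [real_inner_self_eq_norm_sq, show ‖g‖ = 1 from he.1 2, one_pow]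
  constructor
  · rw [← sq_eq_sq₀ (norm_nonneg _) zero_le_one, ← real_inner_self_eq_norm_sq, sphVec]
    simp only [inner_add_left, inner_add_right, inner_smul_left, inner_smul_right, i₁, i₂, i₃, n₁,
      n₂, n₃, real_inner_comm e f, real_inner_comm e g, real_inner_comm f g]
    simp only [conj_trivial]
    linear_combination Real.sin_sq_add_cos_sq θ + Real.sin θ ^ 2 * Real.sin_sq_add_cos_sq ε
  · rw [sphVec]
    simp only [inner_add_right, inner_smul_right, i₁, i₂, n₁, mul_one, mul_zero, add_zero]

/-- The function `ψ`, extended with degree zero to the unit ball and cut to a half-space, is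
integrated once with the abstract sphere measure and once in spherical coordinates. Both results
contain the same radial factor `I`, finite and nonzero, which cancels. -/
theorem lintegral_hemisphere {e f g : V3} (he : Orthonormal ℝ ![e, f, g])
    (he' : Orthonormal ℝ ![e, -f, -g]) {ψ : V3 → ℝ≥0∞} (hψ : Measurable ψ) :
    ∫⁻ ε in Ioc 0 (2 * Real.pi), ∫⁻ θ in Ioc 0 (Real.pi / 2),
        ENNReal.ofReal (Real.sin θ) * ψ (sphVec e f g θ ε) =
      ∫⁻ σ : Metric.sphere (0 : V3) 1, {x : V3 | 0 < ⟪e, x⟫}.indicator ψ σ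
        ∂(volume : Measure V3).toSphere := by
  let Φ : V3 → ℝ≥0∞ := fun x => (Metric.closedBall (0 : V3) 1).indicator
    (fun x => {x : V3 | 0 < ⟪e, x⟫}.indicator ψ (‖x‖⁻¹ • x)) x
  have hS : MeasurableSet {x : V3 | 0 < ⟪e, x⟫} := by
    exact measurableSet_lt measurable_const (by fun_prop)
  have hΦ : Measurable Φ := by
    refine Measurable.indicator ?_ Metric.isClosed_closedBall.measurableSet
    exact (hψ.indicator hS).comp (by fun_prop)
  have hval : ∀ (ρ : ℝ) (x : V3), 0 < ρ → ‖x‖ = 1 →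
      Φ (ρ • x) = (Iic (1 : ℝ)).indicator 1 ρ * {x : V3 | 0 < ⟪e, x⟫}.indicator ψ x := by
    intro ρ x hρ hx
    have h1 : ‖ρ • x‖ = ρ := by rw [norm_smul, hx, mul_one, Real.norm_of_nonneg hρ.le]
    change (Metric.closedBall (0 : V3) 1).indicator _ _ = _
    by_cases h : ρ ≤ 1
    · rw [indicator_of_mem (s := Metric.closedBall (0 : V3) 1) (by simpa [h1] using h),
        indicator_of_mem (s := Iic (1 : ℝ)) (by exact h), h1, smul_smul,
        inv_mul_cancel₀ hρ.ne', one_smul, Pi.one_apply, one_mul]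
    · rw [indicator_of_notMem (s := Metric.closedBall (0 : V3) 1) (by simpa [h1] using h),
        indicator_of_notMem (s := Iic (1 : ℝ)) (by exact h), zero_mul]
  let I : ℝ≥0∞ := ∫⁻ ρ in Ioi (0 : ℝ), ENNReal.ofReal (ρ ^ 2) * (Iic (1 : ℝ)).indicator 1 ρ
  have hI : I ≠ 0 ∧ I ≠ ∞ := by
    have : I = ∫⁻ ρ in Ioc (0 : ℝ) 1, ENNReal.ofReal (ρ ^ 2) := by
      simp only [I]
      rw [← lintegral_indicator measurableSet_Ioi, ← lintegral_indicator measurableSet_Ioc]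
      refine lintegral_congr fun ρ => ?_
      simp only [indicator]
      by_cases h1 : 0 < ρ <;> by_cases h2 : ρ ≤ 1 <;> simp [h1, h2]
    rw [this, ← ofReal_integral_eq_lintegral_ofReal, ← intervalIntegral.integral_of_le zero_le_one]
    · norm_num
    · exact ((continuous_pow 2).intervalIntegrable 0 1).1
    · exact Eventually.of_forall fun ρ => sq_nonneg ρ
  have hm1 : Measurable fun ρ : ℝ => ENNReal.ofReal (ρ ^ 2) * (Iic (1 : ℝ)).indicator 1 ρ := by
    refine Measurable.mul (by fun_prop) (Measurable.indicator measurable_one measurableSet_Iic)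
  have hmσ : Measurable fun σ : Metric.sphere (0 : V3) 1 => {x : V3 | 0 < ⟪e, x⟫}.indicator ψ σ :=
    (hψ.indicator hS).comp measurable_subtype_coe
  have hv : Measurable fun p : ℝ × ℝ => sphVec e f g p.2 p.1 := by unfold sphVec; fun_prop
  have way1 : ∫⁻ x, Φ x = I * ∫⁻ σ : Metric.sphere (0 : V3) 1,
      {x : V3 | 0 < ⟪e, x⟫}.indicator ψ σ ∂(volume : Measure V3).toSphere := by
    rw [lintegral_polar hΦ, ← lintegral_const_mul _ hmσ]
    refine lintegral_congr fun σ => ?_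
    rw [← lintegral_mul_const _ hm1]
    refine setLIntegral_congr_fun measurableSet_Ioi fun r hr => ?_
    rw [hval r σ hr (by simp), mul_assoc]
  have way2 : ∫⁻ x, Φ x = I * ∫⁻ ε in Ioc 0 (2 * Real.pi), ∫⁻ θ in Ioc 0 (Real.pi / 2),
        ENNReal.ofReal (Real.sin θ) * ψ (sphVec e f g θ ε) := by
    rw [lintegral_spherical he' hΦ, ← lintegral_const_mul]
    swap
    · refine Measurable.lintegral_prod_right' (f := fun p : ℝ × ℝ =>
        ENNReal.ofReal (Real.sin p.2) * ψ (sphVec e f g p.2 p.1)) ?_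
      exact Measurable.mul (by fun_prop) (hψ.comp hv)
    rw [Measure.restrict_congr_set Ioo_ae_eq_Ioc]
    refine lintegral_congr fun ε => ?_
    rw [← lintegral_mul_const _ hm1]
    refine setLIntegral_congr_fun measurableSet_Ioi fun ρ hρ => ?_
    have hρ' : 0 < ρ := hρ
    have hmθ : Measurable fun θ : ℝ => ENNReal.ofReal (Real.sin θ) * ψ (sphVec e f g θ ε) :=
      Measurable.mul (by fun_prop) (hψ.comp (by unfold sphVec; fun_prop))
    rw [← lintegral_const_mul _ hmθ, ← Measure.restrict_congr_set Ioo_ae_eq_Ioc,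
      ← lintegral_indicator measurableSet_Ioo, ← lintegral_indicator measurableSet_Ioo]
    refine lintegral_congr fun θ => ?_
    obtain ⟨hn, hc⟩ := norm_sphVec he θ ε
    by_cases h : θ ∈ Ioo 0 Real.pi
    · rw [indicator_of_mem h, hval ρ _ hρ' hn, ENNReal.ofReal_mul (by positivity)]
      by_cases h2 : θ < Real.pi / 2
      · have hc' : 0 < ⟪e, sphVec e f g θ ε⟫ := by
          rw [hc]; exact Real.cos_pos_of_mem_Ioo ⟨by linarith [h.1, Real.pi_pos], h2⟩
        rw [indicator_of_mem (s := Ioo 0 (Real.pi / 2)) ⟨h.1, h2⟩,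
          indicator_of_mem (s := {x : V3 | 0 < ⟪e, x⟫}) hc']
        ring
      · have hc' : ¬ 0 < ⟪e, sphVec e f g θ ε⟫ := by
          rw [hc, not_lt]
          exact Real.cos_nonpos_of_pi_div_two_le_of_le (not_lt.1 h2) (by linarith [h.2, Real.pi_pos])
        rw [indicator_of_notMem (s := Ioo 0 (Real.pi / 2)) (fun hh => h2 hh.2),
          indicator_of_notMem (s := {x : V3 | 0 < ⟪e, x⟫}) hc']
        simp
    · have h' : θ ∉ Ioo 0 (Real.pi / 2) := fun h' => h ⟨h'.1, by linarith [h'.2, Real.pi_pos]⟩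
      rw [indicator_of_notMem h, indicator_of_notMem h']
  exact (ENNReal.mul_right_inj hI.1 hI.2).1 (way2.symm.trans way1)

end LinBoltzmann

namespace LinBoltzmann

/-! ### The Carleman bound for the gain term -/

/-- The integrand of the gain term, with scattering direction `α` and relative velocity `u`. -/
noncomputable def gainIntegrand (γ : ℝ) (v : V3) (h : V3 → ℝ≥0∞) (u α : V3) : ℝ≥0∞ :=
  ENNReal.ofReal (‖u‖ ^ γ * ⟪‖u‖⁻¹ • u, α⟫ *
    Real.exp (‖v‖ ^ 2 / 2 - ‖v + ⟪u, α⟫ • α‖ ^ 2 / 2 - ‖v + u - ⟪u, α⟫ • α‖ ^ 2)) *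
  h (v + ⟪u, α⟫ • α)

theorem measurable_gainIntegrand (γ : ℝ) (v : V3) {h : V3 → ℝ≥0∞} (hh : Measurable h) :
    Measurable fun p : V3 × V3 => gainIntegrand γ v h p.1 p.2 := by
  unfold gainIntegrand
  refine Measurable.mul ?_ (hh.comp (by fun_prop))
  fun_prop

/-- Again two competing poles, `0` and `-a`: the nearer one dominates, with exponent `1/2 < 1`. -/
theorem exists_lintegral_shifted_gaussian_le :
    ∃ C : ℝ≥0, ∀ a : ℝ,
      ∫⁻ b : ℝ, (1 + ipow (1 / 2) b) * ENNReal.ofReal (Real.exp (-(b + a) ^ 2)) ≤ C := by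
  obtain ⟨C₁, h₁⟩ := exists_lintegral_real_gk_le (1 / 2) 1 (by norm_num) one_pos
  obtain ⟨C₀, h₀⟩ := exists_lintegral_real_gk_le 0 1 (by norm_num) one_pos
  refine ⟨C₀ + (C₁ + C₁), fun a => ?_⟩
  have m : ∀ (p w : ℝ), Measurable fun b : ℝ => gk p 1 (b - w) := fun p w =>
    (measurable_gk p 1).comp (measurable_id.sub_const w)
  have e0 : ∀ z : ℝ, gk 0 1 z = ENNReal.ofReal (Real.exp (-z ^ 2)) := by
    intro z; simp [gk, ipow]
  have key : ∀ b : ℝ, (1 + ipow (1 / 2) b) * ENNReal.ofReal (Real.exp (-(b + a) ^ 2)) ≤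
      gk 0 1 (b - -a) + (gk (1 / 2) 1 (b - -a) + gk (1 / 2) 1 (b - 0)) := by
    intro b
    rw [add_mul, one_mul, sub_zero, sub_neg_eq_add, ← e0]
    gcongr
    have e : ∀ z : ℝ, gk (1 / 2) 1 z = ipow (1 / 2) z * gk 0 1 z := by
      intro z
      rw [gk, gk, ← mul_assoc, ← ipow_add (by norm_num) le_rfl]
      norm_num
    rcases le_total ‖b‖ ‖b + a‖ with h | h
    · refine le_trans ?_ le_add_self
      rw [e b]; gcongr; exact gk_anti le_rfl zero_le_one h
    · refine le_trans ?_ le_self_add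
      rw [e (b + a)]; gcongr; exact ipow_anti (by norm_num) h
  calc _ ≤ ∫⁻ b : ℝ, (gk 0 1 (b - -a) + (gk (1 / 2) 1 (b - -a) + gk (1 / 2) 1 (b - 0))) :=
        lintegral_mono key
    _ = (∫⁻ b : ℝ, gk 0 1 (b - -a)) + ((∫⁻ b : ℝ, gk (1 / 2) 1 (b - -a)) +
          ∫⁻ b : ℝ, gk (1 / 2) 1 (b - 0)) := by
        rw [lintegral_add_left (m _ _), lintegral_add_left (m _ _)]
    _ ≤ _ := by push_cast; exact add_le_add (h₀ _) (add_le_add (h₁ _) (h₁ 0))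

/-- With `t/r` the cosine of the scattering angle, the factor is `t r^{γ-1}` and `r^{γ-1} ≤ 1 +
r⁻¹`. The pole `r⁻¹` is shared between two transverse coordinates, `|b|^{-1/2} |c|^{-1/2}`, so that
each part is integrable on a line. -/
theorem rpow_mul_div_le {γ t r b c : ℝ} (hγ : γ ∈ Icc (0 : ℝ) 1) (ht : 0 < t) (hr : t ≤ r)
    (hb : |b| ≤ r) (hc : |c| ≤ r) :
    ENNReal.ofReal (r ^ γ * (t / r)) ≤
      ENNReal.ofReal t * ((1 + ipow (1 / 2) b) * (1 + ipow (1 / 2) c)) := by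
  have hr0 : 0 < r := ht.trans_le hr
  have h1 : r ^ γ * (t / r) = t * r ^ (γ - 1) := by
    rw [Real.rpow_sub_one hr0.ne']; ring
  rw [h1, ENNReal.ofReal_mul ht.le]
  gcongr
  have h2 : ENNReal.ofReal (r ^ (γ - 1)) ≤ 1 + ipow (1 / 2) r * ipow (1 / 2) r := by
    rw [← ipow_add (by norm_num) (by norm_num), ipow_eq_ofReal _ hr0.ne',
      Real.norm_of_nonneg hr0.le, ← ENNReal.ofReal_one, ← ENNReal.ofReal_add zero_le_one (by positivity)]
    apply ENNReal.ofReal_le_ofReal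
    rcases le_total 1 r with h | h
    · have := Real.rpow_le_one_of_one_le_of_nonpos h (by linarith [hγ.2] : γ - 1 ≤ 0)
      have : 0 ≤ r ^ (-(1 / 2 + 1 / 2) : ℝ) := by positivity
      linarith
    · have := Real.rpow_le_rpow_of_exponent_ge hr0 h (by linarith [hγ.1] : (-(1 / 2 + 1 / 2) : ℝ) ≤ γ - 1)
      linarith
  refine h2.trans ?_
  have hb' : ipow (1 / 2) r ≤ ipow (1 / 2) b :=
    ipow_anti (by norm_num) (by simpa [abs_of_pos hr0] using hb)
  have hc' : ipow (1 / 2) r ≤ ipow (1 / 2) c :=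
    ipow_anti (by norm_num) (by simpa [abs_of_pos hr0] using hc)
  calc 1 + ipow (1 / 2) r * ipow (1 / 2) r ≤ 1 + ipow (1 / 2) b * ipow (1 / 2) c := by gcongr
    _ ≤ 1 + ipow (1 / 2) b * ipow (1 / 2) c + (ipow (1 / 2) b + ipow (1 / 2) c) := le_self_add
    _ = _ := by ring

theorem norm_sq_frame {e f g : V3} (he : Orthonormal ℝ ![e, f, g]) (x : V3) :
    ‖x‖ ^ 2 = ⟪e, x⟫ ^ 2 + ⟪f, x⟫ ^ 2 + ⟪g, x⟫ ^ 2 := by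
  have hsp : ⊤ ≤ Submodule.span ℝ (Set.range ![e, f, g]) := by
    rw [he.linearIndependent.span_eq_top_of_card_eq_finrank' (by simp)]
  have h := (OrthonormalBasis.mk he hsp).sum_sq_norm_inner_right x
  simpa [Fin.sum_univ_three] using h.symm

/-- With the scattering direction `e` as first axis, the velocity in the argument of `h` is `v + t
e` and the other one is `v + b f + c g`. The variables therefore separate. -/
theorem gainIntegrand_frame_le {γ : ℝ} (hγ : γ ∈ Icc (0 : ℝ) 1) {e f g : V3}
    (he : Orthonormal ℝ ![e, f, g]) (v : V3) (h : V3 → ℝ≥0∞) {t : ℝ} (ht : 0 < t) (b c : ℝ) :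
    gainIntegrand γ v h (t • e + b • f + c • g) e ≤
      ENNReal.ofReal (t * Real.exp (-(1 / 4) * t ^ 2)) * h (v + t • e) *
        (((1 + ipow (1 / 2) b) * ENNReal.ofReal (Real.exp (-(b + ⟪f, v⟫) ^ 2))) *
        ((1 + ipow (1 / 2) c) * ENNReal.ofReal (Real.exp (-(c + ⟪g, v⟫) ^ 2)))) := by
  have i₁ : ⟪e, f⟫ = 0 := by simpa using he.2 (show (0 : Fin 3) ≠ 1 by decide)
  have i₂ : ⟪e, g⟫ = 0 := by simpa using he.2 (show (0 : Fin 3) ≠ 2 by decide)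
  have i₃ : ⟪f, g⟫ = 0 := by simpa using he.2 (show (1 : Fin 3) ≠ 2 by decide)
  have n₁ : ⟪e, e⟫ = 1 := by rw [real_inner_self_eq_norm_sq, show ‖e‖ = 1 from he.1 0, one_pow]
  have n₂ : ⟪f, f⟫ = 1 := by rw [real_inner_self_eq_norm_sq, show ‖f‖ = 1 from he.1 1, one_pow]
  have n₃ : ⟪g, g⟫ = 1 := by rw [real_inner_self_eq_norm_sq, show ‖g‖ = 1 from he.1 2, one_pow]
  have i₁' : ⟪f, e⟫ = 0 := by rwa [real_inner_comm]
  have i₂' : ⟪g, e⟫ = 0 := by rwa [real_inner_comm]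
  have i₃' : ⟪g, f⟫ = 0 := by rwa [real_inner_comm]
  set u : V3 := t • e + b • f + c • g with hu
  have hue : ⟪u, e⟫ = t := by
    simp only [hu, inner_add_left, inner_smul_left, i₁', i₂', n₁]; simp
  have hnu : ‖u‖ ^ 2 = t ^ 2 + b ^ 2 + c ^ 2 := by
    rw [norm_sq_frame he]
    simp only [hu, inner_add_right, inner_smul_right, i₁, i₂, i₃, i₁', i₂', i₃', n₁, n₂, n₃]
    ring
  have hle : ∀ y : ℝ, y ^ 2 ≤ ‖u‖ ^ 2 → |y| ≤ ‖u‖ := fun y hy =>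
    abs_le_of_sq_le_sq hy (norm_nonneg _)
  have ht' : t ≤ ‖u‖ := (le_abs_self t).trans (hle t (by rw [hnu]; nlinarith))
  -- Completing the square in `⟪e, v⟫` produces `-(⟪e, v⟫ + t/2)² - t²/4`; this is the origin of the
  -- constant `1/4`.
  have hexp : ‖v‖ ^ 2 / 2 - ‖v + ⟪u, e⟫ • e‖ ^ 2 / 2 - ‖v + u - ⟪u, e⟫ • e‖ ^ 2 ≤
      -(1 / 4) * t ^ 2 + (-(b + ⟪f, v⟫) ^ 2 + -(c + ⟪g, v⟫) ^ 2) := by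
    rw [hue, norm_sq_frame he v, norm_sq_frame he (v + t • e), norm_sq_frame he (v + u - t • e)]
    simp only [hu, inner_add_right, inner_sub_right, inner_smul_right, i₁, i₂, i₃, i₁', i₂', i₃',
      n₁, n₂, n₃]
    nlinarith [sq_nonneg (⟪e, v⟫ + t / 2)]
  unfold gainIntegrand
  rw [inner_smul_left, hue]
  rw [hue] at hexp
  have e1 : ENNReal.ofReal (‖u‖ ^ γ * ((starRingEnd ℝ) ‖u‖⁻¹ * t) *
      Real.exp (‖v‖ ^ 2 / 2 - ‖v + t • e‖ ^ 2 / 2 - ‖v + u - t • e‖ ^ 2)) ≤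
      (ENNReal.ofReal t * ((1 + ipow (1 / 2) b) * (1 + ipow (1 / 2) c))) *
      (ENNReal.ofReal (Real.exp (-(1 / 4) * t ^ 2)) *
        (ENNReal.ofReal (Real.exp (-(b + ⟪f, v⟫) ^ 2)) *
          ENNReal.ofReal (Real.exp (-(c + ⟪g, v⟫) ^ 2)))) := by
    rw [conj_trivial, inv_mul_eq_div, ENNReal.ofReal_mul (by positivity)]
    gcongr 1
    · exact rpow_mul_div_le hγ ht ht' (hle b (by rw [hnu]; nlinarith))
        (hle c (by rw [hnu]; nlinarith))
    · rw [← ENNReal.ofReal_mul (by positivity), ← ENNReal.ofReal_mul (by positivity),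
        ← Real.exp_add, ← Real.exp_add]
      exact ENNReal.ofReal_le_ofReal (Real.exp_le_exp.2 hexp)
  calc _ ≤ _ := mul_le_mul_left e1 _
    _ = _ := by rw [ENNReal.ofReal_mul ht.le]; ring

/-- For a fixed scattering direction the two transverse integrals are bounded by a constant. The
remaining `t exp(-t²/4)` equals `t²` times the kernel at `t σ`, ready to be read as polar
coordinates around `v`. -/
theorem lintegral_gain_slice_le {γ : ℝ} (hγ : γ ∈ Icc (0 : ℝ) 1) {C : ℝ≥0}
    (hC : ∀ a : ℝ,
      ∫⁻ b : ℝ, (1 + ipow (1 / 2) b) * ENNReal.ofReal (Real.exp (-(b + a) ^ 2)) ≤ C)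
    (v : V3) {h : V3 → ℝ≥0∞} (hh : Measurable h) {σ : V3} (hσ : ‖σ‖ = 1) :
    ∫⁻ u : V3, {p : V3 × V3 | 0 < ⟪‖p.1‖⁻¹ • p.1, p.2⟫}.indicator
        (fun p => gainIntegrand γ v h p.1 p.2) (u, σ) ≤
      ∫⁻ t in Ioi (0 : ℝ), (C * C : ℝ≥0∞) *
          (ENNReal.ofReal (t ^ 2) * (gk 1 (1 / 4) (t • σ) * h (v + t • σ))) := by
  have hS : MeasurableSet {p : V3 × V3 | 0 < ⟪‖p.1‖⁻¹ • p.1, p.2⟫} :=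
    measurableSet_lt measurable_const (by fun_prop)
  have hΨ : Measurable fun u : V3 => {p : V3 × V3 | 0 < ⟪‖p.1‖⁻¹ • p.1, p.2⟫}.indicator
      (fun p => gainIntegrand γ v h p.1 p.2) (u, σ) :=
    ((measurable_gainIntegrand γ v hh).indicator hS).comp measurable_prodMk_right
  have hσ0 : σ ≠ 0 := by intro h; simp [h] at hσ
  have hf := orthonormal_frame hσ
  rw [lintegral_frame hf (hΨ),
    ← lintegral_indicator measurableSet_Ioi]
  refine lintegral_mono fun t => ?_
  by_cases ht : 0 < t
  · rw [indicator_of_mem (by exact ht)]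
    calc _ ≤ ∫⁻ b : ℝ, ∫⁻ c : ℝ, ENNReal.ofReal (t * Real.exp (-(1 / 4) * t ^ 2)) *
            h (v + t • σ) *
          (((1 + ipow (1 / 2) b) * ENNReal.ofReal (Real.exp (-(b + ⟪frame₂ σ, v⟫) ^ 2))) *
          ((1 + ipow (1 / 2) c) * ENNReal.ofReal (Real.exp (-(c + ⟪frame₃ σ, v⟫) ^ 2)))) := by
          refine lintegral_mono fun b => lintegral_mono fun c => ?_
          refine le_trans ?_ (gainIntegrand_frame_le hγ hf v h ht b c)
          exact indicator_le_self' (fun _ _ => zero_le) _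
      _ = ENNReal.ofReal (t * Real.exp (-(1 / 4) * t ^ 2)) * h (v + t • σ) *
          ((∫⁻ b : ℝ, (1 + ipow (1 / 2) b) *
            ENNReal.ofReal (Real.exp (-(b + ⟪frame₂ σ, v⟫) ^ 2))) *
          (∫⁻ c : ℝ, (1 + ipow (1 / 2) c) *
            ENNReal.ofReal (Real.exp (-(c + ⟪frame₃ σ, v⟫) ^ 2)))) := by
          have mm : ∀ a : ℝ, Measurable fun b : ℝ => (1 + ipow (1 / 2) b) *
              ENNReal.ofReal (Real.exp (-(b + a) ^ 2)) := fun a =>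
            (measurable_const.add (measurable_ipow _)).mul (by fun_prop)
          simp_rw [lintegral_const_mul _ ((mm _).const_mul _), lintegral_const_mul _ (mm _)]
          rw [lintegral_const_mul _ ((mm _).mul_const _), lintegral_mul_const _ (mm _)]
      _ ≤ ENNReal.ofReal (t * Real.exp (-(1 / 4) * t ^ 2)) * h (v + t • σ) *
          (C * C) := by gcongr <;> exact hC _
      _ = _ := by
          have : ENNReal.ofReal (t * Real.exp (-(1 / 4) * t ^ 2)) =
              ENNReal.ofReal (t ^ 2) * gk 1 (1 / 4) (t • σ) := by
            rw [gk, ipow_eq_ofReal _ (smul_ne_zero ht.ne' hσ0), norm_smul, hσ, mul_one,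
              Real.norm_of_nonneg ht.le, Real.rpow_neg_one, ← ENNReal.ofReal_mul (by positivity),
              ← ENNReal.ofReal_mul (by positivity)]
            congr 1
            field_simp
          rw [this]; ring
  · rw [indicator_of_notMem (by exact ht)]
    refine le_of_eq (lintegral_eq_zero_of_ae_eq_zero (Eventually.of_forall fun b =>
      lintegral_eq_zero_of_ae_eq_zero (Eventually.of_forall fun c => ?_)))
    have i₁ : ⟪frame₂ σ, σ⟫ = 0 := by
      simpa using hf.2 (show (1 : Fin 3) ≠ 0 by decide)
    have i₂ : ⟪frame₃ σ, σ⟫ = 0 := by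
      simpa using hf.2 (show (2 : Fin 3) ≠ 0 by decide)
    refine indicator_of_notMem ?_ _
    simp only [mem_ofPred_eq, inner_smul_left, inner_add_left, i₁, i₂,
      real_inner_self_eq_norm_sq, hσ, conj_trivial, mul_zero, add_zero, one_pow, mul_one]
    exact not_lt.2 (mul_nonpos_of_nonneg_of_nonpos (by positivity) (not_lt.1 ht))

theorem ae_ne_zero_V3 : ∀ᵐ u : V3, u ≠ 0 := compl_mem_ae_iff.2 (measure_singleton (0 : V3))

theorem lintegral_gain_angles {γ : ℝ} (v : V3) {f g : V3 → V3} {h : V3 → ℝ≥0∞}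
    (hh : Measurable h)
    (hfg : ∀ e, ‖e‖ = 1 → Orthonormal ℝ ![e, f e, g e] ∧ Orthonormal ℝ ![e, -f e, -g e])
    {u : V3} (hu : u ≠ 0) :
    ∫⁻ ε in Ioc 0 (2 * Real.pi), ∫⁻ θ in Ioc 0 (Real.pi / 2),
        ENNReal.ofReal (Real.sin θ) * gainIntegrand γ v h u
          (sphVec (‖u‖⁻¹ • u) (f (‖u‖⁻¹ • u)) (g (‖u‖⁻¹ • u)) θ ε) =
      ∫⁻ σ : Metric.sphere (0 : V3) 1, {p : V3 × V3 | 0 < ⟪‖p.1‖⁻¹ • p.1, p.2⟫}.indicator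
        (fun p => gainIntegrand γ v h p.1 p.2) (u, (σ : V3)) ∂(volume : Measure V3).toSphere := by
  have hu' : ‖‖u‖⁻¹ • u‖ = 1 := by
    rw [norm_smul, norm_inv, norm_norm, inv_mul_cancel₀ (norm_ne_zero_iff.2 hu)]
  have h1 := (hfg _ hu').1
  have h2 := (hfg _ hu').2
  have hmu : Measurable (gainIntegrand γ v h u) := by
    unfold gainIntegrand
    exact Measurable.mul (by fun_prop) (hh.comp (by fun_prop))
  rw [lintegral_hemisphere h1 h2 hmu]
  refine lintegral_congr fun σ => ?_
  simp only [indicator, mem_ofPred_eq]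

/-- Carleman's representation: after exchanging the integrals over relative velocity and scattering
direction, `t σ` are polar coordinates of `w - v`. The frames `f`, `g` stay free because the term
with `v'_*` needs the reflected frame. -/
theorem exists_gain_le {γ : ℝ} (hγ : γ ∈ Icc (0 : ℝ) 1) :
    ∃ C : ℝ≥0, ∀ (v : V3) (f g : V3 → V3) (h : V3 → ℝ≥0∞), Measurable h →
      (∀ e, ‖e‖ = 1 → Orthonormal ℝ ![e, f e, g e] ∧ Orthonormal ℝ ![e, -f e, -g e]) →
      ∫⁻ u : V3, ∫⁻ ε in Ioc 0 (2 * Real.pi), ∫⁻ θ in Ioc 0 (Real.pi / 2),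
        ENNReal.ofReal (Real.sin θ) * gainIntegrand γ v h u
          (sphVec (‖u‖⁻¹ • u) (f (‖u‖⁻¹ • u)) (g (‖u‖⁻¹ • u)) θ ε) ≤
      C * ∫⁻ w, gk 1 (1 / 4) (v - w) * h w := by
  obtain ⟨C, hC⟩ := exists_lintegral_shifted_gaussian_le
  refine ⟨C * C, fun v f g h hh hfg => ?_⟩
  have hmG := measurable_gainIntegrand γ v hh
  have hS : MeasurableSet {p : V3 × V3 | 0 < ⟪‖p.1‖⁻¹ • p.1, p.2⟫} :=
    measurableSet_lt measurable_const (by fun_prop)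
  let Ψ : V3 × V3 → ℝ≥0∞ := {p : V3 × V3 | 0 < ⟪‖p.1‖⁻¹ • p.1, p.2⟫}.indicator
    fun p => gainIntegrand γ v h p.1 p.2
  have hΨ : Measurable Ψ := hmG.indicator hS
  have hΨσ : Measurable fun p : V3 × Metric.sphere (0 : V3) 1 => Ψ (p.1, p.2) :=
    hΨ.comp (by fun_prop)
  calc _ = ∫⁻ u : V3, ∫⁻ σ : Metric.sphere (0 : V3) 1, Ψ (u, σ) ∂(volume : Measure V3).toSphere := by
        exact lintegral_congr_ae (ae_ne_zero_V3.mono fun u hu => lintegral_gain_angles v hh hfg hu)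
    _ = ∫⁻ σ : Metric.sphere (0 : V3) 1, (∫⁻ u : V3, Ψ (u, σ)) ∂(volume : Measure V3).toSphere :=
        lintegral_lintegral_swap hΨσ.aemeasurable
    _ ≤ ∫⁻ σ : Metric.sphere (0 : V3) 1, (∫⁻ t in Ioi (0 : ℝ), (C * C : ℝ≥0∞) *
          (ENNReal.ofReal (t ^ 2) * (gk 1 (1 / 4) (t • (σ : V3)) * h (v + t • (σ : V3)))))
          ∂(volume : Measure V3).toSphere := by
        refine lintegral_mono fun σ => ?_
        exact lintegral_gain_slice_le hγ hC v hh (by simp)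
    _ = (C * C : ℝ≥0∞) * ∫⁻ z, gk 1 (1 / 4) z * h (v + z) := by
        have mz : Measurable fun z : V3 => gk 1 (1 / 4) z * h (v + z) :=
          (measurable_gk _ _).mul (hh.comp (measurable_const_add v))
        have hCC : (C * C : ℝ≥0∞) ≠ ∞ :=
          (ENNReal.mul_lt_top ENNReal.coe_lt_top ENNReal.coe_lt_top).ne
        simp_rw [lintegral_const_mul' _ _ hCC]
        rw [lintegral_polar mz]
    _ = _ := by
        rw [ENNReal.coe_mul, ← lintegral_add_left_eq_self (fun w => gk 1 (1 / 4) (v - w) * h w) v]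
        simp [gk_neg]

end LinBoltzmann

namespace LinBoltzmann

/-! ### Measurability of the collision data -/

theorem measurable_maxwellian : Measurable maxwellian := by
  unfold maxwellian; fun_prop

theorem maxwellian_pos (v : V3) : 0 < maxwellian v := by
  unfold maxwellian; have := Real.pi_pos; positivity

theorem measurable_toLp_vec {α : Type*} [MeasurableSpace α] {a b c : α → ℝ} (ha : Measurable a)
    (hb : Measurable b) (hc : Measurable c) : Measurable fun x => (!₂[a x, b x, c x] : V3) := by
  refine (PiLp.continuous_toLp 2 (fun _ : Fin 3 => ℝ)).measurable.comp (measurable_pi_lambda _ ?_)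
  intro i
  fin_cases i <;> simpa

theorem measurable_frame₂ : Measurable frame₂ := by
  unfold frame₂
  have h0 : Measurable fun e : V3 => e 0 := by fun_prop
  have h1 : Measurable fun e : V3 => e 1 := by fun_prop
  refine Measurable.ite ?_ measurable_const ?_
  · exact (measurableSet_eq_fun h0 measurable_const).inter (measurableSet_eq_fun h1 measurable_const)
  · have hs : Measurable fun e : V3 => (Real.sqrt (e 0 ^ 2 + e 1 ^ 2))⁻¹ := by fun_prop
    exact hs.smul (measurable_toLp_vec h1.neg h0 measurable_const)

theorem measurable_frame₃ : Measurable frame₃ := by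
  have h := measurable_frame₂
  unfold frame₃
  refine measurable_toLp_vec ?_ ?_ ?_ <;> fun_prop

theorem measurable_scatter {α : Type*} [MeasurableSpace α] {v vs : α → V3} {θ ε : α → ℝ}
    (hv : Measurable v) (hvs : Measurable vs) (hθ : Measurable θ) (hε : Measurable ε) :
    Measurable fun x => scatter (v x) (vs x) (θ x) (ε x) := by
  have h2 := measurable_frame₂
  have h3 := measurable_frame₃
  unfold scatter axis
  fun_prop

theorem measurable_postV {α : Type*} [MeasurableSpace α] {v vs : α → V3} {θ ε : α → ℝ}
    (hv : Measurable v) (hvs : Measurable vs) (hθ : Measurable θ) (hε : Measurable ε) :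
    Measurable fun x => postV (v x) (vs x) (θ x) (ε x) := by
  have h := measurable_scatter hv hvs hθ hε
  unfold postV
  fun_prop

theorem measurable_postVs {α : Type*} [MeasurableSpace α] {v vs : α → V3} {θ ε : α → ℝ}
    (hv : Measurable v) (hvs : Measurable vs) (hθ : Measurable θ) (hε : Measurable ε) :
    Measurable fun x => postVs (v x) (vs x) (θ x) (ε x) := by
  have h := measurable_scatter hv hvs hθ hε
  unfold postVs
  fun_prop

theorem measurable_cross {B : ℝ → ℝ → ℝ} {γ : ℝ} (hB : IsCutoff B γ) {α : Type*} [MeasurableSpace α]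
    {r θ : α → ℝ} (hr : Measurable r) (hθ : Measurable θ) : Measurable fun x => B (r x) (θ x) :=
  hB.measurable.comp (hr.prodMk hθ)

theorem measurable_collisionFrequency {B : ℝ → ℝ → ℝ} {γ : ℝ} (hB : IsCutoff B γ) :
    Measurable (collisionFrequency B) := by
  unfold collisionFrequency
  simp_rw [intervalIntegral.integral_of_le Real.two_pi_pos.le,
    intervalIntegral.integral_of_le Real.pi_div_two_pos.le]
  apply StronglyMeasurable.measurable
  refine StronglyMeasurable.integral_prod_right' (f := fun p : V3 × V3 =>
    ∫ ε in Ioc 0 (2 * Real.pi), ∫ θ in Ioc 0 (Real.pi / 2), maxwellian p.2 * B ‖p.1 - p.2‖ θ) ?_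
  refine StronglyMeasurable.integral_prod_right' (f := fun q : (V3 × V3) × ℝ =>
    ∫ θ in Ioc 0 (Real.pi / 2), maxwellian q.1.2 * B ‖q.1.1 - q.1.2‖ θ) ?_
  refine StronglyMeasurable.integral_prod_right' (f := fun q : ((V3 × V3) × ℝ) × ℝ =>
    maxwellian q.1.1.2 * B ‖q.1.1.1 - q.1.1.2‖ q.2) ?_
  apply Measurable.stronglyMeasurable
  exact (measurable_maxwellian.comp (by fun_prop)).mul
    (measurable_cross hB (by fun_prop) (by fun_prop))

theorem measurable_opK {B : ℝ → ℝ → ℝ} {γ : ℝ} (hB : IsCutoff B γ) {f : V3 × V3 → ℝ}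
    (hf : Measurable f) : Measurable (opK B f) := by
  unfold opK collisionK
  simp_rw [intervalIntegral.integral_of_le Real.two_pi_pos.le,
    intervalIntegral.integral_of_le Real.pi_div_two_pos.le]
  apply StronglyMeasurable.measurable
  apply StronglyMeasurable.integral_prod_right
  apply StronglyMeasurable.integral_prod_right
  apply StronglyMeasurable.integral_prod_right
  apply Measurable.stronglyMeasurable
  have m0 : Measurable fun a : (((V3 × V3) × V3) × ℝ) × ℝ => a.1.1.1.1 := by fun_prop
  have m1 : Measurable fun a : (((V3 × V3) × V3) × ℝ) × ℝ => a.1.1.1.2 := by fun_prop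
  have m2 : Measurable fun a : (((V3 × V3) × V3) × ℝ) × ℝ => a.1.1.2 := by fun_prop
  have m3 : Measurable fun a : (((V3 × V3) × V3) × ℝ) × ℝ => a.1.2 := by fun_prop
  have m4 : Measurable fun a : (((V3 × V3) × V3) × ℝ) × ℝ => a.2 := by fun_prop
  have mB := measurable_cross hB (r := fun a : (((V3 × V3) × V3) × ℝ) × ℝ =>
    ‖a.1.1.1.2 - a.1.1.2‖) (by fun_prop) m4
  have mV := measurable_postV m1 m2 m4 m3
  have mVs := measurable_postVs m1 m2 m4 m3
  have hM := measurable_maxwellian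
  refine Measurable.mul (Measurable.mul (hM.comp m1).sqrt.inv ?_) mB
  refine Measurable.sub (Measurable.add ?_ ?_) ?_
  · exact (hM.comp mV).mul ((hM.comp mVs).sqrt.mul (hf.comp (m0.prodMk mVs)))
  · exact ((hM.comp mV).sqrt.mul (hf.comp (m0.prodMk mV))).mul (hM.comp mVs)
  · exact (hM.comp m1).mul ((hM.comp m2).sqrt.mul (hf.comp (m0.prodMk m2)))

/-! ### The kernel of `K` -/

/-- The measure `dv_* dε dθ`. -/
noncomputable def angleMeasure : Measure (V3 × ℝ × ℝ) :=
  volume.prod ((volume.restrict (Ioc 0 (2 * Real.pi))).prod (volume.restrict (Ioc 0 (Real.pi / 2))))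

theorem lintegral_angleMeasure {F : V3 × ℝ × ℝ → ℝ≥0∞} (hF : Measurable F) :
    ∫⁻ y, F y ∂angleMeasure = ∫⁻ vs : V3, ∫⁻ ε in Ioc 0 (2 * Real.pi),
      ∫⁻ θ in Ioc 0 (Real.pi / 2), F (vs, ε, θ) := by
  rw [angleMeasure, lintegral_prod _ hF.aemeasurable]
  refine lintegral_congr fun vs => ?_
  have : Measurable fun p : ℝ × ℝ => F (vs, p) := by fun_prop
  rw [lintegral_prod _ this.aemeasurable]

theorem integral_angleMeasure {F : V3 × ℝ × ℝ → ℝ} (hF : Integrable F angleMeasure) :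
    ∫ vs : V3, ∫ ε in (0 : ℝ)..(2 * Real.pi), ∫ θ in (0 : ℝ)..(Real.pi / 2), F (vs, ε, θ) =
      ∫ y, F y ∂angleMeasure := by
  simp_rw [intervalIntegral.integral_of_le Real.two_pi_pos.le,
    intervalIntegral.integral_of_le Real.pi_div_two_pos.le]
  rw [angleMeasure] at hF ⊢
  rw [integral_prod _ hF]
  refine integral_congr_ae ?_
  filter_upwards [hF.prod_right_ae] with vs hvs
  rw [integral_prod _ hvs]

theorem ae_angleMeasure (v : V3) : ∀ᵐ y ∂angleMeasure, y.1 ≠ v ∧ y.2.2 ∈ Icc 0 (Real.pi / 2) := by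
  have h1 : ∀ᵐ y ∂angleMeasure, y.1 ≠ v := by
    have : Measure.QuasiMeasurePreserving Prod.fst angleMeasure volume :=
      Measure.quasiMeasurePreserving_fst
    exact this.ae (compl_mem_ae_iff.2 (measure_singleton v))
  have h2 : ∀ᵐ y ∂angleMeasure, y.2.2 ∈ Ioc 0 (Real.pi / 2) := by
    have : Measure.QuasiMeasurePreserving (fun y : V3 × ℝ × ℝ => y.2.2) angleMeasure
        (volume.restrict (Ioc 0 (Real.pi / 2))) :=
      Measure.quasiMeasurePreserving_snd.comp Measure.quasiMeasurePreserving_snd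
    exact this.ae (ae_restrict_mem measurableSet_Ioc)
  filter_upwards [h1, h2] with y hy1 hy2
  exact ⟨hy1, Ioc_subset_Icc_self hy2⟩

theorem sqrt_maxwellian (v : V3) :
    Real.sqrt (maxwellian v) = Real.pi ^ (-(3 / 4) : ℝ) * Real.exp (-‖v‖ ^ 2 / 2) := by
  rw [Real.sqrt_eq_iff_mul_self_eq (maxwellian_pos v).le (by have := Real.pi_pos; positivity)]
  rw [mul_mul_mul_comm, ← Real.exp_add, ← Real.rpow_add Real.pi_pos, maxwellian]
  congr 2 <;> ring

theorem gain_weight_eq (v a b : V3) :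
    (Real.sqrt (maxwellian v))⁻¹ * (Real.sqrt (maxwellian a) * maxwellian b) =
      Real.pi ^ (-(3 / 2) : ℝ) * Real.exp (‖v‖ ^ 2 / 2 - ‖a‖ ^ 2 / 2 - ‖b‖ ^ 2) := by
  rw [sqrt_maxwellian, sqrt_maxwellian, maxwellian, mul_inv, ← Real.exp_neg,
    show ‖v‖ ^ 2 / 2 - ‖a‖ ^ 2 / 2 - ‖b‖ ^ 2 = -(-‖v‖ ^ 2 / 2) + (-‖a‖ ^ 2 / 2 + -‖b‖ ^ 2) by ring,
    Real.exp_add, Real.exp_add]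
  have : (Real.pi ^ (-(3 / 4) : ℝ)) ≠ 0 := (Real.rpow_pos_of_pos Real.pi_pos _).ne'
  field_simp

end LinBoltzmann

/-! ### From angular integrals to an integral kernel. -/

namespace LinBoltzmann

/-- The image under `T` of the weighted measure `c ρ` is dominated by `C κ dw`, hence absolutely
continuous, and its Radon–Nikodym derivative is the kernel. No explicit formula is needed, only the
upper bound tested on nonnegative functions. -/
theorem exists_density {Y : Type*} [MeasurableSpace Y] {ρ : Measure Y} {c : Y → ℝ} {T : Y → V3}
    {κ : V3 → ℝ≥0∞} {C : ℝ≥0} (hc : Measurable c) (hT : Measurable T) (hκ : Measurable κ)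
    (hc0 : ∀ᵐ y ∂ρ, 0 ≤ c y) (hfin : ∫⁻ w, κ w < ∞)
    (hle : ∀ h : V3 → ℝ≥0∞, Measurable h →
      ∫⁻ y, ENNReal.ofReal (c y) * h (T y) ∂ρ ≤ C * ∫⁻ w, κ w * h w) :
    ∃ k : V3 → ℝ, Measurable k ∧ (∀ᵐ w, ‖k w‖ₑ ≤ C * κ w) ∧
      ∀ h : V3 → ℝ, AEStronglyMeasurable h volume → ∫⁻ w, κ w * ‖h w‖ₑ < ∞ →
        Integrable (fun y => c y * h (T y)) ρ ∧ ∫ y, c y * h (T y) ∂ρ = ∫ w, k w * h w ∧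
          Integrable (fun w => k w * h w) := by
  have hcm : Measurable fun y => ENNReal.ofReal (c y) := hc.ennreal_ofReal
  let m : Measure V3 := (ρ.withDensity fun y => ENNReal.ofReal (c y)).map T
  have hmlin : ∀ h : V3 → ℝ≥0∞, Measurable h → ∫⁻ w, h w ∂m =
      ∫⁻ y, ENNReal.ofReal (c y) * h (T y) ∂ρ := by
    intro h hh
    have hhT : Measurable fun y => h (T y) := hh.comp hT
    rw [lintegral_map hh hT, lintegral_withDensity_eq_lintegral_mul _ hcm hhT]
    rfl
  have hmle : m ≤ volume.withDensity fun w => C * κ w := by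
    refine Measure.le_iff.2 fun s hs => ?_
    rw [← lintegral_indicator_one hs, hmlin _ (measurable_one.indicator hs)]
    refine (hle _ (measurable_one.indicator hs)).trans ?_
    rw [withDensity_apply _ hs, lintegral_const_mul _ hκ, ← lintegral_indicator hs]
    refine le_of_eq (congrArg _ (lintegral_congr fun w => ?_))
    by_cases hw : w ∈ s <;> simp [hw]
  have hac : m ≪ volume := (Measure.absolutelyContinuous_of_le hmle).trans
    (withDensity_absolutelyContinuous _ _)
  have hmfin : IsFiniteMeasure m := by
    refine ⟨(hmle univ).trans_lt ?_⟩
    rw [withDensity_apply _ MeasurableSet.univ, Measure.restrict_univ, lintegral_const_mul _ hκ]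
    exact ENNReal.mul_lt_top ENNReal.coe_lt_top hfin
  have hrn : volume.withDensity (m.rnDeriv volume) = m := Measure.withDensity_rnDeriv_eq _ _ hac
  have hrn_lt : ∀ᵐ w, m.rnDeriv volume w < ∞ := Measure.rnDeriv_lt_top m volume
  refine ⟨fun w => (m.rnDeriv volume w).toReal, (Measure.measurable_rnDeriv _ _).ennreal_toReal,
    ?_, ?_⟩
  · have h1 : m.rnDeriv volume ≤ᵐ[volume] fun w => C * κ w := by
      refine ae_le_of_forall_setLIntegral_le_of_sigmaFinite (Measure.measurable_rnDeriv _ _) ?_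
      intro s hs _
      rw [← withDensity_apply _ hs, hrn, ← withDensity_apply _ hs]
      exact hmle s
    filter_upwards [h1, hrn_lt] with w hw hw2
    rwa [Real.enorm_eq_ofReal ENNReal.toReal_nonneg, ENNReal.ofReal_toReal hw2.ne]
  · intro h hh hInt
    have hhm : AEStronglyMeasurable h m := hh.mono_ac hac
    have him : Integrable h m := by
      refine ⟨hhm, ?_⟩
      calc ∫⁻ w, ‖h w‖ₑ ∂m ≤ ∫⁻ w, ‖h w‖ₑ ∂(volume.withDensity fun w => C * κ w) :=
            lintegral_mono' hmle le_rfl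
        _ = ∫⁻ w, (C * κ w) * ‖h w‖ₑ := by
            rw [lintegral_withDensity_eq_lintegral_mul₀ (by fun_prop) hh.enorm]; rfl
        _ = C * ∫⁻ w, κ w * ‖h w‖ₑ := by
            simp_rw [mul_assoc]; rw [lintegral_const_mul' _ _ ENNReal.coe_ne_top]
        _ < ∞ := ENNReal.mul_lt_top ENNReal.coe_lt_top hInt
    have hiT : Integrable (h ∘ T) (ρ.withDensity fun y => ENNReal.ofReal (c y)) :=
      (integrable_map_measure hhm hT.aemeasurable).1 him
    have hlt : ∀ᵐ y ∂ρ, ENNReal.ofReal (c y) < ∞ := Eventually.of_forall fun _ => ENNReal.ofReal_lt_top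
    have e1 : (fun y => c y * h (T y)) =ᵐ[ρ] fun y => (ENNReal.ofReal (c y)).toReal • (h ∘ T) y := by
      filter_upwards [hc0] with y hy
      simp [ENNReal.toReal_ofReal hy]
    refine ⟨?_, ?_, ?_⟩
    · exact ((integrable_withDensity_iff_integrable_smul' hcm hlt).1 hiT).congr e1.symm
    · rw [integral_congr_ae e1, ← integral_withDensity_eq_integral_toReal_smul hcm hlt]
      calc _ = ∫ w, h w ∂m := (integral_map hT.aemeasurable hhm).symm
        _ = _ := by
          rw [← hrn, integral_withDensity_eq_integral_toReal_smul (Measure.measurable_rnDeriv _ _)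
            hrn_lt]
          simp only [smul_eq_mul, hrn]
    · have h2 := him
      rw [← hrn, integrable_withDensity_iff_integrable_smul' (Measure.measurable_rnDeriv _ _)
        hrn_lt] at h2
      simpa only [smul_eq_mul, hrn] using h2

theorem scatter_add (v u : V3) (θ ε : ℝ) : scatter v (v + u) θ ε =
    sphVec (‖u‖⁻¹ • u) (frame₂ (‖u‖⁻¹ • u)) (frame₃ (‖u‖⁻¹ • u)) θ ε := by
  simp [scatter, axis, sphVec]

/-- Angle `π/2 - θ` in the reflected frame gives the unit vector orthogonal to `α` in the plane of
`e₁` and `α`. The projections of `u` on these two vectors add up to `u`, so the two post-collisional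
velocities exchange roles. -/
theorem postVs_eq_reflected {u : V3} (v : V3) (hu : u ≠ 0) (θ ε : ℝ) :
    postVs v (v + u) θ ε = v + ⟪u, sphVec (‖u‖⁻¹ • u) (-frame₂ (‖u‖⁻¹ • u)) (-frame₃ (‖u‖⁻¹ • u))
      (Real.pi / 2 - θ) ε⟫ • sphVec (‖u‖⁻¹ • u) (-frame₂ (‖u‖⁻¹ • u)) (-frame₃ (‖u‖⁻¹ • u))
      (Real.pi / 2 - θ) ε ∧
    postV v (v + u) θ ε = v + u - ⟪u, sphVec (‖u‖⁻¹ • u) (-frame₂ (‖u‖⁻¹ • u))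
      (-frame₃ (‖u‖⁻¹ • u)) (Real.pi / 2 - θ) ε⟫ • sphVec (‖u‖⁻¹ • u) (-frame₂ (‖u‖⁻¹ • u))
      (-frame₃ (‖u‖⁻¹ • u)) (Real.pi / 2 - θ) ε := by
  have hn : ‖u‖ ≠ 0 := norm_ne_zero_iff.2 hu
  set e := ‖u‖⁻¹ • u with he
  have hu' : u = ‖u‖ • e := by rw [he, smul_smul, mul_inv_cancel₀ hn, one_smul]
  have he1 : ‖e‖ = 1 := by rw [he, norm_smul, norm_inv, norm_norm, inv_mul_cancel₀ hn]
  have i1 := (norm_sphVec (orthonormal_frame he1) θ ε).2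
  have i2 := (norm_sphVec (orthonormal_frame_neg he1) (Real.pi / 2 - θ) ε).2
  have key : ⟪u, sphVec e (-frame₂ e) (-frame₃ e) (Real.pi / 2 - θ) ε⟫ •
      sphVec e (-frame₂ e) (-frame₃ e) (Real.pi / 2 - θ) ε =
      u - ⟪u, sphVec e (frame₂ e) (frame₃ e) θ ε⟫ • sphVec e (frame₂ e) (frame₃ e) θ ε := by
    have j1 : ⟪u, sphVec e (frame₂ e) (frame₃ e) θ ε⟫ = ‖u‖ * Real.cos θ := by
      conv_lhs => rw [hu', inner_smul_left, i1]
      simp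
    have j2 : ⟪u, sphVec e (-frame₂ e) (-frame₃ e) (Real.pi / 2 - θ) ε⟫ = ‖u‖ * Real.sin θ := by
      conv_lhs => rw [hu', inner_smul_left, i2, Real.cos_pi_div_two_sub]
      simp
    rw [j1, j2]
    conv_rhs => rw [hu']
    simp only [sphVec, Real.cos_pi_div_two_sub, Real.sin_pi_div_two_sub, norm_smul, he1, norm_norm,
      mul_one]
    have hs : ‖u‖ • e = (‖u‖ * (Real.sin θ ^ 2 + Real.cos θ ^ 2)) • e := by
      rw [Real.sin_sq_add_cos_sq, mul_one]
    rw [hs]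
    module
  constructor
  · rw [key, postVs, scatter_add, add_sub_cancel_left, ← he]; abel
  · rw [key, postV, scatter_add, add_sub_cancel_left, ← he]; abel

theorem lintegral_Ioc_reflect (F : ℝ → ℝ≥0∞) :
    ∫⁻ θ in Ioc 0 (Real.pi / 2), F (Real.pi / 2 - θ) = ∫⁻ θ in Ioc 0 (Real.pi / 2), F θ := by
  rw [← Measure.restrict_congr_set Ioo_ae_eq_Ioc, ← lintegral_indicator measurableSet_Ioo,
    ← lintegral_indicator measurableSet_Ioo,
    ← lintegral_sub_left_eq_self (fun θ => (Ioo 0 (Real.pi / 2)).indicator F θ) (Real.pi / 2)]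
  refine lintegral_congr fun θ => ?_
  by_cases h : θ ∈ Ioo 0 (Real.pi / 2)
  · have h' : Real.pi / 2 - θ ∈ Ioo 0 (Real.pi / 2) := ⟨by linarith [h.2], by linarith [h.1]⟩
    rw [indicator_of_mem h, indicator_of_mem h']
  · have h' : Real.pi / 2 - θ ∉ Ioo 0 (Real.pi / 2) :=
      fun h' => h ⟨by linarith [h'.2], by linarith [h'.1]⟩
    rw [indicator_of_notMem h, indicator_of_notMem h']

section coefficients

variable (B : ℝ → ℝ → ℝ) (v : V3)

/-- The weight of `h (v')` in `collisionK B h v`. -/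
noncomputable def coeffV (y : V3 × ℝ × ℝ) : ℝ :=
  (Real.sqrt (maxwellian v))⁻¹ * (Real.sqrt (maxwellian (postV v y.1 y.2.2 y.2.1)) *
    maxwellian (postVs v y.1 y.2.2 y.2.1)) * B ‖v - y.1‖ y.2.2

/-- The weight of `h (v'_*)` in `collisionK B h v`. -/
noncomputable def coeffVs (y : V3 × ℝ × ℝ) : ℝ :=
  (Real.sqrt (maxwellian v))⁻¹ * (Real.sqrt (maxwellian (postVs v y.1 y.2.2 y.2.1)) *
    maxwellian (postV v y.1 y.2.2 y.2.1)) * B ‖v - y.1‖ y.2.2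

/-- The weight of `- h (v_*)` in `collisionK B h v`. -/
noncomputable def coeffLoss (y : V3 × ℝ × ℝ) : ℝ :=
  (Real.sqrt (maxwellian v))⁻¹ * (maxwellian v * Real.sqrt (maxwellian y.1)) * B ‖v - y.1‖ y.2.2

end coefficients

variable {B : ℝ → ℝ → ℝ} {γ : ℝ}

theorem measurable_coeff (hB : IsCutoff B γ) (v : V3) :
    Measurable (coeffV B v) ∧ Measurable (coeffVs B v) ∧ Measurable (coeffLoss B v) := by
  have mB := measurable_cross hB (r := fun y : V3 × ℝ × ℝ => ‖v - y.1‖) (θ := fun y => y.2.2)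
    (by fun_prop) (by fun_prop)
  have m1 : Measurable fun _ : V3 × ℝ × ℝ => v := measurable_const
  have mV := measurable_postV m1 measurable_fst (measurable_snd.comp measurable_snd)
    (measurable_fst.comp measurable_snd)
  have mVs := measurable_postVs m1 measurable_fst (measurable_snd.comp measurable_snd)
    (measurable_fst.comp measurable_snd)
  have hM := measurable_maxwellian
  refine ⟨?_, ?_, ?_⟩
  · exact (((hM.comp mV).sqrt.mul (hM.comp mVs)).const_mul _).mul mB
  · exact (((hM.comp mVs).sqrt.mul (hM.comp mV)).const_mul _).mul mB
  · exact (((hM.comp measurable_fst).sqrt.const_mul _).const_mul _).mul mB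

theorem coeff_nonneg (hB : IsCutoff B γ) (v : V3) : ∀ᵐ y ∂angleMeasure,
    0 ≤ coeffV B v y ∧ 0 ≤ coeffVs B v y ∧ 0 ≤ coeffLoss B v y := by
  obtain ⟨C, hC⟩ := hB.bound
  filter_upwards [ae_angleMeasure v] with y hy
  have hb := (hC ‖v - y.1‖ (norm_pos_iff.2 (sub_ne_zero.2 hy.1.symm)) _ hy.2).1
  have := fun w => (maxwellian_pos w).le
  refine ⟨?_, ?_, ?_⟩
  · exact mul_nonneg (mul_nonneg (by positivity) (mul_nonneg (by positivity) (this _))) hb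
  · exact mul_nonneg (mul_nonneg (by positivity) (mul_nonneg (by positivity) (this _))) hb
  · exact mul_nonneg (mul_nonneg (by positivity) (mul_nonneg (this _) (by positivity))) hb

theorem exists_bound_pos (hB : IsCutoff B γ) : ∃ C : ℝ, 0 ≤ C ∧ ∀ r : ℝ, 0 < r →
    ∀ θ ∈ Icc (0 : ℝ) (Real.pi / 2),
      0 ≤ B r θ ∧ B r θ ≤ C * (r ^ γ * Real.cos θ * Real.sin θ) := by
  obtain ⟨C, hC⟩ := hB.bound
  refine ⟨max C 0, le_max_right _ _, fun r hr θ hθ => ⟨(hC r hr θ hθ).1, ?_⟩⟩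
  have hs : 0 ≤ Real.sin θ := Real.sin_nonneg_of_nonneg_of_le_pi hθ.1 (by linarith [hθ.2, Real.pi_pos])
  have hc : 0 ≤ Real.cos θ := Real.cos_nonneg_of_neg_pi_div_two_le_of_le
    (by linarith [hθ.1, Real.pi_pos]) hθ.2
  calc B r θ ≤ C * r ^ γ * Real.cos θ * Real.sin θ := (hC r hr θ hθ).2
    _ = C * (r ^ γ * Real.cos θ * Real.sin θ) := by ring
    _ ≤ _ := by gcongr; exact le_max_left _ _

/-- In the cutoff bound, `sin θ` is the area element of the sphere and `cos θ` is the factor `⟪e₁,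
α⟫` inside `gainIntegrand`. -/
theorem exists_coeffV_le (hγ : γ ∈ Icc (0 : ℝ) 1) (hB : IsCutoff B γ) :
    ∃ C : ℝ≥0, ∀ (v : V3) (h : V3 → ℝ≥0∞), Measurable h →
      ∫⁻ y, ENNReal.ofReal (coeffV B v y) * h (postV v y.1 y.2.2 y.2.1) ∂angleMeasure ≤
        C * ∫⁻ w, gk 1 (1 / 4) (v - w) * h w := by
  obtain ⟨C, hC⟩ := exists_gain_le hγ
  obtain ⟨C₀, hC₀, hb⟩ := exists_bound_pos hB
  let D : ℝ≥0 := Real.toNNReal (Real.pi ^ (-(3 / 2) : ℝ) * C₀)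
  refine ⟨D * C, fun v h hh => ?_⟩
  have hm : Measurable fun y : V3 × ℝ × ℝ =>
      ENNReal.ofReal (coeffV B v y) * h (postV v y.1 y.2.2 y.2.1) :=
    (measurable_coeff hB v).1.ennreal_ofReal.mul (hh.comp (measurable_postV measurable_const
      measurable_fst (measurable_snd.comp measurable_snd) (measurable_fst.comp measurable_snd)))
  rw [lintegral_angleMeasure hm, ENNReal.coe_mul, mul_assoc]
  refine le_trans ?_ (mul_le_mul_right (hC v frame₂ frame₃ h hh
    fun e he => ⟨orthonormal_frame he, orthonormal_frame_neg he⟩) _)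
  rw [← lintegral_const_mul' _ _ ENNReal.coe_ne_top, ← lintegral_add_left_eq_self _ v]
  refine lintegral_mono_ae (ae_ne_zero_V3.mono fun u hu => ?_)
  rw [← lintegral_const_mul' _ _ ENNReal.coe_ne_top]
  refine lintegral_mono fun ε => ?_
  rw [← lintegral_const_mul' _ _ ENNReal.coe_ne_top]
  refine setLIntegral_mono' measurableSet_Ioc fun θ hθ => ?_
  have hun : 0 < ‖u‖ := norm_pos_iff.2 hu
  have he : ‖‖u‖⁻¹ • u‖ = 1 := by rw [norm_smul, norm_inv, norm_norm, inv_mul_cancel₀ hun.ne']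
  have hB' := (hb ‖u‖ hun θ (Ioc_subset_Icc_self hθ)).2
  have hs : 0 ≤ Real.sin θ := Real.sin_nonneg_of_nonneg_of_le_pi hθ.1.le
    (by linarith [hθ.2, Real.pi_pos])
  have hi := (norm_sphVec (orthonormal_frame he) θ ε).2
  rw [gainIntegrand, hi, ← mul_assoc (ENNReal.ofReal (Real.sin θ)), ← ENNReal.ofReal_mul hs,
    ← mul_assoc]
  simp only [D]
  rw [← ENNReal.ofReal.eq_1, ← ENNReal.ofReal_mul (mul_nonneg (Real.rpow_nonneg Real.pi_pos.le _) hC₀)]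
  simp only [coeffV, postV, postVs, add_sub_cancel_left, scatter_add, sub_add_cancel_left, norm_neg]
  refine mul_le_mul_left (ENNReal.ofReal_le_ofReal ?_) _
  rw [gain_weight_eq]
  refine (mul_le_mul_of_nonneg_left hB' (mul_nonneg (Real.rpow_nonneg Real.pi_pos.le _)
    (Real.exp_nonneg _))).trans (le_of_eq ?_)
  ring

/-- The substitution `θ ↦ π/2 - θ` exchanges `v'` and `v'_*`. Although `B` has no such symmetry, its
bound `cos θ sin θ` does, so the estimate for `v'` applies again. -/
theorem exists_coeffVs_le (hγ : γ ∈ Icc (0 : ℝ) 1) (hB : IsCutoff B γ) :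
    ∃ C : ℝ≥0, ∀ (v : V3) (h : V3 → ℝ≥0∞), Measurable h →
      ∫⁻ y, ENNReal.ofReal (coeffVs B v y) * h (postVs v y.1 y.2.2 y.2.1) ∂angleMeasure ≤
        C * ∫⁻ w, gk 1 (1 / 4) (v - w) * h w := by
  obtain ⟨C, hC⟩ := exists_gain_le hγ
  obtain ⟨C₀, hC₀, hb⟩ := exists_bound_pos hB
  let D : ℝ≥0 := Real.toNNReal (Real.pi ^ (-(3 / 2) : ℝ) * C₀)
  refine ⟨D * C, fun v h hh => ?_⟩
  have hm : Measurable fun y : V3 × ℝ × ℝ =>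
      ENNReal.ofReal (coeffVs B v y) * h (postVs v y.1 y.2.2 y.2.1) :=
    (measurable_coeff hB v).2.1.ennreal_ofReal.mul (hh.comp (measurable_postVs measurable_const
      measurable_fst (measurable_snd.comp measurable_snd) (measurable_fst.comp measurable_snd)))
  rw [lintegral_angleMeasure hm, ENNReal.coe_mul, mul_assoc]
  refine le_trans ?_ (mul_le_mul_right (hC v (fun e => -frame₂ e) (fun e => -frame₃ e) h hh
    fun e he => ⟨orthonormal_frame_neg he, by simpa using orthonormal_frame he⟩) _)
  rw [← lintegral_const_mul' _ _ ENNReal.coe_ne_top, ← lintegral_add_left_eq_self _ v]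
  refine lintegral_mono_ae (ae_ne_zero_V3.mono fun u hu => ?_)
  rw [← lintegral_const_mul' _ _ ENNReal.coe_ne_top]
  refine lintegral_mono fun ε => ?_
  rw [← lintegral_const_mul' _ _ ENNReal.coe_ne_top]
  refine le_trans ?_ (lintegral_Ioc_reflect _).le
  refine setLIntegral_mono' measurableSet_Ioc fun θ hθ => ?_
  have hun : 0 < ‖u‖ := norm_pos_iff.2 hu
  have he : ‖‖u‖⁻¹ • u‖ = 1 := by rw [norm_smul, norm_inv, norm_norm, inv_mul_cancel₀ hun.ne']
  have hB' := (hb ‖u‖ hun θ (Ioc_subset_Icc_self hθ)).2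
  have hc : 0 ≤ Real.cos θ := Real.cos_nonneg_of_neg_pi_div_two_le_of_le
    (by linarith [hθ.1, Real.pi_pos]) hθ.2
  have hi := (norm_sphVec (orthonormal_frame_neg he) (Real.pi / 2 - θ) ε).2
  obtain ⟨hp1, hp2⟩ := postVs_eq_reflected v hu θ ε
  rw [Real.cos_pi_div_two_sub] at hi
  rw [Real.sin_pi_div_two_sub, gainIntegrand, hi, ← mul_assoc (ENNReal.ofReal (Real.cos θ)),
    ← ENNReal.ofReal_mul hc, ← mul_assoc]
  simp only [D]
  rw [← ENNReal.ofReal.eq_1, ← ENNReal.ofReal_mul (mul_nonneg (Real.rpow_nonneg Real.pi_pos.le _) hC₀)]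
  simp only [coeffVs, sub_add_cancel_left, norm_neg, hp1, hp2]
  refine mul_le_mul_left (ENNReal.ofReal_le_ofReal ?_) _
  rw [gain_weight_eq]
  refine (mul_le_mul_of_nonneg_left hB' (mul_nonneg (Real.rpow_nonneg Real.pi_pos.le _)
    (Real.exp_nonneg _))).trans (le_of_eq ?_)
  ring

/-- The Maxwellian factors give at least the decay `exp(-|v - v_*|²/4)`. Half of it pays for trading
the growth `r^γ` against `r⁻¹`, and `exp(-r²/8)` remains. -/
theorem exists_coeffLoss_le (hγ : γ ∈ Icc (0 : ℝ) 1) (hB : IsCutoff B γ) :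
    ∃ C : ℝ≥0, ∀ (v : V3) (h : V3 → ℝ≥0∞), Measurable h →
      ∫⁻ y, ENNReal.ofReal (coeffLoss B v y) * h y.1 ∂angleMeasure ≤
        C * ∫⁻ w, gk 1 (1 / 8) (v - w) * h w := by
  obtain ⟨C₀, hC₀, hb⟩ := exists_bound_pos hB
  let D : ℝ≥0 := Real.toNNReal (16 * (Real.pi ^ (-(3 / 4) : ℝ) * Real.pi ^ (-(3 / 4) : ℝ)) * C₀)
  let A : ℝ≥0 := Real.toNNReal (2 * Real.pi) * Real.toNNReal (Real.pi / 2)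
  refine ⟨D * A, fun v h hh => ?_⟩
  have hm : Measurable fun y : V3 × ℝ × ℝ => ENNReal.ofReal (coeffLoss B v y) * h y.1 :=
    (measurable_coeff hB v).2.2.ennreal_ofReal.mul (hh.comp measurable_fst)
  rw [lintegral_angleMeasure hm, ← lintegral_const_mul' _ _ ENNReal.coe_ne_top]
  have hne : ∀ᵐ vs : V3, vs ≠ v := compl_mem_ae_iff.2 (measure_singleton v)
  refine lintegral_mono_ae (hne.mono fun vs hvs => ?_)
  have hz : v - vs ≠ 0 := sub_ne_zero.2 hvs.symm
  have hr : 0 < ‖v - vs‖ := norm_pos_iff.2 hz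
  have hpi := Real.rpow_pos_of_pos Real.pi_pos (-(3 / 4) : ℝ)
  have key : ∀ ε : ℝ, ∀ θ ∈ Ioc 0 (Real.pi / 2), ENNReal.ofReal (coeffLoss B v (vs, ε, θ)) * h vs ≤
      D * (gk 1 (1 / 8) (v - vs) * h vs) := by
    intro ε θ hθ
    rw [← mul_assoc]
    gcongr
    have hB' := (hb ‖v - vs‖ hr θ (Ioc_subset_Icc_self hθ)).2
    have hle : ‖v - vs‖ ^ γ * Real.cos θ * Real.sin θ ≤ ‖v - vs‖ ^ γ := by
      rw [mul_assoc]
      refine mul_le_of_le_one_right (by positivity) ?_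
      nlinarith [Real.sin_sq_add_cos_sq θ, sq_nonneg (Real.sin θ - Real.cos θ)]
    have hpow : ‖v - vs‖ ^ γ ≤ 16 * (‖v - vs‖⁻¹ * Real.exp (‖v - vs‖ ^ 2 / 8)) := by
      set r := ‖v - vs‖
      have h1 : r ^ γ ≤ 1 + r := by
        rcases le_total r 1 with h1 | h1
        · linarith [Real.rpow_le_one hr.le h1 hγ.1]
        · have := Real.rpow_le_rpow_of_exponent_le h1 hγ.2
          rw [Real.rpow_one] at this; linarith
      have h2 := Real.add_one_le_exp (r ^ 2 / 8)
      rw [← mul_assoc, mul_comm (16 : ℝ), mul_assoc, ← div_eq_inv_mul, le_div_iff₀ hr]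
      nlinarith [sq_nonneg (r - 1), mul_le_mul_of_nonneg_right h1 hr.le]
    have hpar : ‖v - vs‖ ^ 2 ≤ 2 * (‖v‖ ^ 2 + ‖vs‖ ^ 2) := by
      have := norm_sub_le v vs
      nlinarith [sq_nonneg (‖v‖ - ‖vs‖), norm_nonneg v, norm_nonneg vs]
    rw [gk, ipow_eq_ofReal _ hz, Real.rpow_neg_one, ← ENNReal.ofReal_mul (by positivity)]
    simp only [D]
    rw [← ENNReal.ofReal.eq_1, ← ENNReal.ofReal_mul (by positivity)]
    apply ENNReal.ofReal_le_ofReal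
    have hcoef : (Real.sqrt (maxwellian v))⁻¹ * (maxwellian v * Real.sqrt (maxwellian vs)) =
        (Real.pi ^ (-(3 / 4) : ℝ) * Real.pi ^ (-(3 / 4) : ℝ)) *
          Real.exp (-‖v‖ ^ 2 / 2 + -‖vs‖ ^ 2 / 2) := by
      have hs := Real.mul_self_sqrt (maxwellian_pos v).le
      have hs0 := (Real.sqrt_pos.2 (maxwellian_pos v)).ne'
      calc _ = (Real.sqrt (maxwellian v))⁻¹ * (Real.sqrt (maxwellian v) * Real.sqrt (maxwellian v) *
            Real.sqrt (maxwellian vs)) := by rw [hs]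
        _ = Real.sqrt (maxwellian v) * Real.sqrt (maxwellian vs) := by field_simp
        _ = _ := by rw [sqrt_maxwellian, sqrt_maxwellian, Real.exp_add]; ring
    rw [coeffLoss, hcoef]
    have hB2 : B ‖v - vs‖ θ ≤ C₀ * (16 * (‖v - vs‖⁻¹ * Real.exp (‖v - vs‖ ^ 2 / 8))) :=
      hB'.trans (mul_le_mul_of_nonneg_left (hle.trans hpow) hC₀)
    have hE : Real.exp (-‖v‖ ^ 2 / 2 + -‖vs‖ ^ 2 / 2) * Real.exp (‖v - vs‖ ^ 2 / 8) ≤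
        Real.exp (-(1 / 8) * ‖v - vs‖ ^ 2) := by
      rw [← Real.exp_add]
      apply Real.exp_le_exp.2
      linarith
    set P := Real.pi ^ (-(3 / 4) : ℝ) * Real.pi ^ (-(3 / 4) : ℝ) with hP
    have hP0 : 0 < P := mul_pos hpi hpi
    calc P * Real.exp (-‖v‖ ^ 2 / 2 + -‖vs‖ ^ 2 / 2) * B ‖v - vs‖ θ
        ≤ P * Real.exp (-‖v‖ ^ 2 / 2 + -‖vs‖ ^ 2 / 2) *
          (C₀ * (16 * (‖v - vs‖⁻¹ * Real.exp (‖v - vs‖ ^ 2 / 8)))) := by gcongr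
      _ = (16 * P * C₀ * ‖v - vs‖⁻¹) * (Real.exp (-‖v‖ ^ 2 / 2 + -‖vs‖ ^ 2 / 2) *
          Real.exp (‖v - vs‖ ^ 2 / 8)) := by ring
      _ ≤ (16 * P * C₀ * ‖v - vs‖⁻¹) * Real.exp (-(1 / 8) * ‖v - vs‖ ^ 2) := by gcongr
      _ = _ := by ring
  calc _ ≤ ∫⁻ ε in Ioc 0 (2 * Real.pi), ∫⁻ θ in Ioc 0 (Real.pi / 2),
        D * (gk 1 (1 / 8) (v - vs) * h vs) :=
        lintegral_mono fun ε => setLIntegral_mono' measurableSet_Ioc (key ε)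
    _ = D * A * (gk 1 (1 / 8) (v - vs) * h vs) := by
        simp [A, ENNReal.ofReal]; ring
    _ = _ := by push_cast; rfl

/-- For each `v` the operator `K` is given by a kernel dominated by `|v - w|⁻¹ exp(-|v - w|²/8)`. -/
theorem exists_collision_kernel (hγ : γ ∈ Icc (0 : ℝ) 1) (hB : IsCutoff B γ) :
    ∃ C : ℝ≥0, ∀ v : V3, ∃ k : V3 → ℝ, Measurable k ∧
      (∀ᵐ w, ‖k w‖ₑ ≤ C * gk 1 (1 / 8) (v - w)) ∧
      ∀ h : V3 → ℝ, AEStronglyMeasurable h volume → ∫⁻ w, gk 1 (1 / 8) (v - w) * ‖h w‖ₑ < ∞ →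
        collisionK B h v = ∫ w, k w * h w ∧ Integrable (fun w => k w * h w) := by
  obtain ⟨C₁, h₁⟩ := exists_coeffV_le hγ hB
  obtain ⟨C₂, h₂⟩ := exists_coeffVs_le hγ hB
  obtain ⟨C₃, h₃⟩ := exists_coeffLoss_le hγ hB
  refine ⟨C₁ + C₂ + C₃, fun v => ?_⟩
  -- The gain kernels decay with rate `1/4`, the loss kernel only with rate `1/8`; the slower rate
  -- serves as common bound.
  have hmono : ∀ w : V3, gk 1 (1 / 4) w ≤ gk 1 (1 / 8) w := by
    intro w
    unfold gk
    gcongr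
    have := sq_nonneg ‖w‖
    linarith
  have h4 : ∀ (C : ℝ≥0) (h : V3 → ℝ≥0∞), (C : ℝ≥0∞) * ∫⁻ w, gk 1 (1 / 4) (v - w) * h w ≤
      C * ∫⁻ w, gk 1 (1 / 8) (v - w) * h w := by
    intro C h
    gcongr
    exact hmono _
  obtain ⟨m₁, m₂, m₃⟩ := measurable_coeff hB v
  have hκ : Measurable fun w : V3 => gk 1 (1 / 8) (v - w) :=
    (measurable_gk _ _).comp (measurable_const.sub measurable_id)
  have hfin : ∫⁻ w : V3, gk 1 (1 / 8) (v - w) < ∞ := by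
    obtain ⟨C, hC⟩ := exists_lintegral_gk_le 1 (1 / 8) (by norm_num) (by norm_num)
    refine lt_of_le_of_lt ?_ ((hC v).trans_lt ENNReal.coe_lt_top)
    exact lintegral_mono fun w => (gk_sub_comm _ _ _ _).le
  have mV := measurable_postV (measurable_const (a := v)) measurable_fst
    (measurable_snd.comp measurable_snd) (measurable_fst.comp (measurable_snd (α := V3) (β := ℝ × ℝ)))
  have mVs := measurable_postVs (measurable_const (a := v)) measurable_fst
    (measurable_snd.comp measurable_snd) (measurable_fst.comp (measurable_snd (α := V3) (β := ℝ × ℝ)))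
  have hn := coeff_nonneg hB v
  obtain ⟨k₁, km₁, kb₁, ki₁⟩ := exists_density m₁ mV hκ (hn.mono fun y hy => hy.1) hfin
    fun h hh => (h₁ v h hh).trans (h4 _ _)
  obtain ⟨k₂, km₂, kb₂, ki₂⟩ := exists_density m₂ mVs hκ (hn.mono fun y hy => hy.2.1) hfin
    fun h hh => (h₂ v h hh).trans (h4 _ _)
  obtain ⟨k₃, km₃, kb₃, ki₃⟩ := exists_density m₃ measurable_fst hκ (hn.mono fun y hy => hy.2.2) hfin
    fun h hh => h₃ v h hh
  refine ⟨fun w => k₂ w + k₁ w - k₃ w, (km₂.add km₁).sub km₃, ?_, fun h hh hInt => ?_⟩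
  · filter_upwards [kb₁, kb₂, kb₃] with w b1 b2 b3
    calc ‖k₂ w + k₁ w - k₃ w‖ₑ ≤ ‖k₂ w‖ₑ + ‖k₁ w‖ₑ + ‖k₃ w‖ₑ :=
          (enorm_sub_le).trans (by gcongr; exact enorm_add_le _ _)
      _ ≤ C₂ * gk 1 (1 / 8) (v - w) + C₁ * gk 1 (1 / 8) (v - w) + C₃ * gk 1 (1 / 8) (v - w) := by
          gcongr
      _ = _ := by push_cast; ring
  · obtain ⟨i₁, e₁, j₁⟩ := ki₁ h hh hInt
    obtain ⟨i₂, e₂, j₂⟩ := ki₂ h hh hInt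
    obtain ⟨i₃, e₃, j₃⟩ := ki₃ h hh hInt
    have e4 : (fun w => (k₂ w + k₁ w - k₃ w) * h w) = fun w =>
        k₂ w * h w + k₁ w * h w - k₃ w * h w := by ext w; ring
    rw [e4]
    refine ⟨?_, (j₂.add j₁).sub j₃⟩
    have s1 := integral_sub (f := fun w => k₂ w * h w + k₁ w * h w) (j₂.add j₁) j₃
    have s2 := integral_sub (f := fun y => coeffVs B v y * h (postVs v y.1 y.2.2 y.2.1) +
      coeffV B v y * h (postV v y.1 y.2.2 y.2.1)) (i₂.add i₁) i₃
    have s3 := integral_add i₂ i₁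
    simp only [Function.comp_apply] at e₁ e₂ s3
    rw [s1, integral_add j₂ j₁, ← e₁, ← e₂, ← e₃, ← s3, ← s2, ← integral_angleMeasure, collisionK]
    swap; · exact (i₂.add i₁).sub i₃
    refine integral_congr_ae (Eventually.of_forall fun vs => ?_)
    refine intervalIntegral.integral_congr fun ε _ => ?_
    refine intervalIntegral.integral_congr fun θ _ => ?_
    simp only [coeffV, coeffVs, coeffLoss]
    ring

end LinBoltzmann

namespace LinBoltzmann

/-! ### Geometry of convex domains -/

/-- Bounded open convex sets, together with a strict bound `d` for the diameter. -/
structure IsConvexBody (Ω : Set V3) (d : ℝ) : Prop where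
  isOpen : IsOpen Ω
  convex : Convex ℝ Ω
  nonempty : Ω.Nonempty
  norm_sub_lt : ∀ x ∈ Ω, ∀ y ∈ Ω, ‖x - y‖ < d

theorem IsPosCurvedConvexDomain.exists_isConvexBody {Ω : Set V3} (h : IsPosCurvedConvexDomain Ω) :
    ∃ d, IsConvexBody Ω d := by
  obtain ⟨C, hC⟩ := Metric.isBounded_iff.1 h.isBounded
  refine ⟨C + 1, h.isOpen, h.convex, h.nonempty, fun x hx y hy => ?_⟩
  have := hC hx hy
  rw [dist_eq_norm] at this
  linarith

variable {Ω : Set V3} {d : ℝ}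

theorem IsConvexBody.diam_pos (h : IsConvexBody Ω d) : 0 < d := by
  obtain ⟨x, hx⟩ := h.nonempty
  simpa using h.norm_sub_lt x hx x hx

theorem IsConvexBody.measurableSet (h : IsConvexBody Ω d) : MeasurableSet Ω := h.isOpen.measurableSet

theorem IsConvexBody.volume_lt_top (h : IsConvexBody Ω d) : volume Ω < ∞ := by
  obtain ⟨x, hx⟩ := h.nonempty
  refine (measure_mono (t := Metric.ball x d) fun y hy => ?_).trans_lt measure_ball_lt_top
  rw [Metric.mem_ball, dist_eq_norm]
  exact h.norm_sub_lt y hy x hx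

theorem IsConvexBody.smul_mem_of_le (h : IsConvexBody Ω d) {x v : V3} (hx : x ∈ Ω) {s t : ℝ}
    (hs : 0 ≤ s) (hst : s ≤ t) (ht : x - t • v ∈ Ω) : x - s • v ∈ Ω := by
  rcases hs.eq_or_lt with rfl | hs'
  · simpa using hx
  have ht0 : 0 < t := hs'.trans_le hst
  have := h.convex hx ht (a := 1 - s / t) (b := s / t)
    (by rw [sub_nonneg, div_le_one ht0]; exact hst) (by positivity) (by ring)
  convert this using 1
  have : (s / t) • t • v = s • v := by rw [smul_smul, div_mul_cancel₀ _ ht0.ne']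
  rw [smul_sub, this]
  module

theorem IsConvexBody.lt_of_mem (h : IsConvexBody Ω d) {x v : V3} (hx : x ∈ Ω) (hv : v ≠ 0) {s : ℝ}
    (hs : x - s • v ∈ Ω) : s < d / ‖v‖ := by
  have hn : 0 < ‖v‖ := norm_pos_iff.2 hv
  rw [lt_div_iff₀ hn]
  have := h.norm_sub_lt x hx _ hs
  rw [sub_sub_cancel, norm_smul] at this
  exact (mul_le_mul_of_nonneg_right (le_abs_self s) hn.le).trans_lt this

theorem IsConvexBody.exitSet_nonempty (h : IsConvexBody Ω d) {x v : V3} (hx : x ∈ Ω) (hv : v ≠ 0) :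
    d / ‖v‖ ∈ {t : ℝ | 0 < t ∧ x - t • v ∉ Ω} :=
  ⟨div_pos h.diam_pos (norm_pos_iff.2 hv), fun hm => lt_irrefl _ (h.lt_of_mem hx hv hm)⟩

theorem IsConvexBody.tauMinus_le (h : IsConvexBody Ω d) {x v : V3} (hx : x ∈ Ω) (hv : v ≠ 0) :
    tauMinus Ω x v ≤ d / ‖v‖ :=
  csInf_le ⟨0, fun _ ht => ht.1.le⟩ (h.exitSet_nonempty hx hv)

theorem tauMinus_nonneg (x v : V3) : 0 ≤ tauMinus Ω x v := Real.sInf_nonneg fun _ ht => ht.1.le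

/-- By convexity the nonnegative times spent inside `Ω` form an initial interval, and openness
excludes its right end. -/
theorem IsConvexBody.mem_iff (h : IsConvexBody Ω d) {x v : V3} (hx : x ∈ Ω) (hv : v ≠ 0) {s : ℝ}
    (hs : 0 ≤ s) : x - s • v ∈ Ω ↔ s < tauMinus Ω x v := by
  have hbdd : BddBelow {t : ℝ | 0 < t ∧ x - t • v ∉ Ω} := ⟨0, fun _ ht => ht.1.le⟩
  constructor
  · intro hm
    have hcont : ContinuousAt (fun t : ℝ => x - t • v) s := by fun_prop
    have hev : ∀ᶠ t in 𝓝 s, x - t • v ∈ Ω := hcont (h.isOpen.mem_nhds hm)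
    obtain ⟨ε, hε, hball⟩ := Metric.eventually_nhds_iff.1 hev
    refine lt_of_lt_of_le (show s < s + ε / 2 by linarith) ?_
    refine le_csInf ⟨_, h.exitSet_nonempty hx hv⟩ fun t ht => ?_
    by_contra hlt
    push Not at hlt
    refine ht.2 (h.smul_mem_of_le hx ht.1.le hlt.le (hball ?_))
    rw [Real.dist_eq, add_sub_cancel_left, abs_of_pos (by positivity)]
    linarith
  · intro hlt
    rcases hs.eq_or_lt with rfl | hs'
    · simpa using hx
    by_contra hm
    exact notMem_of_lt_csInf hlt hbdd ⟨hs', hm⟩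

theorem IsConvexBody.tauMinus_pos (h : IsConvexBody Ω d) {x v : V3} (hx : x ∈ Ω) (hv : v ≠ 0) :
    0 < tauMinus Ω x v := (h.mem_iff hx hv le_rfl).1 (by simpa using hx)

theorem tauPlus_eq (x v : V3) : tauPlus Ω x v = tauMinus Ω x (-v) := by
  simp [tauPlus, tauMinus]

/-- The boundary weight `dist(x, ∂Ω)^{-1/2}`. -/
noncomputable def bw (Ω : Set V3) (x : V3) : ℝ≥0∞ := (Metric.infEDist x Ωᶜ)⁻¹ ^ (1 / 2 : ℝ)

theorem measurable_bw : Measurable (bw Ω) := by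
  unfold bw
  exact (Metric.continuous_infEDist.measurable.inv).pow_const _

theorem IsConvexBody.compl_nonempty (h : IsConvexBody Ω d) : Ωᶜ.Nonempty := by
  by_contra hc
  rw [not_nonempty_iff_eq_empty, compl_empty_iff] at hc
  have := h.volume_lt_top
  rw [hc] at this
  simp at this

theorem IsConvexBody.infDist_pos (h : IsConvexBody Ω d) {x : V3} (hx : x ∈ Ω) :
    0 < Metric.infDist x Ωᶜ :=
  (h.isOpen.isClosed_compl.notMem_iff_infDist_pos h.compl_nonempty).1 (by simpa using hx)

theorem IsConvexBody.bw_eq (h : IsConvexBody Ω d) {x : V3} (hx : x ∈ Ω) :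
    bw Ω x = ENNReal.ofReal ((Metric.infDist x Ωᶜ)⁻¹ ^ (1 / 2 : ℝ)) := by
  have hp := h.infDist_pos hx
  rw [bw, ← ENNReal.ofReal_rpow_of_pos (inv_pos.2 hp), ENNReal.ofReal_inv_of_pos hp, Metric.infDist,
    ENNReal.ofReal_toReal (Metric.infEDist_ne_top h.compl_nonempty)]

/-- If `y - s v` is in `Ω`, join it to the point at distance `δ' < dist(x, Ωᶜ)` beyond `x` on the
line from `y` through `x`. By similar triangles the segment meets the backward line of `x` at time
`s δ' / (|x - y| + δ')`, which therefore precedes the exit. -/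
theorem IsConvexBody.mul_tauMinus_le (h : IsConvexBody Ω d) {x y v : V3} (hx : x ∈ Ω) (hy : y ∈ Ω)
    (hv : v ≠ 0) : Metric.infDist x Ωᶜ * tauMinus Ω y v ≤
      (‖x - y‖ + Metric.infDist x Ωᶜ) * tauMinus Ω x v := by
  set δ := Metric.infDist x Ωᶜ with hδ
  have hδ0 : 0 < δ := h.infDist_pos hx
  rcases eq_or_ne x y with rfl | hxy
  · simp
  have hn : 0 < ‖x - y‖ := norm_pos_iff.2 (sub_ne_zero.2 hxy)
  have hball : Metric.ball x δ ⊆ Ω := by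
    intro z hz
    by_contra hzc
    have := Metric.infDist_le_dist_of_mem (x := x) (show z ∈ Ωᶜ from hzc)
    rw [Metric.mem_ball, dist_comm] at hz
    linarith
  have key : ∀ δ' : ℝ, 0 < δ' → δ' < δ → ∀ s : ℝ, 0 ≤ s → s < tauMinus Ω y v →
      δ' * s ≤ (‖x - y‖ + δ') * tauMinus Ω x v := by
    intro δ' hδ' hlt s hs hsl
    have hmem := (h.mem_iff hy hv hs).2 hsl
    have hz : x + (δ' / ‖x - y‖) • (x - y) ∈ Ω := by
      apply hball
      rw [Metric.mem_ball, dist_eq_norm, add_sub_cancel_left, norm_smul, Real.norm_of_nonneg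
        (by positivity), div_mul_cancel₀ _ hn.ne']
      exact hlt
    have hc := h.convex hz hmem (a := ‖x - y‖ / (‖x - y‖ + δ')) (b := δ' / (‖x - y‖ + δ'))
      (by positivity) (by positivity) (by field_simp)
    have e : (‖x - y‖ / (‖x - y‖ + δ')) • (x + (δ' / ‖x - y‖) • (x - y)) +
        (δ' / (‖x - y‖ + δ')) • (y - s • v) = x - (δ' / (‖x - y‖ + δ') * s) • v := by
      have e1 : ‖x - y‖ / (‖x - y‖ + δ') * (δ' / ‖x - y‖) = δ' / (‖x - y‖ + δ') := by field_simp
      have e2 : ‖x - y‖ / (‖x - y‖ + δ') = 1 - δ' / (‖x - y‖ + δ') := by field_simp; ring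
      rw [smul_add, smul_smul, e1, e2]
      module
    rw [e] at hc
    have := (h.mem_iff hx hv (by positivity)).1 hc
    rw [div_mul_eq_mul_div, div_lt_iff₀ (by positivity)] at this
    linarith
  have hτ : 0 < tauMinus Ω y v := h.tauMinus_pos hy hv
  have k2 : ∀ δ' : ℝ, 0 < δ' → δ' < δ →
      δ' * tauMinus Ω y v ≤ (‖x - y‖ + δ') * tauMinus Ω x v := by
    intro δ' h0 h1
    rw [← le_div_iff₀' h0]
    refine le_of_forall_lt_imp_le_of_dense fun s hs => ?_
    rcases le_or_gt 0 s with h2 | h2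
    · rw [le_div_iff₀' h0]; exact key δ' h0 h1 s h2 hs
    · exact h2.le.trans (div_nonneg (mul_nonneg (by positivity) (tauMinus_nonneg _ _)) h0.le)
  -- The limit `δ' → δ` is taken along `(1 - 1/(n+2)) δ`; the shift by `2` keeps the factor strictly
  -- between `0` and `1`.
  refine le_of_tendsto_of_tendsto' (f := fun n : ℕ => (1 - 1 / ((n : ℝ) + 2)) * δ * tauMinus Ω y v)
    (g := fun n : ℕ => (‖x - y‖ + (1 - 1 / ((n : ℝ) + 2)) * δ) * tauMinus Ω x v)
    (b := atTop) ?_ ?_ ?_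
  · have : Tendsto (fun n : ℕ => 1 / ((n : ℝ) + 2)) atTop (𝓝 0) := by
      have := (tendsto_one_div_add_atTop_nhds_zero_nat (𝕜 := ℝ)).comp (tendsto_add_atTop_nat 1)
      refine this.congr fun n => ?_
      simp only [Function.comp_apply]; push_cast; ring
    have h2 := ((tendsto_const_nhds (x := (1 : ℝ))).sub this).mul_const δ |>.mul_const (tauMinus Ω y v)
    simpa using h2
  · have : Tendsto (fun n : ℕ => 1 / ((n : ℝ) + 2)) atTop (𝓝 0) := by
      have := (tendsto_one_div_add_atTop_nhds_zero_nat (𝕜 := ℝ)).comp (tendsto_add_atTop_nat 1)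
      refine this.congr fun n => ?_
      simp only [Function.comp_apply]; push_cast; ring
    have h2 := (((tendsto_const_nhds (x := (1 : ℝ))).sub this).mul_const δ |>.const_add
      ‖x - y‖).mul_const (tauMinus Ω x v)
    simpa using h2
  · intro n
    have h3 : (0 : ℝ) < 1 / ((n : ℝ) + 2) := by positivity
    have h4 : 1 / ((n : ℝ) + 2) < 1 := by
      rw [div_lt_one (by positivity)]
      have : (0 : ℝ) ≤ n := Nat.cast_nonneg n
      linarith
    exact k2 _ (mul_pos (by linarith) hδ0) (by nlinarith)

/-- Two bounds for the difference are available: `(|x - y|/δ) τ₋(x, v)` with `δ = dist(x, Ωᶜ)`, and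
`d/|v|`. As `min(1, r) ≤ √r`, they combine to a Hölder bound of order `1/2`, with a weight that
stays integrable up to the boundary. -/
theorem IsConvexBody.tauMinus_sub_le (h : IsConvexBody Ω d) {x y v : V3} (hx : x ∈ Ω) (hy : y ∈ Ω)
    (hv : v ≠ 0) : ENNReal.ofReal (tauMinus Ω y v - tauMinus Ω x v) ≤
      ENNReal.ofReal d * ipow 1 v * ‖x - y‖ₑ ^ (1 / 2 : ℝ) * bw Ω x := by
  have hδ := h.infDist_pos hx
  have hn : 0 < ‖v‖ := norm_pos_iff.2 hv
  rw [h.bw_eq hx, ipow_eq_ofReal _ hv, ← ofReal_norm, ENNReal.ofReal_rpow_of_nonneg (norm_nonneg _)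
    (by norm_num), ← ENNReal.ofReal_mul h.diam_pos.le, ← ENNReal.ofReal_mul
    (mul_nonneg h.diam_pos.le (by positivity)), ← ENNReal.ofReal_mul
    (mul_nonneg (mul_nonneg h.diam_pos.le (by positivity)) (by positivity))]
  apply ENNReal.ofReal_le_ofReal
  have h1 := h.mul_tauMinus_le hx hy hv
  have h2 := h.tauMinus_le hx hv
  have h3 := h.tauMinus_le hy hv
  have h4 := tauMinus_nonneg (Ω := Ω) x v
  set δ := Metric.infDist x Ωᶜ
  set a := ‖x - y‖
  have ha : 0 ≤ a := norm_nonneg _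
  have e : d * ‖v‖ ^ (-1 : ℝ) * a ^ (1 / 2 : ℝ) * δ⁻¹ ^ (1 / 2 : ℝ) = d / ‖v‖ * Real.sqrt (a / δ) := by
    rw [Real.rpow_neg_one, mul_assoc _ (a ^ (1 / 2 : ℝ)), ← Real.mul_rpow ha (by positivity),
      ← Real.sqrt_eq_rpow, div_eq_mul_inv, div_eq_mul_inv]
  rw [e]
  have hd : 0 ≤ d / ‖v‖ := div_nonneg h.diam_pos.le hn.le
  rcases le_total 1 (a / δ) with hc | hc
  · have : 1 ≤ Real.sqrt (a / δ) := Real.one_le_sqrt.2 hc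
    nlinarith
  · have hs : a / δ ≤ Real.sqrt (a / δ) := Real.le_sqrt_of_sq_le (by nlinarith [div_nonneg ha hδ.le])
    have h5 : tauMinus Ω y v - tauMinus Ω x v ≤ a / δ * tauMinus Ω x v := by
      rw [div_mul_eq_mul_div, le_div_iff₀ hδ]; linarith
    nlinarith [div_nonneg ha hδ.le]

theorem IsConvexBody.volume_exit_le (h : IsConvexBody Ω d) {x y v : V3} (hx : x ∈ Ω) (hy : y ∈ Ω)
    (hv : v ≠ 0) : volume {s : ℝ | 0 < s ∧ x - s • v ∉ Ω ∧ y - s • v ∈ Ω} ≤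
      ENNReal.ofReal d * ipow 1 v * ‖x - y‖ₑ ^ (1 / 2 : ℝ) * bw Ω x := by
  refine le_trans (measure_mono (t := Ico (tauMinus Ω x v) (tauMinus Ω y v)) ?_) ?_
  · rintro s ⟨hs, h1, h2⟩
    rw [h.mem_iff hx hv hs.le] at h1
    rw [h.mem_iff hy hv hs.le] at h2
    exact ⟨not_lt.1 h1, h2⟩
  · rw [Real.volume_Ico]
    exact h.tauMinus_sub_le hx hy hv

end LinBoltzmann

namespace LinBoltzmann

variable {Ω : Set V3} {d : ℝ}

/-! ### Integrability of the boundary weight -/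

theorem lintegral_Ioi_ipow {a r : ℝ} (ha : 1 < a) (hr : 0 < r) :
    ∫⁻ t in Ioi r, ipow a t = ENNReal.ofReal (r ^ (1 - a) / (a - 1)) := by
  have h1 : ∀ t ∈ Ioi r, ipow a t = ENNReal.ofReal (t ^ (-a)) := by
    intro t ht
    have ht' : 0 < t := hr.trans ht
    rw [ipow_eq_ofReal _ ht'.ne', Real.norm_of_nonneg ht'.le]
  rw [setLIntegral_congr_fun measurableSet_Ioi h1, ← ofReal_integral_eq_lintegral_ofReal
    (integrableOn_Ioi_rpow_of_lt (by linarith) hr), integral_Ioi_rpow_of_lt (by linarith) hr]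
  · congr 1
    rw [neg_div, ← div_neg, show -a + 1 = 1 - a by ring, neg_sub]
  · filter_upwards [ae_restrict_mem measurableSet_Ioi] with t ht
    exact Real.rpow_nonneg (hr.trans ht).le _

theorem lintegral_Ioc_ipow {a r : ℝ} (ha : a < 1) (hr : 0 < r) :
    ∫⁻ t in Ioc 0 r, ipow a t = ENNReal.ofReal (r ^ (1 - a) / (1 - a)) := by
  have h1 : ∀ t ∈ Ioc 0 r, ipow a t = ENNReal.ofReal (t ^ (-a)) := by
    intro t ht
    rw [ipow_eq_ofReal _ ht.1.ne', Real.norm_of_nonneg ht.1.le]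
  rw [setLIntegral_congr_fun measurableSet_Ioc h1, ← ofReal_integral_eq_lintegral_ofReal,
    ← intervalIntegral.integral_of_le hr.le, integral_rpow (Or.inl (by linarith))]
  · congr 1
    rw [Real.zero_rpow (by linarith), sub_zero, show -a + 1 = 1 - a by ring]
  · exact (intervalIntegral.intervalIntegrable_rpow' (by linarith)).1
  · filter_upwards [ae_restrict_mem measurableSet_Ioc] with t ht
    exact Real.rpow_nonneg ht.1.le _

/-- Homothety with centre `z` and ratio `lam`. -/
noncomputable def homoth (z : V3) (lam : ℝ) (x : V3) : V3 := z + lam • (x - z)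

theorem lintegral_homoth (z : V3) {lam : ℝ} (hlam : 0 < lam) {F : V3 → ℝ≥0∞} (hF : Measurable F) :
    ∫⁻ x, F x = ENNReal.ofReal (lam ^ 3) * ∫⁻ x, F (homoth z lam x) := by
  have h1 : ∫⁻ x, F (homoth z lam x) = ∫⁻ x, F (z + lam • x) :=
    lintegral_sub_right_eq_self (fun x => F (z + lam • x)) z
  have h2 : ∫⁻ x, F (z + lam • x) = ∫⁻ y, F (z + y) ∂(Measure.map (lam • ·) volume) := by
    have hF' : Measurable fun y => F (z + y) := hF.comp (measurable_const_add z)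
    rw [lintegral_map hF' (measurable_const_smul lam)]
  rw [h1, h2, Measure.map_addHaar_smul _ hlam.ne', finrank_V3, lintegral_smul_measure,
    lintegral_add_left_eq_self F z, smul_eq_mul, ← mul_assoc, ← ENNReal.ofReal_mul (by positivity),
    abs_of_pos (by positivity), mul_inv_cancel₀ (by positivity), ENNReal.ofReal_one, one_mul]

/-- The convex hull of the ball around `z` and of the image with ratio `t` contains a ball of radius
`ρ (1 - s/t)` around the image with ratio `s`. -/
theorem IsConvexBody.infEDist_homoth_ge (h : IsConvexBody Ω d) {z : V3} {ρ : ℝ}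
    (hball : Metric.ball z ρ ⊆ Ω) {x : V3} {s t : ℝ} (hs : 0 < s) (hst : s < t)
    (ht : homoth z t x ∈ Ω) :
    ENNReal.ofReal (ρ * (1 - s / t)) ≤ Metric.infEDist (homoth z s x) Ωᶜ := by
  rw [Metric.le_infEDist]
  intro y hy
  by_contra hlt
  push Not at hlt
  rw [edist_comm, edist_dist, ENNReal.ofReal_lt_ofReal_iff_of_nonneg dist_nonneg, dist_eq_norm] at hlt
  have ht0 : 0 < t := hs.trans hst
  have hm : 0 < 1 - s / t := by rw [sub_pos, div_lt_one ht0]; exact hst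
  refine hy ?_
  have hw : z + (1 - s / t)⁻¹ • (y - homoth z s x) ∈ Ω := by
    apply hball
    rw [Metric.mem_ball, dist_eq_norm, add_sub_cancel_left, norm_smul,
      Real.norm_of_nonneg (inv_nonneg.2 hm.le), inv_mul_lt_iff₀ hm]
    linarith
  have := h.convex ht hw (a := s / t) (b := 1 - s / t) (by positivity) hm.le (by ring)
  have e : (s / t) • homoth z t x + (1 - s / t) • (z + (1 - s / t)⁻¹ • (y - homoth z s x)) = y := by
    rw [smul_add (1 - s / t), smul_smul, mul_inv_cancel₀ hm.ne', one_smul, homoth, homoth, smul_add,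
      smul_smul, div_mul_cancel₀ _ ht0.ne']
    module
  rwa [e] at this

/-- Along a ray from `z`, the distance to the boundary is at least `(ρ/2)(l - s)`, with `l` the last
admissible ratio. Integrating `(l - s)^{-1/2}` over a length `R` gives `√R`. -/
theorem IsConvexBody.exists_lintegral_homoth_bw_le (h : IsConvexBody Ω d) {z : V3} {ρ : ℝ}
    (hρ : 0 < ρ) (hball : Metric.ball z ρ ⊆ Ω) :
    ∃ C : ℝ≥0, ∀ (x : V3) (R : ℝ), 0 < R → R ≤ 1 →
      ∫⁻ s in Ioo 1 (1 + R), Ω.indicator (bw Ω) (homoth z s x) ≤ C * ENNReal.ofReal (Real.sqrt R) := by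
  let c : ℝ≥0∞ := (ENNReal.ofReal (ρ / 2))⁻¹ ^ (1 / 2 : ℝ)
  have hc : c ≠ ∞ := ENNReal.rpow_ne_top_of_nonneg (by norm_num) (by simpa using by positivity)
  have hc0 : c ≠ 0 := by
    refine (ENNReal.rpow_pos (by simp) (by simpa using by positivity)).ne'
  refine ⟨c.toNNReal * 2, fun x R hR hR1 => ?_⟩
  let S : Set ℝ := {s | s ∈ Ioo 1 (1 + R) ∧ homoth z s x ∈ Ω}
  rcases S.eq_empty_or_nonempty with hS | hS
  · refine le_trans (le_of_eq ?_) zero_le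
    rw [setLIntegral_congr_fun (g := fun _ => 0) measurableSet_Ioo, lintegral_zero]
    intro s hs
    refine indicator_of_notMem (fun hm => ?_) _
    have : s ∈ S := ⟨hs, hm⟩
    rw [hS] at this; exact this
  have hbdd : BddAbove S := ⟨1 + R, fun s hs => hs.1.2.le⟩
  set l := sSup S with hl
  have hl2 : l ≤ 1 + R := csSup_le hS fun s hs => hs.1.2.le
  have key : ∀ s ∈ Ioo 1 (1 + R), Ω.indicator (bw Ω) (homoth z s x) ≤
      (Ioc (l - R) l).indicator (fun s => c * ipow (1 / 2) (l - s)) s := by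
    intro s hs
    by_cases hm : homoth z s x ∈ Ω
    · have hsS : s ∈ S := ⟨hs, hm⟩
      have hsl : s ≤ l := le_csSup hbdd hsS
      rw [indicator_of_mem hm, indicator_of_mem (show s ∈ Ioc (l - R) l from
        ⟨by linarith [hs.1], hsl⟩)]
      simp only [c, ipow, bw]
      rw [← ENNReal.mul_rpow_of_nonneg _ _ (by norm_num)]
      refine ENNReal.rpow_le_rpow ?_ (by norm_num)
      -- At `s = l` the right side is `∞`, so nothing has to be shown.
      rcases hsl.eq_or_lt with heq | hlt
      · rw [heq]; simp [ENNReal.mul_top]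
      rw [← ENNReal.mul_inv (Or.inr (by simp)) (Or.inl (by simp)), ENNReal.inv_le_inv]
      rw [← ofReal_norm, Real.norm_of_nonneg (by linarith), ← ENNReal.ofReal_mul (by positivity)]
      -- The supremum `l` need not be attained. A ratio `t` within `η/ρ` of it costs an error of at
      -- most `η`, and `t ≤ 2` explains the factor `1/2`.
      refine ENNReal.le_of_forall_pos_le_add fun η hη _ => ?_
      obtain ⟨t, htS, htl⟩ := exists_lt_of_lt_csSup hS
        (show max s (l - η / ρ) < sSup S from max_lt hlt (by
          have : (0 : ℝ) < η / ρ := div_pos (by exact_mod_cast hη) hρ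
          linarith))
      have hst : s < t := (le_max_left _ _).trans_lt htl
      have htl' : l - η / ρ < t := (le_max_right _ _).trans_lt htl
      have ht2 : t ≤ 2 := by linarith [htS.1.2]
      have h3 := h.infEDist_homoth_ge hball (by linarith [hs.1]) hst htS.2
      have ht0 : 0 < t := by linarith [htS.1.1]
      calc ENNReal.ofReal (ρ / 2 * (l - s)) ≤ ENNReal.ofReal (ρ * (1 - s / t) + η) := by
            apply ENNReal.ofReal_le_ofReal
            have e1 : (t - s) / 2 ≤ 1 - s / t := by
              rw [show 1 - s / t = (t - s) / t by field_simp]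
              exact div_le_div_of_nonneg_left (by linarith) ht0 ht2
            have e2 : ρ * (l - t) ≤ η := by
              have := mul_le_mul_of_nonneg_left htl'.le hρ.le
              rw [mul_sub, mul_div_cancel₀ _ hρ.ne'] at this
              linarith
            have hη0 : (0 : ℝ) ≤ η := η.2
            nlinarith [mul_le_mul_of_nonneg_left e1 hρ.le]
        _ ≤ ENNReal.ofReal (ρ * (1 - s / t)) + η := by
            refine (ENNReal.ofReal_add_le).trans ?_
            rw [ENNReal.ofReal_coe_nnreal]
        _ ≤ _ := by gcongr
    · rw [indicator_of_notMem hm]; exact zero_le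
  have hmi : Measurable fun s : ℝ => ipow (1 / 2) s := measurable_ipow _
  calc _ ≤ ∫⁻ s in Ioo 1 (1 + R), (Ioc (l - R) l).indicator (fun s => c * ipow (1 / 2) (l - s)) s :=
        setLIntegral_mono' measurableSet_Ioo key
    _ ≤ ∫⁻ s, (Ioc (l - R) l).indicator (fun s => c * ipow (1 / 2) (l - s)) s :=
        setLIntegral_le_lintegral _ _
    _ = ∫⁻ t, (Ico 0 R).indicator (fun t => c * ipow (1 / 2) t) t := by
        rw [← lintegral_sub_left_eq_self _ l]
        refine lintegral_congr fun t => ?_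
        by_cases ht : t ∈ Ico 0 R
        · have ht' : l - t ∈ Ioc (l - R) l := ⟨by linarith [ht.2], by linarith [ht.1]⟩
          rw [indicator_of_mem ht, indicator_of_mem ht', sub_sub_cancel]
        · have ht' : l - t ∉ Ioc (l - R) l :=
            fun h' => ht ⟨by linarith [h'.2], by linarith [h'.1]⟩
          rw [indicator_of_notMem ht, indicator_of_notMem ht']
    _ = c * ∫⁻ t in Ioc 0 R, ipow (1 / 2) t := by
        rw [lintegral_indicator measurableSet_Ico, lintegral_const_mul _ hmi,
          Measure.restrict_congr_set Ico_ae_eq_Ioc]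
    _ = _ := by
        rw [lintegral_Ioc_ipow (by norm_num) hR, ENNReal.coe_mul, ENNReal.coe_toNNReal hc, mul_assoc,
          Real.sqrt_eq_rpow]
        congr 1
        rw [show (1 - 1 / 2 : ℝ) = 1 / 2 by norm_num, div_div_eq_mul_div, div_one, mul_comm,
          ENNReal.ofReal_mul zero_le_two]
        simp

/-- The integral is averaged over dilations with ratio in `(1, 1 + R)`, whose Jacobians are at most
`2³ = 8`. By Fubini each point of `A'` contributes at most a multiple of `√R`; division by the
length `R` of the interval leaves `R^{-1/2}`. -/
theorem IsConvexBody.exists_lintegral_inter_bw_le (h : IsConvexBody Ω d) :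
    ∃ z ∈ Ω, ∃ C : ℝ≥0, ∀ (R : ℝ) (A A' : Set V3), 0 < R → R ≤ 1 → MeasurableSet A → MeasurableSet A' →
      (∀ s ∈ Ioo 1 (1 + R), ∀ x, homoth z s x ∈ Ω ∩ A → x ∈ A') →
      ∫⁻ x in Ω ∩ A, bw Ω x ≤ C * ipow (1 / 2) R * volume A' := by
  obtain ⟨z, hz⟩ := h.nonempty
  obtain ⟨ρ, hρ, hball⟩ := Metric.isOpen_iff.1 h.isOpen z hz
  obtain ⟨C, hC⟩ := h.exists_lintegral_homoth_bw_le hρ hball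
  refine ⟨z, hz, 8 * C, fun R A A' hR hR1 hA hA' himp => ?_⟩
  have hmF : Measurable ((Ω ∩ A).indicator (bw Ω)) :=
    measurable_bw.indicator (h.measurableSet.inter hA)
  have hmh : Measurable fun p : ℝ × V3 => homoth z p.1 p.2 := by unfold homoth; fun_prop
  have key : ∀ s ∈ Ioo 1 (1 + R), ∫⁻ x in Ω ∩ A, bw Ω x ≤
      8 * ∫⁻ x, (Ω ∩ A).indicator (bw Ω) (homoth z s x) := by
    intro s hs
    rw [← lintegral_indicator (h.measurableSet.inter hA),
      lintegral_homoth z (show 0 < s by linarith [hs.1]) hmF]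
    gcongr
    rw [show (8 : ℝ≥0∞) = ENNReal.ofReal 8 by simp]
    apply ENNReal.ofReal_le_ofReal
    have : s ≤ 2 := by linarith [hs.2]
    calc s ^ 3 ≤ 2 ^ 3 := by gcongr; linarith [hs.1]
      _ = 8 := by norm_num
  have h1 : ENNReal.ofReal R * ∫⁻ x in Ω ∩ A, bw Ω x ≤
      8 * (C * ENNReal.ofReal (Real.sqrt R) * volume A') := by
    calc ENNReal.ofReal R * ∫⁻ x in Ω ∩ A, bw Ω x
        = ∫⁻ _ in Ioo 1 (1 + R), ∫⁻ x in Ω ∩ A, bw Ω x := by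
          rw [setLIntegral_const, Real.volume_Ioo, add_sub_cancel_left, mul_comm]
      _ ≤ ∫⁻ s in Ioo 1 (1 + R), 8 * ∫⁻ x, (Ω ∩ A).indicator (bw Ω) (homoth z s x) :=
          setLIntegral_mono' measurableSet_Ioo key
      _ = 8 * ∫⁻ x, ∫⁻ s in Ioo 1 (1 + R), (Ω ∩ A).indicator (bw Ω) (homoth z s x) := by
          rw [lintegral_const_mul' _ _ (by simp), lintegral_lintegral_swap]
          exact (hmF.comp hmh).aemeasurable
      _ ≤ 8 * ∫⁻ x, A'.indicator (fun _ => C * ENNReal.ofReal (Real.sqrt R)) x := by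
          gcongr with x
          by_cases hx : x ∈ A'
          · rw [indicator_of_mem hx]
            refine le_trans (lintegral_mono fun s => ?_) (hC x R hR hR1)
            exact indicator_le_indicator_of_subset inter_subset_left (fun _ => zero_le) _
          · rw [indicator_of_notMem hx, setLIntegral_congr_fun (g := fun _ => 0) measurableSet_Ioo,
              lintegral_zero]
            intro s hs
            exact indicator_of_notMem (fun hm => hx (himp s hs x hm)) _
      _ = _ := by rw [lintegral_indicator hA', setLIntegral_const]
  have hR0 : ENNReal.ofReal R ≠ 0 := by simpa using hR
  rw [mul_comm, ← ENNReal.le_div_iff_mul_le (Or.inl hR0) (Or.inl (by simp))] at h1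
  refine h1.trans (le_of_eq ?_)
  have h2 : ENNReal.ofReal (Real.sqrt R) / ENNReal.ofReal R = ipow (1 / 2) R := by
    rw [← ENNReal.ofReal_div_of_pos hR, ipow_eq_ofReal _ hR.ne', Real.norm_of_nonneg hR.le,
      Real.sqrt_div_self', Real.sqrt_eq_rpow, Real.rpow_neg hR.le, one_div]
  rw [← h2, ENNReal.coe_mul]
  simp only [div_eq_mul_inv, ENNReal.coe_ofNat]
  ring

end LinBoltzmann

/-! ### Riesz potential of the boundary weight. -/

namespace LinBoltzmann

variable {Ω : Set V3} {d : ℝ}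

theorem IsConvexBody.lintegral_bw_lt_top (h : IsConvexBody Ω d) : ∫⁻ x in Ω, bw Ω x < ∞ := by
  obtain ⟨z, hz, C, hC⟩ := h.exists_lintegral_inter_bw_le
  have := hC 1 univ Ω one_pos le_rfl MeasurableSet.univ h.measurableSet ?_
  · rw [inter_univ] at this
    refine this.trans_lt (ENNReal.mul_lt_top (ENNReal.mul_lt_top ENNReal.coe_lt_top ?_)
      h.volume_lt_top)
    simp [ipow]
  · rintro s hs x ⟨hx, -⟩
    have hs0 : 0 < s := by linarith [hs.1]
    have := h.convex hx hz (a := s⁻¹) (b := 1 - s⁻¹) (by positivity)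
      (by rw [sub_nonneg]; exact inv_le_one_of_one_le₀ hs.1.le) (by ring)
    have e : s⁻¹ • homoth z s x + (1 - s⁻¹) • z = x := by
      rw [homoth, smul_add, smul_smul, inv_mul_cancel₀ hs0.ne', one_smul]; module
    rwa [e] at this

/-- Undoing a dilation with ratio below `1 + R` moves points of `Ω` by at most `R d`, so the
enlarged set is a ball of radius `(d + 1) R`. The volume `R³` times `R^{-1/2}` gives the exponent
`5/2`. -/
theorem IsConvexBody.exists_lintegral_ball_bw_le (h : IsConvexBody Ω d) :
    ∃ C : ℝ≥0, ∀ (y : V3) (R : ℝ), 0 < R → R ≤ 1 →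
      ∫⁻ x in Ω ∩ Metric.closedBall y R, bw Ω x ≤ C * ENNReal.ofReal (R ^ (5 / 2 : ℝ)) := by
  obtain ⟨z, hz, C, hC⟩ := h.exists_lintegral_inter_bw_le
  have hd := h.diam_pos
  refine ⟨C * ((d + 1) ^ 3).toNNReal * (volume (Metric.ball (0 : V3) 1)).toNNReal,
    fun y R hR hR1 => ?_⟩
  have := hC R (Metric.closedBall y R) (Metric.closedBall y ((d + 1) * R)) hR hR1
    Metric.isClosed_closedBall.measurableSet Metric.isClosed_closedBall.measurableSet ?_
  · refine this.trans (le_of_eq ?_)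
    rw [Measure.addHaar_closedBall _ _ (by positivity), finrank_V3, ipow_eq_ofReal _ hR.ne',
      Real.norm_of_nonneg hR.le, mul_pow, ENNReal.ofReal_mul (by positivity), ENNReal.coe_mul,
      ENNReal.coe_mul, ENNReal.coe_toNNReal measure_ball_lt_top.ne,
      show (R ^ (5 / 2 : ℝ)) = R ^ (-(1 / 2) : ℝ) * R ^ 3 by
        rw [← Real.rpow_natCast, ← Real.rpow_add hR]; norm_num,
      ENNReal.ofReal_mul (by positivity)]
    simp only [ENNReal.ofReal]
    ring
  · rintro s hs x ⟨hx, hx'⟩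
    have hs0 : 0 < s := by linarith [hs.1]
    rw [Metric.mem_closedBall, dist_eq_norm] at hx' ⊢
    have e : x - homoth z s x = (-(1 - s⁻¹)) • (homoth z s x - z) := by
      have : homoth z s x - z = s • (x - z) := by rw [homoth]; abel
      rw [this, smul_smul, show -(1 - s⁻¹) * s = 1 - s by field_simp; ring, homoth]; module
    have e2 : ‖x - homoth z s x‖ ≤ R * d := by
      have h1 : 0 ≤ 1 - s⁻¹ := by rw [sub_nonneg]; exact inv_le_one_of_one_le₀ hs.1.le
      rw [e, norm_smul, norm_neg, Real.norm_of_nonneg h1]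
      refine mul_le_mul ?_ (h.norm_sub_lt _ hx _ hz).le (norm_nonneg _) hR.le
      have : 1 - s⁻¹ = (s - 1) / s := by field_simp
      rw [this, div_le_iff₀ hs0]
      nlinarith [hs.1, hs.2]
    calc ‖x - y‖ = ‖(x - homoth z s x) + (homoth z s x - y)‖ := by congr 1; abel
      _ ≤ R * d + R := (norm_add_le _ _).trans (add_le_add e2 hx')
      _ = _ := by ring

/-- Layer-cake form `|z|⁻² = ∫_{|z|}^∞ 2 R⁻³ dR`, which reduces the Riesz potential to masses of
balls. -/
theorem ipow_two_eq_lintegral {z : V3} (hz : z ≠ 0) :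
    ipow 2 z = ∫⁻ R in Ioi (0 : ℝ), (Ioi ‖z‖).indicator (fun R => 2 * ipow 3 R) R := by
  have hn : 0 < ‖z‖ := norm_pos_iff.2 hz
  have e : ∀ t : ℝ, (2 : ℝ≥0∞) * ENNReal.ofReal t = ENNReal.ofReal (2 * t) := fun t => by
    rw [ENNReal.ofReal_mul zero_le_two, ENNReal.ofReal_ofNat]
  rw [lintegral_indicator measurableSet_Ioi, Measure.restrict_restrict measurableSet_Ioi,
    inter_eq_left.2 (Ioi_subset_Ioi hn.le), lintegral_const_mul' _ _ (by simp),
    lintegral_Ioi_ipow (by norm_num) hn, ipow_eq_ofReal _ hz, e]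
  congr 1
  rw [show (1 - 3 : ℝ) = -2 by norm_num]
  ring

/-- The weight `dist(x, ∂Ω)^{-1/2}` has bounded Riesz potential. -/
theorem IsConvexBody.exists_lintegral_ipow_two_bw_le (h : IsConvexBody Ω d) :
    ∃ C : ℝ≥0, ∀ y : V3, ∫⁻ x in Ω, ipow 2 (x - y) * bw Ω x ≤ C := by
  obtain ⟨C, hC⟩ := h.exists_lintegral_ball_bw_le
  have hb := h.lintegral_bw_lt_top
  let D₁ : ℝ≥0∞ := ∫⁻ R in Ioc (0 : ℝ) 1, 2 * C * ipow (1 / 2) R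
  let D₂ : ℝ≥0∞ := ∫⁻ R in Ioi (1 : ℝ), 2 * (∫⁻ x in Ω, bw Ω x) * ipow 3 R
  have hD₁ : D₁ < ∞ := by
    simp only [D₁]
    rw [lintegral_const_mul' _ _ (ENNReal.mul_ne_top (by simp) (by simp)),
      lintegral_Ioc_ipow (by norm_num) one_pos]
    exact ENNReal.mul_lt_top (ENNReal.mul_lt_top (by simp) (by simp)) (by simp)
  have hD₂ : D₂ < ∞ := by
    simp only [D₂]
    rw [lintegral_const_mul' _ _ (ENNReal.mul_ne_top (by simp) hb.ne),
      lintegral_Ioi_ipow (by norm_num) one_pos]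
    exact ENNReal.mul_lt_top (ENNReal.mul_lt_top (by simp) hb) (by simp)
  refine ⟨(D₁ + D₂).toNNReal, fun y => ?_⟩
  rw [ENNReal.coe_toNNReal (ENNReal.add_lt_top.2 ⟨hD₁, hD₂⟩).ne]
  have hm3 : Measurable fun R : ℝ => 2 * ipow 3 R := (measurable_ipow 3).const_mul 2
  have hset : MeasurableSet {p : V3 × ℝ | ‖p.1 - y‖ < p.2} :=
    measurableSet_lt (by fun_prop) (by fun_prop)
  have hmi : Measurable fun p : V3 × ℝ => (Ioi ‖p.1 - y‖).indicator (fun R => 2 * ipow 3 R) p.2 := by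
    have : (fun p : V3 × ℝ => (Ioi ‖p.1 - y‖).indicator (fun R => 2 * ipow 3 R) p.2) =
        {p : V3 × ℝ | ‖p.1 - y‖ < p.2}.indicator (fun p => 2 * ipow 3 p.2) := by
      ext p; simp only [indicator, mem_Ioi, mem_ofPred_eq]
    rw [this]
    exact (hm3.comp measurable_snd).indicator hset
  have hmb : Measurable fun p : V3 × ℝ => bw Ω p.1 := measurable_bw.comp measurable_fst
  have hm : Measurable fun p : V3 × ℝ =>
      (Ioi ‖p.1 - y‖).indicator (fun R => 2 * ipow 3 R) p.2 * bw Ω p.1 := hmi.mul hmb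
  calc ∫⁻ x in Ω, ipow 2 (x - y) * bw Ω x
      = ∫⁻ x in Ω, ∫⁻ R in Ioi (0 : ℝ),
          (Ioi ‖x - y‖).indicator (fun R => 2 * ipow 3 R) R * bw Ω x := by
        refine lintegral_congr_ae (ae_restrict_of_ae ?_)
        have : ∀ᵐ x : V3, x ≠ y := by simp [ae_iff]
        refine this.mono fun x hx => ?_
        dsimp only
        rw [lintegral_mul_const _ (hm3.indicator measurableSet_Ioi),
          ← ipow_two_eq_lintegral (sub_ne_zero.2 hx)]
    _ = ∫⁻ R in Ioi (0 : ℝ), ∫⁻ x in Ω,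
          (Ioi ‖x - y‖).indicator (fun R => 2 * ipow 3 R) R * bw Ω x :=
        lintegral_lintegral_swap hm.aemeasurable
    _ ≤ ∫⁻ R in Ioi (0 : ℝ), 2 * ipow 3 R * ∫⁻ x in Ω ∩ Metric.closedBall y R, bw Ω x := by
        gcongr with R
        rw [inter_comm, ← Measure.restrict_restrict Metric.isClosed_closedBall.measurableSet,
          ← lintegral_indicator Metric.isClosed_closedBall.measurableSet]
        rw [← lintegral_const_mul _
          (measurable_bw.indicator Metric.isClosed_closedBall.measurableSet)]
        refine lintegral_mono fun x => ?_
        by_cases hx : ‖x - y‖ < R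
        · rw [indicator_of_mem (show R ∈ Ioi ‖x - y‖ from hx), indicator_of_mem]
          rw [Metric.mem_closedBall, dist_eq_norm]; exact hx.le
        · rw [indicator_of_notMem (show R ∉ Ioi ‖x - y‖ from hx), zero_mul]; exact zero_le
    -- For `R ≤ 1` the ball estimate leaves `R^{-3 + 5/2} = R^{-1/2}`, integrable at `0`. For `R >
    -- 1` the total mass and `R⁻³` suffice.
    _ = (∫⁻ R in Ioc (0 : ℝ) 1, 2 * ipow 3 R * ∫⁻ x in Ω ∩ Metric.closedBall y R, bw Ω x) +
          ∫⁻ R in Ioi (1 : ℝ), 2 * ipow 3 R * ∫⁻ x in Ω ∩ Metric.closedBall y R, bw Ω x := by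
        rw [← lintegral_union measurableSet_Ioi (by
          rw [Set.disjoint_left]; intro a ha hb; exact absurd ha.2 (not_le.2 hb)),
          Ioc_union_Ioi_eq_Ioi zero_le_one]
    _ ≤ D₁ + D₂ := by
        refine add_le_add (setLIntegral_mono' measurableSet_Ioc fun R hR => ?_)
          (setLIntegral_mono' measurableSet_Ioi fun R hR => ?_)
        · refine (mul_le_mul_right (hC y R hR.1 hR.2) _).trans (le_of_eq ?_)
          have : ipow 3 R * ENNReal.ofReal (R ^ (5 / 2 : ℝ)) = ipow (1 / 2) R := by
            rw [ipow_eq_ofReal _ hR.1.ne', ipow_eq_ofReal _ hR.1.ne', Real.norm_of_nonneg hR.1.le,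
              ← ENNReal.ofReal_mul (Real.rpow_nonneg hR.1.le _), ← Real.rpow_add hR.1]
            norm_num
          rw [← this]; ring
        · calc 2 * ipow 3 R * ∫⁻ x in Ω ∩ Metric.closedBall y R, bw Ω x
              ≤ 2 * ipow 3 R * ∫⁻ x in Ω, bw Ω x := by
                gcongr; exact inter_subset_left
            _ = _ := by ring

/-- The complement stays at distance `δ = dist(p, Ωᶜ)` from `p`, and the integral of `|z|^{-7/2}`
over `|z| ≥ δ` is a multiple of `δ^{-1/2}`. The exponent is `4 - 1/2`: the Gagliardo exponent less
the Hölder gain of the exit time. -/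
theorem IsConvexBody.exists_lintegral_compl_ipow_le (h : IsConvexBody Ω d) :
    ∃ C : ℝ≥0, ∀ p ∈ Ω, ∫⁻ x in Ωᶜ, ipow (7 / 2) (x - p) ≤ C * bw Ω p := by
  let m : ℝ≥0∞ := (volume : Measure V3).toSphere univ
  have hm : m < ∞ := measure_lt_top _ _
  refine ⟨m.toNNReal * 2, fun p hp => ?_⟩
  have hδ := h.infDist_pos hp
  set δ := Metric.infDist p Ωᶜ with hδd
  have hms : MeasurableSet {z : V3 | δ ≤ ‖z‖} := measurableSet_le measurable_const (by fun_prop)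
  have hmi : Measurable ({z : V3 | δ ≤ ‖z‖}.indicator (ipow (7 / 2))) :=
    (measurable_ipow _).indicator hms
  calc ∫⁻ x in Ωᶜ, ipow (7 / 2) (x - p)
      ≤ ∫⁻ x, {z : V3 | δ ≤ ‖z‖}.indicator (ipow (7 / 2)) (x - p) := by
        rw [← lintegral_indicator h.measurableSet.compl]
        refine lintegral_mono fun x => ?_
        by_cases hx : x ∈ Ωᶜ
        · rw [indicator_of_mem hx, indicator_of_mem]
          have := Metric.infDist_le_dist_of_mem hx (x := p)
          rw [dist_comm, dist_eq_norm] at this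
          exact this
        · rw [indicator_of_notMem hx]; exact zero_le
    _ = ∫⁻ z, {z : V3 | δ ≤ ‖z‖}.indicator (ipow (7 / 2)) z := lintegral_sub_right_eq_self _ p
    _ ≤ ∫⁻ _ : Metric.sphere (0 : V3) 1, 2 * bw Ω p ∂(volume : Measure V3).toSphere := by
        rw [lintegral_polar hmi]
        refine lintegral_mono fun σ => ?_
        have hσ : ‖(σ : V3)‖ = 1 := by simp
        calc ∫⁻ r in Ioi (0 : ℝ), ENNReal.ofReal (r ^ 2) *
              {z : V3 | δ ≤ ‖z‖}.indicator (ipow (7 / 2)) (r • (σ : V3))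
            = ∫⁻ r in Ioi (0 : ℝ), (Ici δ).indicator (ipow (3 / 2)) r := by
              refine setLIntegral_congr_fun measurableSet_Ioi fun r hr => ?_
              have hr0 : (0 : ℝ) < r := hr
              have hn : ‖r • (σ : V3)‖ = r := by rw [norm_smul, hσ, mul_one, Real.norm_of_nonneg hr0.le]
              by_cases hrd : δ ≤ r
              · rw [indicator_of_mem (show r ∈ Ici δ from hrd), indicator_of_mem
                  (show r • (σ : V3) ∈ {z : V3 | δ ≤ ‖z‖} by rw [mem_ofPred_eq, hn]; exact hrd),
                  ipow_eq_ofReal _ hr0.ne', ipow_eq_ofReal _ (by rw [← norm_pos_iff, hn]; exact hr0),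
                  hn, Real.norm_of_nonneg hr0.le, ← ENNReal.ofReal_mul (by positivity),
                  ← Real.rpow_natCast, ← Real.rpow_add hr0]
                norm_num
              · rw [indicator_of_notMem (show r ∉ Ici δ from hrd), indicator_of_notMem
                  (show r • (σ : V3) ∉ {z : V3 | δ ≤ ‖z‖} by rw [mem_ofPred_eq, hn]; exact hrd),
                  mul_zero]
          _ ≤ ∫⁻ r in Ioi δ, ipow (3 / 2) r := by
              refine (setLIntegral_le_lintegral _ _).trans ?_
              rw [lintegral_indicator measurableSet_Ici, Measure.restrict_congr_set Ioi_ae_eq_Ici]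
          _ = 2 * bw Ω p := by
              rw [lintegral_Ioi_ipow (by norm_num) hδ, h.bw_eq hp, ← hδd,
                show (2 : ℝ≥0∞) = ENNReal.ofReal 2 by simp, ← ENNReal.ofReal_mul (by norm_num)]
              congr 1
              rw [Real.inv_rpow hδ.le, ← Real.rpow_neg hδ.le,
                show (1 - 3 / 2 : ℝ) = -(1 / 2) by norm_num]
              ring
    _ = _ := by
        rw [lintegral_const, ENNReal.coe_mul, ENNReal.coe_toNNReal hm.ne, ENNReal.coe_ofNat]
        simp only [m]; ring

end LinBoltzmann

namespace LinBoltzmann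

/-! ### Fourier analysis -/

open scoped FourierTransform

open scoped SchwartzMap ContDiff in
-- Both transforms define the same tempered distribution: the integral one by Fubini, the `L²` one
-- by duality. Agreement on compactly supported smooth functions forces equality almost everywhere.
theorem fourier_ae_eq_lp_fourier {f : V3 → ℂ} (hf : Integrable f) (hf2 : MemLp f 2) :
    𝓕 f =ᵐ[volume] ((𝓕 (hf2.toLp f) : Lp (α := V3) ℂ 2 (volume : Measure V3)) : V3 → ℂ) := by
  have hcont : Continuous (𝓕 f) :=
    VectorFourier.fourierIntegral_continuous Real.continuous_fourierChar continuous_inner hf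
  have hL : LocallyIntegrable ((𝓕 (hf2.toLp f) : Lp (α := V3) ℂ 2 (volume : Measure V3)) : V3 → ℂ) volume :=
    (Lp.memLp _).locallyIntegrable (by norm_num)
  have key : ∀ᵐ x : V3, (𝓕 f - ((𝓕 (hf2.toLp f) : Lp (α := V3) ℂ 2 (volume : Measure V3)) : V3 → ℂ)) x = 0 := by
    refine ae_eq_zero_of_integral_contDiff_smul_eq_zero (hcont.locallyIntegrable.sub hL) ?_
    intro g hg hgs
    have hgs' : HasCompactSupport (fun x => (g x : ℂ)) := hgs.comp_left (g := Complex.ofReal) rfl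
    have hg' : ContDiff ℝ ∞ (fun x => (g x : ℂ)) := Complex.ofRealCLM.contDiff.comp hg
    set ψ : 𝓢(V3, ℂ) := hgs'.toSchwartzMap hg' with hψ
    have hψg : ∀ x, ψ x = g x := fun x => rfl
    have h1 := congrArg (fun T : 𝓢'(V3, ℂ) => T ψ) (Lp.fourier_toTemperedDistribution_eq (hf2.toLp f))
    simp only [TemperedDistribution.fourier_apply, Lp.toTemperedDistribution_apply] at h1
    have h2 : ∫ x, (𝓕 ψ) x • (hf2.toLp f) x = ∫ x, (𝓕 ψ) x • f x :=
      integral_congr_ae (hf2.coeFn_toLp.mono fun x hx => by simp only [hx])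
    have h3 : ∫ x, (𝓕 ψ) x • f x = ∫ x, ψ x • 𝓕 f x := by
      have := VectorFourier.integral_fourierIntegral_smul_eq_flip (L := innerₗ V3)
        (μ := (volume : Measure V3)) (ν := (volume : Measure V3)) Real.continuous_fourierChar
        continuous_inner ψ.integrable hf
      simpa [flip_innerₗ] using! this
    have i1 : Integrable (fun x => g x • 𝓕 f x) :=
      hcont.locallyIntegrable.integrable_smul_left_of_hasCompactSupport hg.continuous hgs
    have i2 : Integrable (fun x => g x • ((𝓕 (hf2.toLp f) : Lp (α := V3) ℂ 2 (volume : Measure V3)) : V3 → ℂ) x) :=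
      hL.integrable_smul_left_of_hasCompactSupport hg.continuous hgs
    simp only [Pi.sub_apply, smul_sub]
    rw [integral_sub i1 i2, sub_eq_zero]
    have e : ∀ (x : V3) (z : ℂ), g x • z = ψ x • z := fun x z => by rw [hψg]; simp
    simp only [e]
    rw [← h3, ← h2, h1]
  exact key.mono fun x hx => by simpa [sub_eq_zero] using hx

theorem lintegral_enorm_fourier_sq {f : V3 → ℂ} (hf : Integrable f) (hf2 : MemLp f 2) :
    ∫⁻ ξ, ‖𝓕 f ξ‖ₑ ^ 2 = ∫⁻ x, ‖f x‖ₑ ^ 2 := by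
  have h := Lp.norm_fourier_eq (hf2.toLp f)
  have h1 : eLpNorm (𝓕 f) 2 volume = eLpNorm f 2 volume := by
    rw [eLpNorm_congr_ae (fourier_ae_eq_lp_fourier hf hf2), ← eLpNorm_congr_ae hf2.coeFn_toLp]
    rw [Lp.norm_def, Lp.norm_def] at h
    exact (ENNReal.toReal_eq_toReal_iff' (Lp.eLpNorm_ne_top _) (Lp.eLpNorm_ne_top _)).1 h
  have e : ∀ g : V3 → ℂ, eLpNorm g 2 volume ^ (2 : ℝ) = ∫⁻ x, ‖g x‖ₑ ^ 2 := fun g => by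
    have := eLpNorm_nnreal_pow_eq_lintegral (f := g) (μ := volume) (p := 2) (by norm_num)
    simpa using this
  rw [← e, ← e, h1]

/-- By scaling, the integral has to be of size `|ξ|`. The radial integral is cut at `r = 1/|ξ|`:
below, the character differs from `1` by at most `2π r |ξ|`; above, by at most `2`. -/
theorem exists_lintegral_multiplier_le :
    ∃ C : ℝ≥0, ∀ ξ : V3,
      ∫⁻ z : V3, ipow 4 z * ‖1 - (Real.fourierChar (-⟪z, ξ⟫) : ℂ)‖ₑ ^ 2 ≤ C * ‖ξ‖ₑ := by
  let m : ℝ≥0∞ := (volume : Measure V3).toSphere univ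
  have hm : m < ∞ := measure_lt_top _ _
  have hb1 : ∀ t : ℝ, ‖1 - (Real.fourierChar t : ℂ)‖ ≤ 2 := fun t => by
    refine (norm_sub_le _ _).trans ?_
    rw [norm_one, Circle.norm_coe]; norm_num
  have hb2 : ∀ t : ℝ, ‖1 - (Real.fourierChar t : ℂ)‖ ≤ 2 * Real.pi * |t| := fun t => by
    rw [norm_sub_rev, Real.fourierChar_apply, mul_comm _ Complex.I]
    refine (Real.norm_exp_I_mul_ofReal_sub_one_le).trans ?_
    rw [Real.norm_eq_abs, abs_mul, abs_of_pos Real.two_pi_pos]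
  refine ⟨m.toNNReal * (Real.toNNReal (4 * Real.pi ^ 2) + 4), fun ξ => ?_⟩
  rcases eq_or_ne ξ 0 with rfl | hξ
  · simp
  have hn : 0 < ‖ξ‖ := norm_pos_iff.2 hξ
  have hmeas : Measurable fun z : V3 => ipow 4 z * ‖1 - (Real.fourierChar (-⟪z, ξ⟫) : ℂ)‖ₑ ^ 2 := by
    have h1 : Measurable fun z : V3 => ipow 4 z := measurable_ipow 4
    have h2 : Continuous fun z : V3 => (Real.fourierChar (-⟪z, ξ⟫) : ℂ) :=
      continuous_subtype_val.comp (Real.continuous_fourierChar.comp (by fun_prop))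
    exact h1.mul (by fun_prop)
  rw [lintegral_polar hmeas]
  calc _ ≤ ∫⁻ _ : Metric.sphere (0 : V3) 1, (ENNReal.ofReal (4 * Real.pi ^ 2) + 4) * ‖ξ‖ₑ
          ∂(volume : Measure V3).toSphere := ?_
    _ = _ := by
      rw [lintegral_const, ENNReal.coe_mul, ENNReal.coe_toNNReal hm.ne]
      simp only [m, ENNReal.coe_add, ENNReal.ofReal, ENNReal.coe_ofNat]; ring
  refine lintegral_mono fun σ => ?_
  have hσ : ‖(σ : V3)‖ = 1 := by simp
  set ρ : ℝ := ‖ξ‖⁻¹ with hρ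
  have hρ0 : 0 < ρ := inv_pos.2 hn
  have h1 : ∀ r : ℝ, 0 < r → ENNReal.ofReal (r ^ 2) * ipow 4 (r • (σ : V3)) = ipow 2 r := by
    intro r hr
    have hr' : ‖r • (σ : V3)‖ = r := by rw [norm_smul, hσ, mul_one, Real.norm_of_nonneg hr.le]
    rw [ipow_eq_ofReal _ (by rw [← norm_pos_iff, hr']; exact hr), hr', ipow_eq_ofReal _ hr.ne',
      Real.norm_of_nonneg hr.le, ← ENNReal.ofReal_mul (by positivity), ← Real.rpow_natCast,
      ← Real.rpow_add hr]
    norm_num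
  rw [← Ioc_union_Ioi_eq_Ioi hρ0.le, lintegral_union measurableSet_Ioi (by
    rw [Set.disjoint_left]; intro a ha hb; exact absurd ha.2 (not_le.2 hb)), add_mul]
  refine add_le_add ?_ ?_
  · calc _ ≤ ∫⁻ r in Ioc 0 ρ, ENNReal.ofReal (4 * Real.pi ^ 2 * ‖ξ‖ ^ 2) := by
          refine setLIntegral_mono' measurableSet_Ioc fun r hr => ?_
          rw [← mul_assoc, h1 r hr.1, ipow_eq_ofReal _ hr.1.ne', Real.norm_of_nonneg hr.1.le,
            ← ofReal_norm, ← ENNReal.ofReal_pow (norm_nonneg _),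
            ← ENNReal.ofReal_mul (by have := hr.1; positivity)]
          apply ENNReal.ofReal_le_ofReal
          have hin : |-⟪r • (σ : V3), ξ⟫| ≤ r * ‖ξ‖ := by
            rw [abs_neg]
            refine (abs_real_inner_le_norm _ _).trans (le_of_eq ?_)
            rw [norm_smul, hσ, mul_one, Real.norm_of_nonneg hr.1.le]
          have h2 : ‖1 - (Real.fourierChar (-⟪r • (σ : V3), ξ⟫) : ℂ)‖ ≤ 2 * Real.pi * (r * ‖ξ‖) :=
            (hb2 _).trans (mul_le_mul_of_nonneg_left hin Real.two_pi_pos.le)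
          have h3 : r ^ (-2 : ℝ) * r ^ 2 = 1 := by
            rw [← Real.rpow_natCast, ← Real.rpow_add hr.1]; norm_num
          calc r ^ (-2 : ℝ) * ‖1 - (Real.fourierChar (-⟪r • (σ : V3), ξ⟫) : ℂ)‖ ^ 2
              ≤ r ^ (-2 : ℝ) * (2 * Real.pi * (r * ‖ξ‖)) ^ 2 := by
                have := hr.1; gcongr
            _ = (r ^ (-2 : ℝ) * r ^ 2) * (4 * Real.pi ^ 2 * ‖ξ‖ ^ 2) := by ring
            _ = _ := by rw [h3, one_mul]
      _ = _ := by
          rw [setLIntegral_const, Real.volume_Ioc, sub_zero, ← ofReal_norm,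
            ← ENNReal.ofReal_mul (by positivity), ← ENNReal.ofReal_mul (by positivity)]
          congr 1
          rw [hρ]; field_simp
  · calc _ ≤ ∫⁻ r in Ioi ρ, 4 * ipow 2 r := by
          refine setLIntegral_mono' measurableSet_Ioi fun r hr => ?_
          rw [← mul_assoc, h1 r (hρ0.trans hr), mul_comm]
          gcongr
          rw [← ofReal_norm, ← ENNReal.ofReal_pow (norm_nonneg _)]
          refine (ENNReal.ofReal_le_ofReal (pow_le_pow_left₀ (norm_nonneg _) (hb1 _) 2)).trans ?_
          norm_num
      _ = _ := by
          rw [lintegral_const_mul' _ _ (by simp), lintegral_Ioi_ipow (by norm_num) hρ0, ← ofReal_norm]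
          congr 2
          rw [hρ, show (1 - 2 : ℝ) = -1 by norm_num, Real.rpow_neg_one, inv_inv]; norm_num

theorem fourier_comp_sub {f : V3 → ℂ} (z ξ : V3) :
    𝓕 (fun x => f (x - z)) ξ = (Real.fourierChar (-⟪z, ξ⟫) : ℂ) * 𝓕 f ξ := by
  have h := VectorFourier.fourierIntegral_comp_add_right Real.fourierChar (volume : Measure V3)
    (innerₗ V3) f (-z)
  have hshift := congrFun h ξ
  simp only [Circle.smul_def, smul_eq_mul, map_neg, LinearMap.neg_apply, innerₗ_apply_apply] at hshift
  simpa [sub_eq_add_neg, Function.comp_def] using! hshift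

/-- The Gagliardo seminorm of order `1/2` is controlled by the Fourier transform. -/
theorem exists_gagliardo_le_fourier :
    ∃ C : ℝ≥0, ∀ f : V3 → ℂ, Measurable f → Integrable f → MemLp f 2 →
      ∫⁻ x, ∫⁻ y, ipow 4 (x - y) * ‖f x - f y‖ₑ ^ 2 ≤ C * ∫⁻ ξ, ‖ξ‖ₑ * ‖𝓕 f ξ‖ₑ ^ 2 := by
  obtain ⟨C, hC⟩ := exists_lintegral_multiplier_le
  refine ⟨C, fun f hm hf hf2 => ?_⟩
  have hcont : Continuous (𝓕 f) :=
    VectorFourier.fourierIntegral_continuous Real.continuous_fourierChar continuous_inner hf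
  have hi4 : Measurable fun z : V3 => ipow 4 z := measurable_ipow 4
  have hch : Continuous fun p : V3 × V3 => (Real.fourierChar (-⟪p.1, p.2⟫) : ℂ) :=
    continuous_subtype_val.comp (Real.continuous_fourierChar.comp (by fun_prop))
  calc ∫⁻ x, ∫⁻ y, ipow 4 (x - y) * ‖f x - f y‖ₑ ^ 2
      = ∫⁻ x, ∫⁻ z, ipow 4 z * ‖f x - f (x - z)‖ₑ ^ 2 := by
        refine lintegral_congr fun x => ?_
        rw [← lintegral_sub_left_eq_self _ x]
        simp only [sub_sub_cancel]
    _ = ∫⁻ z, ∫⁻ x, ipow 4 z * ‖f x - f (x - z)‖ₑ ^ 2 := by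
        refine lintegral_lintegral_swap (Measurable.aemeasurable ?_)
        have : Measurable fun p : V3 × V3 => ‖f p.1 - f (p.1 - p.2)‖ₑ ^ 2 := by fun_prop
        exact (hi4.comp measurable_snd).mul this
    -- Plancherel in `x` for each increment. The point `z = 0`, where `ipow 4` is infinite, is
    -- discarded as a null set.
    _ = ∫⁻ z, ∫⁻ ξ, ipow 4 z * ‖1 - (Real.fourierChar (-⟪z, ξ⟫) : ℂ)‖ₑ ^ 2 * ‖𝓕 f ξ‖ₑ ^ 2 := by
        refine lintegral_congr_ae (ae_ne_zero_V3.mono fun z hz => ?_)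
        dsimp only
        have i1 : Integrable fun x => f (x - z) := hf.comp_sub_right z
        have i2 : MemLp (fun x => f (x - z)) 2 :=
          hf2.comp_measurePreserving (measurePreserving_sub_right volume z)
        have hpl := lintegral_enorm_fourier_sq (hf.sub i1) (hf2.sub i2)
        simp only [Pi.sub_apply] at hpl
        rw [lintegral_const_mul' _ _ (ipow_ne_top (by norm_num) hz), ← hpl]
        simp only [mul_assoc]
        rw [lintegral_const_mul' _ _ (ipow_ne_top (by norm_num) hz)]
        congr 1
        refine lintegral_congr fun ξ => ?_
        have : 𝓕 (f - fun x => f (x - z)) ξ = (1 - (Real.fourierChar (-⟪z, ξ⟫) : ℂ)) * 𝓕 f ξ := by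
          have h1 : 𝓕 (f - fun x => f (x - z)) ξ = 𝓕 f ξ - 𝓕 (fun x => f (x - z)) ξ := by
            simp only [Real.fourier_eq, Pi.sub_apply, smul_sub]
            exact integral_sub ((Real.fourierIntegral_convergent_iff ξ).2 hf)
              ((Real.fourierIntegral_convergent_iff ξ).2 i1)
          rw [h1, fourier_comp_sub]; ring
        rw [this, enorm_mul, mul_pow]
    _ = ∫⁻ ξ, ∫⁻ z, ipow 4 z * ‖1 - (Real.fourierChar (-⟪z, ξ⟫) : ℂ)‖ₑ ^ 2 * ‖𝓕 f ξ‖ₑ ^ 2 := by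
        refine lintegral_lintegral_swap (Measurable.aemeasurable ?_)
        have h1 : Measurable fun p : V3 × V3 => ‖1 - (Real.fourierChar (-⟪p.1, p.2⟫) : ℂ)‖ₑ ^ 2 := by
          fun_prop
        have h2 : Measurable fun p : V3 × V3 => ‖𝓕 f p.2‖ₑ ^ 2 :=
          (hcont.measurable.comp measurable_snd).enorm.pow_const 2
        exact ((hi4.comp measurable_fst).mul h1).mul h2
    _ ≤ ∫⁻ ξ, C * (‖ξ‖ₑ * ‖𝓕 f ξ‖ₑ ^ 2) := by
        refine lintegral_mono fun ξ => ?_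
        dsimp only
        rw [lintegral_mul_const' _ _ (by simp), ← mul_assoc]
        gcongr
        exact hC ξ
    _ = _ := lintegral_const_mul' _ _ ENNReal.coe_ne_top

end LinBoltzmann

namespace LinBoltzmann

/-! ### Mapping properties of the collision operator -/

theorem sq_lintegral_le_of_sq_le_mul {α : Type*} [MeasurableSpace α] {μ : Measure α}
    {f F G : α → ℝ≥0∞} (hF : AEMeasurable F μ) (hG : AEMeasurable G μ)
    (h : ∀ᵐ a ∂μ, f a ^ 2 ≤ F a * G a) :
    (∫⁻ a, f a ∂μ) ^ 2 ≤ (∫⁻ a, F a ∂μ) * ∫⁻ a, G a ∂μ := by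
  have key : ∫⁻ a, f a ∂μ ≤ ∫⁻ a, F a ^ (1 / 2 : ℝ) * G a ^ (1 / 2 : ℝ) ∂μ := by
    refine lintegral_mono_ae (h.mono fun a ha => ?_)
    rw [← ENNReal.mul_rpow_of_nonneg _ _ (by norm_num : (0 : ℝ) ≤ 1 / 2)]
    have := ENNReal.rpow_le_rpow ha (by norm_num : (0 : ℝ) ≤ 1 / 2)
    rwa [← ENNReal.rpow_natCast, ← ENNReal.rpow_mul, show ((2 : ℕ) : ℝ) * (1 / 2) = 1 by norm_num,
      ENNReal.rpow_one] at this
  have e : ∀ x : ℝ≥0∞, (x ^ (1 / 2 : ℝ)) ^ 2 = x := fun x => by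
    rw [← ENNReal.rpow_natCast, ← ENNReal.rpow_mul, show (1 / 2 : ℝ) * ((2 : ℕ) : ℝ) = 1 by norm_num,
      ENNReal.rpow_one]
  refine (pow_le_pow_left₀ zero_le key 2).trans
    ((sq_lintegral_mul_le (hF.pow_const _) (hG.pow_const _)).trans (le_of_eq ?_))
  simp only [e]

variable {B : ℝ → ℝ → ℝ} {γ : ℝ}

/-- This splitting of the squared kernel governs all later exponents. The factor with `3/2` is
integrated over planes against the Fourier multiplier. The factor with `1/2` stays with the data: it
is integrable along rays and still tolerates a weight `|v|⁻²`. -/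
theorem gk_one_sq (z : V3) :
    gk 1 (1 / 8) z ^ 2 = gk (3 / 2) (3 / 16) z * gk (1 / 2) (1 / 16) z := by
  rw [gk_sq (by norm_num), gk_mul_gk (by norm_num) (by norm_num)]
  norm_num

theorem exists_sq_lintegral_gk_one_le :
    ∃ C : ℝ≥0, ∀ (v : V3) (h : V3 → ℝ), AEStronglyMeasurable h volume →
      (∫⁻ w, gk 1 (1 / 8) (v - w) * ‖h w‖ₑ) ^ 2 ≤
        C * ∫⁻ w, gk (1 / 2) (1 / 16) (v - w) * ‖h w‖ₑ ^ 2 := by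
  obtain ⟨C, hC⟩ := exists_lintegral_gk_le (3 / 2) (3 / 16) (by norm_num) (by norm_num)
  refine ⟨C, fun v h hh => ?_⟩
  have m3 : Measurable fun w : V3 => gk (3 / 2) (3 / 16) (v - w) :=
    (measurable_gk _ _).comp (measurable_const.sub measurable_id)
  have m1 : Measurable fun w : V3 => gk (1 / 2) (1 / 16) (v - w) :=
    (measurable_gk _ _).comp (measurable_const.sub measurable_id)
  refine (sq_lintegral_le_of_sq_le_mul m3.aemeasurable
    (m1.aemeasurable.mul (hh.enorm.pow_const 2)) (Eventually.of_forall fun w => ?_)).trans ?_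
  · simp only [Pi.mul_apply]
    rw [mul_pow, gk_one_sq, mul_assoc]
  · gcongr
    · simp only [gk_sub_comm (3 / 2) (3 / 16) v]
      exact hC v
    · simp

theorem lintegral_gk_one_lt_top {v : V3} {h : V3 → ℝ} (hh : AEStronglyMeasurable h volume)
    (hfin : ∫⁻ w, gk (1 / 2) (1 / 16) (v - w) * ‖h w‖ₑ ^ 2 < ∞) :
    ∫⁻ w, gk 1 (1 / 8) (v - w) * ‖h w‖ₑ < ∞ := by
  obtain ⟨C, hC⟩ := exists_sq_lintegral_gk_one_le
  have := (hC v h hh).trans_lt (ENNReal.mul_lt_top ENNReal.coe_lt_top hfin)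
  by_contra hn
  rw [not_lt, top_le_iff] at hn
  rw [hn] at this
  simp at this

/-- The form with a difference yields at once boundedness, independence of the representative, and
later the increments of `K u` in `x`. Finiteness of both weighted integrals guarantees that `K` is
given by its kernel on each function. -/
theorem exists_collisionK_sub_sq_le (hγ : γ ∈ Icc (0 : ℝ) 1) (hB : IsCutoff B γ) :
    ∃ C : ℝ≥0, ∀ (v : V3) (h₁ h₂ : V3 → ℝ), AEStronglyMeasurable h₁ volume →
      AEStronglyMeasurable h₂ volume →
      ∫⁻ w, gk (1 / 2) (1 / 16) (v - w) * ‖h₁ w‖ₑ ^ 2 < ∞ →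
      ∫⁻ w, gk (1 / 2) (1 / 16) (v - w) * ‖h₂ w‖ₑ ^ 2 < ∞ →
      ‖collisionK B h₁ v - collisionK B h₂ v‖ₑ ^ 2 ≤
        C * ∫⁻ w, gk (1 / 2) (1 / 16) (v - w) * ‖h₁ w - h₂ w‖ₑ ^ 2 := by
  obtain ⟨C₁, hC₁⟩ := exists_collision_kernel hγ hB
  obtain ⟨C₂, hC₂⟩ := exists_sq_lintegral_gk_one_le
  refine ⟨C₁ ^ 2 * C₂, fun v h₁ h₂ m₁ m₂ f₁ f₂ => ?_⟩
  obtain ⟨k, -, hk, hK⟩ := hC₁ v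
  obtain ⟨e₁, i₁⟩ := hK h₁ m₁ (lintegral_gk_one_lt_top m₁ f₁)
  obtain ⟨e₂, i₂⟩ := hK h₂ m₂ (lintegral_gk_one_lt_top m₂ f₂)
  have h1 : ‖collisionK B h₁ v - collisionK B h₂ v‖ₑ ≤
      C₁ * ∫⁻ w, gk 1 (1 / 8) (v - w) * ‖h₁ w - h₂ w‖ₑ := by
    rw [e₁, e₂, ← integral_sub i₁ i₂, ← lintegral_const_mul' _ _ ENNReal.coe_ne_top]
    refine (enorm_integral_le_lintegral_enorm _).trans (lintegral_mono_ae (hk.mono fun w hw => ?_))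
    rw [← mul_sub, enorm_mul, ← mul_assoc]
    gcongr
  calc _ ≤ (C₁ * ∫⁻ w, gk 1 (1 / 8) (v - w) * ‖h₁ w - h₂ w‖ₑ) ^ 2 := by gcongr
    _ ≤ C₁ ^ 2 * (C₂ * ∫⁻ w, gk (1 / 2) (1 / 16) (v - w) * ‖h₁ w - h₂ w‖ₑ ^ 2) := by
        rw [mul_pow]; gcongr; exact hC₂ v _ (m₁.sub m₂)
    _ = _ := by push_cast; ring

theorem collisionK_zero (v : V3) : collisionK B (fun _ => 0) v = 0 := by
  simp [collisionK]

theorem exists_collisionK_sq_le (hγ : γ ∈ Icc (0 : ℝ) 1) (hB : IsCutoff B γ) :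
    ∃ C : ℝ≥0, ∀ (v : V3) (h : V3 → ℝ), AEStronglyMeasurable h volume →
      ‖collisionK B h v‖ₑ ^ 2 ≤ C * ∫⁻ w, gk (1 / 2) (1 / 16) (v - w) * ‖h w‖ₑ ^ 2 := by
  obtain ⟨C, hC⟩ := exists_collisionK_sub_sq_le hγ hB
  refine ⟨C + 1, fun v h hh => ?_⟩
  -- If the right side is infinite, the constant has to be nonzero for the bound to be trivial;
  -- hence `C + 1`.
  rcases eq_or_ne (∫⁻ w, gk (1 / 2) (1 / 16) (v - w) * ‖h w‖ₑ ^ 2) ∞ with hi | hi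
  · rw [hi, ENNReal.mul_top (by simp)]; exact le_top
  · have := hC v h (fun _ => 0) hh aestronglyMeasurable_const hi.lt_top (by simp)
    simp only [collisionK_zero, sub_zero] at this
    refine this.trans ?_
    gcongr
    exact_mod_cast le_self_add

theorem collisionK_congr_ae (hγ : γ ∈ Icc (0 : ℝ) 1) (hB : IsCutoff B γ) {v : V3} {h₁ h₂ : V3 → ℝ}
    (m₁ : AEStronglyMeasurable h₁ volume)
    (f₁ : ∫⁻ w, gk (1 / 2) (1 / 16) (v - w) * ‖h₁ w‖ₑ ^ 2 < ∞) (h : h₁ =ᵐ[volume] h₂) :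
    collisionK B h₁ v = collisionK B h₂ v := by
  obtain ⟨C, hC⟩ := exists_collisionK_sub_sq_le hγ hB
  have f₂ : ∫⁻ w, gk (1 / 2) (1 / 16) (v - w) * ‖h₂ w‖ₑ ^ 2 < ∞ := by
    refine lt_of_eq_of_lt (lintegral_congr_ae (h.mono fun w hw => ?_)) f₁
    simp only [hw]
  have := hC v h₁ h₂ m₁ (m₁.congr h) f₁ f₂
  rw [lintegral_congr_ae (g := fun _ => 0) (h.mono fun w hw => by simp [hw])] at this
  simpa [sub_eq_zero] using this

theorem collisionK_add (hγ : γ ∈ Icc (0 : ℝ) 1) (hB : IsCutoff B γ) {v : V3} {h₁ h₂ : V3 → ℝ}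
    (m₁ : AEStronglyMeasurable h₁ volume) (m₂ : AEStronglyMeasurable h₂ volume)
    (f₁ : ∫⁻ w, gk (1 / 2) (1 / 16) (v - w) * ‖h₁ w‖ₑ ^ 2 < ∞)
    (f₂ : ∫⁻ w, gk (1 / 2) (1 / 16) (v - w) * ‖h₂ w‖ₑ ^ 2 < ∞) :
    collisionK B (fun w => h₁ w + h₂ w) v = collisionK B h₁ v + collisionK B h₂ v := by
  obtain ⟨C₁, hC₁⟩ := exists_collision_kernel hγ hB
  obtain ⟨k, -, -, hK⟩ := hC₁ v
  have g₁ := lintegral_gk_one_lt_top m₁ f₁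
  have g₂ := lintegral_gk_one_lt_top m₂ f₂
  obtain ⟨e₁, i₁⟩ := hK h₁ m₁ g₁
  obtain ⟨e₂, i₂⟩ := hK h₂ m₂ g₂
  have g : ∫⁻ w, gk 1 (1 / 8) (v - w) * ‖h₁ w + h₂ w‖ₑ < ∞ := by
    have hm : AEMeasurable (fun w : V3 => gk 1 (1 / 8) (v - w) * ‖h₁ w‖ₑ) :=
      ((measurable_gk _ _).comp (measurable_const.sub measurable_id)).aemeasurable.mul m₁.enorm
    refine lt_of_le_of_lt (lintegral_mono fun w => ?_)
      ((lintegral_add_left' hm _).trans_lt (ENNReal.add_lt_top.2 ⟨g₁, g₂⟩))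
    dsimp only
    rw [← mul_add]
    gcongr
    exact enorm_add_le _ _
  rw [(hK (fun w => h₁ w + h₂ w) (m₁.add m₂) g).1, e₁, e₂, ← integral_add i₁ i₂]
  simp only [mul_add]

theorem collisionK_smul (c : ℝ) (h : V3 → ℝ) (v : V3) :
    collisionK B (fun w => c * h w) v = c * collisionK B h v := by
  unfold collisionK
  rw [← integral_const_mul]
  simp only [← intervalIntegral.integral_const_mul]
  congr 1; ext vs; congr 1; ext ε; congr 1; ext θ
  ring

theorem opK_sub_eq_zero {f : V3 × V3 → ℝ} {x : V3} (hx : ∀ w, f (x, w) = 0) (v : V3) :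
    opK B f (x, v) = 0 := by
  simp only [opK, hx]; exact collisionK_zero v

theorem collisionFrequency_nonneg (hB : IsCutoff B γ) (v : V3) : 0 ≤ collisionFrequency B v := by
  obtain ⟨C, hC⟩ := hB.bound
  refine integral_nonneg_of_ae ?_
  have : ∀ᵐ vs : V3, vs ≠ v := compl_mem_ae_iff.2 (measure_singleton v)
  refine this.mono fun vs hvs => ?_
  refine intervalIntegral.integral_nonneg Real.two_pi_pos.le fun ε _ => ?_
  refine intervalIntegral.integral_nonneg Real.pi_div_two_pos.le fun θ hθ => ?_
  exact mul_nonneg (maxwellian_pos _).le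
    (hC _ (norm_pos_iff.2 (sub_ne_zero.2 hvs.symm)) θ hθ).1

theorem integrable_gaussian {c : ℝ} (hc : 0 < c) :
    Integrable fun w : V3 => Real.exp (-c * ‖w‖ ^ 2) := by
  have := (GaussianFourier.integrable_cexp_neg_mul_sq_norm_add (V := V3) (b := c) (by simpa) 0 0).re
  refine this.congr (Eventually.of_forall fun w => ?_)
  simp only [zero_mul, add_zero]
  rw [← Complex.ofReal_pow, ← Complex.ofReal_neg, ← Complex.ofReal_mul]
  exact Complex.exp_ofReal_re _

/-- Linear growth of `ν` is needed because `ν` is the Lipschitz constant of `exp(-ν τ)` in the exit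
time. It follows from `r^γ ≤ 1 + r` and the first moment of the Maxwellian. -/
theorem exists_collisionFrequency_le (hγ : γ ∈ Icc (0 : ℝ) 1) (hB : IsCutoff B γ) :
    ∃ C : ℝ, 0 ≤ C ∧ ∀ v, collisionFrequency B v ≤ C * (1 + ‖v‖) := by
  obtain ⟨C, hC0, hC⟩ := exists_bound_pos hB
  have i0 : Integrable fun w : V3 => maxwellian w := by
    refine ((integrable_gaussian one_pos).const_mul (Real.pi ^ (-(3 / 2) : ℝ))).congr (Eventually.of_forall fun w => ?_)
    simp only [maxwellian, neg_mul, one_mul]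
  have i1 : Integrable fun w : V3 => ‖w‖ * maxwellian w := by
    refine ((integrable_gaussian (c := 1 / 2) (by norm_num)).const_mul
      (Real.pi ^ (-(3 / 2) : ℝ))).mono'
      (measurable_norm.mul measurable_maxwellian).aestronglyMeasurable
      (Eventually.of_forall fun w => ?_)
    have h1 : ‖w‖ ≤ Real.exp (1 / 2 * ‖w‖ ^ 2) := by
      nlinarith [Real.add_one_le_exp (1 / 2 * ‖w‖ ^ 2), sq_nonneg (‖w‖ - 1)]
    have hp : (0 : ℝ) ≤ Real.pi ^ (-(3 / 2) : ℝ) := by have := Real.pi_pos; positivity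
    rw [Real.norm_of_nonneg (mul_nonneg (norm_nonneg _) (maxwellian_pos _).le), maxwellian]
    calc ‖w‖ * (Real.pi ^ (-(3 / 2) : ℝ) * Real.exp (-‖w‖ ^ 2))
        ≤ Real.exp (1 / 2 * ‖w‖ ^ 2) * (Real.pi ^ (-(3 / 2) : ℝ) * Real.exp (-‖w‖ ^ 2)) := by
          gcongr
      _ = _ := by
          rw [mul_left_comm, ← Real.exp_add]; congr 2; ring
  set I₀ := ∫ w : V3, maxwellian w with hI₀
  set I₁ := ∫ w : V3, ‖w‖ * maxwellian w with hI₁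
  have p0 : 0 ≤ I₀ := integral_nonneg fun w => (maxwellian_pos w).le
  have p1 : 0 ≤ I₁ := integral_nonneg fun w => mul_nonneg (norm_nonneg _) (maxwellian_pos w).le
  set A : ℝ := C * |Real.pi / 2 - 0| * |2 * Real.pi - 0| with hA
  have hA0 : 0 ≤ A := by positivity
  refine ⟨A * (I₀ + I₁), by positivity, fun v => ?_⟩
  have hbound : Integrable fun w : V3 =>
      A * ((1 + ‖v‖) * maxwellian w + ‖w‖ * maxwellian w) :=
    ((i0.const_mul _).add i1).const_mul _
  have key : ‖collisionFrequency B v‖ ≤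
      ∫ w : V3, A * ((1 + ‖v‖) * maxwellian w + ‖w‖ * maxwellian w) := by
    refine norm_integral_le_of_norm_le hbound ?_
    have : ∀ᵐ vs : V3, vs ≠ v := compl_mem_ae_iff.2 (measure_singleton v)
    refine this.mono fun vs hvs => ?_
    have hr : 0 < ‖v - vs‖ := norm_pos_iff.2 (sub_ne_zero.2 hvs.symm)
    have hr' : ‖v - vs‖ ^ γ ≤ 1 + ‖v‖ + ‖vs‖ := by
      have h1 : ‖v - vs‖ ^ γ ≤ 1 + ‖v - vs‖ := by
        rcases le_total ‖v - vs‖ 1 with h | h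
        · exact (Real.rpow_le_one hr.le h hγ.1).trans (by linarith)
        · calc ‖v - vs‖ ^ γ ≤ ‖v - vs‖ ^ (1 : ℝ) := Real.rpow_le_rpow_of_exponent_le h hγ.2
            _ ≤ _ := by rw [Real.rpow_one]; linarith
      linarith [norm_sub_le v vs]
    have hM := (maxwellian_pos vs).le
    calc _ ≤ (maxwellian vs * (C * (1 + ‖v‖ + ‖vs‖)) * |Real.pi / 2 - 0|) * |2 * Real.pi - 0| := by
          refine intervalIntegral.norm_integral_le_of_norm_le_const fun ε _ => ?_
          refine intervalIntegral.norm_integral_le_of_norm_le_const fun θ hθ => ?_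
          rw [uIoc_of_le Real.pi_div_two_pos.le] at hθ
          obtain ⟨b0, b1⟩ := hC _ hr θ ⟨hθ.1.le, hθ.2⟩
          rw [Real.norm_of_nonneg (mul_nonneg hM b0)]
          refine mul_le_mul_of_nonneg_left (b1.trans (mul_le_mul_of_nonneg_left ?_ hC0)) hM
          have hc := Real.cos_le_one θ
          have hs := Real.sin_le_one θ
          have hc0 : 0 ≤ Real.cos θ := Real.cos_nonneg_of_mem_Icc ⟨by linarith [hθ.1, Real.pi_pos], hθ.2⟩
          have hs0 : 0 ≤ Real.sin θ :=
            Real.sin_nonneg_of_nonneg_of_le_pi hθ.1.le (by linarith [hθ.2, Real.pi_pos])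
          calc ‖v - vs‖ ^ γ * Real.cos θ * Real.sin θ ≤ (1 + ‖v‖ + ‖vs‖) * 1 * 1 := by gcongr
            _ = _ := by ring
      _ = _ := by rw [hA]; ring
  have e : ∫ w : V3, A * ((1 + ‖v‖) * maxwellian w + ‖w‖ * maxwellian w) =
      A * ((1 + ‖v‖) * I₀ + I₁) := by
    rw [integral_const_mul, integral_add (i0.const_mul _) i1, integral_const_mul]
  rw [e] at key
  refine (le_abs_self _).trans (key.trans ?_)
  have h1 : (1 + ‖v‖) * I₀ + I₁ ≤ (I₀ + I₁) * (1 + ‖v‖) := by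
    nlinarith [norm_nonneg v, mul_nonneg p1 (norm_nonneg v)]
  linarith [mul_le_mul_of_nonneg_left h1 hA0]

end LinBoltzmann

namespace LinBoltzmann

open scoped FourierTransform

/-! ### Damped averages along a line -/

/-- The damped average of `φ` along the backward line through `x` with velocity `w`. -/
noncomputable def lineAvg (ν T : ℝ) (w : V3) (φ : V3 → ℝ) (x : V3) : ℝ :=
  ∫ s in Ioo 0 T, Real.exp (-ν * s) * φ (x - s • w)

variable {ν T : ℝ} {w : V3} {φ : V3 → ℝ}

theorem enorm_exp_neg_mul_le {ν s : ℝ} (hν : 0 ≤ ν) (hs : 0 ≤ s) :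
    ‖Real.exp (-ν * s)‖ₑ ≤ 1 := by
  rw [← ofReal_norm, Real.norm_of_nonneg (Real.exp_nonneg _), ENNReal.ofReal_le_one,
    Real.exp_le_one_iff]
  nlinarith

theorem enorm_lineAvg_le (hν : 0 ≤ ν) (T : ℝ) (w : V3) (φ : V3 → ℝ) (x : V3) :
    ‖lineAvg ν T w φ x‖ₑ ≤ ∫⁻ s in Ioo 0 T, ‖φ (x - s • w)‖ₑ := by
  refine (enorm_integral_le_lintegral_enorm _).trans
    (setLIntegral_mono' measurableSet_Ioo fun s hs => ?_)
  rw [enorm_mul]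
  exact mul_le_of_le_one_left zero_le (enorm_exp_neg_mul_le hν hs.1.le)

theorem enorm_lineAvg_sq_le (hν : 0 ≤ ν) (T : ℝ) (w : V3) (hφ : Measurable φ) (x : V3) :
    ‖lineAvg ν T w φ x‖ₑ ^ 2 ≤
      ENNReal.ofReal T * ∫⁻ s in Ioo 0 T, ‖φ (x - s • w)‖ₑ ^ 2 := by
  refine (pow_le_pow_left₀ zero_le (enorm_lineAvg_le hν T w φ x) 2).trans ?_
  have hm : Measurable fun s : ℝ => ‖φ (x - s • w)‖ₑ := by fun_prop
  refine (sq_setLIntegral_le _ hm.aemeasurable).trans ?_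
  rw [Real.volume_Ioo, sub_zero]

theorem lintegral_lintegral_comp_sub_smul (T : ℝ) (w : V3) {F : V3 → ℝ≥0∞} (hF : Measurable F) :
    ∫⁻ x, ∫⁻ s in Ioo 0 T, F (x - s • w) = ENNReal.ofReal T * ∫⁻ x, F x := by
  rw [lintegral_lintegral_swap]
  · simp only [lintegral_sub_right_eq_self F]
    rw [setLIntegral_const, Real.volume_Ioo, sub_zero, mul_comm]
  · have : Measurable fun p : V3 × ℝ => F (p.1 - p.2 • w) := by fun_prop
    exact this.aemeasurable

theorem lintegral_lineAvg_sq_le (hν : 0 ≤ ν) (T : ℝ) (w : V3) (hφ : Measurable φ) :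
    ∫⁻ x, ‖lineAvg ν T w φ x‖ₑ ^ 2 ≤ ENNReal.ofReal T ^ 2 * ∫⁻ x, ‖φ x‖ₑ ^ 2 := by
  have hm : Measurable fun x => ‖φ x‖ₑ ^ 2 := by fun_prop
  calc _ ≤ ∫⁻ x, ENNReal.ofReal T * ∫⁻ s in Ioo 0 T, ‖φ (x - s • w)‖ₑ ^ 2 :=
        lintegral_mono fun x => enorm_lineAvg_sq_le hν T w hφ x
    _ = _ := by
      rw [lintegral_const_mul' _ _ (by simp), lintegral_lintegral_comp_sub_smul T w hm, sq, mul_assoc]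

theorem integrable_comp_sub_smul (T : ℝ) (w : V3) (hm : Measurable φ) (hφ : Integrable φ) :
    Integrable (fun p : V3 × ℝ => φ (p.1 - p.2 • w)) (volume.prod (volume.restrict (Ioo 0 T))) := by
  have h1 : Measurable fun p : V3 × ℝ => φ (p.1 - p.2 • w) := by fun_prop
  refine ⟨h1.aestronglyMeasurable, ?_⟩
  rw [HasFiniteIntegral, lintegral_prod _ h1.enorm.aemeasurable,
    lintegral_lintegral_comp_sub_smul T w hm.enorm]
  exact ENNReal.mul_lt_top (by simp) hφ.2

/-- The Fourier multiplier of the damped average along a line. -/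
noncomputable def lineSymbol (ν T : ℝ) (w ξ : V3) : ℂ :=
  ∫ s in Ioo 0 T, (Real.exp (-ν * s) : ℂ) * (Real.fourierChar (-⟪s • w, ξ⟫) : ℂ)

theorem fourier_lineAvg (hν : 0 ≤ ν) (T : ℝ) (w : V3) (hm : Measurable φ) (hφ : Integrable φ) (ξ : V3) :
    𝓕 (fun x => (lineAvg ν T w φ x : ℂ)) ξ = lineSymbol ν T w ξ * 𝓕 (fun x => (φ x : ℂ)) ξ := by
  have hi := (integrable_comp_sub_smul T w hm hφ).ofReal (𝕜 := ℂ)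
  have hc : Continuous fun p : V3 × ℝ =>
      (Real.fourierChar (-⟪p.1, ξ⟫) : ℂ) * (Real.exp (-ν * p.2) : ℂ) := by
    have : Continuous fun p : V3 × ℝ => (Real.fourierChar (-⟪p.1, ξ⟫) : ℂ) :=
      continuous_subtype_val.comp (Real.continuous_fourierChar.comp (by fun_prop))
    fun_prop
  have hi2 : Integrable (fun p : V3 × ℝ => ((Real.fourierChar (-⟪p.1, ξ⟫) : ℂ) *
      (Real.exp (-ν * p.2) : ℂ)) * (φ (p.1 - p.2 • w) : ℂ))
      (volume.prod (volume.restrict (Ioo 0 T))) := by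
    refine hi.bdd_mul (c := 1) hc.aestronglyMeasurable ?_
    have : ∀ᵐ p ∂((volume : Measure V3).prod (volume.restrict (Ioo 0 T))), p.2 ∈ Ioo 0 T :=
      Measure.quasiMeasurePreserving_snd.ae (ae_restrict_mem measurableSet_Ioo)
    refine this.mono fun p hp => ?_
    rw [norm_mul, Circle.norm_coe, one_mul, Complex.norm_real, Real.norm_of_nonneg (Real.exp_nonneg _),
      Real.exp_le_one_iff]
    nlinarith [hp.1]
  calc 𝓕 (fun x => (lineAvg ν T w φ x : ℂ)) ξ
      = ∫ x, ∫ s in Ioo 0 T, ((Real.fourierChar (-⟪x, ξ⟫) : ℂ) *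
          (Real.exp (-ν * s) : ℂ)) * (φ (x - s • w) : ℂ) := by
        rw [Real.fourier_eq]
        refine integral_congr_ae (Eventually.of_forall fun x => ?_)
        simp only [Circle.smul_def, smul_eq_mul, lineAvg]
        rw [← integral_complex_ofReal, ← integral_const_mul]
        refine integral_congr_ae (Eventually.of_forall fun s => ?_)
        simp only [Complex.ofReal_mul]; ring
    _ = ∫ s in Ioo 0 T, ∫ x, ((Real.fourierChar (-⟪x, ξ⟫) : ℂ) *
          (Real.exp (-ν * s) : ℂ)) * (φ (x - s • w) : ℂ) := integral_integral_swap hi2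
    _ = ∫ s in Ioo 0 T, ((Real.exp (-ν * s) : ℂ) * (Real.fourierChar (-⟪s • w, ξ⟫) : ℂ)) *
          𝓕 (fun x => (φ x : ℂ)) ξ := by
        refine integral_congr_ae (Eventually.of_forall fun s => ?_)
        dsimp only
        rw [mul_assoc, ← fourier_comp_sub, Real.fourier_eq, ← integral_const_mul]
        refine integral_congr_ae (Eventually.of_forall fun x => ?_)
        simp only [Circle.smul_def, smul_eq_mul]; ring
    _ = _ := by rw [integral_mul_const, lineSymbol]

theorem norm_lineSymbol_le (hν : 0 ≤ ν) (hT : 0 ≤ T) (w ξ : V3) : ‖lineSymbol ν T w ξ‖ ≤ T := by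
  have := norm_setIntegral_le_of_norm_le_const (μ := volume) (s := Ioo 0 T) (C := 1)
    (f := fun s : ℝ => (Real.exp (-ν * s) : ℂ) * (Real.fourierChar (-⟪s • w, ξ⟫) : ℂ)) (by simp) ?_
  · rwa [one_mul, Measure.real, Real.volume_Ioo, sub_zero, ENNReal.toReal_ofReal hT] at this
  · intro s hs
    rw [norm_mul, Circle.norm_coe, mul_one, Complex.norm_real, Real.norm_of_nonneg (Real.exp_nonneg _),
      Real.exp_le_one_iff]
    nlinarith [hs.1]

/-- The symbol is `(e^{zT} - 1)/z` with `Re z = -ν ≤ 0` and `|Im z| = 2π |⟪w, ξ⟫|`: the numerator is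
at most `2`, the denominator at least `2 |⟪w, ξ⟫|`. -/
theorem norm_lineSymbol_mul_le (hν : 0 ≤ ν) (hT : 0 ≤ T) (w ξ : V3) :
    ‖lineSymbol ν T w ξ‖ * |⟪w, ξ⟫| ≤ 1 := by
  rcases eq_or_ne ⟪w, ξ⟫ 0 with h0 | h0
  · simp [h0]
  set z : ℂ := -(ν : ℂ) - 2 * Real.pi * ⟪w, ξ⟫ * Complex.I with hz
  have hzim : z.im = -(2 * Real.pi * ⟪w, ξ⟫) := by simp [hz]
  have hz0 : z ≠ 0 := by
    intro h
    rw [h] at hzim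
    rw [Complex.zero_im, zero_eq_neg] at hzim
    exact (mul_ne_zero Real.two_pi_pos.ne' h0) hzim
  have e : lineSymbol ν T w ξ = (Complex.exp (z * T) - 1) / z := by
    rw [lineSymbol, ← integral_Ioc_eq_integral_Ioo, ← intervalIntegral.integral_of_le hT]
    have := integral_exp_mul_complex (a := 0) (b := T) hz0
    rw [show Complex.exp (z * T) - 1 = Complex.exp (z * T) - Complex.exp (z * (0 : ℝ)) by simp, ← this]
    refine intervalIntegral.integral_congr fun s _ => ?_
    simp only [Real.fourierChar_apply, Complex.ofReal_exp]
    rw [← Complex.exp_add]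
    congr 1
    rw [hz, real_inner_smul_left]
    push_cast
    ring
  have hn : ‖Complex.exp (z * T) - 1‖ ≤ 2 := by
    refine (norm_sub_le _ _).trans ?_
    rw [norm_one, Complex.norm_exp]
    have : Real.exp (z * T).re ≤ 1 := by
      rw [Real.exp_le_one_iff]
      have : (z * T).re = -(ν * T) := by simp [hz]
      rw [this]
      have := mul_nonneg hν hT
      linarith
    linarith
  have hzn : 2 * |⟪w, ξ⟫| ≤ ‖z‖ := by
    refine le_trans ?_ (Complex.abs_im_le_norm z)
    rw [hzim, abs_neg, abs_mul, abs_of_pos Real.two_pi_pos]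
    have := Real.pi_gt_three
    have := abs_nonneg ⟪w, ξ⟫
    nlinarith
  have hzp : 0 < ‖z‖ := norm_pos_iff.2 hz0
  rw [e, norm_div, div_mul_eq_mul_div, div_le_one hzp]
  calc _ ≤ 2 * |⟪w, ξ⟫| := by gcongr
    _ ≤ _ := hzn

/-- The trivial bound `(d/|w|)²` and the oscillation bound `⟪w, ξ⟫⁻²` share the factor `1 + |w|⁻²`.
With it taken out, the minimum depends on `w` through `⟪w, ξ⟫` alone, as slicing requires. -/
theorem enorm_fourier_lineAvg_sq_le {d : ℝ} (hν : 0 ≤ ν) (hd : 0 ≤ d) (hw : w ≠ 0) (hm : Measurable φ)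
    (hφ : Integrable φ) (ξ : V3) :
    ‖𝓕 (fun x => (lineAvg ν (d / ‖w‖) w φ x : ℂ)) ξ‖ₑ ^ 2 ≤
      min (ENNReal.ofReal d ^ 2) (ipow 2 ⟪w, ξ⟫) *
        ((1 + ipow 2 w) * ‖𝓕 (fun x => (φ x : ℂ)) ξ‖ₑ ^ 2) := by
  have hT : 0 ≤ d / ‖w‖ := by positivity
  rw [fourier_lineAvg hν _ w hm hφ, enorm_mul, mul_pow, ← mul_assoc]
  gcongr
  rw [min_mul_of_nonneg _ _ zero_le]
  refine le_min ?_ ?_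
  · calc ‖lineSymbol ν (d / ‖w‖) w ξ‖ₑ ^ 2 ≤ ENNReal.ofReal (d / ‖w‖) ^ 2 := by
          rw [← ofReal_norm]; gcongr; exact norm_lineSymbol_le hν hT w ξ
      _ = ENNReal.ofReal d ^ 2 * ipow 2 w := by
          rw [ENNReal.ofReal_div_of_pos (norm_pos_iff.2 hw), div_eq_mul_inv, mul_pow, ipow, ofReal_norm,
            ENNReal.rpow_two]
      _ ≤ _ := by gcongr; exact le_add_self
  · calc ‖lineSymbol ν (d / ‖w‖) w ξ‖ₑ ^ 2 ≤ ipow 2 ⟪w, ξ⟫ := by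
          rw [ipow, ENNReal.rpow_two]
          gcongr
          rw [ENNReal.le_inv_iff_mul_le, ← ofReal_norm, ← ofReal_norm, ← ENNReal.ofReal_mul (norm_nonneg _),
            ENNReal.ofReal_le_one]
          exact norm_lineSymbol_mul_le hν hT w ξ
      _ ≤ _ := le_mul_of_one_le_right zero_le le_self_add

/-- The function is integrable on the line, and rescaling by `r = |ξ|` gives the factor `1/|ξ|`. For
squared Fourier transforms this is the half derivative. -/
theorem exists_lintegral_min_ipow_le {d : ℝ} (hd : 0 ≤ d) :
    ∃ C : ℝ≥0, ∀ r : ℝ, 0 < r →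
      ‖r‖ₑ * ∫⁻ t : ℝ, min (ENNReal.ofReal d ^ 2) (ipow 2 (r * t)) ≤ C := by
  have hmm : Measurable fun t : ℝ => min (ENNReal.ofReal d ^ 2) (ipow 2 t) :=
    measurable_const.min (measurable_ipow 2)
  have hfin : ∫⁻ t : ℝ, min (ENNReal.ofReal d ^ 2) (ipow 2 t) < ∞ := by
    have hi := (integrable_inv_one_add_sq.const_mul (d ^ 2 + 1)).2
    refine lt_of_le_of_lt (lintegral_mono_ae ?_) hi
    have : ∀ᵐ t : ℝ, t ≠ 0 := compl_mem_ae_iff.2 (measure_singleton (0 : ℝ))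
    refine this.mono fun t ht => ?_
    have ht2 : 0 < t ^ 2 := by positivity
    dsimp only
    rw [ipow_eq_ofReal _ ht, ← ENNReal.ofReal_pow hd, ← ENNReal.ofReal_min, ← ofReal_norm,
      Real.norm_of_nonneg (show 0 ≤ (d ^ 2 + 1) * (1 + t ^ 2)⁻¹ by positivity)]
    apply ENNReal.ofReal_le_ofReal
    rw [Real.rpow_neg (norm_nonneg _), Real.rpow_two, Real.norm_eq_abs, sq_abs,
      ← div_eq_mul_inv, le_div_iff₀ (by positivity), mul_add, mul_one]
    refine add_le_add (min_le_left _ _) ?_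
    calc min (d ^ 2) (t ^ 2)⁻¹ * t ^ 2 ≤ (t ^ 2)⁻¹ * t ^ 2 := by gcongr; exact min_le_right _ _
      _ = 1 := inv_mul_cancel₀ ht2.ne'
  refine ⟨(∫⁻ t : ℝ, min (ENNReal.ofReal d ^ 2) (ipow 2 t)).toNNReal, fun r hr => ?_⟩
  rw [ENNReal.coe_toNNReal hfin.ne]
  have h2 : ∫⁻ t : ℝ, min (ENNReal.ofReal d ^ 2) (ipow 2 (r * t)) =
      ∫⁻ t, min (ENNReal.ofReal d ^ 2) (ipow 2 t) ∂(Measure.map (r * ·) volume) := by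
    rw [lintegral_map hmm (measurable_const_mul r)]
  rw [h2, Real.map_volume_mul_left hr.ne', lintegral_smul_measure, smul_eq_mul, ← mul_assoc,
    ← ofReal_norm, ← ENNReal.ofReal_mul (norm_nonneg _), abs_of_pos (inv_pos.2 hr),
    Real.norm_of_nonneg hr.le, mul_inv_cancel₀ hr.ne', ENNReal.ofReal_one, one_mul]

end LinBoltzmann

namespace LinBoltzmann

open scoped FourierTransform

/-! ### Velocity averaging -/

/-- The transport operator with the exit time replaced by `d / |v|`. It agrees with `opS Ω B` on
functions that vanish outside `Ω`. -/
noncomputable def truncS (d : ℝ) (B : ℝ → ℝ → ℝ) (h : V3 × V3 → ℝ) (p : V3 × V3) : ℝ :=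
  lineAvg (collisionFrequency B p.2) (d / ‖p.2‖) p.2 (fun x => h (x, p.2)) p.1

variable {B : ℝ → ℝ → ℝ} {γ d : ℝ} {Ω : Set V3} {h : V3 × V3 → ℝ}

theorem measurable_truncS (hB : IsCutoff B γ) (hh : Measurable h) : Measurable (truncS d B h) := by
  have hν := measurable_collisionFrequency hB
  have hset : MeasurableSet {q : (V3 × V3) × ℝ | 0 < q.2 ∧ q.2 < d / ‖q.1.2‖} :=
    (measurableSet_lt measurable_const measurable_snd).inter
      (measurableSet_lt measurable_snd (by fun_prop))
  have hF : Measurable fun q : (V3 × V3) × ℝ =>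
      Real.exp (-collisionFrequency B q.1.2 * q.2) * h (q.1.1 - q.2 • q.1.2, q.1.2) := by fun_prop
  have e : truncS d B h = fun p => ∫ s, {q : (V3 × V3) × ℝ | 0 < q.2 ∧ q.2 < d / ‖q.1.2‖}.indicator
      (fun q => Real.exp (-collisionFrequency B q.1.2 * q.2) * h (q.1.1 - q.2 • q.1.2, q.1.2))
      (p, s) := by
    ext p
    rw [truncS, lineAvg, ← integral_indicator measurableSet_Ioo]
    rfl
  rw [e]
  exact ((hF.indicator hset).stronglyMeasurable.integral_prod_right').measurable

theorem gk_ne_zero {a c : ℝ} (ha : 0 ≤ a) (z : V3) : gk a c z ≠ 0 := by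
  refine mul_ne_zero ?_ (by simpa using Real.exp_pos _)
  rw [ipow]
  exact (ENNReal.rpow_pos_of_nonneg (by simp) ha).ne'

theorem lintegral_gk_truncS_sq_le (hB : IsCutoff B γ) (hh : Measurable h) (v : V3) :
    ∫⁻ x, ∫⁻ w, gk (1 / 2) (1 / 16) (v - w) * ‖truncS d B h (x, w)‖ₑ ^ 2 ≤
      ENNReal.ofReal d ^ 2 *
        ∫⁻ w, gk (1 / 2) (1 / 16) (v - w) * ((1 + ipow 2 w) * ∫⁻ x, ‖h (x, w)‖ₑ ^ 2) := by
  have hu : Measurable (truncS d B h) := measurable_truncS hB hh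
  have hg : Measurable fun w : V3 => gk (1 / 2) (1 / 16) (v - w) :=
    (measurable_gk _ _).comp (measurable_const.sub measurable_id)
  have hm : Measurable fun p : V3 × V3 =>
      gk (1 / 2) (1 / 16) (v - p.2) * ‖truncS d B h p‖ₑ ^ 2 :=
    (hg.comp measurable_snd).mul (hu.enorm.pow_const 2)
  rw [lintegral_lintegral_swap hm.aemeasurable, ← lintegral_const_mul' _ _ (by simp)]
  refine lintegral_mono_ae (ae_ne_zero_V3.mono fun w hw => ?_)
  have hux : Measurable fun x => ‖truncS d B h (x, w)‖ₑ ^ 2 := by fun_prop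
  rw [lintegral_const_mul _ hux, mul_left_comm]
  gcongr
  refine (lintegral_lineAvg_sq_le (collisionFrequency_nonneg hB w) (d / ‖w‖) w
    (φ := fun x => h (x, w)) (by fun_prop)).trans ?_
  rw [← mul_assoc]
  gcongr
  rw [ENNReal.ofReal_div_of_pos (norm_pos_iff.2 hw), div_eq_mul_inv, mul_pow, ofReal_norm]
  gcongr
  rw [ipow, ENNReal.rpow_two]
  exact le_add_self

/-- In time `d/|w|` a line covers the distance `d`, so a function supported in `Ω` is moved by less
than `d`. The result has bounded support, uniformly in the velocity. -/
theorem truncS_eq_zero (hz : ∀ x ∈ Ω, ∀ y ∈ Ω, ‖x - y‖ < d) {z : V3} (hzΩ : z ∈ Ω)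
    (hsupp : ∀ x, x ∉ Ω → ∀ w, h (x, w) = 0) {x : V3} (hx : 2 * d ≤ ‖x - z‖) (w : V3) :
    truncS d B h (x, w) = 0 := by
  rw [truncS, lineAvg, setIntegral_congr_fun (g := fun _ => 0) measurableSet_Ioo, integral_zero]
  intro s hs
  dsimp only
  rw [hsupp, mul_zero]
  intro hm
  have h1 := hz _ hm _ hzΩ
  have hw : 0 < ‖w‖ := by
    by_contra h0
    have : ‖w‖ = 0 := le_antisymm (not_lt.1 h0) (norm_nonneg _)
    rw [this, div_zero] at hs
    exact absurd (hs.1.trans hs.2) (lt_irrefl _)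
  have h2 : ‖s • w‖ < d := by
    rw [norm_smul, Real.norm_of_nonneg hs.1.le]
    exact (lt_div_iff₀ hw).1 hs.2
  have h3 : ‖x - z‖ ≤ ‖x - s • w - z‖ + ‖s • w‖ := by
    calc ‖x - z‖ = ‖(x - s • w - z) + s • w‖ := by congr 1; abel
      _ ≤ _ := norm_add_le _ _
  linarith

/-- Bounded support in `x` turns the `L²` bound into an `L¹` bound, which the Fourier integral and
Fubini's theorem require. -/
theorem exists_sq_lintegral_lintegral_gk_one_le (d : ℝ) :
    ∃ C : ℝ≥0, ∀ (u : V3 × V3 → ℝ) (z v : V3), Measurable u →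
      (∀ x w, 2 * d ≤ ‖x - z‖ → u (x, w) = 0) →
      (∫⁻ x, ∫⁻ w, gk 1 (1 / 8) (v - w) * ‖u (x, w)‖ₑ) ^ 2 ≤
        C * ∫⁻ x, ∫⁻ w, gk (1 / 2) (1 / 16) (v - w) * ‖u (x, w)‖ₑ ^ 2 := by
  obtain ⟨C, hC⟩ := exists_sq_lintegral_gk_one_le
  refine ⟨(volume (Metric.ball (0 : V3) (2 * d))).toNNReal * C, fun u z v hu hs => ?_⟩
  have hg : Measurable fun w : V3 => gk 1 (1 / 8) (v - w) :=
    (measurable_gk _ _).comp (measurable_const.sub measurable_id)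
  have hm : Measurable fun p : V3 × V3 => gk 1 (1 / 8) (v - p.2) * ‖u p‖ₑ :=
    (hg.comp measurable_snd).mul hu.enorm
  have hm' : Measurable fun x => ∫⁻ w, gk 1 (1 / 8) (v - w) * ‖u (x, w)‖ₑ := hm.lintegral_prod_right'
  have h0 : ∫⁻ x, ∫⁻ w, gk 1 (1 / 8) (v - w) * ‖u (x, w)‖ₑ =
      ∫⁻ x in Metric.ball z (2 * d), ∫⁻ w, gk 1 (1 / 8) (v - w) * ‖u (x, w)‖ₑ := by
    rw [← lintegral_indicator Metric.isOpen_ball.measurableSet]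
    refine lintegral_congr fun x => ?_
    by_cases hx : x ∈ Metric.ball z (2 * d)
    · rw [indicator_of_mem hx]
    · rw [indicator_of_notMem hx]
      rw [Metric.mem_ball, dist_eq_norm, not_lt] at hx
      simp [hs x _ hx]
  rw [h0]
  refine (sq_setLIntegral_le _ hm'.aemeasurable).trans ?_
  rw [ENNReal.coe_mul, ENNReal.coe_toNNReal measure_ball_lt_top.ne, mul_assoc,
    Measure.addHaar_ball_center, ← lintegral_const_mul' _ _ ENNReal.coe_ne_top]
  refine mul_le_mul_right ((setLIntegral_le_lintegral _ _).trans (lintegral_mono fun x => ?_)) _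
  have hux : Measurable fun w => u (x, w) := by fun_prop
  exact hC v _ hux.aestronglyMeasurable

/-- The Fourier transform in the space variable. -/
noncomputable def fourierX (h : V3 × V3 → ℝ) (ξ w : V3) : ℂ := 𝓕 (fun x => (h (x, w) : ℂ)) ξ

theorem measurable_fourierX (hh : Measurable h) :
    Measurable fun p : V3 × V3 => fourierX h p.1 p.2 := by
  simp only [fourierX, Real.fourier_eq, Circle.smul_def, smul_eq_mul]
  have hc : Continuous fun q : (V3 × V3) × V3 => (Real.fourierChar (-⟪q.2, q.1.1⟫) : ℂ) :=
    continuous_subtype_val.comp (Real.continuous_fourierChar.comp (by fun_prop))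
  have hm : Measurable fun q : (V3 × V3) × V3 =>
      (Real.fourierChar (-⟪q.2, q.1.1⟫) : ℂ) * (h (q.2, q.1.2) : ℂ) := by fun_prop
  exact (hm.stronglyMeasurable.integral_prod_right').measurable

theorem enorm_ofReal_complex (t : ℝ) : ‖(t : ℂ)‖ₑ = ‖t‖ₑ := by simp [← ofReal_norm]

theorem lintegral_enorm_fourierX_sq {w : V3} (h1 : Integrable fun x => h (x, w))
    (h2 : MemLp (fun x => h (x, w)) 2) :
    ∫⁻ ξ, ‖fourierX h ξ w‖ₑ ^ 2 = ∫⁻ x, ‖h (x, w)‖ₑ ^ 2 := by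
  have := lintegral_enorm_fourier_sq (f := fun x => (h (x, w) : ℂ)) h1.ofReal h2.ofReal
  simp only [enorm_ofReal_complex] at this
  exact this

theorem enorm_fourierX_truncS_sq_le (hB : IsCutoff B γ) (hd : 0 ≤ d) (hh : Measurable h) {w : V3}
    (hw : w ≠ 0) (h1 : Integrable fun x => h (x, w)) (ξ : V3) :
    ‖fourierX (truncS d B h) ξ w‖ₑ ^ 2 ≤
      min (ENNReal.ofReal d ^ 2) (ipow 2 ⟪w, ξ⟫) * ((1 + ipow 2 w) * ‖fourierX h ξ w‖ₑ ^ 2) := by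
  have hmw : Measurable fun x => h (x, w) := by fun_prop
  exact enorm_fourier_lineAvg_sq_le (collisionFrequency_nonneg hB w) hd hw hmw h1 ξ

theorem fourier_integral_eq {k : V3 → ℝ} {u : V3 × V3 → ℝ}
    (hInt : Integrable (fun p : V3 × V3 => k p.2 * u p) (volume.prod volume)) (ξ : V3) :
    𝓕 (fun x => ((∫ w, k w * u (x, w) : ℝ) : ℂ)) ξ = ∫ w, (k w : ℂ) * fourierX u ξ w := by
  have hc : Continuous fun p : V3 × V3 => (Real.fourierChar (-⟪p.1, ξ⟫) : ℂ) :=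
    continuous_subtype_val.comp (Real.continuous_fourierChar.comp (by fun_prop))
  have hInt2 : Integrable (fun p : V3 × V3 => (Real.fourierChar (-⟪p.1, ξ⟫) : ℂ) *
      ((k p.2 * u p : ℝ) : ℂ)) (volume.prod volume) :=
    (hInt.ofReal (𝕜 := ℂ)).bdd_mul (c := 1) hc.aestronglyMeasurable
      (Eventually.of_forall fun p => by rw [Circle.norm_coe])
  calc _ = ∫ x, ∫ w, (Real.fourierChar (-⟪x, ξ⟫) : ℂ) * ((k w * u (x, w) : ℝ) : ℂ) := by
        rw [Real.fourier_eq]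
        refine integral_congr_ae (Eventually.of_forall fun x => ?_)
        simp only [Circle.smul_def, smul_eq_mul]
        rw [← integral_complex_ofReal, ← integral_const_mul]
    _ = ∫ w, ∫ x, (Real.fourierChar (-⟪x, ξ⟫) : ℂ) * ((k w * u (x, w) : ℝ) : ℂ) :=
        integral_integral_swap hInt2
    _ = _ := by
        refine integral_congr_ae (Eventually.of_forall fun w => ?_)
        dsimp only
        rw [fourierX, Real.fourier_eq, ← integral_const_mul]
        refine integral_congr_ae (Eventually.of_forall fun x => ?_)
        simp only [Circle.smul_def, smul_eq_mul, Complex.ofReal_mul]; ring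

/-- Slicing in the direction `ξ/|ξ|` leaves a one-dimensional integral of size `1/|ξ|`. This is the
averaging gain. -/
theorem exists_lintegral_slice_min_le (hd : 0 ≤ d) :
    ∃ C : ℝ≥0, ∀ v ξ : V3, ξ ≠ 0 →
      ‖ξ‖ₑ * ∫⁻ w, gk (3 / 2) (3 / 16) (v - w) * min (ENNReal.ofReal d ^ 2) (ipow 2 ⟪w, ξ⟫) ≤ C := by
  obtain ⟨C₂, hC₂⟩ := exists_lintegral_slice_le (3 / 16) (by norm_num)
  obtain ⟨C₃, hC₃⟩ := exists_lintegral_min_ipow_le hd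
  refine ⟨C₂ * C₃, fun v ξ hξ => ?_⟩
  have hn : 0 < ‖ξ‖ := norm_pos_iff.2 hξ
  set e : V3 := ‖ξ‖⁻¹ • ξ with he
  have he1 : ‖e‖ = 1 := by
    rw [he, norm_smul, norm_inv, norm_norm, inv_mul_cancel₀ hn.ne']
  have hein : ∀ w : V3, ⟪w, ξ⟫ = ‖ξ‖ * ⟪e, w⟫ := fun w => by
    rw [he, real_inner_smul_left, ← mul_assoc, mul_inv_cancel₀ hn.ne', one_mul, real_inner_comm]
  let Θ : ℝ → ℝ≥0∞ := fun t => min (ENNReal.ofReal d ^ 2) (ipow 2 (‖ξ‖ * t))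
  have hΘ : Measurable Θ := by
    have : Measurable fun t : ℝ => ipow 2 (‖ξ‖ * t) := (measurable_ipow 2).comp (by fun_prop)
    exact measurable_const.min this
  simp only [hein]
  calc _ ≤ ‖ξ‖ₑ * (C₂ * ∫⁻ t, Θ t) := mul_le_mul_right (hC₂ e v Θ he1 hΘ) _
    _ = C₂ * (‖‖ξ‖‖ₑ * ∫⁻ t, Θ t) := by rw [enorm_norm]; ring
    _ ≤ C₂ * C₃ := mul_le_mul_right (hC₃ ‖ξ‖ hn) _
    _ = _ := by rw [ENNReal.coe_mul]

theorem sq_enorm_integral_le {α : Type*} [MeasurableSpace α] {μ : Measure α}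
    {f : α → ℂ} {F G : α → ℝ≥0∞} (hF : AEMeasurable F μ) (hG : AEMeasurable G μ)
    (h : ∀ᵐ a ∂μ, ‖f a‖ₑ ^ 2 ≤ F a * G a) :
    ‖∫ a, f a ∂μ‖ₑ ^ 2 ≤ (∫⁻ a, F a ∂μ) * ∫⁻ a, G a ∂μ :=
  (pow_le_pow_left₀ zero_le (enorm_integral_le_lintegral_enorm _) 2).trans
    (sq_lintegral_le_of_sq_le_mul hF hG h)

/-- Fourier bound for velocity averages of `truncS`. -/
theorem exists_fourier_average_le (hB : IsCutoff B γ) (hd : 0 ≤ d) :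
    ∃ C : ℝ≥0, ∀ (C₁ : ℝ≥0) (h : V3 × V3 → ℝ) (k : V3 → ℝ) (v : V3), Measurable h →
      (∀ᵐ w, ‖k w‖ₑ ≤ C₁ * gk 1 (1 / 8) (v - w)) →
      (∀ᵐ w, Integrable fun x => h (x, w)) → (∀ᵐ w, MemLp (fun x => h (x, w)) 2) →
      Integrable (fun p : V3 × V3 => k p.2 * truncS d B h p) (volume.prod volume) →
      ∫⁻ ξ, ‖ξ‖ₑ * ‖𝓕 (fun x => ((∫ w, k w * truncS d B h (x, w) : ℝ) : ℂ)) ξ‖ₑ ^ 2 ≤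
        C₁ ^ 2 * C * ∫⁻ w, gk (1 / 2) (1 / 16) (v - w) * ((1 + ipow 2 w) * ∫⁻ x, ‖h (x, w)‖ₑ ^ 2) := by
  obtain ⟨C, hC⟩ := exists_lintegral_slice_min_le hd
  refine ⟨C, fun C₁ h k v hh hk1 hi1 hi2 hInt => ?_⟩
  have hF := measurable_fourierX hh
  have hg : Measurable fun w : V3 => gk (1 / 2) (1 / 16) (v - w) :=
    (measurable_gk _ _).comp (measurable_const.sub measurable_id)
  have hg3 : Measurable fun w : V3 => gk (3 / 2) (3 / 16) (v - w) :=
    (measurable_gk _ _).comp (measurable_const.sub measurable_id)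
  have hi : Measurable fun w : V3 => 1 + ipow 2 w := measurable_const.add (measurable_ipow 2)
  have hpt : ∀ ξ : V3, ξ ≠ 0 →
      ‖ξ‖ₑ * ‖𝓕 (fun x => ((∫ w, k w * truncS d B h (x, w) : ℝ) : ℂ)) ξ‖ₑ ^ 2 ≤
      C₁ ^ 2 * C * ∫⁻ w, gk (1 / 2) (1 / 16) (v - w) *
        ((1 + ipow 2 w) * ‖fourierX h ξ w‖ₑ ^ 2) := by
    intro ξ hξ
    have hFξ : Measurable fun w => ‖fourierX h ξ w‖ₑ ^ 2 := by
      have : Measurable fun w : V3 => fourierX h ξ w :=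
        Measurable.of_uncurry_left (f := fourierX h) hF
      exact this.enorm.pow_const 2
    have hΘ : Measurable fun w : V3 => min (ENNReal.ofReal d ^ 2) (ipow 2 ⟪w, ξ⟫) :=
      measurable_const.min ((measurable_ipow 2).comp (by fun_prop))
    -- Cauchy–Schwarz in `w` with the kernel split by `gk_one_sq`: the first integral gathers the
    -- symbol, the second the transform of the data.
    have h1 : ‖∫ w, (k w : ℂ) * fourierX (truncS d B h) ξ w‖ₑ ^ 2 ≤
        (∫⁻ w, C₁ ^ 2 * (gk (3 / 2) (3 / 16) (v - w) *
          min (ENNReal.ofReal d ^ 2) (ipow 2 ⟪w, ξ⟫))) *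
        ∫⁻ w, gk (1 / 2) (1 / 16) (v - w) * ((1 + ipow 2 w) * ‖fourierX h ξ w‖ₑ ^ 2) := by
      refine sq_enorm_integral_le ((hg3.mul hΘ).const_mul _).aemeasurable
        (hg.mul (hi.mul hFξ)).aemeasurable ((hk1.and (hi1.and ae_ne_zero_V3)).mono ?_)
      rintro w ⟨hkw, hiw, hw0⟩
      have := enorm_fourierX_truncS_sq_le hB hd hh hw0 hiw ξ
      rw [enorm_mul, mul_pow, enorm_ofReal_complex]
      refine (mul_le_mul' (pow_le_pow_left₀ zero_le hkw 2) this).trans (le_of_eq ?_)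
      rw [mul_pow, gk_one_sq]; ring
    have h2 : ‖ξ‖ₑ * ∫⁻ w, C₁ ^ 2 * (gk (3 / 2) (3 / 16) (v - w) *
        min (ENNReal.ofReal d ^ 2) (ipow 2 ⟪w, ξ⟫)) ≤ C₁ ^ 2 * C := by
      rw [lintegral_const_mul' _ _ (by simp), mul_left_comm]
      exact mul_le_mul_right (hC v ξ hξ) _
    rw [fourier_integral_eq hInt ξ]
    refine (mul_le_mul_right h1 _).trans ?_
    rw [← mul_assoc]
    exact mul_le_mul_left h2 _
  calc _ ≤ ∫⁻ ξ, C₁ ^ 2 * C * ∫⁻ w, gk (1 / 2) (1 / 16) (v - w) *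
        ((1 + ipow 2 w) * ‖fourierX h ξ w‖ₑ ^ 2) :=
        lintegral_mono_ae (ae_ne_zero_V3.mono hpt)
    _ = C₁ ^ 2 * C * ∫⁻ w, ∫⁻ ξ, gk (1 / 2) (1 / 16) (v - w) *
        ((1 + ipow 2 w) * ‖fourierX h ξ w‖ₑ ^ 2) := by
        rw [lintegral_const_mul' _ _ (by simp [ENNReal.mul_eq_top]), lintegral_lintegral_swap]
        have : Measurable fun p : V3 × V3 => gk (1 / 2) (1 / 16) (v - p.2) *
            ((1 + ipow 2 p.2) * ‖fourierX h p.1 p.2‖ₑ ^ 2) :=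
          (hg.comp measurable_snd).mul ((hi.comp measurable_snd).mul (hF.enorm.pow_const 2))
        exact this.aemeasurable
    -- Plancherel in `x` for almost every `w`.
    _ = _ := by
        congr 1
        refine lintegral_congr_ae ((hi1.and hi2).mono ?_)
        rintro w ⟨hw1, hw2⟩
        have hFw : Measurable fun ξ => ‖fourierX h ξ w‖ₑ ^ 2 := by
          have : Measurable fun ξ : V3 => fourierX h ξ w :=
            Measurable.of_uncurry_right (f := fourierX h) hF
          exact this.enorm.pow_const 2
        dsimp only
        rw [lintegral_const_mul _ (hFw.const_mul _), lintegral_const_mul _ hFw,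
          lintegral_enorm_fourierX_sq hw1 hw2]

end LinBoltzmann

/-! ### The averaging gain expressed in the Gagliardo seminorm. -/

namespace LinBoltzmann

variable {B : ℝ → ℝ → ℝ} {γ d : ℝ} {Ω : Set V3} {h : V3 × V3 → ℝ}

/-- The square of the Gagliardo seminorm of order `1/2` on a measurable set. -/
noncomputable def gagliardo (Ω : Set V3) (g : V3 → ℝ) : ℝ≥0∞ :=
  ∫⁻ x in Ω, ∫⁻ y in Ω, ipow 4 (x - y) * ‖g x - g y‖ₑ ^ 2

theorem gagliardo_congr_ae {g g' : V3 → ℝ} (h : g =ᵐ[volume.restrict Ω] g') :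
    gagliardo Ω g = gagliardo Ω g' := by
  refine lintegral_congr_ae (h.mono fun x hx => ?_)
  refine lintegral_congr_ae (h.mono fun y hy => ?_)
  dsimp only
  rw [hx, hy]

theorem gagliardo_mono {Ω' : Set V3} (h : Ω ⊆ Ω') (g : V3 → ℝ) : gagliardo Ω g ≤ gagliardo Ω' g :=
  lintegral_mono' (Measure.restrict_mono h le_rfl) fun _ => lintegral_mono_set h

theorem memLp_two_of_lintegral {α : Type*} [MeasurableSpace α] {μ : Measure α} {g : α → ℝ}
    (hg : AEStronglyMeasurable g μ) (hfin : ∫⁻ x, ‖g x‖ₑ ^ 2 ∂μ < ∞) : MemLp g 2 μ := by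
  refine ⟨hg, ?_⟩
  rw [eLpNorm_lt_top_iff_lintegral_rpow_enorm_lt_top (by norm_num) (by norm_num)]
  simpa using hfin

theorem integrable_of_lintegral_sq_of_support {g : V3 → ℝ} {s : Set V3} (hs : volume s < ∞)
    (hg : Measurable g) (hfin : ∫⁻ x, ‖g x‖ₑ ^ 2 < ∞) (h0 : ∀ x, x ∉ s → g x = 0) : Integrable g := by
  have h1 : MemLp g 2 (volume.restrict s) := memLp_two_of_lintegral hg.aestronglyMeasurable
    ((setLIntegral_le_lintegral _ _).trans_lt hfin)
  have : IsFiniteMeasure (volume.restrict s) := ⟨by simpa using hs⟩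
  have h2 : IntegrableOn g s := h1.integrable (by norm_num)
  exact (integrableOn_iff_integrable_of_support_subset fun x hx => by
    by_contra hn; exact hx (h0 x hn)).1 h2

/-- Velocity averaging: `K` applied to a solution of the transport equation gains half a derivative
in the space variable. -/
theorem IsConvexBody.exists_averaging_le (hΩ : IsConvexBody Ω d) (hγ : γ ∈ Icc (0 : ℝ) 1)
    (hB : IsCutoff B γ) :
    ∃ C : ℝ≥0, ∀ h : V3 × V3 → ℝ, Measurable h → (∀ x, x ∉ Ω → ∀ w, h (x, w) = 0) → ∀ v,
      gagliardo univ (fun x => opK B (truncS d B h) (x, v)) ≤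
        C * ∫⁻ w, gk (1 / 2) (1 / 16) (v - w) * ((1 + ipow 2 w) * ∫⁻ x, ‖h (x, w)‖ₑ ^ 2) := by
  have hd := hΩ.diam_pos
  obtain ⟨C₁, hC₁⟩ := exists_collision_kernel hγ hB
  obtain ⟨C₂, hC₂⟩ := exists_fourier_average_le hB hd.le
  obtain ⟨C₃, hC₃⟩ := exists_gagliardo_le_fourier
  obtain ⟨C₄, hC₄⟩ := exists_sq_lintegral_lintegral_gk_one_le d
  obtain ⟨C₅, hC₅⟩ := exists_collisionK_sq_le hγ hB
  refine ⟨C₃ * (C₁ ^ 2 * C₂) + 1, fun h hh hsupp v => ?_⟩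
  obtain ⟨k, hkm, hk1, hK⟩ := hC₁ v
  set N := ∫⁻ w, gk (1 / 2) (1 / 16) (v - w) * ((1 + ipow 2 w) * ∫⁻ x, ‖h (x, w)‖ₑ ^ 2) with hN
  -- For `N = ∞` the bound is trivial since the constant is nonzero; otherwise almost every slice of
  -- `h` is square integrable.
  rcases eq_or_ne N ∞ with hNt | hNt
  · rw [hNt, ENNReal.mul_top (by simp)]; exact le_top
  have hu : Measurable (truncS d B h) := measurable_truncS hB hh
  have hA := (lintegral_gk_truncS_sq_le (d := d) hB hh v).trans_lt
    (ENNReal.mul_lt_top (by simp) hNt.lt_top)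
  have hg : Measurable fun w : V3 => gk (1 / 2) (1 / 16) (v - w) :=
    (measurable_gk _ _).comp (measurable_const.sub measurable_id)
  have hi : Measurable fun w : V3 => 1 + ipow 2 w := measurable_const.add (measurable_ipow 2)
  have hh2 : Measurable fun p : V3 × V3 => ‖h p‖ₑ ^ 2 := by fun_prop
  have hhw : Measurable fun w => ∫⁻ x, ‖h (x, w)‖ₑ ^ 2 := hh2.lintegral_prod_left'
  obtain ⟨z, hz⟩ := hΩ.nonempty
  have hus : ∀ x w, 2 * d ≤ ‖x - z‖ → truncS d B h (x, w) = 0 := fun x w hx =>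
    truncS_eq_zero hΩ.norm_sub_lt hz hsupp hx w
  have hfin : ∀ᵐ w, ∫⁻ x, ‖h (x, w)‖ₑ ^ 2 < ∞ := by
    refine (ae_lt_top (hg.mul (hi.mul hhw)) hNt).mono fun w hw => ?_
    have h1 := ENNReal.lt_top_of_mul_ne_top_right hw.ne (gk_ne_zero (by norm_num) _)
    exact ENNReal.lt_top_of_mul_ne_top_right h1.ne (by simp)
  have hi1 : ∀ᵐ w, Integrable fun x => h (x, w) := hfin.mono fun w hw =>
    integrable_of_lintegral_sq_of_support hΩ.volume_lt_top (by fun_prop) hw fun x hx => hsupp x hx w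
  have hi2 : ∀ᵐ w, MemLp (fun x => h (x, w)) 2 := hfin.mono fun w hw =>
    memLp_two_of_lintegral (Measurable.aestronglyMeasurable (by fun_prop)) hw
  have hInt : Integrable (fun p : V3 × V3 => k p.2 * truncS d B h p) (volume.prod volume) := by
    have hm : Measurable fun p : V3 × V3 => k p.2 * truncS d B h p := by fun_prop
    refine ⟨hm.aestronglyMeasurable, ?_⟩
    rw [HasFiniteIntegral, lintegral_prod _ hm.enorm.aemeasurable]
    have h1 : ∫⁻ x, ∫⁻ w, gk 1 (1 / 8) (v - w) * ‖truncS d B h (x, w)‖ₑ < ∞ := by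
      have := (hC₄ (truncS d B h) z v hu hus).trans_lt (ENNReal.mul_lt_top ENNReal.coe_lt_top hA)
      by_contra hn
      rw [not_lt, top_le_iff] at hn
      rw [hn] at this
      simp at this
    refine lt_of_le_of_lt ?_ (ENNReal.mul_lt_top (ENNReal.coe_lt_top (r := C₁)) h1)
    rw [← lintegral_const_mul' _ _ ENNReal.coe_ne_top]
    refine lintegral_mono fun x => ?_
    rw [← lintegral_const_mul' _ _ ENNReal.coe_ne_top]
    refine lintegral_mono_ae (hk1.mono fun w hw => ?_)
    dsimp only
    rw [enorm_mul, ← mul_assoc]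
    exact mul_le_mul_left hw _
  set g : V3 → ℝ := fun x => ∫ w, k w * truncS d B h (x, w) with hgdef
  have hgm : Measurable g := by
    have hm : Measurable fun p : V3 × V3 => k p.2 * truncS d B h p := by fun_prop
    exact (hm.stronglyMeasurable.integral_prod_right').measurable
  have hux : ∀ x, AEStronglyMeasurable (fun w => truncS d B h (x, w)) volume := fun x =>
    Measurable.aestronglyMeasurable (by fun_prop)
  have hm1 : Measurable fun p : V3 × V3 => gk (1 / 2) (1 / 16) (v - p.2) * ‖truncS d B h p‖ₑ ^ 2 :=
    (hg.comp measurable_snd).mul (hu.enorm.pow_const 2)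
  -- The kernel represents `K` only where the weighted integral is finite, hence at almost every
  -- `x`; the seminorm ignores the exceptional set.
  have hae : (fun x => opK B (truncS d B h) (x, v)) =ᵐ[volume] g :=
    (ae_lt_top hm1.lintegral_prod_right' hA.ne).mono fun x hx =>
      (hK _ (hux x) (lintegral_gk_one_lt_top (hux x) hx)).1
  have hg1 : Integrable g := hInt.integral_prod_left
  have hg2 : MemLp g 2 := by
    refine memLp_two_of_lintegral hgm.aestronglyMeasurable ?_
    refine lt_of_le_of_lt ?_ (ENNReal.mul_lt_top (ENNReal.coe_lt_top (r := C₅)) hA)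
    rw [← lintegral_const_mul' _ _ ENNReal.coe_ne_top]
    refine lintegral_mono_ae (hae.mono fun x hx => ?_)
    rw [← hx]
    exact hC₅ v _ (hux x)
  rw [gagliardo_congr_ae (by simpa using hae)]
  have h3 := hC₃ (fun x => (g x : ℂ)) (by fun_prop) hg1.ofReal hg2.ofReal
  have h4 := hC₂ C₁ h k v hh hk1 hi1 hi2 hInt
  simp only [← Complex.ofReal_sub, enorm_ofReal_complex] at h3
  rw [gagliardo, Measure.restrict_univ]
  calc _ ≤ C₃ * (C₁ ^ 2 * C₂ * N) := h3.trans (mul_le_mul_right h4 _)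
    _ = ↑(C₃ * (C₁ ^ 2 * C₂)) * N := by push_cast; ring
    _ ≤ _ := by
      refine mul_le_mul_left ?_ _
      exact_mod_cast le_self_add

end LinBoltzmann

namespace LinBoltzmann

/-! ### Weighted integrals along characteristics -/

theorem lintegral_rotate {α β δ : Type*} [MeasurableSpace α] [MeasurableSpace β] [MeasurableSpace δ]
    {μ : Measure α} {ν : Measure β} {ρ : Measure δ} [SFinite μ] [SFinite ν] [SFinite ρ]
    {Y : α → β → δ → ℝ≥0∞} (hY : Measurable fun p : α × β × δ => Y p.1 p.2.1 p.2.2) :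
    ∫⁻ a, (∫⁻ b, (∫⁻ c, Y a b c ∂ρ) ∂ν) ∂μ = ∫⁻ c, (∫⁻ a, (∫⁻ b, Y a b c ∂ν) ∂μ) ∂ρ := by
  have h1 : ∀ a, ∫⁻ b, (∫⁻ c, Y a b c ∂ρ) ∂ν = ∫⁻ c, (∫⁻ b, Y a b c ∂ν) ∂ρ := by
    intro a
    refine lintegral_lintegral_swap ?_
    have : Measurable fun p : β × δ => Y a p.1 p.2 :=
      hY.comp (measurable_const.prodMk (measurable_fst.prodMk measurable_snd))
    exact this.aemeasurable
  simp only [h1]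
  refine lintegral_lintegral_swap ?_
  have h2 : Measurable fun q : (α × δ) × β => Y q.1.1 q.2 q.1.2 :=
    hY.comp ((measurable_fst.comp measurable_fst).prodMk
      (measurable_snd.prodMk (measurable_snd.comp measurable_fst)))
  exact h2.lintegral_prod_right'.aemeasurable

theorem lintegral_rotate₄ {α β δ ε : Type*} [MeasurableSpace α] [MeasurableSpace β]
    [MeasurableSpace δ] [MeasurableSpace ε] {μ : Measure α} {ν : Measure β} {ρ : Measure δ}
    {σ : Measure ε} [SFinite μ] [SFinite ν] [SFinite ρ] [SFinite σ] {Y : α → β → δ → ε → ℝ≥0∞}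
    (hY : Measurable fun p : α × β × δ × ε => Y p.1 p.2.1 p.2.2.1 p.2.2.2) :
    ∫⁻ a, (∫⁻ b, (∫⁻ c, (∫⁻ e, Y a b c e ∂σ) ∂ρ) ∂ν) ∂μ =
      ∫⁻ e, (∫⁻ a, (∫⁻ b, (∫⁻ c, Y a b c e ∂ρ) ∂ν) ∂μ) ∂σ := by
  have h1 : ∀ a, ∫⁻ b, (∫⁻ c, (∫⁻ e, Y a b c e ∂σ) ∂ρ) ∂ν =
      ∫⁻ e, (∫⁻ b, (∫⁻ c, Y a b c e ∂ρ) ∂ν) ∂σ := by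
    intro a
    refine lintegral_rotate (Y := fun b c e => Y a b c e) ?_
    exact hY.comp (measurable_const.prodMk measurable_id)
  simp only [h1]
  refine lintegral_lintegral_swap ?_
  have h2 : Measurable fun q : ((α × ε) × β) × δ => Y q.1.1.1 q.1.2 q.2 q.1.1.2 :=
    hY.comp ((measurable_fst.comp (measurable_fst.comp measurable_fst)).prodMk
      ((measurable_snd.comp measurable_fst).prodMk
        (measurable_snd.prodMk (measurable_snd.comp (measurable_fst.comp measurable_fst)))))
  exact h2.lintegral_prod_right'.lintegral_prod_right'.aemeasurable

/-- The translation `q = x - s v` moves the line from `F` to the weight. The average over `v` of the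
line integrals of `ω` through `q` is bounded by its Riesz potential, hence by a constant. -/
theorem exists_lintegral_weight_line_le {c : ℝ} (hc : 0 < c) {ω : V3 → ℝ≥0∞} (hω : Measurable ω)
    {D : ℝ≥0} (hD : ∀ q, ∫⁻ X, ipow 2 X * ω (q + X) ≤ D) :
    ∃ C : ℝ≥0, ∀ (w : V3) (F : V3 → ℝ≥0∞), Measurable F →
      ∫⁻ v, gk (1 / 2) c (v - w) * ipow 1 v *
        ∫⁻ s in Ioi (0 : ℝ), ∫⁻ x, ω x * F (x - s • v) ≤ C * ∫⁻ x, F x := by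
  obtain ⟨C, hC⟩ := exists_lintegral_gk_line_le c hc
  refine ⟨C * D, fun w F hF => ?_⟩
  have hgi : Measurable fun v : V3 => gk (1 / 2) c (v - w) * ipow 1 v := by
    have : Measurable fun v : V3 => gk (1 / 2) c (v - w) :=
      (measurable_gk _ _).comp (measurable_id.sub measurable_const)
    exact this.mul (measurable_ipow 1)
  have h1 : ∀ (v : V3) (s : ℝ), ∫⁻ x, ω x * F (x - s • v) = ∫⁻ q, ω (q + s • v) * F q := by
    intro v s
    rw [← lintegral_add_right_eq_self (fun x => ω x * F (x - s • v)) (s • v)]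
    simp only [add_sub_cancel_right]
  have hm2 : Measurable fun p : V3 × ℝ × V3 => ω (p.2.2 + p.2.1 • p.1) * F p.2.2 := by fun_prop
  calc _ = ∫⁻ v, ∫⁻ s in Ioi (0 : ℝ), ∫⁻ q,
        gk (1 / 2) c (v - w) * ipow 1 v * (ω (q + s • v) * F q) := by
        refine lintegral_congr fun v => ?_
        simp only [h1]
        have hm3 : ∀ s : ℝ, Measurable fun q : V3 => ω (q + s • v) * F q := fun s => by fun_prop
        have hm4 : Measurable fun p : ℝ × V3 => ω (p.2 + p.1 • v) * F p.2 := by fun_prop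
        rw [← lintegral_const_mul _ hm4.lintegral_prod_right']
        refine lintegral_congr fun s => ?_
        rw [lintegral_const_mul _ (hm3 s)]
    _ = ∫⁻ q, ∫⁻ v, ∫⁻ s in Ioi (0 : ℝ),
        gk (1 / 2) c (v - w) * ipow 1 v * (ω (q + s • v) * F q) := by
        refine lintegral_rotate (Y := fun v s q =>
          gk (1 / 2) c (v - w) * ipow 1 v * (ω (q + s • v) * F q)) ?_
        exact (hgi.comp measurable_fst).mul hm2
    _ = ∫⁻ q, (∫⁻ v, gk (1 / 2) c (v - w) * ipow 1 v * ∫⁻ s in Ioi (0 : ℝ), ω (q + s • v)) * F q := by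
        refine lintegral_congr fun q => ?_
        have hm5 : Measurable fun p : V3 × ℝ => ω (q + p.2 • p.1) := by fun_prop
        have hm6 : ∀ v : V3, Measurable fun s : ℝ => ω (q + s • v) := fun v => by fun_prop
        have hm7 : Measurable fun v : V3 => gk (1 / 2) c (v - w) * ipow 1 v *
            ∫⁻ s in Ioi (0 : ℝ), ω (q + s • v) := hgi.mul hm5.lintegral_prod_right'
        rw [← lintegral_mul_const _ hm7]
        refine lintegral_congr fun v => ?_
        rw [mul_assoc, ← lintegral_mul_const _ (hm6 v), ← lintegral_const_mul _ ((hm6 v).mul_const _)]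
    _ ≤ ∫⁻ q, ↑(C * D) * F q := by
        refine lintegral_mono fun q => mul_le_mul_left ?_ _
        refine (hC w q ω hω).trans ?_
        rw [ENNReal.coe_mul]
        exact mul_le_mul_right (hD q) _
    _ = _ := lintegral_const_mul' _ _ ENNReal.coe_ne_top

theorem exists_lintegral_weight_kernel_le {c : ℝ} (hc : 0 < c) {ω : V3 → ℝ≥0∞} (hω : Measurable ω)
    {D : ℝ≥0} (hD : ∀ q, ∫⁻ X, ipow 2 X * ω (q + X) ≤ D) :
    ∃ C : ℝ≥0, ∀ F : V3 × V3 → ℝ≥0∞, Measurable F →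
      ∫⁻ v, ipow 1 v * ∫⁻ s in Ioi (0 : ℝ), ∫⁻ x, ω x *
        ∫⁻ w, gk (1 / 2) c (v - w) * F (x - s • v, w) ≤ C * ∫⁻ w, ∫⁻ x, F (x, w) := by
  obtain ⟨C, hC⟩ := exists_lintegral_weight_line_le hc hω hD
  refine ⟨C, fun F hF => ?_⟩
  have hgm : Measurable fun p : V3 × V3 => gk (1 / 2) c (p.1 - p.2) :=
    (measurable_gk _ _).comp (measurable_fst.sub measurable_snd)
  have him : Measurable fun v : V3 => ipow 1 v := measurable_ipow 1
  let Y : V3 → ℝ → V3 → V3 → ℝ≥0∞ := fun v s x w =>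
    ipow 1 v * (ω x * (gk (1 / 2) c (v - w) * F (x - s • v, w)))
  have hY : Measurable fun p : V3 × ℝ × V3 × V3 => Y p.1 p.2.1 p.2.2.1 p.2.2.2 := by
    have g1 : Measurable fun p : V3 × ℝ × V3 × V3 => gk (1 / 2) c (p.1 - p.2.2.2) :=
      (measurable_gk _ _).comp (by fun_prop)
    have g2 : Measurable fun p : V3 × ℝ × V3 × V3 => F (p.2.2.1 - p.2.1 • p.1, p.2.2.2) := by fun_prop
    have g3 : Measurable fun p : V3 × ℝ × V3 × V3 => ω p.2.2.1 := by fun_prop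
    exact (him.comp measurable_fst).mul (g3.mul (g1.mul g2))
  calc _ = ∫⁻ v, ∫⁻ s in Ioi (0 : ℝ), ∫⁻ x, ∫⁻ w, Y v s x w := by
        refine lintegral_congr fun v => ?_
        have g0 : Measurable fun q : (ℝ × V3) × V3 => gk (1 / 2) c (v - q.2) :=
          (measurable_gk _ _).comp (by fun_prop)
        have g1 : Measurable fun q : (ℝ × V3) × V3 =>
            gk (1 / 2) c (v - q.2) * F (q.1.2 - q.1.1 • v, q.2) := g0.mul (by fun_prop)
        have g2 : Measurable fun q : ℝ × V3 => ω q.2 * ∫⁻ w, gk (1 / 2) c (v - w) *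
            F (q.2 - q.1 • v, w) :=
          (hω.comp measurable_snd).mul g1.lintegral_prod_right'
        rw [← lintegral_const_mul _ g2.lintegral_prod_right']
        refine lintegral_congr fun s => ?_
        have g3 : Measurable fun x : V3 => ω x * ∫⁻ w, gk (1 / 2) c (v - w) * F (x - s • v, w) :=
          Measurable.of_uncurry_left (f := fun s x => ω x * ∫⁻ w, gk (1 / 2) c (v - w) *
            F (x - s • v, w)) g2
        rw [← lintegral_const_mul _ g3]
        refine lintegral_congr fun x => ?_
        have g4 : Measurable fun w : V3 => gk (1 / 2) c (v - w) * F (x - s • v, w) := by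
          have : Measurable fun w : V3 => gk (1 / 2) c (v - w) :=
            (measurable_gk _ _).comp (by fun_prop)
          exact this.mul (by fun_prop)
        rw [← lintegral_const_mul _ g4, ← lintegral_const_mul _ (g4.const_mul _)]
    _ = ∫⁻ w, ∫⁻ v, ∫⁻ s in Ioi (0 : ℝ), ∫⁻ x, Y v s x w := lintegral_rotate₄ hY
    _ = ∫⁻ w, ∫⁻ v, gk (1 / 2) c (v - w) * ipow 1 v *
          ∫⁻ s in Ioi (0 : ℝ), ∫⁻ x, ω x * F (x - s • v, w) := by
        refine lintegral_congr fun w => lintegral_congr fun v => ?_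
        have g1 : Measurable fun q : ℝ × V3 => ω q.2 * F (q.2 - q.1 • v, w) := by fun_prop
        have g2 : ∀ s : ℝ, Measurable fun x : V3 => ω x * F (x - s • v, w) := fun s => by fun_prop
        rw [← lintegral_const_mul _ g1.lintegral_prod_right']
        refine lintegral_congr fun s => ?_
        rw [← lintegral_const_mul _ (g2 s)]
        refine lintegral_congr fun x => ?_
        simp only [Y]; ring
    _ ≤ ∫⁻ w, C * ∫⁻ x, F (x, w) :=
        lintegral_mono fun w => hC w (fun x => F (x, w)) (by fun_prop)
    _ = _ := lintegral_const_mul' _ _ ENNReal.coe_ne_top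

end LinBoltzmann

namespace LinBoltzmann

variable {B : ℝ → ℝ → ℝ} {γ d : ℝ} {Ω : Set V3}

/-! ### Regularity of the transport operator -/

theorem IsConvexBody.exists_lintegral_indicator_bw_le (hΩ : IsConvexBody Ω d) :
    ∃ D : ℝ≥0, ∀ q, ∫⁻ X, ipow 2 X * Ω.indicator (bw Ω) (q + X) ≤ D := by
  obtain ⟨D, hD⟩ := hΩ.exists_lintegral_ipow_two_bw_le
  refine ⟨D, fun q => le_trans (le_of_eq ?_) (hD q)⟩
  rw [← lintegral_indicator hΩ.measurableSet, 
    ← lintegral_add_left_eq_self (Ω.indicator fun x => ipow 2 (x - q) * bw Ω x) q]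
  refine lintegral_congr fun X => ?_
  by_cases hx : q + X ∈ Ω
  · rw [indicator_of_mem hx, indicator_of_mem hx, add_sub_cancel_left]
  · rw [indicator_of_notMem hx, indicator_of_notMem hx, mul_zero]

theorem ofReal_div_norm (d : ℝ) {v : V3} (hv : v ≠ 0) :
    ENNReal.ofReal (d / ‖v‖) = ENNReal.ofReal d * ipow 1 v := by
  rw [ENNReal.ofReal_div_of_pos (norm_pos_iff.2 hv), div_eq_mul_inv, ipow, ofReal_norm,
    ENNReal.rpow_one]

theorem enorm_lineAvg_sub_le {ν T : ℝ} (hν : 0 ≤ ν) {w : V3} {φ : V3 → ℝ} (hφ : Measurable φ) {x y : V3}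
    (hx : ∫⁻ s in Ioo 0 T, ‖φ (x - s • w)‖ₑ < ∞) (hy : ∫⁻ s in Ioo 0 T, ‖φ (y - s • w)‖ₑ < ∞) :
    ‖lineAvg ν T w φ x - lineAvg ν T w φ y‖ₑ ≤
      ∫⁻ s in Ioo 0 T, ‖φ (x - s • w) - φ (y - s • w)‖ₑ := by
  have hi : ∀ z, ∫⁻ s in Ioo 0 T, ‖φ (z - s • w)‖ₑ < ∞ →
      IntegrableOn (fun s => Real.exp (-ν * s) * φ (z - s • w)) (Ioo 0 T) := by
    intro z hz
    have hm : Measurable fun s : ℝ => Real.exp (-ν * s) * φ (z - s • w) := by fun_prop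
    refine ⟨hm.aestronglyMeasurable, lt_of_le_of_lt ?_ hz⟩
    refine setLIntegral_mono' measurableSet_Ioo fun s hs => ?_
    rw [enorm_mul]
    exact mul_le_of_le_one_left zero_le (enorm_exp_neg_mul_le hν hs.1.le)
  rw [lineAvg, lineAvg, ← integral_sub (hi x hx) (hi y hy)]
  refine (enorm_integral_le_lintegral_enorm _).trans
    (setLIntegral_mono' measurableSet_Ioo fun s hs => ?_)
  rw [← mul_sub, enorm_mul]
  exact mul_le_of_le_one_left zero_le (enorm_exp_neg_mul_le hν hs.1.le)

/-- Both points inside: the interior contribution to a difference of line averages. -/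
noncomputable def insideDiff (Ω : Set V3) (φ : V3 → ℝ) (a b : V3) : ℝ≥0∞ :=
  Ω.indicator (fun a => Ω.indicator (fun b => ‖φ a - φ b‖ₑ) b) a

/-- First point outside, second point inside: the boundary contribution to a difference of line
averages. -/
noncomputable def exitDiff (Ω : Set V3) (φ : V3 → ℝ) (a b : V3) : ℝ≥0∞ :=
  Ωᶜ.indicator (fun _ => Ω.indicator (fun b => ‖φ b‖ₑ) b) a

theorem enorm_indicator_sub_le (φ : V3 → ℝ) (a b : V3) :
    ‖Ω.indicator φ a - Ω.indicator φ b‖ₑ ≤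
      insideDiff Ω φ a b + (exitDiff Ω φ a b + exitDiff Ω φ b a) := by
  by_cases ha : a ∈ Ω <;> by_cases hb : b ∈ Ω <;>
    simp [insideDiff, exitDiff, ha, hb]

theorem measurable_insideDiff (hΩ : MeasurableSet Ω) {φ : V3 → ℝ} (hφ : Measurable φ) :
    Measurable fun p : V3 × V3 => insideDiff Ω φ p.1 p.2 := by
  have e : (fun p : V3 × V3 => insideDiff Ω φ p.1 p.2) =
      (Ω ×ˢ Ω).indicator fun p => ‖φ p.1 - φ p.2‖ₑ := by
    ext p
    by_cases ha : p.1 ∈ Ω <;> by_cases hb : p.2 ∈ Ω <;> simp [insideDiff, indicator, ha, hb]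
  rw [e]
  exact Measurable.indicator (by fun_prop) (hΩ.prod hΩ)

theorem measurable_exitDiff (hΩ : MeasurableSet Ω) {φ : V3 → ℝ} (hφ : Measurable φ) :
    Measurable fun p : V3 × V3 => exitDiff Ω φ p.1 p.2 := by
  have e : (fun p : V3 × V3 => exitDiff Ω φ p.1 p.2) =
      (Ωᶜ ×ˢ Ω).indicator fun p => ‖φ p.2‖ₑ := by
    ext p
    by_cases ha : p.1 ∈ Ω <;> by_cases hb : p.2 ∈ Ω <;> simp [exitDiff, indicator, ha, hb]
  rw [e]
  exact Measurable.indicator (by fun_prop) (hΩ.compl.prod hΩ)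

/-- Only an inequality: at `z = 0` the left side is `∞ · 0 = 0` while the right side is `∞`. -/
theorem ipow_four_mul_le (z : V3) : ipow 4 z * ‖z‖ₑ ^ (1 / 2 : ℝ) ≤ ipow (7 / 2) z := by
  rcases eq_or_ne z 0 with rfl | hz
  · simp
  · have hn : 0 < ‖z‖ := norm_pos_iff.2 hz
    rw [ipow_eq_ofReal _ hz, ipow_eq_ofReal _ hz, ← ofReal_norm, ENNReal.ofReal_rpow_of_pos hn,
      ← ENNReal.ofReal_mul (by positivity), ← Real.rpow_add hn]
    norm_num

/-- The interior part of the Gagliardo seminorm of a line average. -/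
theorem lintegral_inside_le (hΩ : MeasurableSet Ω) (T : ℝ) (v : V3) {φ : V3 → ℝ} (hφ : Measurable φ) :
    ∫⁻ x in Ω, ∫⁻ y in Ω, ipow 4 (x - y) *
      (∫⁻ s in Ioo 0 T, insideDiff Ω φ (x - s • v) (y - s • v)) ^ 2 ≤
      ENNReal.ofReal T ^ 2 * gagliardo Ω φ := by
  have hm := measurable_insideDiff hΩ hφ
  have hi4 : Measurable fun z : V3 => ipow 4 z := measurable_ipow 4
  let Ψ : V3 → V3 → ℝ≥0∞ := fun a b => ipow 4 (a - b) * insideDiff Ω φ a b ^ 2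
  have hΨ : Measurable fun p : V3 × V3 => Ψ p.1 p.2 :=
    (hi4.comp (measurable_fst.sub measurable_snd)).mul (hm.pow_const 2)
  have e1 : ∫⁻ a, ∫⁻ b, Ψ a b = gagliardo Ω φ := by
    rw [gagliardo, ← lintegral_indicator hΩ]
    refine lintegral_congr fun a => ?_
    by_cases ha : a ∈ Ω
    · rw [indicator_of_mem ha, ← lintegral_indicator hΩ]
      refine lintegral_congr fun b => ?_
      by_cases hb : b ∈ Ω <;> simp [Ψ, insideDiff, ha, hb]
    · rw [indicator_of_notMem ha]
      simp [Ψ, insideDiff, ha]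
  calc _ ≤ ∫⁻ x, ∫⁻ y, ENNReal.ofReal T * ∫⁻ s in Ioo 0 T, Ψ (x - s • v) (y - s • v) := by
        refine (setLIntegral_le_lintegral _ _).trans (lintegral_mono fun x => ?_)
        refine (setLIntegral_le_lintegral _ _).trans (lintegral_mono fun y => ?_)
        have hs : Measurable fun s : ℝ => insideDiff Ω φ (x - s • v) (y - s • v) :=
          hm.comp (f := fun s : ℝ => (x - s • v, y - s • v)) (by fun_prop)
        have h1 := sq_setLIntegral_le (Ioo 0 T) (μ := volume) hs.aemeasurable
        rw [Real.volume_Ioo, sub_zero] at h1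
        refine (mul_le_mul_right h1 _).trans (le_of_eq ?_)
        rw [mul_left_comm, ← lintegral_const_mul _ (hs.pow_const 2)]
        simp only [Ψ, sub_sub_sub_cancel_right]
    _ = ENNReal.ofReal T * ∫⁻ x, ∫⁻ y, ∫⁻ s in Ioo 0 T, Ψ (x - s • v) (y - s • v) := by
        rw [← lintegral_const_mul' _ _ (by simp)]
        refine lintegral_congr fun x => ?_
        rw [lintegral_const_mul' _ _ (by simp)]
    _ = ENNReal.ofReal T * ∫⁻ s in Ioo 0 T, ∫⁻ x, ∫⁻ y, Ψ (x - s • v) (y - s • v) := by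
        congr 1
        refine lintegral_rotate (Y := fun x y s => Ψ (x - s • v) (y - s • v)) ?_
        exact hΨ.comp (f := fun p : V3 × V3 × ℝ => (p.1 - p.2.2 • v, p.2.1 - p.2.2 • v)) (by fun_prop)
    _ = _ := by
        -- Translating both points by `s v` preserves their difference, so each time contributes the
        -- same seminorm.
        have e2 : ∀ s : ℝ, ∫⁻ x, ∫⁻ y, Ψ (x - s • v) (y - s • v) = gagliardo Ω φ := by
          intro s
          rw [← e1, ← lintegral_sub_right_eq_self (fun a => ∫⁻ b, Ψ a b) (s • v)]
          refine lintegral_congr fun x => ?_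
          exact lintegral_sub_right_eq_self (fun b => Ψ (x - s • v) b) (s • v)
        simp only [e2]
        rw [setLIntegral_const, Real.volume_Ioo, sub_zero]; ring

/-- The layer potential of `φ` over `Ω`, evaluated outside `Ω`. -/
noncomputable def outerPotential (Ω : Set V3) (φ : V3 → ℝ≥0∞) (a : V3) : ℝ≥0∞ :=
  Ωᶜ.indicator (fun a => ∫⁻ p in Ω, ipow (7 / 2) (a - p) * φ p) a

/-- The weighted density of the times at which the line through `x` has left `Ω` while the line
through `y` has not. -/
noncomputable def exitKernel (Ω : Set V3) (φ : V3 → ℝ) (v x y : V3) (s : ℝ) : ℝ≥0∞ :=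
  Ω.indicator (bw Ω) x * (ipow (7 / 2) (x - y) * exitDiff Ω φ (x - s • v) (y - s • v) ^ 2)

theorem measurable_exitKernel (hΩ : MeasurableSet Ω) {φ : V3 → ℝ} (hφ : Measurable φ) (v : V3) :
    Measurable fun p : V3 × V3 × ℝ => exitKernel Ω φ v p.1 p.2.1 p.2.2 := by
  refine ((measurable_bw.indicator hΩ).comp measurable_fst).mul
    (Measurable.mul ?_ (Measurable.pow_const ?_ 2))
  · exact (measurable_ipow (7 / 2)).comp (f := fun p : V3 × V3 × ℝ => p.1 - p.2.1) (by fun_prop)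
  · exact (measurable_exitDiff hΩ hφ).comp
      (f := fun p : V3 × V3 × ℝ => (p.1 - p.2.2 • v, p.2.1 - p.2.2 • v)) (by fun_prop)

/-- Since `x - y` is unchanged when both points are shifted by `s v`, the integral over `y` is a
layer potential of `|φ|²` at the exterior point `x - s v`. -/
theorem lintegral_exitKernel (hΩ : MeasurableSet Ω) {φ : V3 → ℝ} (hφ : Measurable φ) (v : V3) :
    ∫⁻ x, ∫⁻ y, ∫⁻ s in Ioi (0 : ℝ), exitKernel Ω φ v x y s =
      ∫⁻ s in Ioi (0 : ℝ), ∫⁻ x, Ω.indicator (bw Ω) x *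
        outerPotential Ω (fun p => ‖φ p‖ₑ ^ 2) (x - s • v) := by
  rw [lintegral_rotate (measurable_exitKernel hΩ hφ v)]
  refine lintegral_congr fun s => lintegral_congr fun x => ?_
  have hs : Measurable fun y : V3 =>
      ipow (7 / 2) (x - y) * exitDiff Ω φ (x - s • v) (y - s • v) ^ 2 := by
    refine Measurable.mul ((measurable_ipow (7 / 2)).comp (f := fun y : V3 => x - y) (by fun_prop))
      (Measurable.pow_const ?_ 2)
    exact (measurable_exitDiff hΩ hφ).comp (f := fun y : V3 => (x - s • v, y - s • v)) (by fun_prop)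
  simp only [exitKernel]
  rw [lintegral_const_mul _ hs]
  congr 1
  by_cases ha : x - s • v ∈ Ω
  · simp [outerPotential, exitDiff, ha]
  · rw [outerPotential, indicator_of_mem (show x - s • v ∈ Ωᶜ from ha),
      ← lintegral_indicator hΩ, ← lintegral_sub_right_eq_self
        (Ω.indicator fun p => ipow (7 / 2) (x - s • v - p) * ‖φ p‖ₑ ^ 2) (s • v)]
    refine lintegral_congr fun y => ?_
    by_cases hb : y - s • v ∈ Ω <;> simp [exitDiff, ha, hb]

/-- Cauchy–Schwarz in time over the set where the line of `x` has left `Ω` and that of `y` has not.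
Its length supplies `|x - y|^{1/2} dist(x, ∂Ω)^{-1/2}` and softens the kernel from `|x - y|⁻⁴` to
`|x - y|^{-7/2}`. -/
theorem IsConvexBody.lintegral_exit_le (hΩ : IsConvexBody Ω d) {v : V3} (hv : v ≠ 0) {φ : V3 → ℝ}
    (hφ : Measurable φ) (T : ℝ) :
    ∫⁻ x in Ω, ∫⁻ y in Ω, ipow 4 (x - y) *
      (∫⁻ s in Ioo 0 T, exitDiff Ω φ (x - s • v) (y - s • v)) ^ 2 ≤
      ENNReal.ofReal d * ipow 1 v * ∫⁻ s in Ioi (0 : ℝ), ∫⁻ x, Ω.indicator (bw Ω) x *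
        outerPotential Ω (fun p => ‖φ p‖ₑ ^ 2) (x - s • v) := by
  have hm := measurable_exitDiff hΩ.measurableSet hφ
  have hc : ENNReal.ofReal d * ipow 1 v ≠ ∞ :=
    ENNReal.mul_ne_top (by simp) (ipow_ne_top zero_le_one hv)
  have hpt : ∀ x ∈ Ω, ∀ y ∈ Ω, ipow 4 (x - y) *
      (∫⁻ s in Ioo 0 T, exitDiff Ω φ (x - s • v) (y - s • v)) ^ 2 ≤
      ENNReal.ofReal d * ipow 1 v * ∫⁻ s in Ioi (0 : ℝ), exitKernel Ω φ v x y s := by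
    intro x hx y hy
    have hs : Measurable fun s : ℝ => exitDiff Ω φ (x - s • v) (y - s • v) :=
      hm.comp (f := fun s : ℝ => (x - s • v, y - s • v)) (by fun_prop)
    let S : Set ℝ := {s : ℝ | 0 < s ∧ x - s • v ∉ Ω ∧ y - s • v ∈ Ω}
    have hS : MeasurableSet S := by
      have m1 : Measurable fun s : ℝ => x - s • v := by fun_prop
      have m2 : Measurable fun s : ℝ => y - s • v := by fun_prop
      exact measurableSet_Ioi.inter ((m1 hΩ.measurableSet.compl).inter (m2 hΩ.measurableSet))
    have h1 : ∫⁻ s in Ioo 0 T, exitDiff Ω φ (x - s • v) (y - s • v) ≤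
        ∫⁻ s in S, exitDiff Ω φ (x - s • v) (y - s • v) := by
      rw [← lintegral_indicator measurableSet_Ioo, ← lintegral_indicator hS]
      refine lintegral_mono fun s => ?_
      by_cases hsS : s ∈ S
      · rw [indicator_of_mem hsS]
        exact indicator_le_self _ _ _
      · rw [indicator_of_notMem hsS]
        by_cases hsT : s ∈ Ioo 0 T
        · rw [indicator_of_mem hsT]
          by_cases ha : x - s • v ∈ Ω
          · simp [exitDiff, ha]
          · by_cases hb : y - s • v ∈ Ω
            · exact absurd ⟨hsT.1, ha, hb⟩ hsS
            · simp [exitDiff, hb]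
        · rw [indicator_of_notMem hsT]
    have h2 := (pow_le_pow_left₀ zero_le h1 2).trans (sq_setLIntegral_le S (μ := volume) hs.aemeasurable)
    have h3 := hΩ.volume_exit_le hx hy hv
    calc _ ≤ ipow 4 (x - y) * ((ENNReal.ofReal d * ipow 1 v * ‖x - y‖ₑ ^ (1 / 2 : ℝ) * bw Ω x) *
          ∫⁻ s in Ioi (0 : ℝ), exitDiff Ω φ (x - s • v) (y - s • v) ^ 2) := by
          refine mul_le_mul_right (h2.trans (mul_le_mul' h3 ?_)) _
          exact lintegral_mono_set fun s hs => hs.1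
      _ = (ENNReal.ofReal d * ipow 1 v) * ((ipow 4 (x - y) * ‖x - y‖ₑ ^ (1 / 2 : ℝ)) * (bw Ω x *
          ∫⁻ s in Ioi (0 : ℝ), exitDiff Ω φ (x - s • v) (y - s • v) ^ 2)) := by ring
      _ ≤ (ENNReal.ofReal d * ipow 1 v) * (ipow (7 / 2) (x - y) * (bw Ω x *
          ∫⁻ s in Ioi (0 : ℝ), exitDiff Ω φ (x - s • v) (y - s • v) ^ 2)) :=
          mul_le_mul_right (mul_le_mul_left (ipow_four_mul_le _) _) _
      _ = _ := by
          congr 1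
          simp only [exitKernel, indicator_of_mem hx]
          rw [lintegral_const_mul _ ((hs.pow_const 2).const_mul _), lintegral_const_mul _ (hs.pow_const 2)]
          ring
  calc _ ≤ ∫⁻ x, ∫⁻ y, ENNReal.ofReal d * ipow 1 v * ∫⁻ s in Ioi (0 : ℝ), exitKernel Ω φ v x y s := by
        refine (setLIntegral_mono' hΩ.measurableSet fun x hx => ?_).trans
          (setLIntegral_le_lintegral Ω _)
        exact (setLIntegral_mono' hΩ.measurableSet fun y hy => hpt x hx y hy).trans
          (setLIntegral_le_lintegral _ _)
    _ = ENNReal.ofReal d * ipow 1 v * ∫⁻ x, ∫⁻ y, ∫⁻ s in Ioi (0 : ℝ), exitKernel Ω φ v x y s := by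
        rw [← lintegral_const_mul' _ _ hc]
        refine lintegral_congr fun x => ?_
        rw [lintegral_const_mul' _ _ hc]
    _ = _ := by rw [lintegral_exitKernel hΩ.measurableSet hφ]

end LinBoltzmann

namespace LinBoltzmann

variable {B : ℝ → ℝ → ℝ} {γ d : ℝ} {Ω : Set V3}

/-- Exchanging `x` and `y` shows that both exit terms have equal integrals, hence `8 = 4 + 4`. -/
theorem lintegral_lintegral_symm_add {a e : V3 → V3 → ℝ≥0∞}
    (hma : Measurable fun p : V3 × V3 => a p.1 p.2) (hme : Measurable fun p : V3 × V3 => e p.1 p.2) :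
    ∫⁻ x in Ω, ∫⁻ y in Ω, 2 * a x y + 4 * (e x y + e y x) =
      2 * (∫⁻ x in Ω, ∫⁻ y in Ω, a x y) + 8 * (∫⁻ x in Ω, ∫⁻ y in Ω, e x y) := by
  have hme' : Measurable fun p : V3 × V3 => e p.2 p.1 := hme.comp measurable_swap
  have hT3 : ∫⁻ x in Ω, ∫⁻ y in Ω, e y x = ∫⁻ x in Ω, ∫⁻ y in Ω, e x y :=
    lintegral_lintegral_swap hme'.aemeasurable
  have hax : ∀ x, Measurable (a x) := fun x => Measurable.of_uncurry_left (f := a) hma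
  have hex : ∀ x, Measurable (e x) := fun x => Measurable.of_uncurry_left (f := e) hme
  calc _ = ∫⁻ x in Ω, (2 * ∫⁻ y in Ω, a x y) + 4 * ((∫⁻ y in Ω, e x y) + ∫⁻ y in Ω, e y x) := by
        refine lintegral_congr fun x => ?_
        rw [lintegral_add_left ((hax x).const_mul _), lintegral_const_mul' _ _ (by simp),
          lintegral_const_mul' _ _ (by simp), lintegral_add_left (hex x)]
    _ = 2 * (∫⁻ x in Ω, ∫⁻ y in Ω, a x y) +
        4 * ((∫⁻ x in Ω, ∫⁻ y in Ω, e x y) + ∫⁻ x in Ω, ∫⁻ y in Ω, e y x) := by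
        have m1 : Measurable fun x => ∫⁻ y in Ω, a x y := hma.lintegral_prod_right'
        have m2 : Measurable fun x => ∫⁻ y in Ω, e x y := hme.lintegral_prod_right'
        rw [lintegral_add_left (m1.const_mul _), lintegral_const_mul' _ _ (by simp),
          lintegral_const_mul' _ _ (by simp), lintegral_add_left m2]
    _ = _ := by rw [hT3]; ring

theorem enorm_lineAvg_indicator_sub_sq_le (hΩ : MeasurableSet Ω) {ν : ℝ} (hν : 0 ≤ ν) {v : V3}
    {φ : V3 → ℝ} (hφ : Measurable φ) {T : ℝ} {x y : V3}
    (hx : ∫⁻ s in Ioo 0 T, ‖Ω.indicator φ (x - s • v)‖ₑ < ∞)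
    (hy : ∫⁻ s in Ioo 0 T, ‖Ω.indicator φ (y - s • v)‖ₑ < ∞) :
    ‖lineAvg ν T v (Ω.indicator φ) x - lineAvg ν T v (Ω.indicator φ) y‖ₑ ^ 2 ≤
      2 * (∫⁻ s in Ioo 0 T, insideDiff Ω φ (x - s • v) (y - s • v)) ^ 2 +
      4 * ((∫⁻ s in Ioo 0 T, exitDiff Ω φ (x - s • v) (y - s • v)) ^ 2 +
        (∫⁻ s in Ioo 0 T, exitDiff Ω φ (y - s • v) (x - s • v)) ^ 2) := by
  have mI : Measurable fun s : ℝ => insideDiff Ω φ (x - s • v) (y - s • v) :=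
    (measurable_insideDiff hΩ hφ).comp (f := fun s : ℝ => (x - s • v, y - s • v)) (by fun_prop)
  have mE : Measurable fun s : ℝ => exitDiff Ω φ (x - s • v) (y - s • v) :=
    (measurable_exitDiff hΩ hφ).comp (f := fun s : ℝ => (x - s • v, y - s • v)) (by fun_prop)
  have h1 : ‖lineAvg ν T v (Ω.indicator φ) x - lineAvg ν T v (Ω.indicator φ) y‖ₑ ≤
      (∫⁻ s in Ioo 0 T, insideDiff Ω φ (x - s • v) (y - s • v)) +
      ((∫⁻ s in Ioo 0 T, exitDiff Ω φ (x - s • v) (y - s • v)) +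
        ∫⁻ s in Ioo 0 T, exitDiff Ω φ (y - s • v) (x - s • v)) := by
    refine (enorm_lineAvg_sub_le hν (hφ.indicator hΩ) hx hy).trans ?_
    rw [← lintegral_add_left mE, ← lintegral_add_left mI]
    exact lintegral_mono fun s => enorm_indicator_sub_le φ _ _
  refine (pow_le_pow_left₀ zero_le h1 2).trans ((ennreal_add_sq_le _ _).trans ?_)
  refine (mul_le_mul_right (add_le_add_right (ennreal_add_sq_le _ _) _) _).trans (le_of_eq ?_)
  ring

/-- At each time the increment is interior, or belongs to exactly one exited point, or vanishes. The
interior part costs the squared time length, the exit parts give the layer potential. -/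
theorem IsConvexBody.gagliardo_lineAvg_le (hΩ : IsConvexBody Ω d) {ν : ℝ} (hν : 0 ≤ ν) {v : V3}
    (hv : v ≠ 0) {φ : V3 → ℝ} (hφ : Measurable φ) (hfin : ∫⁻ x in Ω, ‖φ x‖ₑ < ∞) (T : ℝ) :
    gagliardo Ω (lineAvg ν T v (Ω.indicator φ)) ≤
      2 * (ENNReal.ofReal T ^ 2 * gagliardo Ω φ) +
      8 * (ENNReal.ofReal d * ipow 1 v * ∫⁻ s in Ioi (0 : ℝ), ∫⁻ x, Ω.indicator (bw Ω) x *
        outerPotential Ω (fun p => ‖φ p‖ₑ ^ 2) (x - s • v)) := by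
  have hmφ : Measurable (Ω.indicator φ) := hφ.indicator hΩ.measurableSet
  have hmI := measurable_insideDiff hΩ.measurableSet hφ
  have hmE := measurable_exitDiff hΩ.measurableSet hφ
  have hi4 : Measurable fun p : V3 × V3 => ipow 4 (p.1 - p.2) :=
    (measurable_ipow 4).comp (measurable_fst.sub measurable_snd)
  have hma : Measurable fun p : V3 × V3 => ipow 4 (p.1 - p.2) *
      (∫⁻ s in Ioo 0 T, insideDiff Ω φ (p.1 - s • v) (p.2 - s • v)) ^ 2 := by
    have h1 : Measurable fun q : (V3 × V3) × ℝ =>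
        insideDiff Ω φ (q.1.1 - q.2 • v) (q.1.2 - q.2 • v) :=
      hmI.comp (f := fun q : (V3 × V3) × ℝ => (q.1.1 - q.2 • v, q.1.2 - q.2 • v)) (by fun_prop)
    exact hi4.mul (h1.lintegral_prod_right'.pow_const 2)
  have hme : Measurable fun p : V3 × V3 => ipow 4 (p.1 - p.2) *
      (∫⁻ s in Ioo 0 T, exitDiff Ω φ (p.1 - s • v) (p.2 - s • v)) ^ 2 := by
    have h1 : Measurable fun q : (V3 × V3) × ℝ =>
        exitDiff Ω φ (q.1.1 - q.2 • v) (q.1.2 - q.2 • v) :=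
      hmE.comp (f := fun q : (V3 × V3) × ℝ => (q.1.1 - q.2 • v, q.1.2 - q.2 • v)) (by fun_prop)
    exact hi4.mul (h1.lintegral_prod_right'.pow_const 2)
  have hae : ∀ᵐ x : V3, ∫⁻ s in Ioo 0 T, ‖Ω.indicator φ (x - s • v)‖ₑ < ∞ := by
    have hm : Measurable fun q : V3 × ℝ => ‖Ω.indicator φ (q.1 - q.2 • v)‖ₑ := by fun_prop
    refine ae_lt_top hm.lintegral_prod_right' ?_
    rw [lintegral_lintegral_comp_sub_smul T v hmφ.enorm]
    refine (ENNReal.mul_lt_top (by simp) ?_).ne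
    have : ∀ x, ‖Ω.indicator φ x‖ₑ = Ω.indicator (fun x => ‖φ x‖ₑ) x := fun x => by
      by_cases hx : x ∈ Ω <;> simp [hx]
    simp only [this]
    rwa [lintegral_indicator hΩ.measurableSet]
  refine le_trans ?_ ((lintegral_lintegral_symm_add (Ω := Ω) hma hme).le.trans
    (add_le_add (mul_le_mul_right (lintegral_inside_le hΩ.measurableSet T v hφ) _)
      (mul_le_mul_right (hΩ.lintegral_exit_le hv hφ T) _)))
  refine lintegral_mono_ae (ae_restrict_of_ae (hae.mono fun x hx => ?_))
  refine lintegral_mono_ae (ae_restrict_of_ae (hae.mono fun y hy => ?_))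
  refine (mul_le_mul_right (enorm_lineAvg_indicator_sub_sq_le hΩ.measurableSet hν hφ hx hy) _).trans
    (le_of_eq ?_)
  rw [ipow_sub_comm 4 y x]
  ring

/-- Extension of a function on phase space by zero outside `Ω`. -/
noncomputable def zeroExt (Ω : Set V3) (f : V3 × V3 → ℝ) : V3 × V3 → ℝ :=
  (Prod.fst ⁻¹' Ω).indicator f

theorem measurable_zeroExt (hΩ : MeasurableSet Ω) {f : V3 × V3 → ℝ} (hf : Measurable f) :
    Measurable (zeroExt Ω f) := hf.indicator (measurable_fst hΩ)

theorem zeroExt_of_mem {f : V3 × V3 → ℝ} {x : V3} (hx : x ∈ Ω) (v : V3) :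
    zeroExt Ω f (x, v) = f (x, v) := indicator_of_mem (show (x, v) ∈ Prod.fst ⁻¹' Ω from hx) f

theorem zeroExt_of_notMem {f : V3 × V3 → ℝ} {x : V3} (hx : x ∉ Ω) (v : V3) :
    zeroExt Ω f (x, v) = 0 := indicator_of_notMem (show (x, v) ∉ Prod.fst ⁻¹' Ω from hx) f

/-- By convexity a line that has left `Ω` never returns, so the zero extension makes the integrand
vanish from the exit time up to `d/|v|`. -/
theorem IsConvexBody.opS_eq_truncS (hΩ : IsConvexBody Ω d) (f : V3 × V3 → ℝ) {x : V3} (hx : x ∈ Ω)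
    (v : V3) : opS Ω B f (x, v) = truncS d B (zeroExt Ω f) (x, v) := by
  rw [opS, truncS, lineAvg]
  dsimp only
  -- For `v = 0` both sides are integrals over an empty range: the exit set is empty, so its `sInf`
  -- is `0`, and `d/0 = 0`.
  rcases eq_or_ne v 0 with rfl | hv
  · have : tauMinus Ω x 0 = 0 := by simp [tauMinus, hx]
    simp [this]
  rw [intervalIntegral.integral_of_le (tauMinus_nonneg _ _), integral_Ioc_eq_integral_Ioo,
    ← integral_indicator measurableSet_Ioo, ← integral_indicator measurableSet_Ioo]
  congr 1
  ext s
  have hle := hΩ.tauMinus_le hx hv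
  by_cases h1 : s ∈ Ioo 0 (tauMinus Ω x v)
  · rw [indicator_of_mem h1, indicator_of_mem (show s ∈ Ioo 0 (d / ‖v‖) from ⟨h1.1, h1.2.trans_le hle⟩),
      zeroExt_of_mem ((hΩ.mem_iff hx hv h1.1.le).2 h1.2)]
  · rw [indicator_of_notMem h1]
    by_cases h2 : s ∈ Ioo 0 (d / ‖v‖)
    · rw [indicator_of_mem h2, zeroExt_of_notMem, mul_zero]
      exact fun hm => h1 ⟨h2.1, (hΩ.mem_iff hx hv h2.1.le).1 hm⟩
    · rw [indicator_of_notMem h2]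

theorem IsConvexBody.one_le_bw (hΩ : IsConvexBody Ω d) {x : V3} (hx : x ∈ Ω) :
    1 ≤ ENNReal.ofReal d ^ (1 / 2 : ℝ) * bw Ω x := by
  have hd := hΩ.diam_pos
  have hδ := hΩ.infDist_pos hx
  have h1 : Metric.infDist x Ωᶜ ≤ d := by
    obtain ⟨v, hv⟩ := exists_norm_eq V3 (zero_le_one)
    have hv0 : v ≠ 0 := by rw [← norm_pos_iff, hv]; exact one_pos
    have h2 := (hΩ.exitSet_nonempty hx hv0).2
    refine (Metric.infDist_le_dist_of_mem (show x - (d / ‖v‖) • v ∈ Ωᶜ from h2)).trans ?_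
    rw [dist_eq_norm, sub_sub_cancel, hv, div_one, norm_smul, hv, mul_one, Real.norm_of_nonneg hd.le]
  rw [hΩ.bw_eq hx, ENNReal.ofReal_rpow_of_pos hd, ← ENNReal.ofReal_mul (by positivity),
    ENNReal.one_le_ofReal, ← Real.mul_rpow hd.le (by positivity)]
  refine Real.one_le_rpow ?_ (by norm_num)
  rw [← div_eq_mul_inv, one_le_div hδ]
  exact h1

end LinBoltzmann

/-! ### Weighted bounds for `K`, for `S K` and for the layer potential. -/

namespace LinBoltzmann

variable {B : ℝ → ℝ → ℝ} {γ d : ℝ} {Ω : Set V3}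

theorem measurable_gk_sub (a c : ℝ) (v : V3) : Measurable fun w : V3 => gk a c (v - w) :=
  (measurable_gk a c).comp (measurable_const.sub measurable_id)

theorem measurable_gk_sub₂ (a c : ℝ) : Measurable fun p : V3 × V3 => gk a c (p.1 - p.2) :=
  (measurable_gk a c).comp (measurable_fst.sub measurable_snd)

theorem measurable_one_add_ipow : Measurable fun v : V3 => 1 + ipow 2 v :=
  measurable_const.add (measurable_ipow 2)

/-- Each application of `S` costs a weight `|v|⁻²`; the velocity kernel of `K` absorbs it. -/
theorem exists_lintegral_convolution_le :
    ∃ C : ℝ≥0, ∀ Φ : V3 → ℝ≥0∞, Measurable Φ →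
      ∫⁻ v, (1 + ipow 2 v) * ∫⁻ w, gk (1 / 2) (1 / 16) (v - w) * Φ w ≤ C * ∫⁻ w, Φ w := by
  obtain ⟨C, hC⟩ := exists_lintegral_ipow_two_mul_gk_le (1 / 16) (by norm_num)
  refine ⟨C, fun Φ hΦ => ?_⟩
  have hg := measurable_gk_sub₂ (1 / 2) (1 / 16)
  calc _ = ∫⁻ v, ∫⁻ w, (1 + ipow 2 v) * (gk (1 / 2) (1 / 16) (v - w) * Φ w) := by
        refine lintegral_congr fun v => ?_
        have hm : Measurable fun w => gk (1 / 2) (1 / 16) (v - w) * Φ w :=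
          (measurable_gk_sub _ _ v).mul hΦ
        rw [lintegral_const_mul _ hm]
    _ = ∫⁻ w, ∫⁻ v, (1 + ipow 2 v) * (gk (1 / 2) (1 / 16) (v - w) * Φ w) := by
        refine lintegral_lintegral_swap (Measurable.aemeasurable ?_)
        exact (measurable_one_add_ipow.comp measurable_fst).mul (hg.mul (hΦ.comp measurable_snd))
    _ = ∫⁻ w, (∫⁻ v, (1 + ipow 2 v) * gk (1 / 2) (1 / 16) (v - w)) * Φ w := by
        refine lintegral_congr fun w => ?_
        have hg' : Measurable fun v : V3 => gk (1 / 2) (1 / 16) (v - w) :=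
          (measurable_gk _ _).comp (measurable_id.sub measurable_const)
        have hm : Measurable fun v : V3 => (1 + ipow 2 v) * gk (1 / 2) (1 / 16) (v - w) :=
          measurable_one_add_ipow.mul hg'
        rw [← lintegral_mul_const _ hm]
        simp only [mul_assoc]
    _ ≤ ∫⁻ w, C * Φ w := lintegral_mono fun w => mul_le_mul_left (hC w) _
    _ = _ := lintegral_const_mul' _ _ ENNReal.coe_ne_top

/-- The measure in `x` is arbitrary because `K` acts in `v` only; both Lebesgue measure on the whole
space and its restriction to `Ω` are used. -/
theorem exists_lintegral_opK_sq_le (hγ : γ ∈ Icc (0 : ℝ) 1) (hB : IsCutoff B γ) :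
    ∃ C : ℝ≥0, ∀ (μ : Measure V3) [SFinite μ] (f : V3 × V3 → ℝ), Measurable f →
      ∫⁻ v, (1 + ipow 2 v) * ∫⁻ x, ‖opK B f (x, v)‖ₑ ^ 2 ∂μ ≤
        C * ∫⁻ w, (∫⁻ x, ‖f (x, w)‖ₑ ^ 2 ∂μ) := by
  obtain ⟨C₁, hC₁⟩ := exists_collisionK_sq_le hγ hB
  obtain ⟨C₂, hC₂⟩ := exists_lintegral_convolution_le
  refine ⟨C₁ * C₂, fun μ _ f hf => ?_⟩
  have hf2 : Measurable fun p : V3 × V3 => ‖f p‖ₑ ^ 2 := by fun_prop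
  calc _ ≤ ∫⁻ v, (1 + ipow 2 v) *
        (C₁ * ∫⁻ w, gk (1 / 2) (1 / 16) (v - w) * ∫⁻ x, ‖f (x, w)‖ₑ ^ 2 ∂μ) := by
        refine lintegral_mono fun v => mul_le_mul_right ?_ _
        calc ∫⁻ x, ‖opK B f (x, v)‖ₑ ^ 2 ∂μ
            ≤ ∫⁻ x, (C₁ * ∫⁻ w, gk (1 / 2) (1 / 16) (v - w) * ‖f (x, w)‖ₑ ^ 2) ∂μ :=
              lintegral_mono fun x => hC₁ v _ (Measurable.aestronglyMeasurable (by fun_prop))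
          _ = C₁ * ∫⁻ w, (∫⁻ x, gk (1 / 2) (1 / 16) (v - w) * ‖f (x, w)‖ₑ ^ 2 ∂μ) := by
              rw [lintegral_const_mul' _ _ ENNReal.coe_ne_top, lintegral_lintegral_swap]
              exact (((measurable_gk_sub _ _ v).comp measurable_snd).mul hf2).aemeasurable
          _ = C₁ * ∫⁻ w, gk (1 / 2) (1 / 16) (v - w) * ∫⁻ x, ‖f (x, w)‖ₑ ^ 2 ∂μ := by
              congr 1
              refine lintegral_congr fun w => ?_
              have hm : Measurable fun x => ‖f (x, w)‖ₑ ^ 2 := by fun_prop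
              rw [lintegral_const_mul _ hm]
    _ = C₁ * ∫⁻ v, (1 + ipow 2 v) *
        ∫⁻ w, gk (1 / 2) (1 / 16) (v - w) * ∫⁻ x, ‖f (x, w)‖ₑ ^ 2 ∂μ := by
        rw [← lintegral_const_mul' _ _ ENNReal.coe_ne_top]
        refine lintegral_congr fun v => ?_
        ring
    _ ≤ _ := by
        rw [ENNReal.coe_mul, mul_assoc]
        exact mul_le_mul_right (hC₂ _ hf2.lintegral_prod_left') _

/-- The boundary weight does no harm after `S K`: spread over all lines by the velocity average,
`dist^{-1/2}` enters only through its bounded Riesz potential. -/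
theorem IsConvexBody.exists_lintegral_bw_truncS_le (hΩ : IsConvexBody Ω d)
    (hγ : γ ∈ Icc (0 : ℝ) 1) (hB : IsCutoff B γ) :
    ∃ C : ℝ≥0, ∀ f : V3 × V3 → ℝ, Measurable f →
      ∫⁻ v, ∫⁻ x in Ω, bw Ω x * ‖truncS d B (opK B f) (x, v)‖ₑ ^ 2 ≤
        C * ∫⁻ w, ∫⁻ x, ‖f (x, w)‖ₑ ^ 2 := by
  obtain ⟨C₁, hC₁⟩ := exists_collisionK_sq_le hγ hB
  have hmω : Measurable (Ω.indicator (bw Ω)) := measurable_bw.indicator hΩ.measurableSet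
  obtain ⟨D, hD⟩ := hΩ.exists_lintegral_indicator_bw_le
  obtain ⟨C₂, hC₂⟩ := exists_lintegral_weight_kernel_le (c := 1 / 16) (by norm_num) hmω hD
  refine ⟨d.toNNReal * C₁ * C₂, fun f hf => ?_⟩
  have hK : Measurable (opK B f) := measurable_opK hB hf
  have hf2 : Measurable fun p : V3 × V3 => ‖f p‖ₑ ^ 2 := by fun_prop
  have hpt : ∀ v : V3, v ≠ 0 → ∫⁻ x in Ω, bw Ω x * ‖truncS d B (opK B f) (x, v)‖ₑ ^ 2 ≤
      d.toNNReal * C₁ * (ipow 1 v * ∫⁻ s in Ioi (0 : ℝ), ∫⁻ x, Ω.indicator (bw Ω) x *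
        ∫⁻ w, gk (1 / 2) (1 / 16) (v - w) * ‖f (x - s • v, w)‖ₑ ^ 2) := by
    intro v hv
    have hg := measurable_gk_sub (1 / 2) (1 / 16) v
    have mg : Measurable fun q : (V3 × ℝ) × V3 =>
        gk (1 / 2) (1 / 16) (v - q.2) * ‖f (q.1.1 - q.1.2 • v, q.2)‖ₑ ^ 2 :=
      (hg.comp measurable_snd).mul (by fun_prop)
    let J : V3 → ℝ → ℝ≥0∞ := fun x s => ∫⁻ w, gk (1 / 2) (1 / 16) (v - w) * ‖f (x - s • v, w)‖ₑ ^ 2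
    have mJ : Measurable fun p : V3 × ℝ => J p.1 p.2 := mg.lintegral_prod_right'
    have hu : ∀ x, ‖truncS d B (opK B f) (x, v)‖ₑ ^ 2 ≤
        ENNReal.ofReal d * ipow 1 v * (C₁ * ∫⁻ s in Ioi (0 : ℝ), J x s) := by
      intro x
      have h1 := enorm_lineAvg_sq_le (collisionFrequency_nonneg hB v) (d / ‖v‖) v
        (φ := fun x => opK B f (x, v)) (by fun_prop) x
      rw [ofReal_div_norm d hv] at h1
      refine h1.trans (mul_le_mul_right ?_ _)
      rw [← lintegral_const_mul' _ _ ENNReal.coe_ne_top]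
      refine (lintegral_mono_set fun s hs => hs.1).trans (lintegral_mono fun s => ?_)
      exact hC₁ v _ (Measurable.aestronglyMeasurable (by fun_prop))
    calc _ = ∫⁻ x, Ω.indicator (bw Ω) x * ‖truncS d B (opK B f) (x, v)‖ₑ ^ 2 := by
          rw [← lintegral_indicator hΩ.measurableSet]
          refine lintegral_congr fun x => ?_
          by_cases hx : x ∈ Ω <;> simp [hx]
      _ ≤ ∫⁻ x, ENNReal.ofReal d * C₁ * (ipow 1 v *
            ∫⁻ s in Ioi (0 : ℝ), Ω.indicator (bw Ω) x * J x s) := by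
          refine lintegral_mono fun x => (mul_le_mul_right (hu x) _).trans (le_of_eq ?_)
          have : Measurable (J x) := Measurable.of_uncurry_left (f := J) mJ
          rw [lintegral_const_mul _ this]
          ring
      _ = _ := by
          rw [lintegral_const_mul' _ _ (by simp [ENNReal.mul_eq_top]),
            lintegral_const_mul' _ _ (ipow_ne_top zero_le_one hv), lintegral_lintegral_swap]
          · rfl
          · exact ((hmω.comp measurable_fst).mul mJ).aemeasurable
  calc _ ≤ ∫⁻ v, d.toNNReal * C₁ * (ipow 1 v * ∫⁻ s in Ioi (0 : ℝ), ∫⁻ x, Ω.indicator (bw Ω) x *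
        ∫⁻ w, gk (1 / 2) (1 / 16) (v - w) * ‖f (x - s • v, w)‖ₑ ^ 2) :=
        lintegral_mono_ae (ae_ne_zero_V3.mono hpt)
    _ ≤ d.toNNReal * C₁ * (C₂ * ∫⁻ w, ∫⁻ x, ‖f (x, w)‖ₑ ^ 2) := by
        rw [lintegral_const_mul' _ _ (by simp [ENNReal.mul_eq_top])]
        exact mul_le_mul_right (hC₂ _ hf2) _
    _ = _ := by push_cast; ring

theorem IsConvexBody.exists_lintegral_outerPotential_le (hΩ : IsConvexBody Ω d) :
    ∃ C : ℝ≥0, ∀ φ : V3 → ℝ≥0∞, Measurable φ →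
      ∫⁻ a, outerPotential Ω φ a ≤ C * ∫⁻ p in Ω, bw Ω p * φ p := by
  obtain ⟨C, hC⟩ := hΩ.exists_lintegral_compl_ipow_le
  refine ⟨C, fun φ hφ => ?_⟩
  have hi : Measurable fun p : V3 × V3 => ipow (7 / 2) (p.1 - p.2) :=
    (measurable_ipow _).comp (measurable_fst.sub measurable_snd)
  unfold outerPotential
  rw [lintegral_indicator hΩ.measurableSet.compl, lintegral_lintegral_swap
    (hi.mul (hφ.comp measurable_snd)).aemeasurable, ← lintegral_const_mul' _ _ ENNReal.coe_ne_top]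
  refine setLIntegral_mono' hΩ.measurableSet fun p hp => ?_
  have hi' : Measurable fun a : V3 => ipow (7 / 2) (a - p) :=
    (measurable_ipow _).comp (measurable_id.sub measurable_const)
  rw [lintegral_mul_const _ hi', ← mul_assoc]
  exact mul_le_mul_left (hC p hp) _

theorem measurable_outerPotential (hΩ : MeasurableSet Ω) {φ : V3 × V3 → ℝ≥0∞} (hφ : Measurable φ) :
    Measurable fun q : V3 × V3 => outerPotential Ω (fun p => φ (p, q.2)) q.1 := by
  have e : (fun q : V3 × V3 => outerPotential Ω (fun p => φ (p, q.2)) q.1) =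
      (Prod.fst ⁻¹' Ωᶜ).indicator fun q => ∫⁻ p in Ω, ipow (7 / 2) (q.1 - p) * φ (p, q.2) := by
    ext q
    by_cases hq : q.1 ∈ Ω <;> simp [outerPotential, hq]
  rw [e]
  refine Measurable.indicator ?_ (measurable_fst hΩ.compl)
  have hi : Measurable fun p : (V3 × V3) × V3 => ipow (7 / 2) (p.1.1 - p.2) :=
    (measurable_ipow _).comp (by fun_prop)
  have hm : Measurable fun p : (V3 × V3) × V3 => ipow (7 / 2) (p.1.1 - p.2) * φ (p.2, p.1.2) :=
    hi.mul (by fun_prop)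
  exact hm.lintegral_prod_right'

/-- The layer potential is linear and monotone in its density, so it commutes with the velocity
kernel that bounds `|K u|²`. -/
theorem outerPotential_kernel_le {C : ℝ≥0} {v : V3} {φ : V3 → ℝ≥0∞} {ψ : V3 × V3 → ℝ≥0∞}
    (hψ : Measurable ψ) (h : ∀ p, φ p ≤ C * ∫⁻ w, gk (1 / 2) (1 / 16) (v - w) * ψ (p, w)) (a : V3) :
    outerPotential Ω φ a ≤
      C * ∫⁻ w, gk (1 / 2) (1 / 16) (v - w) * outerPotential Ω (fun p => ψ (p, w)) a := by
  by_cases ha : a ∈ Ω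
  · simp [outerPotential, ha]
  have hg := measurable_gk_sub (1 / 2) (1 / 16) v
  have hi : Measurable fun p : V3 => ipow (7 / 2) (a - p) :=
    (measurable_ipow _).comp (measurable_const.sub measurable_id)
  simp only [outerPotential, indicator_of_mem (show a ∈ Ωᶜ from ha)]
  calc _ ≤ ∫⁻ p in Ω, ∫⁻ w, C * (gk (1 / 2) (1 / 16) (v - w) * (ipow (7 / 2) (a - p) * ψ (p, w))) := by
        refine lintegral_mono fun p => (mul_le_mul_right (h p) _).trans (le_of_eq ?_)
        have hm : Measurable fun w => gk (1 / 2) (1 / 16) (v - w) * ψ (p, w) := hg.mul (by fun_prop)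
        rw [lintegral_const_mul' _ _ ENNReal.coe_ne_top, mul_left_comm, ← lintegral_const_mul _ hm]
        congr 1
        refine lintegral_congr fun w => ?_
        ring
    _ = ∫⁻ w, ∫⁻ p in Ω, C * (gk (1 / 2) (1 / 16) (v - w) * (ipow (7 / 2) (a - p) * ψ (p, w))) := by
        refine lintegral_lintegral_swap (Measurable.aemeasurable ?_)
        exact ((hg.comp measurable_snd).mul ((hi.comp measurable_fst).mul hψ)).const_mul _
    _ = _ := by
        rw [← lintegral_const_mul' _ _ ENNReal.coe_ne_top]
        refine lintegral_congr fun w => ?_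
        have hm : Measurable fun p => ipow (7 / 2) (a - p) * ψ (p, w) := hi.mul (by fun_prop)
        rw [lintegral_const_mul' _ _ ENNReal.coe_ne_top, lintegral_const_mul _ hm]

end LinBoltzmann

/-! ### The twofold estimate for functions vanishing outside `Ω`. -/

namespace LinBoltzmann

variable {B : ℝ → ℝ → ℝ} {γ d : ℝ} {Ω : Set V3}

theorem IsConvexBody.lintegral_le_bw (hΩ : IsConvexBody Ω d) (φ : V3 → ℝ≥0∞) :
    ∫⁻ x in Ω, φ x ≤ ENNReal.ofReal d ^ (1 / 2 : ℝ) * ∫⁻ x in Ω, bw Ω x * φ x := by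
  rw [← lintegral_const_mul' _ _ (ENNReal.rpow_ne_top_of_nonneg (by norm_num) (by simp))]
  refine setLIntegral_mono' hΩ.measurableSet fun x hx => ?_
  rw [← mul_assoc]
  exact le_mul_of_one_le_left zero_le (hΩ.one_le_bw hx)

/-- The transport operator composed with `K` preserves half a derivative in `x`, up to a weighted
norm that accounts for the boundary. -/
theorem IsConvexBody.exists_gagliardo_transport_le (hΩ : IsConvexBody Ω d)
    (hγ : γ ∈ Icc (0 : ℝ) 1) (hB : IsCutoff B γ) :
    ∃ C : ℝ≥0, ∀ u : V3 × V3 → ℝ, Measurable u →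
      ∫⁻ v, gagliardo Ω (fun x => truncS d B (zeroExt Ω (opK B u)) (x, v)) ≤
        C * ((∫⁻ v, ipow 2 v * gagliardo Ω (fun x => opK B u (x, v))) +
          ∫⁻ w, ∫⁻ p in Ω, bw Ω p * ‖u (p, w)‖ₑ ^ 2) := by
  obtain ⟨C₁, hC₁⟩ := exists_collisionK_sq_le hγ hB
  obtain ⟨C₀, hC₀⟩ := exists_lintegral_opK_sq_le hγ hB
  have hmω : Measurable (Ω.indicator (bw Ω)) := measurable_bw.indicator hΩ.measurableSet
  obtain ⟨D, hD⟩ := hΩ.exists_lintegral_indicator_bw_le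
  obtain ⟨C₂, hC₂⟩ := exists_lintegral_weight_kernel_le (c := 1 / 16) (by norm_num) hmω hD
  obtain ⟨C₃, hC₃⟩ := hΩ.exists_lintegral_outerPotential_le
  have hd := hΩ.diam_pos
  set d' : ℝ≥0 := d.toNNReal with hd'
  have hdd : ENNReal.ofReal d = d' := rfl
  refine ⟨2 * d' ^ 2 + 8 * (d' * C₁ * (C₂ * C₃)) + 1, fun u hu => ?_⟩
  set A := ∫⁻ v, ipow 2 v * gagliardo Ω (fun x => opK B u (x, v)) with hA
  set W := ∫⁻ w, ∫⁻ p in Ω, bw Ω p * ‖u (p, w)‖ₑ ^ 2 with hW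
  rcases eq_or_ne W ∞ with hWt | hWt
  · rw [hWt, add_top, ENNReal.mul_top (by simp)]; exact le_top
  have hK : Measurable (opK B u) := measurable_opK hB hu
  have hu2 : Measurable fun p : V3 × V3 => ‖u p‖ₑ ^ 2 := by fun_prop
  have hfin : ∀ᵐ v, ∫⁻ x in Ω, ‖opK B u (x, v)‖ₑ < ∞ := by
    have h1 : ∫⁻ w, ∫⁻ x in Ω, ‖u (x, w)‖ₑ ^ 2 < ∞ := by
      refine lt_of_le_of_lt (lintegral_mono fun w => hΩ.lintegral_le_bw _) ?_
      rw [lintegral_const_mul' _ _ (ENNReal.rpow_ne_top_of_nonneg (by norm_num) (by simp))]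
      exact ENNReal.mul_lt_top (ENNReal.rpow_lt_top_of_nonneg (by norm_num) (by simp)) hWt.lt_top
    have h2 := (hC₀ (volume.restrict Ω) u hu).trans_lt (ENNReal.mul_lt_top ENNReal.coe_lt_top h1)
    have hm : Measurable fun p : V3 × V3 => ‖opK B u p‖ₑ ^ 2 := by fun_prop
    have hm2 : Measurable fun v : V3 => (1 + ipow 2 v) * ∫⁻ x in Ω, ‖opK B u (x, v)‖ₑ ^ 2 :=
      measurable_one_add_ipow.mul hm.lintegral_prod_left'
    refine (ae_lt_top hm2 h2.ne).mono fun v hv => ?_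
    have h3 := ENNReal.lt_top_of_mul_ne_top_right hv.ne (by simp)
    have hmv : Measurable fun x => ‖opK B u (x, v)‖ₑ := by fun_prop
    have h4 := (sq_setLIntegral_le Ω (μ := volume) hmv.aemeasurable).trans_lt
      (ENNReal.mul_lt_top hΩ.volume_lt_top h3)
    by_contra hn
    rw [not_lt, top_le_iff] at hn
    rw [hn] at h4
    simp at h4
  let F : V3 × V3 → ℝ≥0∞ := fun q => outerPotential Ω (fun p => ‖u (p, q.2)‖ₑ ^ 2) q.1
  have hF : Measurable F := measurable_outerPotential hΩ.measurableSet hu2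
  let Z : V3 → ℝ≥0∞ := fun v => ipow 1 v * ∫⁻ s in Ioi (0 : ℝ), ∫⁻ x, Ω.indicator (bw Ω) x *
    ∫⁻ w, gk (1 / 2) (1 / 16) (v - w) * F (x - s • v, w)
  have hZ : ∫⁻ v, Z v ≤ C₂ * (C₃ * W) := by
    refine (hC₂ F hF).trans (mul_le_mul_right ?_ _)
    rw [← lintegral_const_mul' _ _ ENNReal.coe_ne_top]
    exact lintegral_mono fun w => hC₃ _ (by fun_prop)
  have hpt : ∀ᵐ v, gagliardo Ω (fun x => truncS d B (zeroExt Ω (opK B u)) (x, v)) ≤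
      2 * d' ^ 2 * (ipow 2 v * gagliardo Ω (fun x => opK B u (x, v))) + 8 * (d' * C₁) * Z v := by
    refine (hfin.and ae_ne_zero_V3).mono ?_
    rintro v ⟨hv, hv0⟩
    have hmv : Measurable fun x => opK B u (x, v) := by fun_prop
    refine (hΩ.gagliardo_lineAvg_le (collisionFrequency_nonneg hB v) hv0 hmv hv (d / ‖v‖)).trans ?_
    refine add_le_add (le_of_eq ?_) ?_
    · rw [ofReal_div_norm d hv0, hdd, mul_pow, show ipow 1 v ^ 2 = ipow 2 v by
        rw [ipow, ipow, ENNReal.rpow_one, ENNReal.rpow_two]]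
      ring
    · calc _ ≤ 8 * (ENNReal.ofReal d * ipow 1 v * ∫⁻ s in Ioi (0 : ℝ), ∫⁻ x, Ω.indicator (bw Ω) x *
            (C₁ * ∫⁻ w, gk (1 / 2) (1 / 16) (v - w) * F (x - s • v, w))) := by
            refine mul_le_mul_right (mul_le_mul_right ?_ _) _
            refine lintegral_mono fun s => lintegral_mono fun x => mul_le_mul_right ?_ _
            refine outerPotential_kernel_le (ψ := fun p => ‖u p‖ₑ ^ 2) hu2 (fun p => ?_) _
            exact hC₁ v _ (Measurable.aestronglyMeasurable (by fun_prop))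
        _ = 8 * (ENNReal.ofReal d * ipow 1 v * (C₁ * ∫⁻ s in Ioi (0 : ℝ), ∫⁻ x,
            Ω.indicator (bw Ω) x * ∫⁻ w, gk (1 / 2) (1 / 16) (v - w) * F (x - s • v, w))) := by
            congr 2
            rw [← lintegral_const_mul' _ _ ENNReal.coe_ne_top]
            refine lintegral_congr fun s => ?_
            rw [← lintegral_const_mul' _ _ ENNReal.coe_ne_top]
            refine lintegral_congr fun x => ?_
            rw [mul_left_comm]
        _ = _ := by simp only [Z, hdd]; ring
  have hc2 : (2 * (d' : ℝ≥0∞) ^ 2) ≠ ∞ := by simp [ENNReal.mul_eq_top]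
  have hc8 : (8 * ((d' : ℝ≥0∞) * C₁)) ≠ ∞ := by simp [ENNReal.mul_eq_top]
  have hZm : Measurable Z := by
    have g1 : Measurable fun q : ((V3 × ℝ) × V3) × V3 =>
        gk (1 / 2) (1 / 16) (q.1.1.1 - q.2) * F (q.1.2 - q.1.1.2 • q.1.1.1, q.2) := by
      have : Measurable fun q : ((V3 × ℝ) × V3) × V3 => gk (1 / 2) (1 / 16) (q.1.1.1 - q.2) :=
        (measurable_gk _ _).comp (by fun_prop)
      exact this.mul (by fun_prop)
    have g2 : Measurable fun q : (V3 × ℝ) × V3 => Ω.indicator (bw Ω) q.2 *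
        ∫⁻ w, gk (1 / 2) (1 / 16) (q.1.1 - w) * F (q.2 - q.1.2 • q.1.1, w) :=
      (hmω.comp measurable_snd).mul g1.lintegral_prod_right'
    exact (measurable_ipow 1).mul (g2.lintegral_prod_right'.lintegral_prod_right')
  calc _ ≤ ∫⁻ v, (2 * d' ^ 2 * (ipow 2 v * gagliardo Ω (fun x => opK B u (x, v))) +
        8 * (d' * C₁) * Z v) := lintegral_mono_ae hpt
    _ = 2 * d' ^ 2 * A + 8 * (d' * C₁) * ∫⁻ v, Z v := by
        rw [lintegral_add_right _ (hZm.const_mul _), lintegral_const_mul' _ _ hc2,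
          lintegral_const_mul' _ _ hc8]
    _ ≤ 2 * d' ^ 2 * A + 8 * (d' * C₁) * (C₂ * (C₃ * W)) := by gcongr
    _ ≤ 2 * d' ^ 2 * (A + W) + 8 * (d' * C₁) * (C₂ * (C₃ * (A + W))) := by
        gcongr
        · exact le_self_add
        · exact le_add_self
    _ = ((2 * d' ^ 2 + 8 * (d' * C₁ * (C₂ * C₃)) : ℝ≥0) : ℝ≥0∞) * (A + W) := by push_cast; ring
    _ ≤ _ := by
        refine mul_le_mul_left ?_ _
        exact_mod_cast le_self_add

theorem opK_eq_zero_of_notMem {f : V3 × V3 → ℝ} (hf : ∀ x, x ∉ Ω → ∀ w, f (x, w) = 0) :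
    ∀ x, x ∉ Ω → ∀ w, opK B f (x, w) = 0 := fun x hx w => opK_sub_eq_zero (hf x hx) w

/-- The averaging gain for data `K f`. The weight `|v|⁻²` on the left belongs to the outer
transport; the inner one is absorbed by the velocity regularity of `K f`. -/
theorem IsConvexBody.exists_gagliardo_opK_truncS_le (hΩ : IsConvexBody Ω d)
    (hγ : γ ∈ Icc (0 : ℝ) 1) (hB : IsCutoff B γ) :
    ∃ C : ℝ≥0, ∀ f : V3 × V3 → ℝ, Measurable f → (∀ x, x ∉ Ω → ∀ w, f (x, w) = 0) →
      ∫⁻ v, ipow 2 v * gagliardo Ω (fun x => opK B (truncS d B (opK B f)) (x, v)) ≤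
        C * ∫⁻ w, ∫⁻ x, ‖f (x, w)‖ₑ ^ 2 := by
  obtain ⟨C₁, hC₁⟩ := hΩ.exists_averaging_le hγ hB
  obtain ⟨C₂, hC₂⟩ := exists_lintegral_convolution_le
  obtain ⟨C₃, hC₃⟩ := exists_lintegral_opK_sq_le hγ hB
  refine ⟨C₁ * (C₂ * C₃), fun f hf hsupp => ?_⟩
  have hK : Measurable (opK B f) := measurable_opK hB hf
  have hK2 : Measurable fun p : V3 × V3 => ‖opK B f p‖ₑ ^ 2 := by fun_prop
  have hΦ : Measurable fun w : V3 => (1 + ipow 2 w) * ∫⁻ x, ‖opK B f (x, w)‖ₑ ^ 2 :=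
    measurable_one_add_ipow.mul hK2.lintegral_prod_left'
  calc _ ≤ ∫⁻ v, C₁ * ((1 + ipow 2 v) * ∫⁻ w, gk (1 / 2) (1 / 16) (v - w) *
        ((1 + ipow 2 w) * ∫⁻ x, ‖opK B f (x, w)‖ₑ ^ 2)) := by
        refine lintegral_mono fun v => ?_
        rw [mul_left_comm]
        refine mul_le_mul' le_add_self ?_
        exact (gagliardo_mono (subset_univ _) _).trans (hC₁ _ hK (opK_eq_zero_of_notMem hsupp) v)
    _ ≤ C₁ * (C₂ * ∫⁻ w, (1 + ipow 2 w) * ∫⁻ x, ‖opK B f (x, w)‖ₑ ^ 2) := by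
        rw [lintegral_const_mul' _ _ ENNReal.coe_ne_top]
        exact mul_le_mul_right (hC₂ _ hΦ) _
    _ ≤ C₁ * (C₂ * (C₃ * ∫⁻ w, ∫⁻ x, ‖f (x, w)‖ₑ ^ 2)) :=
        mul_le_mul_right (mul_le_mul_right (hC₃ volume f hf) _) _
    _ = _ := by push_cast; ring

/-- The regularity estimate for `S K S K` on functions that vanish outside `Ω`. -/
theorem IsConvexBody.exists_gagliardo_twofold_le (hΩ : IsConvexBody Ω d)
    (hγ : γ ∈ Icc (0 : ℝ) 1) (hB : IsCutoff B γ) :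
    ∃ C : ℝ≥0, ∀ f : V3 × V3 → ℝ, Measurable f → (∀ x, x ∉ Ω → ∀ w, f (x, w) = 0) →
      ∫⁻ v, gagliardo Ω (fun x => truncS d B (zeroExt Ω (opK B (truncS d B (opK B f)))) (x, v)) ≤
        C * ∫⁻ w, ∫⁻ x, ‖f (x, w)‖ₑ ^ 2 := by
  obtain ⟨C₁, hC₁⟩ := hΩ.exists_gagliardo_transport_le hγ hB
  obtain ⟨C₂, hC₂⟩ := hΩ.exists_gagliardo_opK_truncS_le hγ hB
  obtain ⟨C₃, hC₃⟩ := hΩ.exists_lintegral_bw_truncS_le hγ hB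
  refine ⟨C₁ * (C₂ + C₃), fun f hf hsupp => ?_⟩
  refine (hC₁ _ (measurable_truncS hB (measurable_opK hB hf))).trans ?_
  rw [ENNReal.coe_mul, ENNReal.coe_add, mul_assoc, add_mul]
  exact mul_le_mul_right (add_le_add (hC₂ f hf hsupp) (hC₃ f hf)) _

end LinBoltzmann

namespace LinBoltzmann

variable {B : ℝ → ℝ → ℝ} {γ d : ℝ} {Ω : Set V3}

/-! ### Measurable representatives -/

/-- On the diagonal the two sides follow different conventions: real division by `0` gives `0`,
whereas `ipow 4 0 = ∞`. There the increment vanishes, so the alternative is harmless. -/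
theorem ofReal_sq_div_eq_ipow (t : ℝ) (z : V3) :
    ENNReal.ofReal (|t| ^ 2 / ‖z‖ ^ (3 + 2 * (1 / 2 : ℝ))) = ipow 4 z * ‖t‖ₑ ^ 2 ∨ z = 0 := by
  rcases eq_or_ne z 0 with hz | hz
  · exact Or.inr hz
  · left
    rw [ipow_eq_ofReal 4 hz, ← ofReal_norm, Real.norm_eq_abs, ← ENNReal.ofReal_pow (abs_nonneg t),
      ← ENNReal.ofReal_mul (by positivity), Real.rpow_neg (norm_nonneg z), div_eq_inv_mul]
    norm_num

theorem slobodeckij_half_eq (f : V3 × V3 → ℝ) :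
    slobodeckij Ω (1 / 2) f = ∫⁻ v, gagliardo Ω (fun x => f (x, v)) := by
  refine lintegral_congr fun v => lintegral_congr fun y => lintegral_congr fun x => ?_
  rcases ofReal_sq_div_eq_ipow (f (x, v) - f (y, v)) (x - y) with h | h
  · rw [h, ipow_sub_comm, enorm_sub_rev]
  · rw [sub_eq_zero.1 h]; simp

theorem ae_ae_of_ae_phase {P : V3 × V3 → Prop} (h : ∀ᵐ p ∂phaseMeasure Ω, P p) :
    ∀ᵐ v, ∀ᵐ x ∂volume.restrict Ω, P (x, v) := by
  have h2 : ∀ᵐ z ∂(volume : Measure V3).prod (volume.restrict Ω), P z.swap :=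
    Measure.measurePreserving_swap.quasiMeasurePreserving.ae h
  exact Measure.ae_ae_of_ae_prod h2

theorem slobodeckij_half_congr_ae {f f' : V3 × V3 → ℝ} (h : f =ᵐ[phaseMeasure Ω] f') :
    slobodeckij Ω (1 / 2) f = slobodeckij Ω (1 / 2) f' := by
  rw [slobodeckij_half_eq, slobodeckij_half_eq]
  exact lintegral_congr_ae ((ae_ae_of_ae_phase h).mono fun v hv => gagliardo_congr_ae hv)

theorem eLpNorm_two_sq {α : Type*} [MeasurableSpace α] (μ : Measure α) (f : α → ℝ) :
    eLpNorm f 2 μ ^ 2 = ∫⁻ x, ‖f x‖ₑ ^ 2 ∂μ := by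
  have := eLpNorm_nnreal_pow_eq_lintegral (f := f) (μ := μ) (p := 2) (by norm_num)
  simpa using this

theorem lintegral_phase {φ : V3 × V3 → ℝ≥0∞} (hφ : Measurable φ) :
    ∫⁻ p, φ p ∂phaseMeasure Ω = ∫⁻ w, ∫⁻ x in Ω, φ (x, w) :=
  lintegral_prod_symm' _ hφ

theorem lintegral_phase' {φ : V3 × V3 → ℝ≥0∞} (hφ : Measurable φ) :
    ∫⁻ p, φ p ∂phaseMeasure Ω = ∫⁻ x in Ω, ∫⁻ w, φ (x, w) :=
  lintegral_prod _ hφ.aemeasurable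

theorem ae_phase_mem (hΩ : MeasurableSet Ω) : ∀ᵐ p ∂phaseMeasure Ω, p.1 ∈ Ω :=
  Measure.quasiMeasurePreserving_fst.ae (ae_restrict_mem hΩ)

theorem ae_phase_ne_zero : ∀ᵐ p ∂phaseMeasure Ω, p.2 ≠ 0 :=
  Measure.quasiMeasurePreserving_snd.ae ae_ne_zero_V3

theorem zeroExt_ae_eq (hΩ : MeasurableSet Ω) (f : V3 × V3 → ℝ) :
    zeroExt Ω f =ᵐ[phaseMeasure Ω] f :=
  (ae_phase_mem hΩ).mono fun p hp => zeroExt_of_mem (f := f) hp p.2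

theorem lintegral_zeroExt (hΩ : MeasurableSet Ω) (f : V3 × V3 → ℝ) :
    ∫⁻ w, ∫⁻ x, ‖zeroExt Ω f (x, w)‖ₑ ^ 2 = ∫⁻ w, ∫⁻ x in Ω, ‖f (x, w)‖ₑ ^ 2 := by
  refine lintegral_congr fun w => ?_
  rw [← lintegral_indicator hΩ]
  refine lintegral_congr fun x => ?_
  by_cases hx : x ∈ Ω
  · rw [zeroExt_of_mem hx, indicator_of_mem hx]
  · rw [zeroExt_of_notMem hx, indicator_of_notMem hx]; simp

/-- Every `f ∈ L²(Ω × ℝ³)` has a measurable representative that vanishes outside `Ω`. -/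
theorem exists_measurable_representative (hΩ : MeasurableSet Ω) {f : V3 × V3 → ℝ}
    (hf : AEStronglyMeasurable f (phaseMeasure Ω)) :
    ∃ f' : V3 × V3 → ℝ, Measurable f' ∧ (∀ x, x ∉ Ω → ∀ w, f' (x, w) = 0) ∧
      f =ᵐ[phaseMeasure Ω] f' ∧
      ∫⁻ w, ∫⁻ x, ‖f' (x, w)‖ₑ ^ 2 = eLpNorm f 2 (phaseMeasure Ω) ^ 2 := by
  have hm : Measurable (hf.mk f) := hf.stronglyMeasurable_mk.measurable
  refine ⟨zeroExt Ω (hf.mk f), measurable_zeroExt hΩ hm, fun x hx w => zeroExt_of_notMem hx w,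
    hf.ae_eq_mk.trans (zeroExt_ae_eq hΩ _).symm, ?_⟩
  rw [lintegral_zeroExt hΩ, eLpNorm_congr_ae hf.ae_eq_mk, eLpNorm_two_sq, lintegral_phase]
  fun_prop

/-- A property that holds almost everywhere holds along almost every line in the velocity
direction. -/
theorem ae_ae_line (hΩ : MeasurableSet Ω) {P : V3 × V3 → Prop}
    (h : ∀ᵐ p ∂phaseMeasure Ω, P p) :
    ∀ᵐ p ∂phaseMeasure Ω, ∀ᵐ s : ℝ, p.1 - s • p.2 ∈ Ω → P (p.1 - s • p.2, p.2) := by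
  set μ := phaseMeasure Ω with hμ
  have : SFinite μ := by rw [hμ, phaseMeasure]; infer_instance
  set N := toMeasurable μ {p | ¬ P p} with hN
  have hNm : MeasurableSet N := measurableSet_toMeasurable _ _
  have hN0 : μ N = 0 := by rw [hN, measure_toMeasurable]; exact h
  set M : Set ((V3 × V3) × ℝ) :=
    {q | q.1.1 - q.2 • q.1.2 ∈ Ω ∧ (q.1.1 - q.2 • q.1.2, q.1.2) ∈ N} with hM
  have hMm : MeasurableSet M := by
    have g1 : Measurable fun q : (V3 × V3) × ℝ => q.1.1 - q.2 • q.1.2 := by fun_prop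
    have g2 : Measurable fun q : (V3 × V3) × ℝ => (q.1.1 - q.2 • q.1.2, q.1.2) := by fun_prop
    exact (g1 hΩ).inter (g2 hNm)
  have hNv : ∀ᵐ v, volume {x | x ∈ Ω ∧ (x, v) ∈ N} = 0 := by
    have h1 : ∀ᵐ p ∂phaseMeasure Ω, p ∉ N := measure_eq_zero_iff_ae_notMem.1 hN0
    refine (ae_ae_of_ae_phase h1).mono fun v hv => ?_
    rw [ae_restrict_iff' hΩ] at hv
    refine measure_mono_null ?_ (ae_iff.1 hv)
    rintro x ⟨hx, hxv⟩ hc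
    exact hc hx hxv
  -- Fubini with the time outside: for fixed `s` and `v` the section lies in a translate of a null
  -- set.
  have hM0 : (μ.prod volume) M = 0 := by
    rw [Measure.prod_apply_symm hMm, lintegral_eq_zero_iff (measurable_measure_prodMk_right hMm)]
    refine Eventually.of_forall fun s => ?_
    have hsm : MeasurableSet ((fun p : V3 × V3 => (p, s)) ⁻¹' M) := measurable_prodMk_right hMm
    show μ ((fun p : V3 × V3 => (p, s)) ⁻¹' M) = 0
    rw [hμ, phaseMeasure, Measure.prod_apply_symm hsm,
      lintegral_eq_zero_iff (measurable_measure_prodMk_right hsm)]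
    refine hNv.mono fun v hv => ?_
    refine le_antisymm (le_trans (Measure.restrict_apply_le _ _) ?_) zero_le
    have : (fun x : V3 => (x, v)) ⁻¹' ((fun p : V3 × V3 => (p, s)) ⁻¹' M) =
        (fun x => x + -(s • v)) ⁻¹' {x | x ∈ Ω ∧ (x, v) ∈ N} := by
      simp only [← sub_eq_add_neg]; rfl
    rw [this, measure_preimage_add_right, hv]
    rfl
  have h3 : ∀ᵐ q ∂μ.prod volume, q ∉ M := measure_eq_zero_iff_ae_notMem.1 hM0
  refine (Measure.ae_ae_of_ae_prod h3).mono fun p hp => hp.mono fun s hs hsΩ => ?_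
  by_contra hc
  exact hs ⟨hsΩ, subset_toMeasurable _ _ hc⟩

theorem IsConvexBody.opS_congr_ae (hΩ : IsConvexBody Ω d) {h h' : V3 × V3 → ℝ}
    (hh : h =ᵐ[phaseMeasure Ω] h') : opS Ω B h =ᵐ[phaseMeasure Ω] opS Ω B h' := by
  refine ((ae_ae_line hΩ.measurableSet hh).and
    ((ae_phase_mem hΩ.measurableSet).and ae_phase_ne_zero)).mono ?_
  rintro ⟨x, v⟩ ⟨h1, hx, hv⟩
  refine intervalIntegral.integral_congr_ae ?_
  refine (h1.and (compl_mem_ae_iff.2 (measure_singleton (tauMinus Ω x v)))).mono ?_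
  rintro s ⟨hs, hs'⟩ hsi
  rw [uIoc_of_le (tauMinus_nonneg x v)] at hsi
  have : s < tauMinus Ω x v := lt_of_le_of_ne hsi.2 hs'
  have h3 := hs ((hΩ.mem_iff hx hv hsi.1.le).2 this)
  simp only [h3]

/-- The weighted velocity integrals that control `K f` are finite almost everywhere. -/
theorem ae_lintegral_gk_lt_top {f : V3 × V3 → ℝ} (hf : Measurable f)
    (hfin : ∫⁻ w, ∫⁻ x in Ω, ‖f (x, w)‖ₑ ^ 2 < ∞) :
    ∀ᵐ p ∂phaseMeasure Ω, ∫⁻ w, gk (1 / 2) (1 / 16) (p.2 - w) * ‖f (p.1, w)‖ₑ ^ 2 < ∞ := by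
  obtain ⟨C, hC⟩ := exists_lintegral_gk_le (1 / 2) (1 / 16) (by norm_num) (by norm_num)
  have hm3 : Measurable fun q : (V3 × V3) × V3 =>
      gk (1 / 2) (1 / 16) (q.1.2 - q.2) * ‖f (q.1.1, q.2)‖ₑ ^ 2 := by
    have : Measurable fun q : (V3 × V3) × V3 => gk (1 / 2) (1 / 16) (q.1.2 - q.2) :=
      (measurable_gk _ _).comp (by fun_prop)
    exact this.mul (by fun_prop)
  have hm : Measurable fun p : V3 × V3 =>
      ∫⁻ w, gk (1 / 2) (1 / 16) (p.2 - w) * ‖f (p.1, w)‖ₑ ^ 2 := hm3.lintegral_prod_right'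
  refine ae_lt_top hm (ne_of_lt ?_)
  have hf2 : Measurable fun p : V3 × V3 => ‖f p‖ₑ ^ 2 := by fun_prop
  rw [lintegral_phase' hm]
  calc _ ≤ ∫⁻ x in Ω, C * ∫⁻ w, ‖f (x, w)‖ₑ ^ 2 := by
        refine lintegral_mono fun x => ?_
        have hm2 : Measurable fun q : V3 × V3 =>
            gk (1 / 2) (1 / 16) (q.1 - q.2) * ‖f (x, q.2)‖ₑ ^ 2 := by
          have : Measurable fun q : V3 × V3 => gk (1 / 2) (1 / 16) (q.1 - q.2) :=
            (measurable_gk _ _).comp (by fun_prop)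
          exact this.mul (by fun_prop)
        rw [lintegral_lintegral_swap hm2.aemeasurable, ← lintegral_const_mul' _ _ ENNReal.coe_ne_top]
        refine lintegral_mono fun w => ?_
        have hm1 : Measurable fun v : V3 => gk (1 / 2) (1 / 16) (v - w) :=
          (measurable_gk _ _).comp (by fun_prop)
        dsimp only
        rw [lintegral_mul_const _ hm1]
        exact mul_le_mul_left (hC w) _
    _ = C * ∫⁻ w, ∫⁻ x in Ω, ‖f (x, w)‖ₑ ^ 2 := by
        rw [lintegral_const_mul' _ _ ENNReal.coe_ne_top, ← lintegral_phase' hf2, lintegral_phase hf2]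
    _ < ∞ := ENNReal.mul_lt_top ENNReal.coe_lt_top hfin

theorem ae_slice_ae_eq {f f' : V3 × V3 → ℝ} (h : f =ᵐ[phaseMeasure Ω] f') :
    ∀ᵐ p ∂phaseMeasure Ω, (fun w => f (p.1, w)) =ᵐ[volume] fun w => f' (p.1, w) :=
  Measure.quasiMeasurePreserving_fst.ae (Measure.ae_ae_of_ae_prod h)

theorem opK_congr_ae (hγ : γ ∈ Icc (0 : ℝ) 1) (hB : IsCutoff B γ) {f f' : V3 × V3 → ℝ}
    (hf' : Measurable f') (hfin : ∫⁻ w, ∫⁻ x in Ω, ‖f' (x, w)‖ₑ ^ 2 < ∞)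
    (h : f =ᵐ[phaseMeasure Ω] f') : opK B f =ᵐ[phaseMeasure Ω] opK B f' := by
  refine ((ae_lintegral_gk_lt_top hf' hfin).and (ae_slice_ae_eq h)).mono ?_
  rintro ⟨x, v⟩ ⟨h1, h2⟩
  exact (collisionK_congr_ae hγ hB (Measurable.aestronglyMeasurable (by fun_prop)) h1 h2.symm).symm

theorem zeroExt_eq_self {f : V3 × V3 → ℝ} (hf : ∀ x, x ∉ Ω → ∀ w, f (x, w) = 0) :
    zeroExt Ω f = f := by
  ext ⟨x, w⟩
  by_cases hx : x ∈ Ω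
  · rw [zeroExt_of_mem hx]
  · rw [zeroExt_of_notMem hx, hf x hx]

theorem IsConvexBody.opS_opK_ae_eq (hΩ : IsConvexBody Ω d) (hγ : γ ∈ Icc (0 : ℝ) 1)
    (hB : IsCutoff B γ) {f f' : V3 × V3 → ℝ} (hf' : Measurable f')
    (hfin : ∫⁻ w, ∫⁻ x in Ω, ‖f' (x, w)‖ₑ ^ 2 < ∞) (h : f =ᵐ[phaseMeasure Ω] f') :
    opS Ω B (opK B f) =ᵐ[phaseMeasure Ω] truncS d B (zeroExt Ω (opK B f')) := by
  refine (hΩ.opS_congr_ae (opK_congr_ae hγ hB hf' hfin h)).trans ?_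
  exact (ae_phase_mem hΩ.measurableSet).mono fun p hp => hΩ.opS_eq_truncS _ hp p.2

end LinBoltzmann

namespace LinBoltzmann

variable {B : ℝ → ℝ → ℝ} {γ d : ℝ} {Ω : Set V3}

/-! ### `S K` and `S K S K` as bounded operators -/

theorem ae_lintegral_line_lt_top (d : ℝ) {h : V3 × V3 → ℝ}
    (hh : Measurable h) (hfin : ∫⁻ w, ∫⁻ x, ‖h (x, w)‖ₑ ^ 2 < ∞) :
    ∀ᵐ p ∂phaseMeasure Ω, ∫⁻ s in Ioo 0 (d / ‖p.2‖), ‖h (p.1 - s • p.2, p.2)‖ₑ < ∞ := by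
  have hh2 : Measurable fun p : V3 × V3 => ‖h p‖ₑ ^ 2 := by fun_prop
  have hg : Measurable fun q : (V3 × V3) × ℝ => ‖h (q.1.1 - q.2 • q.1.2, q.1.2)‖ₑ := by fun_prop
  have hm : MeasurableSet {p : V3 × V3 |
      ∫⁻ s in Ioo 0 (d / ‖p.2‖), ‖h (p.1 - s • p.2, p.2)‖ₑ < ∞} := by
    have g1 : MeasurableSet {q : (V3 × V3) × ℝ | q.2 ∈ Ioo 0 (d / ‖q.1.2‖)} := by
      have a1 : Measurable fun q : (V3 × V3) × ℝ => q.2 := measurable_snd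
      have a2 : Measurable fun q : (V3 × V3) × ℝ => d / ‖q.1.2‖ := by fun_prop
      exact (measurableSet_lt measurable_const a1).inter (measurableSet_lt a1 a2)
    have g2 := (hg.indicator g1).lintegral_prod_right' (ν := volume)
    have g3 : (fun p : V3 × V3 => ∫⁻ s in Ioo 0 (d / ‖p.2‖), ‖h (p.1 - s • p.2, p.2)‖ₑ) =
        fun p => ∫⁻ s, {q : (V3 × V3) × ℝ | q.2 ∈ Ioo 0 (d / ‖q.1.2‖)}.indicator
          (fun q => ‖h (q.1.1 - q.2 • q.1.2, q.1.2)‖ₑ) (p, s) := by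
      ext p
      rw [← lintegral_indicator measurableSet_Ioo]
      rfl
    have g4 : Measurable fun p : V3 × V3 =>
        ∫⁻ s in Ioo 0 (d / ‖p.2‖), ‖h (p.1 - s • p.2, p.2)‖ₑ := by rw [g3]; exact g2
    exact measurableSet_lt g4 measurable_const
  have key : ∀ᵐ w : V3, ∀ᵐ x ∂volume.restrict Ω,
      ∫⁻ s in Ioo 0 (d / ‖w‖), ‖h (x - s • w, w)‖ₑ < ∞ := by
    refine (ae_lt_top hh2.lintegral_prod_left' hfin.ne).mono fun w hw => ?_
    have hF : Measurable fun x => ‖h (x, w)‖ₑ ^ 2 := by fun_prop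
    have e1 := lintegral_lintegral_comp_sub_smul (d / ‖w‖) w hF
    have hGm : Measurable fun q : V3 × ℝ => ‖h (q.1 - q.2 • w, w)‖ₑ ^ 2 := by fun_prop
    have e2 : ∫⁻ x, ∫⁻ s in Ioo 0 (d / ‖w‖), ‖h (x - s • w, w)‖ₑ ^ 2 ≠ ∞ := by
      rw [e1]; exact (ENNReal.mul_lt_top (by simp) hw).ne
    refine ae_restrict_of_ae ((ae_lt_top hGm.lintegral_prod_right' e2).mono fun x hx => ?_)
    have hms : Measurable fun s : ℝ => ‖h (x - s • w, w)‖ₑ := by fun_prop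
    have h4 := (sq_setLIntegral_le (Ioo 0 (d / ‖w‖)) (μ := volume) hms.aemeasurable).trans_lt
      (ENNReal.mul_lt_top (by simp) hx)
    by_contra hn
    rw [not_lt, top_le_iff] at hn
    rw [hn] at h4
    simp at h4
  have : ∀ᵐ z ∂(volume : Measure V3).prod (volume.restrict Ω),
      ∫⁻ s in Ioo 0 (d / ‖z.1‖), ‖h (z.2 - s • z.1, z.1)‖ₑ < ∞ :=
    (Measure.ae_prod_iff_ae_ae (measurable_swap hm)).2 key
  exact Measure.measurePreserving_swap.quasiMeasurePreserving.ae this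

/-- Square integrable functions are integrable along almost every backward characteristic. -/
theorem IsConvexBody.ae_integrableOn_line (hΩ : IsConvexBody Ω d) {h : V3 × V3 → ℝ}
    (hh : MemLp h 2 (phaseMeasure Ω)) : ∀ᵐ p ∂phaseMeasure Ω,
      IntegrableOn (fun s : ℝ => h (p.1 - s • p.2, p.2)) (Ioc 0 (tauMinus Ω p.1 p.2)) := by
  obtain ⟨h', hm, hz, hae, hn⟩ := exists_measurable_representative hΩ.measurableSet hh.1
  have hfin : ∫⁻ w, ∫⁻ x, ‖h' (x, w)‖ₑ ^ 2 < ∞ := by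
    rw [hn]; exact ENNReal.pow_lt_top hh.2
  refine ((ae_lintegral_line_lt_top d hm hfin).and ((ae_ae_line hΩ.measurableSet hae).and
    ((ae_phase_mem hΩ.measurableSet).and ae_phase_ne_zero))).mono ?_
  rintro ⟨x, v⟩ ⟨h1, h2, hx, hv⟩
  rw [integrableOn_Ioc_iff_integrableOn_Ioo]
  have i1 : IntegrableOn (fun s : ℝ => h' (x - s • v, v)) (Ioo 0 (tauMinus Ω x v)) := by
    refine IntegrableOn.mono_set (t := Ioo 0 (d / ‖v‖)) ?_
      (Ioo_subset_Ioo_right (hΩ.tauMinus_le hx hv))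
    refine ⟨Measurable.aestronglyMeasurable (by fun_prop), ?_⟩
    exact h1
  refine i1.congr_fun_ae ?_
  rw [EventuallyEq, ae_restrict_iff' measurableSet_Ioo]
  exact h2.mono fun s hs hsi => (hs ((hΩ.mem_iff hx hv hsi.1.le).2 hsi.2)).symm

theorem IsConvexBody.ae_intervalIntegrable_line (hΩ : IsConvexBody Ω d) {h : V3 × V3 → ℝ}
    (hh : MemLp h 2 (phaseMeasure Ω)) : ∀ᵐ p ∂phaseMeasure Ω,
      IntervalIntegrable (fun s : ℝ => Real.exp (-collisionFrequency B p.2 * s) *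
        h (p.1 - s • p.2, p.2)) volume 0 (tauMinus Ω p.1 p.2) := by
  refine (hΩ.ae_integrableOn_line hh).mono fun p hp => ?_
  rw [← intervalIntegrable_iff_integrableOn_Ioc_of_le (tauMinus_nonneg _ _)] at hp
  exact hp.continuousOn_mul (by fun_prop)

theorem IsConvexBody.opS_add_ae (hΩ : IsConvexBody Ω d) {h k : V3 × V3 → ℝ}
    (hh : MemLp h 2 (phaseMeasure Ω)) (hk : MemLp k 2 (phaseMeasure Ω)) :
    opS Ω B (h + k) =ᵐ[phaseMeasure Ω] opS Ω B h + opS Ω B k := by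
  refine ((hΩ.ae_intervalIntegrable_line (B := B) hh).and
    (hΩ.ae_intervalIntegrable_line (B := B) hk)).mono ?_
  rintro p ⟨h1, h2⟩
  simp only [opS, Pi.add_apply, mul_add]
  exact intervalIntegral.integral_add h1 h2

theorem opS_smul (c : ℝ) (h : V3 × V3 → ℝ) : opS Ω B (c • h) = c • opS Ω B h := by
  ext p
  simp only [opS, Pi.smul_apply, smul_eq_mul, mul_left_comm _ c]
  exact intervalIntegral.integral_const_mul c _

theorem opK_smul (c : ℝ) (h : V3 × V3 → ℝ) : opK B (c • h) = c • opK B h := by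
  ext p
  exact collisionK_smul c _ _

theorem opK_add_ae (hΩ : MeasurableSet Ω) (hγ : γ ∈ Icc (0 : ℝ) 1) (hB : IsCutoff B γ)
    {h k : V3 × V3 → ℝ} (hh : MemLp h 2 (phaseMeasure Ω)) (hk : MemLp k 2 (phaseMeasure Ω)) :
    opK B (h + k) =ᵐ[phaseMeasure Ω] opK B h + opK B k := by
  obtain ⟨h', hm, hz, hae, hn⟩ := exists_measurable_representative hΩ hh.1
  obtain ⟨k', km, kz, kae, kn⟩ := exists_measurable_representative hΩ hk.1
  have hfin : ∫⁻ w, ∫⁻ x in Ω, ‖h' (x, w)‖ₑ ^ 2 < ∞ :=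
    (lintegral_mono fun w => setLIntegral_le_lintegral _ _).trans_lt
      (hn ▸ ENNReal.pow_lt_top hh.2)
  have kfin : ∫⁻ w, ∫⁻ x in Ω, ‖k' (x, w)‖ₑ ^ 2 < ∞ :=
    (lintegral_mono fun w => setLIntegral_le_lintegral _ _).trans_lt
      (kn ▸ ENNReal.pow_lt_top hk.2)
  refine (((ae_lintegral_gk_lt_top hm hfin).and (ae_lintegral_gk_lt_top km kfin)).and
    ((ae_slice_ae_eq hae).and (ae_slice_ae_eq kae))).mono ?_
  rintro ⟨x, v⟩ ⟨⟨h1, h2⟩, h3, h4⟩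
  have m1 : AEStronglyMeasurable (fun w => h (x, w)) volume :=
    ⟨fun w => h' (x, w), Measurable.stronglyMeasurable (by fun_prop), h3⟩
  have m2 : AEStronglyMeasurable (fun w => k (x, w)) volume :=
    ⟨fun w => k' (x, w), Measurable.stronglyMeasurable (by fun_prop), h4⟩
  refine collisionK_add hγ hB m1 m2 ?_ ?_
  · exact (lintegral_congr_ae (h3.mono fun w hw => congrArg
      (fun t : ℝ => gk (1 / 2) (1 / 16) (v - w) * ‖t‖ₑ ^ 2) hw)).trans_lt h1
  · exact (lintegral_congr_ae (h4.mono fun w hw => congrArg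
      (fun t : ℝ => gk (1 / 2) (1 / 16) (v - w) * ‖t‖ₑ ^ 2) hw)).trans_lt h2

theorem memLp_opK (hΩ : MeasurableSet Ω) (hγ : γ ∈ Icc (0 : ℝ) 1) (hB : IsCutoff B γ)
    {h : V3 × V3 → ℝ} (hh : MemLp h 2 (phaseMeasure Ω)) :
    MemLp (opK B h) 2 (phaseMeasure Ω) := by
  obtain ⟨h', hm, hz, hae, hn⟩ := exists_measurable_representative hΩ hh.1
  have hfin : ∫⁻ w, ∫⁻ x in Ω, ‖h' (x, w)‖ₑ ^ 2 < ∞ :=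
    (lintegral_mono fun w => setLIntegral_le_lintegral _ _).trans_lt
      (hn ▸ ENNReal.pow_lt_top hh.2)
  have e1 := opK_congr_ae hγ hB hm hfin hae
  have hK : Measurable (opK B h') := measurable_opK hB hm
  obtain ⟨C, hC⟩ := exists_lintegral_opK_sq_le hγ hB
  refine (memLp_congr_ae e1).2 (memLp_two_of_lintegral hK.aestronglyMeasurable ?_)
  rw [lintegral_phase (by fun_prop)]
  refine lt_of_le_of_lt (lintegral_mono fun v => ?_)
    ((hC (volume.restrict Ω) h' hm).trans_lt (ENNReal.mul_lt_top ENNReal.coe_lt_top hfin))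
  exact le_mul_of_one_le_left zero_le le_self_add

/-- `S K` is bounded on `L²(Ω × ℝ³)`. -/
theorem IsConvexBody.exists_opS_opK_le (hΩ : IsConvexBody Ω d) (hγ : γ ∈ Icc (0 : ℝ) 1)
    (hB : IsCutoff B γ) :
    ∃ C : ℝ≥0, ∀ f : V3 × V3 → ℝ, MemLp f 2 (phaseMeasure Ω) →
      MemLp (opS Ω B (opK B f)) 2 (phaseMeasure Ω) ∧
      eLpNorm (opS Ω B (opK B f)) 2 (phaseMeasure Ω) ^ 2 ≤
        C * eLpNorm f 2 (phaseMeasure Ω) ^ 2 := by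
  obtain ⟨C, hC⟩ := hΩ.exists_lintegral_bw_truncS_le hγ hB
  refine ⟨d.toNNReal ^ (1 / 2 : ℝ) * C, fun f hf => ?_⟩
  obtain ⟨f', hm, hz, hae, hn⟩ := exists_measurable_representative hΩ.measurableSet hf.1
  have htop : eLpNorm f 2 (phaseMeasure Ω) ^ 2 < ∞ := ENNReal.pow_lt_top hf.2
  have hfin : ∫⁻ w, ∫⁻ x in Ω, ‖f' (x, w)‖ₑ ^ 2 < ∞ :=
    (lintegral_mono fun w => setLIntegral_le_lintegral _ _).trans_lt (hn ▸ htop)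
  have e := hΩ.opS_opK_ae_eq hγ hB hm hfin hae
  -- The representative vanishes outside `Ω` for all velocities, hence so does its image under `K`,
  -- and no second extension is needed.
  rw [zeroExt_eq_self (opK_eq_zero_of_notMem hz)] at e
  have hu : Measurable (truncS d B (opK B f')) := measurable_truncS hB (measurable_opK hB hm)
  have hle : eLpNorm (opS Ω B (opK B f)) 2 (phaseMeasure Ω) ^ 2 ≤
      ((d.toNNReal ^ (1 / 2 : ℝ) * C : ℝ≥0) : ℝ≥0∞) * eLpNorm f 2 (phaseMeasure Ω) ^ 2 := by
    rw [eLpNorm_congr_ae e, eLpNorm_two_sq, lintegral_phase (by fun_prop), ENNReal.coe_mul,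
      ENNReal.coe_rpow_of_nonneg _ (by norm_num), mul_assoc, ← hn]
    refine (lintegral_mono fun v => hΩ.lintegral_le_bw _).trans ?_
    rw [lintegral_const_mul' _ _ (ENNReal.rpow_ne_top_of_nonneg (by norm_num) (by simp))]
    exact mul_le_mul_right (hC f' hm) _
  refine ⟨⟨hu.aestronglyMeasurable.congr e.symm, ?_⟩, hle⟩
  have := hle.trans_lt (ENNReal.mul_lt_top ENNReal.coe_lt_top htop)
  by_contra hc
  rw [not_lt, top_le_iff] at hc
  rw [hc] at this
  simp at this

theorem IsConvexBody.exists_slobodeckij_twofold_le (hΩ : IsConvexBody Ω d)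
    (hγ : γ ∈ Icc (0 : ℝ) 1) (hB : IsCutoff B γ) :
    ∃ C : ℝ≥0, ∀ f : V3 × V3 → ℝ, MemLp f 2 (phaseMeasure Ω) →
      slobodeckij Ω (1 / 2) (opS Ω B (opK B (opS Ω B (opK B f)))) ≤
        C * eLpNorm f 2 (phaseMeasure Ω) ^ 2 := by
  obtain ⟨C, hC⟩ := hΩ.exists_gagliardo_twofold_le hγ hB
  obtain ⟨C₁, hC₁⟩ := hΩ.exists_opS_opK_le hγ hB
  refine ⟨C, fun f hf => ?_⟩
  obtain ⟨f', hm, hz, hae, hn⟩ := exists_measurable_representative hΩ.measurableSet hf.1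
  have htop : eLpNorm f 2 (phaseMeasure Ω) ^ 2 < ∞ := ENNReal.pow_lt_top hf.2
  have hfin : ∫⁻ w, ∫⁻ x in Ω, ‖f' (x, w)‖ₑ ^ 2 < ∞ :=
    (lintegral_mono fun w => setLIntegral_le_lintegral _ _).trans_lt (hn ▸ htop)
  have e := hΩ.opS_opK_ae_eq hγ hB hm hfin hae
  rw [zeroExt_eq_self (opK_eq_zero_of_notMem hz)] at e
  have hu : Measurable (truncS d B (opK B f')) := measurable_truncS hB (measurable_opK hB hm)
  have hufin : ∫⁻ w, ∫⁻ x in Ω, ‖truncS d B (opK B f') (x, w)‖ₑ ^ 2 < ∞ := by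
    have := ENNReal.pow_lt_top (n := 2) (hC₁ f hf).1.2
    rwa [eLpNorm_congr_ae e, eLpNorm_two_sq, lintegral_phase (by fun_prop)] at this
  have e2 := hΩ.opS_opK_ae_eq hγ hB hu hufin e
  rw [slobodeckij_half_congr_ae e2, slobodeckij_half_eq, ← hn]
  exact hC f' hm hz

/-- `S K` as a bounded operator on `L²(Ω × ℝ³)`. -/
theorem IsConvexBody.exists_clm_opS_opK (hΩ : IsConvexBody Ω d) (hγ : γ ∈ Icc (0 : ℝ) 1)
    (hB : IsCutoff B γ) :
    ∃ T : Lp ℝ 2 (phaseMeasure Ω) →L[ℝ] Lp ℝ 2 (phaseMeasure Ω),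
      ∀ (f : V3 × V3 → ℝ) (hf : MemLp f 2 (phaseMeasure Ω)),
        T (hf.toLp f) =ᵐ[phaseMeasure Ω] opS Ω B (opK B f) := by
  obtain ⟨C, hC⟩ := hΩ.exists_opS_opK_le hγ hB
  -- Independence of the representative, which makes `S K` a map on classes; linearity then has to
  -- hold only almost everywhere.
  have congr : ∀ {f f' : V3 × V3 → ℝ}, MemLp f' 2 (phaseMeasure Ω) → f =ᵐ[phaseMeasure Ω] f' →
      opS Ω B (opK B f) =ᵐ[phaseMeasure Ω] opS Ω B (opK B f') := by
    intro f f' hf' h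
    obtain ⟨g, hm, hz, hae, hn⟩ := exists_measurable_representative hΩ.measurableSet hf'.1
    have hfin : ∫⁻ w, ∫⁻ x in Ω, ‖g (x, w)‖ₑ ^ 2 < ∞ :=
      (lintegral_mono fun w => setLIntegral_le_lintegral _ _).trans_lt
        (hn ▸ ENNReal.pow_lt_top hf'.2)
    exact (hΩ.opS_opK_ae_eq hγ hB hm hfin (h.trans hae)).trans
      (hΩ.opS_opK_ae_eq hγ hB hm hfin hae).symm
  let T₀ : Lp ℝ 2 (phaseMeasure Ω) →ₗ[ℝ] Lp ℝ 2 (phaseMeasure Ω) :=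
    { toFun := fun F => (hC F (Lp.memLp F)).1.toLp _
      map_add' := fun F G => by
        rw [← MemLp.toLp_add]
        refine MemLp.toLp_congr _ _ ?_
        have kF := memLp_opK hΩ.measurableSet hγ hB (Lp.memLp F)
        have kG := memLp_opK hΩ.measurableSet hγ hB (Lp.memLp G)
        refine (congr ((Lp.memLp F).add (Lp.memLp G)) (Lp.coeFn_add F G)).trans ?_
        exact (hΩ.opS_congr_ae (opK_add_ae hΩ.measurableSet hγ hB (Lp.memLp F)
          (Lp.memLp G))).trans (hΩ.opS_add_ae kF kG)
      map_smul' := fun c F => by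
        rw [RingHom.id_apply, ← MemLp.toLp_const_smul]
        refine MemLp.toLp_congr _ _ ?_
        refine (congr ((Lp.memLp F).const_smul c) (Lp.coeFn_smul c F)).trans ?_
        rw [opK_smul, opS_smul] }
  refine ⟨T₀.mkContinuous (Real.sqrt C) fun F => ?_, fun f hf => ?_⟩
  · have h1 := (hC F (Lp.memLp F)).2
    rw [← pow_le_pow_iff_left₀ (norm_nonneg _) (by positivity) two_ne_zero, mul_pow,
      Real.sq_sqrt C.coe_nonneg]
    have h2 := ENNReal.toReal_mono (ENNReal.mul_ne_top ENNReal.coe_ne_top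
      (ENNReal.pow_ne_top (Lp.memLp F).2.ne)) h1
    rw [ENNReal.toReal_mul, ENNReal.toReal_pow, ENNReal.toReal_pow, ENNReal.coe_toReal,
      ← Lp.norm_def] at h2
    show ‖(hC F (Lp.memLp F)).1.toLp _‖ ^ 2 ≤ _
    rwa [Lp.norm_toLp]
  · rw [LinearMap.mkContinuous_apply]
    exact (MemLp.coeFn_toLp (hC _ (Lp.memLp (hf.toLp f))).1).trans (congr hf hf.coeFn_toLp)

theorem IsConvexBody.exists_bounded_twofold (hΩ : IsConvexBody Ω d) (hγ : γ ∈ Icc (0 : ℝ) 1)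
    (hB : IsCutoff B γ) :
    ∃ (T : Lp ℝ 2 (phaseMeasure Ω) →L[ℝ] Lp ℝ 2 (phaseMeasure Ω)) (C : ℝ≥0),
      ∀ (f : V3 × V3 → ℝ) (hf : MemLp f 2 (phaseMeasure Ω)),
        T (hf.toLp f) =ᵐ[phaseMeasure Ω] opS Ω B (opK B (opS Ω B (opK B f))) ∧
        MemL2Hs Ω (1 / 2) (opS Ω B (opK B (opS Ω B (opK B f)))) ∧
        l2HsNorm Ω (1 / 2) (opS Ω B (opK B (opS Ω B (opK B f)))) ≤
          C * eLpNorm f 2 (phaseMeasure Ω) := by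
  obtain ⟨T, hT⟩ := hΩ.exists_clm_opS_opK hγ hB
  obtain ⟨C₁, hC₁⟩ := hΩ.exists_opS_opK_le hγ hB
  obtain ⟨C₂, hC₂⟩ := hΩ.exists_slobodeckij_twofold_le hγ hB
  refine ⟨T.comp T, (C₁ * C₁ + C₂) ^ (1 / 2 : ℝ), fun f hf => ?_⟩
  obtain ⟨m1, b1⟩ := hC₁ f hf
  obtain ⟨m2, b2⟩ := hC₁ _ m1
  have b3 := hC₂ f hf
  refine ⟨?_, ⟨m2, b3.trans_lt (ENNReal.mul_lt_top ENNReal.coe_lt_top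
    (ENNReal.pow_lt_top hf.2))⟩, ?_⟩
  · have : T (hf.toLp f) = m1.toLp _ := by
      refine Lp.ext ((hT f hf).trans (MemLp.coeFn_toLp _).symm)
    rw [ContinuousLinearMap.comp_apply, this]
    exact hT _ m1
  · have hsq : ∀ t : ℝ≥0∞, t = (t ^ 2) ^ (1 / 2 : ℝ) := fun t => by
      rw [← ENNReal.rpow_two, ← ENNReal.rpow_mul]; norm_num
    rw [ENNReal.coe_rpow_of_nonneg _ (by norm_num), hsq (eLpNorm f 2 (phaseMeasure Ω)),
      ← ENNReal.mul_rpow_of_nonneg _ _ (by norm_num : (0 : ℝ) ≤ 1 / 2), l2HsNorm]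
    refine ENNReal.rpow_le_rpow ?_ (by norm_num)
    rw [ENNReal.coe_add, add_mul, ENNReal.coe_mul, mul_assoc]
    exact add_le_add (b2.trans (mul_le_mul_right b1 _)) b3

end LinBoltzmann

namespace LinBoltzmann

variable {B : ℝ → ℝ → ℝ} {γ d : ℝ} {Ω : Set V3}

/-! ### Regularity of the exit time -/

theorem IsConvexBody.sqrt_tauMinus_sub_le (hΩ : IsConvexBody Ω d) {x y v : V3} (hx : x ∈ Ω)
    (hy : y ∈ Ω) (hv : v ≠ 0) :
    ENNReal.ofReal (tauMinus Ω y v - tauMinus Ω x v) ^ (1 / 2 : ℝ) ≤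
      (ENNReal.ofReal d * ipow 1 v) ^ (1 / 2 : ℝ) * (‖x - y‖ₑ ^ (1 / 2 : ℝ) * bw Ω x) := by
  have hδ := hΩ.infDist_pos hx
  have h1 := hΩ.mul_tauMinus_le hx hy hv
  have h2 := hΩ.tauMinus_le hx hv
  have h3 : tauMinus Ω y v - tauMinus Ω x v ≤
      d / ‖v‖ * (‖x - y‖ * (Metric.infDist x Ωᶜ)⁻¹) := by
    rw [← mul_assoc, ← div_eq_mul_inv, le_div_iff₀ hδ]
    have := mul_le_mul_of_nonneg_right h2 (norm_nonneg (x - y))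
    linarith
  have hd : 0 ≤ d / ‖v‖ := div_nonneg hΩ.diam_pos.le (norm_nonneg v)
  rw [hΩ.bw_eq hx, ← ofReal_norm, ← ENNReal.ofReal_rpow_of_nonneg (by positivity) (by norm_num),
    ← ENNReal.mul_rpow_of_nonneg _ _ (by norm_num), ← ENNReal.mul_rpow_of_nonneg _ _ (by norm_num),
    ← ofReal_div_norm d hv, ← ENNReal.ofReal_mul (norm_nonneg _), ← ENNReal.ofReal_mul hd]
  exact ENNReal.rpow_le_rpow (ENNReal.ofReal_le_ofReal h3) (by norm_num)

/-- Written as the duration for which only the line of `y` is inside, the difference of exit times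
can be averaged in `v` like the exit terms of `S`. -/
theorem IsConvexBody.tauMinus_sub_le_lintegral_exitDiff (hΩ : IsConvexBody Ω d) {x y v : V3}
    (hx : x ∈ Ω) (hy : y ∈ Ω) (hv : v ≠ 0) :
    ENNReal.ofReal (tauMinus Ω y v - tauMinus Ω x v) ≤
      ∫⁻ s in Ioi (0 : ℝ), exitDiff Ω (fun _ => 1) (x - s • v) (y - s • v) ^ 2 := by
  have hpos := hΩ.tauMinus_pos hx hv
  rw [← Real.volume_Ico, ← setLIntegral_one]
  refine (setLIntegral_mono' measurableSet_Ico fun s hs => ?_).trans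
    (lintegral_mono_set fun s hs => hpos.trans_le hs.1)
  have hs0 : 0 ≤ s := hpos.le.trans hs.1
  have h1 : x - s • v ∉ Ω := fun h => not_lt.2 hs.1 ((hΩ.mem_iff hx hv hs0).1 h)
  have h2 : y - s • v ∈ Ω := (hΩ.mem_iff hy hv hs0).2 hs.2
  simp [exitDiff, h1, h2]

theorem ENNReal_rpow_three_halves (t : ℝ≥0∞) : t ^ (3 / 2 : ℝ) = t ^ (1 / 2 : ℝ) * t := by
  conv_rhs => rw [← ENNReal.rpow_one t, ← ENNReal.rpow_mul,
    ← ENNReal.rpow_add_of_nonneg _ _ (by norm_num) (by norm_num)]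
  norm_num

theorem measurable_exitDiff_line (hΩ : MeasurableSet Ω) (x y v : V3) :
    Measurable fun s : ℝ => exitDiff Ω (fun _ => 1) (x - s • v) (y - s • v) ^ 2 :=
  ((measurable_exitDiff hΩ measurable_const).comp
    (f := fun s : ℝ => (x - s • v, y - s • v)) (by fun_prop)).pow_const 2

/-- The power `3/2` is split as `1/2 + 1`. The half power takes the bound by `|x - y|^{1/2}
dist^{-1/2}`, which softens the kernel to `|x - y|^{-7/2}`; the full power stays an integral over
exit times. -/
theorem IsConvexBody.ipow_mul_tauMinus_sub_le (hΩ : IsConvexBody Ω d) {x y v : V3}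
    (hx : x ∈ Ω) (hy : y ∈ Ω) (hv : v ≠ 0) :
    ipow 4 (x - y) * ENNReal.ofReal (tauMinus Ω y v - tauMinus Ω x v) ^ (3 / 2 : ℝ) ≤
      (ENNReal.ofReal d * ipow 1 v) ^ (1 / 2 : ℝ) *
        ∫⁻ s in Ioi (0 : ℝ), exitKernel Ω (fun _ => 1) v x y s := by
  rw [ENNReal_rpow_three_halves]
  have hs := measurable_exitDiff_line hΩ.measurableSet x y v
  set e := ∫⁻ s in Ioi (0 : ℝ), exitDiff Ω (fun _ => 1) (x - s • v) (y - s • v) ^ 2 with he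
  set D := (ENNReal.ofReal d * ipow 1 v) ^ (1 / 2 : ℝ)
  calc _ ≤ ipow 4 (x - y) * (D * (‖x - y‖ₑ ^ (1 / 2 : ℝ) * bw Ω x) * e) :=
        mul_le_mul_right (mul_le_mul' (hΩ.sqrt_tauMinus_sub_le hx hy hv)
          (hΩ.tauMinus_sub_le_lintegral_exitDiff hx hy hv)) _
    _ = D * ((ipow 4 (x - y) * ‖x - y‖ₑ ^ (1 / 2 : ℝ)) * (bw Ω x * e)) := by ring
    _ ≤ D * (ipow (7 / 2) (x - y) * (bw Ω x * e)) :=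
        mul_le_mul_right (mul_le_mul_left (ipow_four_mul_le _) _) _
    _ = _ := by
        congr 1
        simp only [exitKernel, indicator_of_mem hx]
        rw [lintegral_const_mul _ (hs.const_mul _), lintegral_const_mul _ hs, he]
        ring

/-- The exit time has a fractional derivative in the averaged sense. -/
theorem IsConvexBody.lintegral_tauMinus_sub_le (hΩ : IsConvexBody Ω d) {v : V3} (hv : v ≠ 0) :
    ∫⁻ x in Ω, ∫⁻ y in Ω, ipow 4 (x - y) * ‖tauMinus Ω x v - tauMinus Ω y v‖ₑ ^ (3 / 2 : ℝ) ≤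
      2 * ((ENNReal.ofReal d * ipow 1 v) ^ (1 / 2 : ℝ) *
        ∫⁻ s in Ioi (0 : ℝ), ∫⁻ x, Ω.indicator (bw Ω) x *
          outerPotential Ω (fun _ => 1) (x - s • v)) := by
  set D := (ENNReal.ofReal d * ipow 1 v) ^ (1 / 2 : ℝ) with hD
  have hDt : D ≠ ∞ := ENNReal.rpow_ne_top_of_nonneg (by norm_num)
    (ENNReal.mul_ne_top (by simp) (ipow_ne_top zero_le_one hv))
  have hm : Measurable fun p : V3 × V3 × ℝ => exitKernel Ω (fun _ => 1) v p.1 p.2.1 p.2.2 :=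
    measurable_exitKernel hΩ.measurableSet measurable_const v
  let E : V3 → V3 → ℝ≥0∞ := fun x y => ∫⁻ s in Ioi (0 : ℝ), exitKernel Ω (fun _ => 1) v x y s
  have hm' : Measurable fun q : (V3 × V3) × ℝ => exitKernel Ω (fun _ => 1) v q.1.1 q.1.2 q.2 :=
    hm.comp (f := fun q : (V3 × V3) × ℝ => (q.1.1, q.1.2, q.2)) (by fun_prop)
  have hE : Measurable fun p : V3 × V3 => E p.1 p.2 := hm'.lintegral_prod_right'
  have hE' : Measurable fun p : V3 × V3 => E p.2 p.1 := hE.comp measurable_swap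
  have hpt : ∀ x ∈ Ω, ∀ y ∈ Ω,
      ipow 4 (x - y) * ‖tauMinus Ω x v - tauMinus Ω y v‖ₑ ^ (3 / 2 : ℝ) ≤
        D * (E x y + E y x) := by
    intro x hx y hy
    rcases le_total (tauMinus Ω x v) (tauMinus Ω y v) with h | h
    · rw [enorm_sub_rev, ← ofReal_norm, Real.norm_of_nonneg (sub_nonneg.2 h)]
      exact (hΩ.ipow_mul_tauMinus_sub_le hx hy hv).trans (mul_le_mul_right le_self_add _)
    · rw [ipow_sub_comm, ← ofReal_norm, Real.norm_of_nonneg (sub_nonneg.2 h)]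
      exact (hΩ.ipow_mul_tauMinus_sub_le hy hx hv).trans (mul_le_mul_right le_add_self _)
  have hI : ∫⁻ x, ∫⁻ y, E x y = ∫⁻ s in Ioi (0 : ℝ), ∫⁻ x, Ω.indicator (bw Ω) x *
          outerPotential Ω (fun _ => 1) (x - s • v) := by
    have := lintegral_exitKernel hΩ.measurableSet (measurable_const (a := (1 : ℝ))) v
    simpa [E] using this
  calc _ ≤ ∫⁻ x, ∫⁻ y, D * (E x y + E y x) := by
        refine (setLIntegral_mono' hΩ.measurableSet fun x hx => ?_).trans
          (setLIntegral_le_lintegral Ω _)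
        exact (setLIntegral_mono' hΩ.measurableSet fun y hy => hpt x hx y hy).trans
          (setLIntegral_le_lintegral _ _)
    _ = D * ∫⁻ x, ∫⁻ y, (E x y + E y x) := by
        rw [← lintegral_const_mul' _ _ hDt]
        refine lintegral_congr fun x => ?_
        rw [lintegral_const_mul' _ _ hDt]
    _ = D * ((∫⁻ x, ∫⁻ y, E x y) + ∫⁻ x, ∫⁻ y, E y x) := by
        rw [← lintegral_add_left hE.lintegral_prod_right']
        congr 1
        refine lintegral_congr fun x => ?_
        exact lintegral_add_left (hE.of_uncurry_left (x := x)) _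
    _ = D * ((∫⁻ x, ∫⁻ y, E x y) + ∫⁻ x, ∫⁻ y, E x y) := by
        rw [lintegral_lintegral_swap (f := fun x y => E y x) hE'.aemeasurable]
    _ = _ := by rw [hI]; ring

/-- The net exponent is `4 - 3/2 = 5/2 < 3`. The factor `exp(d²)` merely compensates the Gaussian of
the comparison kernel on a set of diameter at most `d`. -/
theorem IsConvexBody.exists_lintegral_ipow_five_halves_le (hΩ : IsConvexBody Ω d) :
    ∃ C : ℝ≥0, ∫⁻ x in Ω, ∫⁻ y in Ω, ipow 4 (x - y) * ‖x - y‖ₑ ^ (3 / 2 : ℝ) ≤ C := by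
  obtain ⟨C, hC⟩ := exists_lintegral_gk_le (5 / 2) 1 (by norm_num) one_pos
  have hvol := hΩ.volume_lt_top
  have key : ∀ x ∈ Ω, ∫⁻ y in Ω, ipow 4 (x - y) * ‖x - y‖ₑ ^ (3 / 2 : ℝ) ≤
      ENNReal.ofReal (Real.exp (d ^ 2)) * C := by
    intro x hx
    calc _ ≤ ∫⁻ y in Ω, ENNReal.ofReal (Real.exp (d ^ 2)) * gk (5 / 2) 1 (y - x) := by
          refine lintegral_mono_ae ?_
          have h0 : ∀ᵐ y ∂volume.restrict Ω, y ≠ x :=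
            ae_restrict_of_ae (compl_mem_ae_iff.2 (measure_singleton x))
          refine (h0.and (ae_restrict_mem hΩ.measurableSet)).mono ?_
          rintro y ⟨hne, hy⟩
          have hz : y - x ≠ 0 := sub_ne_zero.2 hne
          have hn : 0 < ‖y - x‖ := norm_pos_iff.2 hz
          rw [ipow_sub_comm, enorm_sub_rev, gk, mul_left_comm, ipow_eq_ofReal _ hz,
            ipow_eq_ofReal _ hz, ← ofReal_norm, ENNReal.ofReal_rpow_of_nonneg hn.le (by norm_num),
            ← ENNReal.ofReal_mul (by positivity), ← Real.rpow_add hn]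
          refine le_mul_of_one_le_right zero_le ?_ |>.trans' (by norm_num)
          rw [← ENNReal.ofReal_mul (by positivity), ← Real.exp_add, ENNReal.one_le_ofReal,
            Real.one_le_exp_iff]
          have := hΩ.norm_sub_lt y hy x hx
          nlinarith
      _ ≤ _ := by
          rw [lintegral_const_mul' _ _ ENNReal.ofReal_ne_top]
          exact mul_le_mul_right ((setLIntegral_le_lintegral _ _).trans (hC x)) _
  refine ⟨(ENNReal.ofReal (Real.exp (d ^ 2)) * C * volume Ω).toNNReal, ?_⟩
  rw [ENNReal.coe_toNNReal (ENNReal.mul_ne_top (ENNReal.mul_ne_top (by simp) (by simp)) hvol.ne)]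
  refine (setLIntegral_mono' hΩ.measurableSet key).trans ?_
  rw [setLIntegral_const]

end LinBoltzmann

namespace LinBoltzmann

variable {B : ℝ → ℝ → ℝ} {γ d : ℝ} {Ω : Set V3}

/-! ### Free transport of the incoming data -/

theorem IsConvexBody.qMinus_notMem (hΩ : IsConvexBody Ω d) {x v : V3} (hx : x ∈ Ω) (hv : v ≠ 0) :
    qMinus Ω x v ∉ Ω := fun h =>
  lt_irrefl _ ((hΩ.mem_iff hx hv (tauMinus_nonneg x v)).1 h)

theorem IsConvexBody.qMinus_mem_closure (hΩ : IsConvexBody Ω d) {x v : V3} (hx : x ∈ Ω)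
    (hv : v ≠ 0) : qMinus Ω x v ∈ closure Ω := by
  have hpos := hΩ.tauMinus_pos hx hv
  have hc : Continuous fun s : ℝ => x - s • v := by fun_prop
  have h1 : Tendsto (fun s : ℝ => x - s • v) (𝓝[<] tauMinus Ω x v) (𝓝 (qMinus Ω x v)) :=
    (hc.tendsto _).mono_left nhdsWithin_le_nhds
  refine mem_closure_of_tendsto h1 ?_
  filter_upwards [Ioo_mem_nhdsLT hpos] with s hs
  exact (hΩ.mem_iff hx hv hs.1.le).2 hs.2

/-- A supporting hyperplane at the exit point separates it strictly from the open set `Ω`. Since `x`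
is reached from that point in direction `v`, the normal satisfies `n · v < 0`. -/
theorem IsConvexBody.qMinus_mem_gammaMinus (hΩ : IsConvexBody Ω d) {x v : V3} (hx : x ∈ Ω)
    (hv : v ≠ 0) : (qMinus Ω x v, v) ∈ gammaMinus Ω := by
  have hpos := hΩ.tauMinus_pos hx hv
  have hq := hΩ.qMinus_notMem hx hv
  refine ⟨⟨hΩ.qMinus_mem_closure hx hv, fun h => hq (interior_subset h)⟩, ?_⟩
  obtain ⟨f, hf⟩ := geometric_hahn_banach_open_point hΩ.convex hΩ.isOpen hq
  set m : V3 := (InnerProductSpace.toDual ℝ V3).symm f with hm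
  have hfm : ∀ z, ⟪m, z⟫ = f z := fun z => InnerProductSpace.toDual_symm_apply
  have hm0 : m ≠ 0 := by
    intro h0
    have h1 := hf x hx
    rw [← hfm, ← hfm, h0, inner_zero_left, inner_zero_left] at h1
    exact lt_irrefl _ h1
  have hn : 0 < ‖m‖⁻¹ := inv_pos.2 (norm_pos_iff.2 hm0)
  have hlt : ∀ z ∈ Ω, ⟪m, z - qMinus Ω x v⟫ < 0 := fun z hz => by
    rw [inner_sub_right, hfm, hfm]; linarith [hf z hz]
  refine ⟨‖m‖⁻¹ • m, ⟨norm_smul_inv_norm hm0, fun z hz => ?_⟩, ?_⟩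
  · show ⟪‖m‖⁻¹ • m, z - qMinus Ω x v⟫ ≤ 0
    rw [real_inner_smul_left]
    exact mul_nonpos_of_nonneg_of_nonpos hn.le (hlt z hz).le
  · have h1 := hlt x hx
    rw [qMinus, sub_sub_cancel, real_inner_smul_right] at h1
    have h2 : ⟪m, v⟫ < 0 := by
      by_contra hc
      exact absurd h1 (not_lt.2 (mul_nonneg hpos.le (not_lt.1 hc)))
    rw [real_inner_smul_left]
    exact mul_neg_of_pos_of_neg hn h2

/-- The free transport of the incoming data, `e^{-ν τ₋} g(q₋, v)`. -/
noncomputable def inflow (Ω : Set V3) (B : ℝ → ℝ → ℝ) (g : V3 × V3 → ℝ) (p : V3 × V3) : ℝ :=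
  Real.exp (-collisionFrequency B p.2 * tauMinus Ω p.1 p.2) * g (qMinus Ω p.1 p.2, p.2)

theorem abs_exp_neg_sub_exp_neg_le {a b : ℝ} (ha : 0 ≤ a) (hb : 0 ≤ b) :
    |Real.exp (-a) - Real.exp (-b)| ≤ |a - b| := by
  wlog h : a ≤ b generalizing a b
  · rw [abs_sub_comm, abs_sub_comm a b]
    exact this hb ha (le_of_not_ge h)
  have h1 : Real.exp (-b) ≤ Real.exp (-a) := Real.exp_le_exp.2 (by linarith)
  rw [abs_of_nonneg (by linarith), abs_sub_comm, abs_of_nonneg (by linarith)]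
  have h2 : Real.exp (-b) = Real.exp (-a) * Real.exp (a - b) := by rw [← Real.exp_add]; ring_nf
  have h3 := Real.add_one_le_exp (a - b)
  have h4 : Real.exp (-a) ≤ 1 := Real.exp_le_one_iff.2 (by linarith)
  rw [h2]
  nlinarith [Real.exp_pos (-a)]

/-- Interpolation between a sup bound `a`, which keeps the Gaussian decay, and a Lipschitz bound
`b`, whose power `3/2` matches the exit-time estimate. -/
theorem sq_le_rpow_mul_rpow {t a b : ℝ≥0∞} (ha : t ≤ a) (hb : t ≤ b) :
    t ^ 2 ≤ a ^ (1 / 2 : ℝ) * b ^ (3 / 2 : ℝ) := by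
  have : t ^ 2 = t ^ (1 / 2 : ℝ) * t ^ (3 / 2 : ℝ) := by
    rw [← ENNReal.rpow_add_of_nonneg _ _ (by norm_num) (by norm_num), ← ENNReal.rpow_two]
    norm_num
  rw [this]
  exact mul_le_mul' (ENNReal.rpow_le_rpow ha (by norm_num)) (ENNReal.rpow_le_rpow hb (by norm_num))

theorem rpow_three_halves_add_le (s t : ℝ≥0∞) :
    (s + t) ^ (3 / 2 : ℝ) ≤ 2 * (s ^ (3 / 2 : ℝ) + t ^ (3 / 2 : ℝ)) := by
  refine (ENNReal.rpow_add_le_mul_rpow_add_rpow s t (p := 3 / 2) (by norm_num)).trans ?_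
  refine mul_le_mul_left ?_ _
  calc (2 : ℝ≥0∞) ^ ((3 / 2 : ℝ) - 1) ≤ 2 ^ (1 : ℝ) :=
        ENNReal.rpow_le_rpow_of_exponent_le (by norm_num) (by norm_num)
    _ = 2 := ENNReal.rpow_one _

/-- The bounds on the free transport of the incoming data that its regularity rests on: Gaussian
decay, and a modulus of continuity in terms of the exit times. -/
theorem IsConvexBody.exists_inflow_le (hΩ : IsConvexBody Ω d) (hγ : γ ∈ Icc (0 : ℝ) 1)
    (hB : IsCutoff B γ) {g : V3 × V3 → ℝ} (hg : IsIncomingData Ω g) :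
    ∃ (a : ℝ) (A : ℝ≥0), 0 < a ∧
      (∀ x ∈ Ω, ∀ v : V3, v ≠ 0 →
        ‖inflow Ω B g (x, v)‖ₑ ≤ A * ENNReal.ofReal (Real.exp (-a * ‖v‖ ^ 2))) ∧
      ∀ x ∈ Ω, ∀ y ∈ Ω, ∀ v : V3, v ≠ 0 →
        ‖inflow Ω B g (x, v) - inflow Ω B g (y, v)‖ₑ ^ 2 ≤
          A * ENNReal.ofReal (Real.exp (-a * ‖v‖ ^ 2)) ^ (1 / 2 : ℝ) *
            (ENNReal.ofReal (1 + ‖v‖) ^ (3 / 2 : ℝ) *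
              ‖tauMinus Ω x v - tauMinus Ω y v‖ₑ ^ (3 / 2 : ℝ) + ‖x - y‖ₑ ^ (3 / 2 : ℝ)) := by
  obtain ⟨a, C, ha, hC, hg1, hg2⟩ := hg
  obtain ⟨N, hN, hν⟩ := exists_collisionFrequency_le hγ hB
  set c : ℝ≥0 := C.toNNReal with hc
  have hcC : ENNReal.ofReal C = c := rfl
  set n : ℝ≥0 := N.toNNReal with hnn
  have hnN : ENNReal.ofReal N = n := rfl
  have hgq : ∀ x ∈ Ω, ∀ v : V3, v ≠ 0 →
      ‖g (qMinus Ω x v, v)‖ₑ ≤ c * ENNReal.ofReal (Real.exp (-a * ‖v‖ ^ 2)) := by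
    intro x hx v hv
    have := hg1 _ (hΩ.qMinus_mem_gammaMinus hx hv)
    rw [← hcC, ← ENNReal.ofReal_mul hC.le, ← ofReal_norm]
    exact ENNReal.ofReal_le_ofReal this
  have hE1 : ∀ x v : V3,
      ‖Real.exp (-collisionFrequency B v * tauMinus Ω x v)‖ₑ ≤ 1 := by
    intro x v
    rw [← ofReal_norm, ENNReal.ofReal_le_one, Real.norm_of_nonneg (Real.exp_pos _).le,
      Real.exp_le_one_iff]
    nlinarith [collisionFrequency_nonneg hB v, tauMinus_nonneg (Ω := Ω) x v]
  -- The summand `c` serves the pointwise decay; the other two come from the increments of the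
  -- exponential and of the data.
  refine ⟨a, c + (2 * (n ^ (3 / 2 : ℝ) * c ^ 2) +
    2 * (2 * ((2 * c) ^ (1 / 2 : ℝ) * c ^ (3 / 2 : ℝ)))), ha, fun x hx v hv => ?_,
    fun x hx y hy v hv => ?_⟩
  · rw [inflow, enorm_mul]
    calc _ ≤ 1 * (c * ENNReal.ofReal (Real.exp (-a * ‖v‖ ^ 2))) :=
          mul_le_mul' (hE1 x v) (hgq x hx v hv)
      _ ≤ _ := by
          rw [one_mul]
          refine mul_le_mul_left ?_ _
          exact_mod_cast le_self_add
  · set G := ENNReal.ofReal (Real.exp (-a * ‖v‖ ^ 2)) with hG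
    set L := ENNReal.ofReal (1 + ‖v‖) with hL
    set T := ‖tauMinus Ω x v - tauMinus Ω y v‖ₑ with hT
    set R := ‖x - y‖ₑ with hR
    set Ex := Real.exp (-collisionFrequency B v * tauMinus Ω x v) with hEx
    set Ey := Real.exp (-collisionFrequency B v * tauMinus Ω y v) with hEy
    set gx := g (qMinus Ω x v, v)
    set gy := g (qMinus Ω y v, v)
    have hν0 := collisionFrequency_nonneg hB v
    have hG1 : G ≤ 1 := by
      rw [hG, ENNReal.ofReal_le_one, Real.exp_le_one_iff]
      nlinarith [sq_nonneg ‖v‖]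
    have hG2 : G ^ 2 ≤ G ^ (1 / 2 : ℝ) := by
      rw [← ENNReal.rpow_two]
      exact ENNReal.rpow_le_rpow_of_exponent_ge hG1 (by norm_num)
    have hLT : ‖v‖ₑ * T ≤ L * T := by
      refine mul_le_mul_left ?_ _
      rw [hL, ← ofReal_norm]
      exact ENNReal.ofReal_le_ofReal (by linarith)
    have t1 : ‖Ex - Ey‖ₑ ≤ 1 := by
      rw [← ofReal_norm, ENNReal.ofReal_le_one, Real.norm_eq_abs, abs_le]
      have e1 : Ex ≤ 1 := by
        rw [hEx, Real.exp_le_one_iff]; nlinarith [tauMinus_nonneg (Ω := Ω) x v]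
      have e2 : Ey ≤ 1 := by
        rw [hEy, Real.exp_le_one_iff]; nlinarith [tauMinus_nonneg (Ω := Ω) y v]
      constructor <;> linarith [Real.exp_pos (-collisionFrequency B v * tauMinus Ω x v),
        Real.exp_pos (-collisionFrequency B v * tauMinus Ω y v)]
    have t2 : ‖Ex - Ey‖ₑ ≤ n * (L * T) := by
      have h1 := abs_exp_neg_sub_exp_neg_le (mul_nonneg hν0 (tauMinus_nonneg (Ω := Ω) x v))
        (mul_nonneg hν0 (tauMinus_nonneg (Ω := Ω) y v))
      rw [← mul_sub, abs_mul, abs_of_nonneg hν0, ← neg_mul, ← neg_mul] at h1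
      rw [← hnN, ← mul_assoc, hL, ← ENNReal.ofReal_mul hN, hT, ← ofReal_norm, ← ofReal_norm,
        ← ENNReal.ofReal_mul (by positivity)]
      exact ENNReal.ofReal_le_ofReal (h1.trans (mul_le_mul_of_nonneg_right (hν v) (abs_nonneg _)))
    have t3 : ‖gx - gy‖ₑ ≤ 2 * c * G := by
      calc _ ≤ ‖gx‖ₑ + ‖gy‖ₑ := enorm_sub_le
        _ ≤ c * G + c * G := add_le_add (hgq x hx v hv) (hgq y hy v hv)
        _ = _ := by ring
    have t4 : ‖gx - gy‖ₑ ≤ c * (R + L * T) := by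
      have h1 := hg2 _ _ v (hΩ.qMinus_mem_gammaMinus hx hv) (hΩ.qMinus_mem_gammaMinus hy hv)
      calc ‖gx - gy‖ₑ ≤ c * ‖qMinus Ω x v - qMinus Ω y v‖ₑ := by
            rw [← hcC, ← ofReal_norm, ← ofReal_norm, ← ENNReal.ofReal_mul hC.le]
            exact ENNReal.ofReal_le_ofReal h1
        _ ≤ _ := by
            refine mul_le_mul_right ?_ _
            have : qMinus Ω x v - qMinus Ω y v =
                (x - y) - (tauMinus Ω x v - tauMinus Ω y v) • v := by
              simp only [qMinus]; module
            rw [this]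
            refine enorm_sub_le.trans (add_le_add_right ?_ _)
            rw [enorm_smul, mul_comm]
            exact hLT
    -- The exponential has only the sup bound `1`, its Gaussian factor coming from the data; the
    -- increment of the data keeps `G^{1/2}` from the sup bound `2 c G`.
    have s1 := sq_le_rpow_mul_rpow t1 t2
    have s2 := sq_le_rpow_mul_rpow t3 t4
    rw [ENNReal.one_rpow, one_mul, ENNReal.mul_rpow_of_nonneg _ _ (by norm_num),
      ENNReal.mul_rpow_of_nonneg _ _ (by norm_num)] at s1
    rw [ENNReal.mul_rpow_of_nonneg _ _ (by norm_num),
      ENNReal.mul_rpow_of_nonneg _ (R + L * T) (by norm_num)] at s2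
    have s3 := rpow_three_halves_add_le R (L * T)
    rw [ENNReal.mul_rpow_of_nonneg L T (by norm_num)] at s3
    set L' := L ^ (3 / 2 : ℝ)
    set T' := T ^ (3 / 2 : ℝ)
    set R' := R ^ (3 / 2 : ℝ)
    set G' := G ^ (1 / 2 : ℝ)
    have hdiff : ‖inflow Ω B g (x, v) - inflow Ω B g (y, v)‖ₑ ≤
        ‖Ex - Ey‖ₑ * ‖gx‖ₑ + ‖gx - gy‖ₑ := by
      have : inflow Ω B g (x, v) - inflow Ω B g (y, v) = (Ex - Ey) * gx + Ey * (gx - gy) := by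
        simp only [inflow, Ex, Ey, gx, gy]; ring
      rw [this]
      refine (enorm_add_le _ _).trans (add_le_add (enorm_mul _ _).le ?_)
      rw [enorm_mul]
      exact (mul_le_mul_left (hE1 y v) _).trans (one_mul _).le
    have p1 : (‖Ex - Ey‖ₑ * ‖gx‖ₑ) ^ 2 ≤ (n : ℝ≥0∞) ^ (3 / 2 : ℝ) * c ^ 2 * (G' * (L' * T')) := by
      rw [mul_pow]
      calc _ ≤ (n : ℝ≥0∞) ^ (3 / 2 : ℝ) * (L' * T') * (c * G) ^ 2 :=
            mul_le_mul' s1 (pow_le_pow_left₀ zero_le (hgq x hx v hv) 2)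
        _ = (n : ℝ≥0∞) ^ (3 / 2 : ℝ) * c ^ 2 * (G ^ 2 * (L' * T')) := by ring
        _ ≤ _ := mul_le_mul_right (mul_le_mul_left hG2 _) _
    have p2 : ‖gx - gy‖ₑ ^ 2 ≤ (2 * (((2 * c : ℝ≥0∞)) ^ (1 / 2 : ℝ) * (c : ℝ≥0∞) ^ (3 / 2 : ℝ))) *
        (G' * (L' * T' + R')) := by
      refine s2.trans ((mul_le_mul_right (mul_le_mul_right s3 _) _).trans (le_of_eq ?_))
      ring
    have p3 : G' * (L' * T') ≤ G' * (L' * T' + R') := mul_le_mul_right le_self_add _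
    push_cast
    rw [ENNReal.coe_rpow_of_nonneg _ (by norm_num), ENNReal.coe_rpow_of_nonneg _ (by norm_num),
      ENNReal.coe_rpow_of_nonneg _ (by norm_num)]
    push_cast
    calc _ ≤ (‖Ex - Ey‖ₑ * ‖gx‖ₑ + ‖gx - gy‖ₑ) ^ 2 := pow_le_pow_left₀ zero_le hdiff 2
      _ ≤ 2 * (‖Ex - Ey‖ₑ * ‖gx‖ₑ) ^ 2 + 2 * ‖gx - gy‖ₑ ^ 2 := by
          refine (ennreal_add_sq_le _ _).trans (le_of_eq ?_)
          ring
      _ ≤ 2 * ((n : ℝ≥0∞) ^ (3 / 2 : ℝ) * c ^ 2 * (G' * (L' * T' + R'))) +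
          2 * ((2 * (((2 * c : ℝ≥0∞)) ^ (1 / 2 : ℝ) * (c : ℝ≥0∞) ^ (3 / 2 : ℝ))) *
            (G' * (L' * T' + R'))) :=
          add_le_add (mul_le_mul_right (p1.trans (mul_le_mul_right p3 _)) _)
            (mul_le_mul_right p2 _)
      _ = (2 * ((n : ℝ≥0∞) ^ (3 / 2 : ℝ) * c ^ 2) +
          2 * (2 * ((2 * c : ℝ≥0∞) ^ (1 / 2 : ℝ) * (c : ℝ≥0∞) ^ (3 / 2 : ℝ)))) * G' *
            (L' * T' + R') := by ring
      _ ≤ _ := mul_le_mul_left (mul_le_mul_left le_add_self _) _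

end LinBoltzmann

namespace LinBoltzmann

variable {B : ℝ → ℝ → ℝ} {γ d : ℝ} {Ω : Set V3}

/-! ### The Duhamel formula -/

/-- Variation of constants for `φ' = ψ - ν φ` on `(0, τ]` with `φ(0+) = c`, in integrated form. -/
theorem variation_of_constants {φ ψ : ℝ → ℝ} {ν τ c : ℝ} (hτ : 0 < τ)
    (hφ : IntervalIntegrable φ volume 0 τ) (hψ : IntervalIntegrable ψ volume 0 τ)
    (h : ∀ a b : ℝ, 0 < a → a ≤ b → b ≤ τ → φ b - φ a = ∫ s in a..b, (ψ s - ν * φ s))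
    (hlim : Tendsto φ (𝓝[>] 0) (𝓝 c)) :
    φ τ = Real.exp (-ν * τ) * c + ∫ s in (0 : ℝ)..τ, Real.exp (-ν * s) * ψ (τ - s) := by
  let k : ℝ → ℝ := fun s => ψ s - ν * φ s
  have hk : IntervalIntegrable k volume 0 τ := hψ.sub (hφ.const_mul ν)
  have hsub : ∀ {a b : ℝ}, a ∈ Icc 0 τ → b ∈ Icc 0 τ → IntervalIntegrable k volume a b :=
    fun ha hb => hk.mono_set (by
      rw [uIcc_of_le hτ.le]; exact (convex_Icc (0 : ℝ) τ).ordConnected.uIcc_subset ha hb)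
  have h0 : (0 : ℝ) ∈ Icc 0 τ := ⟨le_rfl, hτ.le⟩
  -- Letting the lower endpoint tend to `0` brings in the boundary value, since the primitive of an
  -- integrable function is continuous.
  have h1 : ∀ b ∈ Ioc 0 τ, φ b = c + ∫ s in (0 : ℝ)..b, k s := by
    intro b hb
    have hb' : b ∈ Icc 0 τ := ⟨hb.1.le, hb.2⟩
    have hcont := intervalIntegral.continuousOn_primitive_interval' (a := b) (hsub h0 hb')
      (by rw [uIcc_of_le hb.1.le]; exact ⟨hb.1.le, le_rfl⟩)
    have h2 : Tendsto (fun a => ∫ s in b..a, k s) (𝓝[>] 0) (𝓝 (∫ s in b..0, k s)) := by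
      refine (hcont 0 left_mem_uIcc).mono_left ?_
      rw [uIcc_of_le hb.1.le]
      refine nhdsWithin_le_iff.2 ?_
      filter_upwards [Ioo_mem_nhdsGT hb.1] with s hs using ⟨hs.1.le, hs.2.le⟩
    have h3 : Tendsto φ (𝓝[>] 0) (𝓝 (φ b + ∫ s in b..0, k s)) := by
      refine (tendsto_const_nhds.add h2).congr' ?_
      filter_upwards [Ioo_mem_nhdsGT hb.1] with a ha
      have := h a b ha.1 ha.2.le hb.2
      rw [intervalIntegral.integral_symm, ← this]
      ring
    have h4 := tendsto_nhds_unique hlim h3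
    rw [h4, intervalIntegral.integral_symm]
    ring
  -- The integrating factor. As the primitive of `k` is only absolutely continuous, the product rule
  -- is used as integration by parts.
  let E : ℝ → ℝ := fun s => Real.exp (-ν * (τ - s))
  have hEd : ∀ s, HasDerivAt E (ν * E s) s := by
    intro s
    have a1 : HasDerivAt (fun s : ℝ => -ν * (τ - s)) ν s := by
      have := ((hasDerivAt_id s).const_sub τ).const_mul (-ν)
      simpa using this
    have := a1.exp
    rwa [mul_comm] at this
  have hE : AbsolutelyContinuousOnInterval E 0 τ := by
    refine ContDiffOn.absolutelyContinuousOnInterval (ContDiff.contDiffOn ?_)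
    fun_prop
  have hP := hk.absolutelyContinuousOnInterval_intervalIntegral (c := 0) left_mem_uIcc
  have hP' : ∀ᵐ s, s ∈ uIoc 0 τ → deriv (fun s => ∫ t in (0 : ℝ)..s, k t) s = k s := by
    refine hk.ae_hasDerivAt_integral.mono fun s hs hsi => ?_
    exact (hs (uIoc_subset_uIcc hsi) 0 left_mem_uIcc).deriv
  have hparts := hE.integral_mul_deriv_eq_deriv_mul hP
  have e1 : ∫ s in (0 : ℝ)..τ, E s * deriv (fun s => ∫ t in (0 : ℝ)..s, k t) s =
      ∫ s in (0 : ℝ)..τ, E s * k s := by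
    refine intervalIntegral.integral_congr_ae (hP'.mono fun s hs hsi => ?_)
    rw [hs hsi]
  have e2 : ∫ s in (0 : ℝ)..τ, deriv E s * ∫ t in (0 : ℝ)..s, k t =
      ∫ s in (0 : ℝ)..τ, (ν * (E s * φ s) - ν * E s * c) := by
    refine intervalIntegral.integral_congr_ae (Eventually.of_forall fun s hsi => ?_)
    rw [uIoc_of_le hτ.le] at hsi
    rw [(hEd s).deriv, h1 s hsi]
    ring
  have hEc : Continuous E := by fun_prop
  have iφ : IntervalIntegrable (fun s => E s * φ s) volume 0 τ :=
    hφ.continuousOn_mul hEc.continuousOn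
  have iψ : IntervalIntegrable (fun s => E s * ψ s) volume 0 τ :=
    hψ.continuousOn_mul hEc.continuousOn
  have iE : IntervalIntegrable (fun s => ν * E s * c) volume 0 τ :=
    (by fun_prop : Continuous fun s => ν * E s * c).intervalIntegrable _ _
  have e3 : ∫ s in (0 : ℝ)..τ, E s * k s =
      (∫ s in (0 : ℝ)..τ, E s * ψ s) - ∫ s in (0 : ℝ)..τ, ν * (E s * φ s) := by
    rw [← intervalIntegral.integral_sub iψ (iφ.const_mul ν)]
    refine intervalIntegral.integral_congr fun s _ => ?_
    simp only [k]; ring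
  have e4 : ∫ s in (0 : ℝ)..τ, ν * E s * c = (E τ - E 0) * c := by
    rw [intervalIntegral.integral_mul_const]
    congr 1
    exact intervalIntegral.integral_eq_sub_of_hasDerivAt (fun s _ => hEd s)
      ((by fun_prop : Continuous fun s => ν * E s).intervalIntegrable _ _)
  have e5 : ∫ s in (0 : ℝ)..τ, E s * ψ s = ∫ s in (0 : ℝ)..τ, Real.exp (-ν * s) * ψ (τ - s) := by
    have := intervalIntegral.integral_comp_sub_left (a := 0) (b := τ)
      (fun s => E s * ψ s) τ
    rw [sub_self, sub_zero] at this
    rw [← this]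
    refine intervalIntegral.integral_congr fun s _ => ?_
    simp only [E, sub_sub_cancel]
  have hEτ : E τ = 1 := by simp [E]
  have hE0 : E 0 = Real.exp (-ν * τ) := by simp [E]
  rw [e1, e2, e3, intervalIntegral.integral_sub (iφ.const_mul ν) iE, e4,
    intervalIntegral.integral_same, hEτ, hE0, e5] at hparts
  have h5 := h1 τ ⟨hτ, le_rfl⟩
  linarith

/-- Duhamel's formula: a solution of the incoming boundary value problem is the sum of the free
transport of the data and of `S K f`. -/
theorem IsConvexBody.ae_eq_inflow_add (hΩ : IsConvexBody Ω d) (hγ : γ ∈ Icc (0 : ℝ) 1)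
    (hB : IsCutoff B γ) {g F : V3 × V3 → ℝ} (hF : MemLp F 2 (phaseMeasure Ω))
    (h : ∀ᵐ p ∂(phaseMeasure Ω),
      (∀ a b : ℝ, 0 < a → a ≤ b → b < tauMinus Ω p.1 p.2 + tauPlus Ω p.1 p.2 →
        F (qMinus Ω p.1 p.2 + b • p.2, p.2) - F (qMinus Ω p.1 p.2 + a • p.2, p.2) =
          ∫ s in a..b, (opK B F (qMinus Ω p.1 p.2 + s • p.2, p.2) -
            collisionFrequency B p.2 * F (qMinus Ω p.1 p.2 + s • p.2, p.2))) ∧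
      Tendsto (fun s : ℝ => F (qMinus Ω p.1 p.2 + s • p.2, p.2)) (𝓝[>] 0)
        (𝓝 (g (qMinus Ω p.1 p.2, p.2)))) :
    F =ᵐ[phaseMeasure Ω] inflow Ω B g + opS Ω B (opK B F) := by
  have i1 := hΩ.ae_integrableOn_line hF
  have i2 := hΩ.ae_integrableOn_line (memLp_opK hΩ.measurableSet hγ hB hF)
  refine ((h.and (i1.and i2)).and ((ae_phase_mem hΩ.measurableSet).and ae_phase_ne_zero)).mono ?_
  rintro ⟨x, v⟩ ⟨⟨⟨h1, h2⟩, i1, i2⟩, hx, hv⟩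
  dsimp only at h1 h2 i1 i2 hx hv
  have hτ := hΩ.tauMinus_pos hx hv
  -- Positivity of the forward exit time puts `x` strictly inside the characteristic, so the
  -- integrated equation holds up to parameter `τ₋` inclusive.
  have hτ' : 0 < tauPlus Ω x v := by
    rw [tauPlus_eq]; exact hΩ.tauMinus_pos hx (neg_ne_zero.2 hv)
  set τ := tauMinus Ω x v with hτd
  have hline : ∀ s : ℝ, qMinus Ω x v + (τ - s) • v = x - s • v := fun s => by
    simp only [qMinus, ← hτd]; module
  have key : ∀ u : V3 × V3 → ℝ, IntegrableOn (fun s : ℝ => u (x - s • v, v)) (Ioc 0 τ) →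
      IntervalIntegrable (fun s : ℝ => u (qMinus Ω x v + s • v, v)) volume 0 τ := by
    intro u hu
    rw [← intervalIntegrable_iff_integrableOn_Ioc_of_le hτ.le] at hu
    have := (hu.comp_sub_left τ).symm
    rw [sub_self, sub_zero] at this
    refine IntervalIntegrable.congr (fun s _ => ?_) this
    simp only [← hline, sub_sub_cancel]
  have := variation_of_constants hτ (key F i1) (key (opK B F) i2)
    (fun a b ha hab hb => h1 a b ha hab (by linarith)) h2
  simp only [hline] at this
  rw [show qMinus Ω x v + τ • v = x by simp [qMinus, ← hτd]] at this
  exact this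

end LinBoltzmann

namespace LinBoltzmann

variable {B : ℝ → ℝ → ℝ} {γ d : ℝ} {Ω : Set V3}

/-! ### Regularity of solutions -/

theorem exists_one_add_pow_le_exp {c : ℝ} (hc : 0 < c) :
    ∃ K : ℝ, 0 ≤ K ∧ ∀ r : ℝ, 0 ≤ r → (1 + r) ^ 4 ≤ K * Real.exp (c * r ^ 2) := by
  refine ⟨8 + 16 / c ^ 2, by positivity, fun r hr => ?_⟩
  have h1 := Real.quadratic_le_exp_of_nonneg (mul_nonneg hc.le (sq_nonneg r))
  have h2 : (1 + r) ^ 4 ≤ 8 * (1 + r ^ 4) := by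
    nlinarith [sq_nonneg (r - 1), sq_nonneg (r ^ 2 - 1), sq_nonneg (r ^ 2 - r), sq_nonneg (r + 1)]
  have h3 : 1 ≤ Real.exp (c * r ^ 2) := Real.one_le_exp (by positivity)
  have h4 : 8 * r ^ 4 = 16 / c ^ 2 * ((c * r ^ 2) ^ 2 / 2) := by field_simp; ring
  have h5 : 16 / c ^ 2 * ((c * r ^ 2) ^ 2 / 2) ≤ 16 / c ^ 2 * Real.exp (c * r ^ 2) := by
    gcongr
    nlinarith [mul_nonneg hc.le (sq_nonneg r)]
  nlinarith

/-- The target carries one more factor `|v|⁻¹` than the left side, so a power of `|v|` has to be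
paid besides `(1 + |v|)^{3/2}`. Half of the Gaussian `exp(-a|v|²/2)` absorbs both; the other half
gives the rate `a/4`. -/
theorem exists_velocity_weight_le {a : ℝ} (ha : 0 < a) (hd : 0 ≤ d) :
    ∃ K : ℝ≥0, ∀ v : V3, v ≠ 0 →
      ENNReal.ofReal (Real.exp (-a * ‖v‖ ^ 2)) ^ (1 / 2 : ℝ) *
        ENNReal.ofReal (1 + ‖v‖) ^ (3 / 2 : ℝ) * (ENNReal.ofReal d * ipow 1 v) ^ (1 / 2 : ℝ) ≤
      K * (gk (1 / 2) (a / 4) (v - 0) * ipow 1 v) := by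
  obtain ⟨K, hK, hKe⟩ := exists_one_add_pow_le_exp (c := a / 4) (by positivity)
  refine ⟨(K * d ^ (1 / 2 : ℝ)).toNNReal, fun v hv => ?_⟩
  have hr : 0 < ‖v‖ := norm_pos_iff.2 hv
  rw [sub_zero, gk, ipow_eq_ofReal _ hv, ipow_eq_ofReal _ hv]
  set r := ‖v‖
  rw [← ENNReal.ofReal_mul hd, ENNReal.ofReal_rpow_of_nonneg (by positivity) (by norm_num),
    ENNReal.ofReal_rpow_of_nonneg (by positivity) (by norm_num),
    ENNReal.ofReal_rpow_of_nonneg (by positivity) (by norm_num),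
    ← ENNReal.ofReal_mul (by positivity), ← ENNReal.ofReal_mul (by positivity),
    ← ENNReal.ofReal_mul (by positivity), ← ENNReal.ofReal_mul (by positivity),
    show ((K * d ^ (1 / 2 : ℝ)).toNNReal : ℝ≥0∞) = ENNReal.ofReal (K * d ^ (1 / 2 : ℝ)) from rfl,
    ← ENNReal.ofReal_mul (by positivity)]
  refine ENNReal.ofReal_le_ofReal ?_
  have e1 : Real.exp (-a * r ^ 2) ^ (1 / 2 : ℝ) =
      Real.exp (-(a / 4) * r ^ 2) * Real.exp (-(a / 4) * r ^ 2) := by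
    rw [← Real.exp_mul, ← Real.exp_add]; ring_nf
  have e2 : (d * r ^ (-1 : ℝ)) ^ (1 / 2 : ℝ) = d ^ (1 / 2 : ℝ) * r ^ (-(1 / 2) : ℝ) := by
    rw [Real.mul_rpow hd (by positivity), ← Real.rpow_mul hr.le]; norm_num
  have h1 : (1 + r) ^ (3 / 2 : ℝ) * r ≤ (1 + r) ^ 4 := by
    have : (1 + r) ^ (3 / 2 : ℝ) ≤ (1 + r) ^ (3 : ℝ) :=
      Real.rpow_le_rpow_of_exponent_le (by linarith) (by norm_num)
    rw [show (1 + r) ^ (3 : ℝ) = (1 + r) ^ 3 by exact_mod_cast Real.rpow_natCast (1 + r) 3] at this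
    calc _ ≤ (1 + r) ^ 3 * (1 + r) := by gcongr; linarith
      _ = _ := by ring
  have h2 : Real.exp (-(a / 4) * r ^ 2) * ((1 + r) ^ (3 / 2 : ℝ) * r) ≤ K := by
    have h3 := h1.trans (hKe r hr.le)
    calc _ ≤ Real.exp (-(a / 4) * r ^ 2) * (K * Real.exp (a / 4 * r ^ 2)) := by gcongr
      _ = K * (Real.exp (-(a / 4) * r ^ 2) * Real.exp (a / 4 * r ^ 2)) := by ring
      _ = K := by rw [← Real.exp_add]; simp
  rw [e1, e2, Real.rpow_neg_one]
  calc _ = (Real.exp (-(a / 4) * r ^ 2) * ((1 + r) ^ (3 / 2 : ℝ) * r)) *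
        (d ^ (1 / 2 : ℝ) * (r ^ (-(1 / 2) : ℝ) * Real.exp (-(a / 4) * r ^ 2) * r⁻¹)) := by
        field_simp
    _ ≤ K * (d ^ (1 / 2 : ℝ) * (r ^ (-(1 / 2) : ℝ) * Real.exp (-(a / 4) * r ^ 2) * r⁻¹)) := by
        gcongr
    _ = _ := by ring

theorem lintegral_gaussian_lt_top {c : ℝ} (hc : 0 < c) :
    ∫⁻ v : V3, ENNReal.ofReal (Real.exp (-c * ‖v‖ ^ 2)) < ∞ :=
  (integrable_gaussian hc).lintegral_lt_top

theorem IsConvexBody.lintegral_bw_inflow_lt_top (hΩ : IsConvexBody Ω d) (hγ : γ ∈ Icc (0 : ℝ) 1)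
    (hB : IsCutoff B γ) {g : V3 × V3 → ℝ} (hg : IsIncomingData Ω g) :
    ∫⁻ v, ∫⁻ x in Ω, bw Ω x * ‖inflow Ω B g (x, v)‖ₑ ^ 2 < ∞ := by
  obtain ⟨a, A, ha, h1, -⟩ := hΩ.exists_inflow_le hγ hB hg
  have hb := hΩ.lintegral_bw_lt_top
  have hpt : ∀ᵐ v : V3, ∫⁻ x in Ω, bw Ω x * ‖inflow Ω B g (x, v)‖ₑ ^ 2 ≤
      (∫⁻ x in Ω, bw Ω x) * (A ^ 2 * ENNReal.ofReal (Real.exp (-(2 * a) * ‖v‖ ^ 2))) := by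
    refine ae_ne_zero_V3.mono fun v hv => ?_
    rw [← lintegral_mul_const _ measurable_bw]
    refine setLIntegral_mono' hΩ.measurableSet fun x hx => mul_le_mul_right ?_ _
    refine (pow_le_pow_left₀ zero_le (h1 x hx v hv) 2).trans (le_of_eq ?_)
    rw [mul_pow, ← ENNReal.ofReal_pow (Real.exp_pos _).le, ← Real.exp_nat_mul]
    congr 3
    push_cast; ring
  refine (lintegral_mono_ae hpt).trans_lt ?_
  rw [lintegral_const_mul' _ _ hb.ne, lintegral_const_mul' _ _ (by simp)]
  exact ENNReal.mul_lt_top hb (ENNReal.mul_lt_top (by simp)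
    (lintegral_gaussian_lt_top (by positivity)))

/-- The free transport of the incoming data has half a derivative in `x`. -/
theorem IsConvexBody.lintegral_gagliardo_inflow_lt_top (hΩ : IsConvexBody Ω d)
    (hγ : γ ∈ Icc (0 : ℝ) 1) (hB : IsCutoff B γ) {g : V3 × V3 → ℝ} (hg : IsIncomingData Ω g) :
    ∫⁻ v, gagliardo Ω (fun x => inflow Ω B g (x, v)) < ∞ := by
  obtain ⟨a, A, ha, -, h2⟩ := hΩ.exists_inflow_le hγ hB hg
  obtain ⟨K, hK⟩ := exists_velocity_weight_le ha hΩ.diam_pos.le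
  obtain ⟨I, hI⟩ := hΩ.exists_lintegral_ipow_five_halves_le
  have hmω : Measurable (Ω.indicator (bw Ω)) := measurable_bw.indicator hΩ.measurableSet
  obtain ⟨D, hD⟩ := hΩ.exists_lintegral_indicator_bw_le
  obtain ⟨C₁, hC₁⟩ := exists_lintegral_weight_line_le (c := a / 4) (by positivity) hmω hD
  obtain ⟨C₂, hC₂⟩ := hΩ.exists_lintegral_outerPotential_le
  have hP : Measurable (outerPotential Ω fun _ => 1) := by
    have := measurable_outerPotential hΩ.measurableSet
      (measurable_const (a := (1 : ℝ≥0∞)) (β := V3 × V3))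
    exact this.comp (measurable_id.prodMk (measurable_const (a := (0 : V3))))
  let Z : V3 → ℝ≥0∞ := fun v => ∫⁻ s in Ioi (0 : ℝ), ∫⁻ x, Ω.indicator (bw Ω) x *
    outerPotential Ω (fun _ => 1) (x - s • v)
  let H : V3 → ℝ≥0∞ := fun v => ENNReal.ofReal (Real.exp (-a * ‖v‖ ^ 2)) ^ (1 / 2 : ℝ)
  have hH : H = fun v => ENNReal.ofReal (Real.exp (-(a / 2) * ‖v‖ ^ 2)) := by
    ext v
    simp only [H]
    rw [ENNReal.ofReal_rpow_of_nonneg (Real.exp_pos _).le (by norm_num), ← Real.exp_mul]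
    ring_nf
  have hHm : Measurable H := by rw [hH]; fun_prop
  have hHt : ∀ v, H v ≠ ∞ := fun v => by rw [hH]; simp
  have hpt : ∀ᵐ v : V3, gagliardo Ω (fun x => inflow Ω B g (x, v)) ≤
      (2 * A * K) * (gk (1 / 2) (a / 4) (v - 0) * ipow 1 v * Z v) + (A * I) * H v := by
    refine ae_ne_zero_V3.mono fun v hv => ?_
    set L := ENNReal.ofReal (1 + ‖v‖) ^ (3 / 2 : ℝ) with hL
    have hLt : L ≠ ∞ := ENNReal.rpow_ne_top_of_nonneg (by norm_num) (by simp)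
    have hmR : Measurable fun p : V3 × V3 => ipow 4 (p.1 - p.2) * ‖p.1 - p.2‖ₑ ^ (3 / 2 : ℝ) := by
      have : Measurable fun p : V3 × V3 => ipow 4 (p.1 - p.2) :=
        (measurable_ipow 4).comp (by fun_prop)
      exact this.mul (by fun_prop)
    have hAH : (A : ℝ≥0∞) * H v ≠ ∞ := ENNReal.mul_ne_top (by simp) (hHt v)
    calc gagliardo Ω (fun x => inflow Ω B g (x, v)) ≤ ∫⁻ x in Ω, ∫⁻ y in Ω, A * H v *
          (L * (ipow 4 (x - y) * ‖tauMinus Ω x v - tauMinus Ω y v‖ₑ ^ (3 / 2 : ℝ)) +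
            ipow 4 (x - y) * ‖x - y‖ₑ ^ (3 / 2 : ℝ)) := by
          refine setLIntegral_mono' hΩ.measurableSet fun x hx =>
            setLIntegral_mono' hΩ.measurableSet fun y hy => ?_
          refine (mul_le_mul_right (h2 x hx y hy v hv) _).trans (le_of_eq ?_)
          simp only [H, hL]
          ring
      _ = A * H v * (L * (∫⁻ x in Ω, ∫⁻ y in Ω,
            ipow 4 (x - y) * ‖tauMinus Ω x v - tauMinus Ω y v‖ₑ ^ (3 / 2 : ℝ)) +
            ∫⁻ x in Ω, ∫⁻ y in Ω, ipow 4 (x - y) * ‖x - y‖ₑ ^ (3 / 2 : ℝ)) := by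
          rw [← lintegral_const_mul' _ _ hLt, ← lintegral_add_right _ hmR.lintegral_prod_right',
            ← lintegral_const_mul' _ _ hAH]
          refine lintegral_congr fun x => ?_
          have hmx : Measurable fun y => ipow 4 (x - y) * ‖x - y‖ₑ ^ (3 / 2 : ℝ) :=
            hmR.of_uncurry_left (f := fun x y => ipow 4 (x - y) * ‖x - y‖ₑ ^ (3 / 2 : ℝ)) (x := x)
          rw [lintegral_const_mul' _ _ hAH, lintegral_add_right _ hmx,
            lintegral_const_mul' _ _ hLt]
      _ ≤ A * H v * (L * (2 * ((ENNReal.ofReal d * ipow 1 v) ^ (1 / 2 : ℝ) * Z v)) + I) :=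
          mul_le_mul_right (add_le_add (mul_le_mul_right (hΩ.lintegral_tauMinus_sub_le hv) _) hI) _
      _ = (2 * A) * ((H v * L * (ENNReal.ofReal d * ipow 1 v) ^ (1 / 2 : ℝ)) * Z v) +
            A * I * H v := by ring
      _ ≤ (2 * A) * ((K * (gk (1 / 2) (a / 4) (v - 0) * ipow 1 v)) * Z v) + A * I * H v :=
          add_le_add_left (mul_le_mul_right (mul_le_mul_left (hK v hv) _) _) _
      _ = _ := by ring
  refine (lintegral_mono_ae hpt).trans_lt ?_
  rw [lintegral_add_right _ (hHm.const_mul _), lintegral_const_mul' _ _ (by finiteness),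
    lintegral_const_mul' _ _ (by finiteness)]
  refine ENNReal.add_lt_top.2 ⟨ENNReal.mul_lt_top (by finiteness) ?_,
    ENNReal.mul_lt_top (by finiteness) ?_⟩
  -- The averaging lemma for weighted lines, with the kernel centred at velocity `0`: the Gaussian
  -- decay of the data plays the part of the collision kernel.
  · refine (hC₁ 0 _ hP).trans_lt (ENNReal.mul_lt_top (by simp) ?_)
    refine (hC₂ _ measurable_const).trans_lt (ENNReal.mul_lt_top (by simp) ?_)
    simpa using hΩ.lintegral_bw_lt_top
  · rw [hH]; exact lintegral_gaussian_lt_top (by positivity)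

theorem measurable_gagliardo_integrand {u : V3 × V3 → ℝ} (hu : Measurable u) :
    Measurable fun q : (V3 × V3) × V3 =>
      ipow 4 (q.1.2 - q.2) * ‖u (q.1.2, q.1.1) - u (q.2, q.1.1)‖ₑ ^ 2 := by
  have : Measurable fun q : (V3 × V3) × V3 => ipow 4 (q.1.2 - q.2) :=
    (measurable_ipow 4).comp (by fun_prop)
  exact this.mul (by fun_prop)

theorem measurable_gagliardo {u : V3 × V3 → ℝ} (hu : Measurable u) :
    Measurable fun w => gagliardo Ω (fun x => u (x, w)) :=
  (measurable_gagliardo_integrand hu).lintegral_prod_right'.lintegral_prod_right'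

/-- `K` acts on the velocity only, so it preserves half a derivative in `x`. -/
theorem exists_gagliardo_opK_le (hγ : γ ∈ Icc (0 : ℝ) 1) (hB : IsCutoff B γ) :
    ∃ C : ℝ≥0, ∀ u : V3 × V3 → ℝ, Measurable u → ∫⁻ w, ∫⁻ x in Ω, ‖u (x, w)‖ₑ ^ 2 < ∞ →
      ∫⁻ v, ipow 2 v * gagliardo Ω (fun x => opK B u (x, v)) ≤
        C * ∫⁻ w, gagliardo Ω (fun x => u (x, w)) := by
  obtain ⟨C₁, hC₁⟩ := exists_collisionK_sub_sq_le hγ hB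
  obtain ⟨C₂, hC₂⟩ := exists_lintegral_convolution_le
  refine ⟨C₁ * C₂, fun u hu hfin => ?_⟩
  have hae := ae_ae_of_ae_phase (ae_lintegral_gk_lt_top hu hfin)
  have hpt : ∀ᵐ v : V3, gagliardo Ω (fun x => opK B u (x, v)) ≤
      C₁ * ∫⁻ w, gk (1 / 2) (1 / 16) (v - w) * gagliardo Ω (fun x => u (x, w)) := by
    refine hae.mono fun v hv => ?_
    have hk : Measurable fun w : V3 => gk (1 / 2) (1 / 16) (v - w) :=
      (measurable_gk _ _).comp (by fun_prop)
    let Y : V3 → V3 → V3 → ℝ≥0∞ := fun x y w =>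
      gk (1 / 2) (1 / 16) (v - w) * (ipow 4 (x - y) * ‖u (x, w) - u (y, w)‖ₑ ^ 2)
    have hY : Measurable fun p : V3 × V3 × V3 => Y p.1 p.2.1 p.2.2 := by
      refine (hk.comp (f := fun p : V3 × V3 × V3 => p.2.2) (by fun_prop)).mul ?_
      exact (measurable_gagliardo_integrand hu).comp
        (f := fun p : V3 × V3 × V3 => ((p.2.2, p.1), p.2.1)) (by fun_prop)
    calc _ ≤ ∫⁻ x in Ω, ∫⁻ y in Ω, C₁ * ∫⁻ w, Y x y w := by
          refine lintegral_mono_ae (hv.mono fun x hx => lintegral_mono_ae (hv.mono fun y hy => ?_))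
          have hm : Measurable fun w =>
              gk (1 / 2) (1 / 16) (v - w) * ‖u (x, w) - u (y, w)‖ₑ ^ 2 := hk.mul (by fun_prop)
          have := hC₁ v (fun w => u (x, w)) (fun w => u (y, w))
            (Measurable.aestronglyMeasurable (by fun_prop))
            (Measurable.aestronglyMeasurable (by fun_prop)) hx hy
          refine (mul_le_mul_right this _).trans (le_of_eq ?_)
          rw [mul_left_comm, ← lintegral_const_mul _ hm]
          congr 1
          exact lintegral_congr fun w => by simp only [Y]; ring
      _ = C₁ * ∫⁻ x in Ω, ∫⁻ y in Ω, ∫⁻ w, Y x y w := by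
          rw [← lintegral_const_mul' _ _ ENNReal.coe_ne_top]
          refine lintegral_congr fun x => ?_
          rw [lintegral_const_mul' _ _ ENNReal.coe_ne_top]
      _ = C₁ * ∫⁻ w, ∫⁻ x in Ω, ∫⁻ y in Ω, Y x y w := by rw [lintegral_rotate hY]
      _ = _ := by
          congr 1
          refine lintegral_congr fun w => ?_
          have hm := measurable_gagliardo_integrand hu
          have hm1 : Measurable fun q : V3 × V3 =>
              ipow 4 (q.1 - q.2) * ‖u (q.1, w) - u (q.2, w)‖ₑ ^ 2 :=
            hm.comp (f := fun q : V3 × V3 => ((w, q.1), q.2)) (by fun_prop)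
          rw [gagliardo, ← lintegral_const_mul _ hm1.lintegral_prod_right']
          refine lintegral_congr fun x => ?_
          exact lintegral_const_mul _ (hm1.of_uncurry_left
            (f := fun x y => ipow 4 (x - y) * ‖u (x, w) - u (y, w)‖ₑ ^ 2) (x := x))
  calc _ ≤ ∫⁻ v, C₁ * ((1 + ipow 2 v) * ∫⁻ w, gk (1 / 2) (1 / 16) (v - w) *
        gagliardo Ω (fun x => u (x, w))) := by
        refine lintegral_mono_ae (hpt.mono fun v hv => ?_)
        rw [mul_left_comm]
        exact mul_le_mul' le_add_self hv
    _ ≤ C₁ * (C₂ * ∫⁻ w, gagliardo Ω (fun x => u (x, w))) := by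
        rw [lintegral_const_mul' _ _ ENNReal.coe_ne_top]
        exact mul_le_mul_right (hC₂ _ (measurable_gagliardo hu)) _
    _ = _ := by push_cast; ring

theorem gagliardo_add_le {f g : V3 → ℝ} (hf : Measurable f) :
    gagliardo Ω (fun x => f x + g x) ≤ 2 * (gagliardo Ω f + gagliardo Ω g) := by
  have hm : Measurable fun q : V3 × V3 => ipow 4 (q.1 - q.2) * ‖f q.1 - f q.2‖ₑ ^ 2 := by
    have : Measurable fun q : V3 × V3 => ipow 4 (q.1 - q.2) :=
      (measurable_ipow 4).comp (by fun_prop)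
    exact this.mul (by fun_prop)
  calc _ ≤ ∫⁻ x in Ω, ∫⁻ y in Ω, 2 * (ipow 4 (x - y) * ‖f x - f y‖ₑ ^ 2 +
        ipow 4 (x - y) * ‖g x - g y‖ₑ ^ 2) := by
        refine lintegral_mono fun x => lintegral_mono fun y => ?_
        rw [← mul_add, mul_left_comm]
        refine mul_le_mul_right ?_ _
        rw [add_sub_add_comm]
        exact (pow_le_pow_left₀ zero_le (enorm_add_le _ _) 2).trans (ennreal_add_sq_le _ _)
    _ = _ := by
        rw [gagliardo, gagliardo, ← lintegral_add_left hm.lintegral_prod_right',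
          ← lintegral_const_mul' _ _ (by simp)]
        refine lintegral_congr fun x => ?_
        have hmx : Measurable fun y => ipow 4 (x - y) * ‖f x - f y‖ₑ ^ 2 :=
          hm.of_uncurry_left (f := fun x y => ipow 4 (x - y) * ‖f x - f y‖ₑ ^ 2) (x := x)
        rw [lintegral_const_mul' _ _ (by simp), lintegral_add_left hmx]

/-- Measurability of one summand suffices to split the integrals, so the other term is left without
such a condition. -/
theorem slobodeckij_half_add_lt_top (hΩ : MeasurableSet Ω) {f g : V3 × V3 → ℝ}
    (hf : AEStronglyMeasurable f (phaseMeasure Ω)) (h1 : slobodeckij Ω (1 / 2) f < ∞)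
    (h2 : slobodeckij Ω (1 / 2) g < ∞) : slobodeckij Ω (1 / 2) (f + g) < ∞ := by
  obtain ⟨f', hm, -, hae, -⟩ := exists_measurable_representative hΩ hf
  rw [slobodeckij_half_congr_ae (hae.add (EventuallyEq.refl _ g)), slobodeckij_half_eq]
  rw [slobodeckij_half_congr_ae hae, slobodeckij_half_eq] at h1
  rw [slobodeckij_half_eq] at h2
  refine lt_of_le_of_lt (lintegral_mono fun v => gagliardo_add_le
    (f := fun x => f' (x, v)) (g := fun x => g (x, v)) (by fun_prop)) ?_
  rw [lintegral_const_mul' _ _ (by simp), lintegral_add_left (measurable_gagliardo hm)]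
  exact ENNReal.mul_lt_top (by simp) (ENNReal.add_lt_top.2 ⟨h1, h2⟩)

/-- `S K` maps functions with half a derivative and finite boundary-weighted norm to functions with
half a derivative. -/
theorem IsConvexBody.slobodeckij_opS_opK_lt_top (hΩ : IsConvexBody Ω d) (hγ : γ ∈ Icc (0 : ℝ) 1)
    (hB : IsCutoff B γ) {f : V3 × V3 → ℝ} (hf : MemLp f 2 (phaseMeasure Ω))
    (h1 : slobodeckij Ω (1 / 2) f < ∞)
    (h2 : ∫⁻ v, ∫⁻ x in Ω, bw Ω x * ‖f (x, v)‖ₑ ^ 2 < ∞) :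
    slobodeckij Ω (1 / 2) (opS Ω B (opK B f)) < ∞ := by
  obtain ⟨C₁, hC₁⟩ := hΩ.exists_gagliardo_transport_le hγ hB
  obtain ⟨C₂, hC₂⟩ := exists_gagliardo_opK_le (Ω := Ω) hγ hB
  obtain ⟨u, hm, -, hae, hn⟩ := exists_measurable_representative hΩ.measurableSet hf.1
  have hfin : ∫⁻ w, ∫⁻ x in Ω, ‖u (x, w)‖ₑ ^ 2 < ∞ :=
    (lintegral_mono fun w => setLIntegral_le_lintegral _ _).trans_lt
      (hn ▸ ENNReal.pow_lt_top hf.2)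
  rw [slobodeckij_half_congr_ae (hΩ.opS_opK_ae_eq hγ hB hm hfin hae), slobodeckij_half_eq]
  rw [slobodeckij_half_congr_ae hae, slobodeckij_half_eq] at h1
  have h3 : ∫⁻ w, ∫⁻ x in Ω, bw Ω x * ‖u (x, w)‖ₑ ^ 2 < ∞ := by
    refine lt_of_eq_of_lt (lintegral_congr_ae ((ae_ae_of_ae_phase hae).mono fun v hv => ?_)) h2
    exact lintegral_congr_ae (hv.mono fun x hx => congrArg (fun t : ℝ => bw Ω x * ‖t‖ₑ ^ 2) hx.symm)
  refine (hC₁ u hm).trans_lt (ENNReal.mul_lt_top (by simp) (ENNReal.add_lt_top.2 ⟨?_, h3⟩))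
  exact (hC₂ u hm hfin).trans_lt (ENNReal.mul_lt_top (by simp) h1)

/-- Duhamel's formula inserted into itself: the free transport and its image under `S K` are regular
because the data are, the remainder because of the twofold operator bound. -/
theorem IsConvexBody.memL2Hs_of_isIncomingSolution (hΩ : IsConvexBody Ω d)
    (hγ : γ ∈ Icc (0 : ℝ) 1) (hB : IsCutoff B γ) {g f : V3 × V3 → ℝ} (hg : IsIncomingData Ω g)
    (hf : IsIncomingSolution Ω B g f) : MemL2Hs Ω (1 / 2) f := by
  obtain ⟨hfL, F, hFf, hsol⟩ := hf
  obtain ⟨C₁, hC₁⟩ := hΩ.exists_opS_opK_le hγ hB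
  obtain ⟨C₂, hC₂⟩ := hΩ.exists_slobodeckij_twofold_le hγ hB
  have hF : MemLp F 2 (phaseMeasure Ω) := (memLp_congr_ae hFf).2 hfL
  have hduh := hΩ.ae_eq_inflow_add hγ hB hF hsol
  set u := inflow Ω B g with hu
  have mSK := (hC₁ F hF).1
  -- The data `g` come without measurability, so `u` is recognised as a square integrable function
  -- through `u = F - S K F` almost everywhere.
  have hu_mem : MemLp u 2 (phaseMeasure Ω) := by
    refine (memLp_congr_ae ?_).2 (hF.sub mSK)
    exact hduh.mono fun p hp => by simp only [Pi.sub_apply, hp, Pi.add_apply]; ring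
  have s1 : slobodeckij Ω (1 / 2) u < ∞ := by
    rw [slobodeckij_half_eq]; exact hΩ.lintegral_gagliardo_inflow_lt_top hγ hB hg
  have s2 := hΩ.slobodeckij_opS_opK_lt_top hγ hB hu_mem s1
    (hΩ.lintegral_bw_inflow_lt_top hγ hB hg)
  have s3 : slobodeckij Ω (1 / 2) (opS Ω B (opK B (opS Ω B (opK B F)))) < ∞ :=
    (hC₂ F hF).trans_lt (ENNReal.mul_lt_top (by simp) (ENNReal.pow_lt_top hF.2))
  have hSK : opS Ω B (opK B F) =ᵐ[phaseMeasure Ω]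
      opS Ω B (opK B u) + opS Ω B (opK B (opS Ω B (opK B F))) := by
    obtain ⟨F', hm, -, hae, hn⟩ := exists_measurable_representative hΩ.measurableSet hF.1
    have hfin : ∫⁻ w, ∫⁻ x in Ω, ‖F' (x, w)‖ₑ ^ 2 < ∞ :=
      (lintegral_mono fun w => setLIntegral_le_lintegral _ _).trans_lt
        (hn ▸ ENNReal.pow_lt_top hF.2)
    have k1 := opK_congr_ae hγ hB hm hfin hae
    have k2 := opK_congr_ae hγ hB hm hfin (hduh.symm.trans hae)
    have k3 := opK_add_ae hΩ.measurableSet hγ hB hu_mem mSK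
    exact (hΩ.opS_congr_ae (k1.trans (k2.symm.trans k3))).trans
      (hΩ.opS_add_ae (memLp_opK hΩ.measurableSet hγ hB hu_mem)
        (memLp_opK hΩ.measurableSet hγ hB mSK))
  refine ⟨hfL, ?_⟩
  have hdec : f =ᵐ[phaseMeasure Ω]
      u + (opS Ω B (opK B u) + opS Ω B (opK B (opS Ω B (opK B F)))) :=
    hFf.symm.trans (hduh.trans ((EventuallyEq.refl _ u).add hSK))
  rw [slobodeckij_half_congr_ae hdec]
  exact slobodeckij_half_add_lt_top hΩ.measurableSet hu_mem.1 s1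
    (slobodeckij_half_add_lt_top hΩ.measurableSet (hC₁ u hu_mem).1.1 s2 s3)

end LinBoltzmann

theorem mainTheorem3 (Ω : Set V3) (hΩ : IsPosCurvedConvexDomain Ω)
    (γ : ℝ) (hγ : γ ∈ Set.Icc (0 : ℝ) 1) (B : ℝ → ℝ → ℝ) (hB : IsCutoff B γ) :
    (∃ (T : Lp ℝ 2 (phaseMeasure Ω) →L[ℝ] Lp ℝ 2 (phaseMeasure Ω)) (C : ℝ≥0),
      ∀ (f : V3 × V3 → ℝ) (hf : MemLp f 2 (phaseMeasure Ω)),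
        T (hf.toLp f) =ᵐ[phaseMeasure Ω] opS Ω B (opK B (opS Ω B (opK B f))) ∧
        MemL2Hs Ω (1 / 2) (opS Ω B (opK B (opS Ω B (opK B f)))) ∧
        l2HsNorm Ω (1 / 2) (opS Ω B (opK B (opS Ω B (opK B f)))) ≤
          C * eLpNorm f 2 (phaseMeasure Ω)) ∧
    (∀ g f : V3 × V3 → ℝ, IsIncomingData Ω g → IsIncomingSolution Ω B g f →
      MemL2Hs Ω (1 / 2) f) := by
  obtain ⟨d, hd⟩ := hΩ.exists_isConvexBody
  exact ⟨hd.exists_bounded_twofold hγ hB,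
    fun _ _ hg hf => hd.memL2Hs_of_isIncomingSolution hγ hB hg hf⟩
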